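/- Let $V$ be a real function with four bounded derivatives on $[-1,1]$. Let $\rho$ be the density of the equilibrium measure, i.e. of the minimizer of $\int V(\cos\lambda)\,m(d\lambda)-\iint\log|e^{i\lambda}-e^{i\mu}|\,m(d\lambda)m(d\mu)$ among unit measures $m$ on $[-\pi,\pi]$. Assume: (C1) the support of $\rho$ is $\sigma=[-\theta,\theta]$ with $0<\theta<\pi$; (C2) $\rho$ (its continuous version) has no zeros in $(-\theta,\theta)$, $\rho(\lambda)\sim K|\lambda\mp\theta|^{1/2}$ with $K>0$ as $\lambda\to\pm\theta$ inside $\sigma$, and $u(\lambda)=V(\cos\lambda)-2\int_\sigma\log|e^{i\lambda}-e^{i\mu}|\rho(\mu)\,d\mu$ attains its minimum over $[-\pi,\pi]$ at $\lambda$ if and only if $\lambda\in\sigma$. Put $a=\cos^2\frac\theta2$, $b=\cos\frac\theta2\sin\frac\theta2$, $c=\sin^2\frac\theta2$, $\chi(\lambda)=\sqrt{|\cos\lambda-\cos\theta|}$ and $$P(\lambda)=\int_{-\theta}^{\theta}\frac{(V(\cos\mu))'-(V(\cos\lambda))'}{\sin\frac{\mu-\lambda}{2}}\,\frac{d\mu}{\chi(\mu)}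 .$$ **Orthogonal polynomials.** For $n\ge1$ let $P_k^{(n)}(\lambda)=\sum_{l=0}^k c^{(n)}_{k,l}e^{il\lambda}$, $k\ge0$, be the polynomials orthonormal on $[-\pi,\pi]$ with weight $e^{-nV(\cos\lambda)}$, $c^{(n)}_{k,k}>0$. Let $\alpha_k^{(n)}=c^{(n)}_{k,0}/c^{(n)}_{k,k}$, $\rho_k^{(n)}=c^{(n)}_{k-1,k-1}/c^{(n)}_{k,k}$ for $k\ge1$, $\rho_0^{(n)}=0$. Let $C^{(n)}=(C_{j,k})_{j,k\ge0}$ be the five-diagonal CMV matrix: for even $j$ the entries $C_{j,j-2},\dots,C_{j,j+1}$ are $\rho_{j-1}\rho_j,\ \alpha_{j-1}\rho_j,\ -\alpha_j\alpha_{j+1},\ \alpha_j\rho_{j+1}$, for odd $j$ the entries $C_{j,j-1},\dots,C_{j,j+2}$ are $-\rho_j\alpha_{j+1},\ -\alpha_j\alpha_{j+1},\ -\rho_{j+1}\alpha_{j+2},\ \rho_{j+1}\rho_{j+2}$, and all others vanish. Fix $s\in\{1,-1\}$. For $l\ge-n$ let $\tilde x_l\in[-\pi,\pi)$ be determined by $$\alpha^{(n)}_{n+l}=(-1)^{n+l}s\cos\big(\tfrac\theta2+\tilde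 x_l\big),\qquad \rho^{(n)}_{n+l}=\sin\big(\tfrac\theta2+\tilde x_l\big);$$ for $l<-n$ put $\tilde x_l=0$. Let $S_k=\sum_{j=-10}^{10}\tilde x_{k+j}^2$. **String equations.** Let $M^\star_{j,k}=a\,\delta_{j,k}+\frac c2(\delta_{j-2,k}+\delta_{j,k-2})$, $j,k\in\mathbb Z$. Let $\widetilde M_{j,k}=\frac12(C_{n+j,n+k}+C_{n+k,n+j})$ for $j,k\ge-n$, $\widetilde M_{j,k}=M^\star_{j,k}$ for $j,k<-n$, and $\widetilde M_{j,k}=0$ otherwise. Let $\delta M=\widetilde M-M^\star$, and $\widetilde L_{j,k}=\frac12(C_{n+j,n+k}-C_{n+k,n+j})$ for $j,k\ge-n$, $\widetilde L_{j,k}=0$ otherwise. Put $v_0=\frac1{2\pi}\int_{-\pi}^{\pi}V'(a+c\cos2\phi)\,d\phi$ and $$\mathbf B_{\alpha,\beta}=\frac1{4\pi^2c}\int_{-\pi}^{\pi}\!\int_{-\pi}^{\pi}\frac{V'(a+c\cos2u)-V'(a+c\cos2v)}{\cos2u-\cos2v}\,e^{i(\alpha u+\beta v)}\,du\,dv .$$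 The string equation with index $n+k\ge1$, with first-order terms in $\delta M$ written out, is $$\frac{\widetilde L_{k,k+1}}{c}+(\widetilde L_{k,k+1}+\widetilde L_{k,k-1})v_0+\sum_{d,d_1=-2}^{2}\sum_{l\in\mathbb Z}\widetilde L_{k,k+d}\,\mathbf B_{l-d,\,l+d_1+1}\,\delta M_{k+l,k+l+d_1}+r_k^{(n)}=(-1)^{n+k}\frac{\alpha^{(n)}_{n+k}}{\rho^{(n)}_{n+k}}\Big(1+\frac kn\Big),$$ which identifies the higher-order remainder $r_k^{(n)}$. **Resolvent.** Let $R^\star(z)=(M^\star-zI)^{-1}$ in $\ell^2(\mathbb Z)$ and, for $y>0$, $x\in\mathbb R$, $z=-x+iy$, $$r_{k,y}(x)=\min\Big\{y^{-1}\sum_{t\in\mathbb Z}|R^\star_{2t,0}(z)|^2S_{k+2t},\ \ \mathrm{dist}^{-1}(z,[-1,1])+y^{-1}\,\Im R^\star_{0,0}(z)\Big\}.$$ **Lemma.** The numbers $\tilde x_l$ are well defined, and there are real numbers $(A_l)_{l\in\mathbb Z}$ with $$\sum_{l\in\mathbb Z}A_le^{il\phi}=\delta(\phi):=\frac{\sqrt{1-c\cos^2(\phi/2)}}{\pi\sqrt2}\,P\Big(-2\arcsin\big(\sin\tfrac\theta2\cos\tfrac\phi2\big)\Big)\qquad(\phi\in\mathbb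 R)$$ and constants $\varepsilon_1>0$, $C>0$, all depending only on $V$, such that for both $s=\pm1$, all $n\ge1$ and all integers $|k|\le\varepsilon_1n$ the string equations take the form $$\sum_{l\in\mathbb Z}A_{k-l}\,\tilde x_l=\frac bc\,\frac kn+R_k,$$ where the series converge absolutely and $$|R_k|\le C\Big(\frac{k^2}{n^2}+S_k+\sum_{l\ne0}S_{k+2l}|l|^{-5/2}\Big)+|r_k^{(n)}|,\qquad |r_k^{(n)}|^2\le C\int_0^\infty e^{-y}y^5\,\|r_{k,y}\|_{L^2(\mathbb R)}^2\,dy .$$ -/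

import Mathlib

open scoped ENNReal
open MeasureTheory Set Filter Topology

noncomputable section

namespace OPUC

/-! ### The equilibrium problem on the unit circle -/

/-- The kernel `log (2 / |e^{ix} - e^{iy}|) ≥ 0`, equal to `∞` where `e^{ix} = e^{iy}`. -/
def logKernel (x y : ℝ) : ℝ≥0∞ :=
  if Complex.exp (x * Complex.I) = Complex.exp (y * Complex.I) then ⊤
  else ENNReal.ofReal
    (Real.log 2 - Real.log ‖Complex.exp (x * Complex.I) - Complex.exp (y * Complex.I)‖)

/-- `∬ log (2 / |e^{ix} - e^{iy}|) m(dx) m(dy)`. -/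
def logEnergy (m : Measure ℝ) : ℝ≥0∞ := ∫⁻ x, ∫⁻ y, logKernel x y ∂m ∂m

/-- The functional `∫ V(cos x) m(dx) - ∬ log |e^{ix} - e^{iy}| m(dx) m(dy)`
(for `m` a probability measure with finite logarithmic energy). -/
def energy (V : ℝ → ℝ) (m : Measure ℝ) : ℝ :=
  ∫ x, V (Real.cos x) ∂m + ((logEnergy m).toReal - Real.log 2)

/-- `m` is a unit measure on `[-π, π]` with finite logarithmic energy. -/
structure IsAdmissible (m : Measure ℝ) : Prop where
  prob : IsProbabilityMeasure m
  carrier : m (Icc (-Real.pi) Real.pi)ᶜ = 0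
  finite_energy : logEnergy m ≠ ⊤

/-- `m` minimizes the energy among unit measures on `[-π, π]`
(those of infinite logarithmic energy have energy `+∞` and cannot compete). -/
def IsEquilibriumMeasure (V : ℝ → ℝ) (m : Measure ℝ) : Prop :=
  IsAdmissible m ∧ ∀ m' : Measure ℝ, IsAdmissible m' → energy V m ≤ energy V m'

/-- The measure `ρ(x) dx`. -/
def densityMeasure (ρ : ℝ → ℝ) : Measure ℝ :=
  volume.withDensity fun x => ENNReal.ofReal (ρ x)

/-- `ρ` is a density of the equilibrium measure. -/
structure IsEquilibriumDensity (V ρ : ℝ → ℝ) : Prop where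
  measurable : Measurable ρ
  nonneg : ∀ x, 0 ≤ ρ x
  equilibrium : IsEquilibriumMeasure V (densityMeasure ρ)

/-- `u(x) = V(cos x) - 2 ∫_σ log |e^{ix} - e^{iy}| ρ(y) dy` with `σ = [-θ, θ]`. -/
def effectivePotential (V ρ : ℝ → ℝ) (θ x : ℝ) : ℝ :=
  V (Real.cos x) - 2 * ∫ y in Icc (-θ) θ,
    Real.log ‖Complex.exp (x * Complex.I) - Complex.exp (y * Complex.I)‖ * ρ y

/-- One-interval support: `supp ρ = [-θ, θ]` with `0 < θ < π`. -/
structure ConditionC1 (ρ : ℝ → ℝ) (θ : ℝ) : Prop where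
  pos : 0 < θ
  lt_pi : θ < Real.pi
  support_eq : (densityMeasure ρ).support = Icc (-θ) θ

/-- Regularity of the equilibrium density: (the continuous version of) `ρ` has no zeros inside
`σ`, has square-root behaviour at both ends of `σ`, and `u` attains its minimum
over `[-π, π]` exactly on `σ`. -/
structure ConditionC2 (V ρ : ℝ → ℝ) (θ : ℝ) : Prop where
  continuousOn : ContinuousOn ρ (Ioo (-θ) θ)
  ne_zero : ∀ x ∈ Ioo (-θ) θ, ρ x ≠ 0
  edges : ∃ K : ℝ, 0 < K ∧
    Tendsto (fun x => ρ x / Real.sqrt |x - θ|) (𝓝[<] θ) (𝓝 K) ∧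
    Tendsto (fun x => ρ x / Real.sqrt |x + θ|) (𝓝[>] (-θ)) (𝓝 K)
  minimum_iff : ∀ x ∈ Icc (-Real.pi) Real.pi,
    (∀ y ∈ Icc (-Real.pi) Real.pi,
      effectivePotential V ρ θ x ≤ effectivePotential V ρ θ y) ↔ x ∈ Icc (-θ) θ

/-- The potential `V` has four bounded derivatives on `[-1, 1]`
(the fourth one need not be continuous). -/
structure ConditionC3 (V : ℝ → ℝ) : Prop where
  contDiffOn : ContDiffOn ℝ 3 V (Icc (-1) 1)
  differentiableOn : DifferentiableOn ℝ (iteratedDerivWithin 3 V (Icc (-1) 1)) (Icc (-1) 1)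
  bounded : ∃ K : ℝ, ∀ x ∈ Icc (-1 : ℝ) 1, |iteratedDerivWithin 4 V (Icc (-1) 1) x| ≤ K

/-- The derivative `V'` on `[-1, 1]`. -/
def dV (V : ℝ → ℝ) (x : ℝ) : ℝ := derivWithin V (Icc (-1) 1) x

/-- `χ(x) = √|cos x - cos θ|`. -/
def chi (θ x : ℝ) : ℝ := Real.sqrt |Real.cos x - Real.cos θ|

/-- `P(x) = ∫_{-θ}^{θ} ((V(cos y))' - (V(cos x))') / sin((y - x)/2) · dy / χ(y)`. -/
def P (V : ℝ → ℝ) (θ x : ℝ) : ℝ :=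
  ∫ y in (-θ)..θ,
    (deriv (fun t => V (Real.cos t)) y - deriv (fun t => V (Real.cos t)) x)
      / Real.sin ((y - x) / 2) / chi θ y

/-! ### Orthogonal polynomials on the unit circle with varying weight -/

/-- `⟨p, q⟩ = ∫_{-π}^{π} p(e^{ix}) conj(q(e^{ix})) e^{-n V(cos x)} dx`. -/
def innerProd (V : ℝ → ℝ) (n : ℕ) (p q : Polynomial ℂ) : ℂ :=
  ∫ x in (-Real.pi)..Real.pi,
    p.eval (Complex.exp (x * Complex.I))
      * (starRingEnd ℂ) (q.eval (Complex.exp (x * Complex.I)))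
      * (Real.exp (-(n * V (Real.cos x))) : ℝ)

/-- Monic orthogonal polynomials: the Gram-Schmidt procedure (without normalization)
applied to `1, z, z², …`. -/
def monicOP (V : ℝ → ℝ) (n : ℕ) (k : ℕ) : Polynomial ℂ :=
  Polynomial.X ^ k - ∑ j : Fin k,
    Polynomial.C (innerProd V n (Polynomial.X ^ k) (monicOP V n j)
        / innerProd V n (monicOP V n j) (monicOP V n j))
      * monicOP V n j
termination_by k
decreasing_by all_goals exact j.isLt

/-- The orthonormal polynomials `P_k^{(n)}`. -/
def orthoPoly (V : ℝ → ℝ) (n k : ℕ) : Polynomial ℂ :=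
  Polynomial.C (((Real.sqrt (innerProd V n (monicOP V n k) (monicOP V n k)).re)⁻¹ : ℝ) : ℂ)
    * monicOP V n k

/-- The coefficient `c_{k,l}^{(n)}` of `e^{ilx}` in `P_k^{(n)}`.  It is a real number, because the
weight is an even function of `x`; the real part only changes the type. -/
def coeffOP (V : ℝ → ℝ) (n k l : ℕ) : ℝ := ((orthoPoly V n k).coeff l).re

/-- Verblunsky coefficients `α_k^{(n)} = c_{k,0} / c_{k,k}`; in particular `α_0 = 1`. -/
def alpha (V : ℝ → ℝ) (n k : ℕ) : ℝ := coeffOP V n k 0 / coeffOP V n k k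

/-- `ρ_k^{(n)} = c_{k-1,k-1} / c_{k,k}` for `k ≥ 1`, and `ρ_0 = 0`. -/
def rho (V : ℝ → ℝ) (n k : ℕ) : ℝ :=
  if k = 0 then 0 else coeffOP V n (k - 1) (k - 1) / coeffOP V n k k

/-- Entry `(j, k)`, `j, k ≥ 0`, of the five-diagonal CMV matrix with Verblunsky
coefficients `α`, `r` (where `α 0 = 1`). -/
def cmv (α r : ℕ → ℝ) (j k : ℕ) : ℝ :=
  if Even j then
    if k + 2 = j then r (j - 1) * r j
    else if k + 1 = j then α (j - 1) * r j
    else if k = j then -(α j * α (j + 1))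
    else if k = j + 1 then α j * r (j + 1)
    else 0
  else
    if k + 1 = j then -(r j * α (j + 1))
    else if k = j then -(α j * α (j + 1))
    else if k = j + 1 then -(r (j + 1) * α (j + 2))
    else if k = j + 2 then r (j + 1) * r (j + 2)
    else 0

/-- The matrix `C^{(n)}`. -/
def matC (V : ℝ → ℝ) (n j k : ℕ) : ℝ := cmv (alpha V n) (rho V n) j k

/-- `a = cos²(θ/2)`. -/
def ca (θ : ℝ) : ℝ := Real.cos (θ / 2) ^ 2

/-- `b = cos(θ/2) sin(θ/2)`. -/
def cb (θ : ℝ) : ℝ := Real.cos (θ / 2) * Real.sin (θ / 2)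

/-- `c = sin²(θ/2)`. -/
def cc (θ : ℝ) : ℝ := Real.sin (θ / 2) ^ 2

/-- Entries of the double-infinite matrix `M⋆`. -/
def Mstar (θ : ℝ) (j k : ℤ) : ℝ :=
  (if j = k then ca θ else 0)
    + 1 / 2 * ((if j - 2 = k then 1 else 0) + (if j = k - 2 then 1 else 0)) * cc θ

/-- The double-infinite matrix `M̃`: the matrix `M = (C + C*)/2` with indices shifted by `n`
in the block `j, k ≥ -n`, and `M⋆` in the block `j, k < -n`. -/
def Mtilde (V : ℝ → ℝ) (θ : ℝ) (n : ℕ) (j k : ℤ) : ℝ :=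
  if 0 ≤ n + j ∧ 0 ≤ n + k then
    (matC V n (n + j).toNat (n + k).toNat + matC V n (n + k).toNat (n + j).toNat) / 2
  else if n + j < 0 ∧ n + k < 0 then Mstar θ j k
  else 0

/-- `L = (C - C*)/2` with indices shifted by `n`. -/
def Ltilde (V : ℝ → ℝ) (n : ℕ) (j k : ℤ) : ℝ :=
  if 0 ≤ n + j ∧ 0 ≤ n + k then
    (matC V n (n + j).toNat (n + k).toNat - matC V n (n + k).toNat (n + j).toNat) / 2
  else 0

/-- `δM = M̃ - M⋆`. -/
def deltaM (V : ℝ → ℝ) (θ : ℝ) (n : ℕ) (j k : ℤ) : ℝ := Mtilde V θ n j k - Mstar θ j k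

/-- `v_0`, the mean value of `V'(a + c cos 2φ)`. -/
def v0 (V : ℝ → ℝ) (θ : ℝ) : ℝ :=
  1 / (2 * Real.pi) * ∫ φ in (-Real.pi)..Real.pi, dV V (ca θ + cc θ * Real.cos (2 * φ))

/-- The coefficients `B_{α,β}` of the linear part of `V'(M̃)`; the integrand is even in `u` and
in `v`, so `cos (α u + β v)` may be written in place of `e^{i(α u + β v)}`. -/
def Bcoef (V : ℝ → ℝ) (θ : ℝ) (α β : ℤ) : ℝ :=
  1 / (4 * Real.pi ^ 2 * cc θ) *
    ∫ u in (-Real.pi)..Real.pi, ∫ v in (-Real.pi)..Real.pi,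
      (dV V (ca θ + cc θ * Real.cos (2 * u)) - dV V (ca θ + cc θ * Real.cos (2 * v)))
        / (Real.cos (2 * u) - Real.cos (2 * v)) * Real.cos (α * u + β * v)

/-- The remainder `r_k^{(n)}` of the string equation
`L̃_{k,k+1}/c + (L̃_{k,k+1} + L̃_{k,k-1}) v_0
  + ∑_{d,d₁=-2}^{2} ∑_l L̃_{k,k+d} B_{l-d,l+d₁+1} δM_{k+l,k+l+d₁} + r_k
  = (-1)^{n+k} (α_{n+k} / ρ_{n+k}) (1 + k/n)`,
that is, what is left of the string equation after its expansion in `δM` up to first order. -/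
def stringRemainder (V : ℝ → ℝ) (θ : ℝ) (n : ℕ) (k : ℤ) : ℝ :=
  (-1) ^ (n + k).toNat * (alpha V n (n + k).toNat / rho V n (n + k).toNat) * (1 + k / n)
    - (Ltilde V n k (k + 1) / cc θ
      + (Ltilde V n k (k + 1) + Ltilde V n k (k - 1)) * v0 V θ
      + ∑ d ∈ Finset.Icc (-2 : ℤ) 2, ∑ d₁ ∈ Finset.Icc (-2 : ℤ) 2, ∑' l : ℤ,
          Ltilde V n k (k + d) * Bcoef V θ (l - d) (l + d₁ + 1)
            * deltaM V θ n (k + l) (k + l + d₁))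

/-- `x̃_l = x_{n+l}^{(n)}`, i.e. the number in `[-π, π)` with
`α_{n+l} = (-1)^{n+l} s cos(θ/2 + x̃_l)` and `ρ_{n+l} = sin(θ/2 + x̃_l) ≥ 0`.
It is extended by `0` to `l < -n`, where `M̃` is `M⋆`. -/
def xt (V : ℝ → ℝ) (θ s : ℝ) (n : ℕ) (l : ℤ) : ℝ :=
  if 0 ≤ n + l then Real.arccos ((-1) ^ (n + l).toNat * s * alpha V n (n + l).toNat) - θ / 2
  else 0

/-- `S_k = ∑_{j=-10}^{10} x̃_{k+j}²`. -/
def S (V : ℝ → ℝ) (θ s : ℝ) (n : ℕ) (k : ℤ) : ℝ :=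
  ∑ j ∈ Finset.Icc (-10 : ℤ) 10, xt V θ s n (k + j) ^ 2

/-- The symbol `δ(φ)`. -/
def symbol (V : ℝ → ℝ) (θ φ : ℝ) : ℝ :=
  Real.sqrt (1 - cc θ * Real.cos (φ / 2) ^ 2) / (Real.pi * Real.sqrt 2)
    * P V θ (-2 * Real.arcsin (Real.sin (θ / 2) * Real.cos (φ / 2)))

/-! ### The resolvent of `M⋆` -/

/-- The complex Hilbert space `ℓ²(ℤ)`. -/
abbrev L2Z : Type := lp (fun _ : ℤ => ℂ) 2

theorem memlp_shift (m : ℤ) (f : L2Z) :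
    Memℓp (fun j : ℤ => (f : ℤ → ℂ) (j + m)) 2 := by
  have h2 : 0 < (2 : ℝ≥0∞).toReal := by norm_num
  have hf := (lp.memℓp f).summable h2
  exact memℓp_gen ((Equiv.addRight m).summable_iff.mpr hf)

/-- The shift `(T_m f)_j = f_{j+m}` on `ℓ²(ℤ)`. -/
def shift (m : ℤ) : L2Z →L[ℂ] L2Z :=
  LinearMap.mkContinuous
    { toFun := fun f => ⟨fun j : ℤ => (f : ℤ → ℂ) (j + m), memlp_shift m f⟩
      map_add' := fun _ _ => rfl
      map_smul' := fun _ _ => rfl } 1 (by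
    intro f
    have h2 : 0 < (2 : ℝ≥0∞).toReal := by norm_num
    rw [one_mul, lp.norm_eq_tsum_rpow h2, lp.norm_eq_tsum_rpow h2]
    apply le_of_eq
    congr 1
    exact (Equiv.addRight m).tsum_eq fun j => ‖(f : ℤ → ℂ) j‖ ^ (2 : ℝ≥0∞).toReal)

/-- `M⋆` as a bounded operator on `ℓ²(ℤ)`: `(M⋆ f)_j = a f_j + (c/2)(f_{j-2} + f_{j+2})`. -/
def MstarOp (θ : ℝ) : L2Z →L[ℂ] L2Z :=
  (ca θ : ℂ) • (1 : L2Z →L[ℂ] L2Z) + ((cc θ / 2 : ℝ) : ℂ) • (shift (-2) + shift 2)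

/-- The operator has the matrix `M⋆`. -/
theorem MstarOp_entry (θ : ℝ) (j k : ℤ) :
    (MstarOp θ (lp.single 2 k (1 : ℂ)) : ℤ → ℂ) j = (Mstar θ j k : ℂ) := by
  have e : (MstarOp θ (lp.single 2 k (1 : ℂ)) : ℤ → ℂ) j
      = (ca θ : ℂ) * (Pi.single k (1 : ℂ) : ℤ → ℂ) j
        + ((cc θ / 2 : ℝ) : ℂ) * ((Pi.single k (1 : ℂ) : ℤ → ℂ) (j + -2)
          + (Pi.single k (1 : ℂ) : ℤ → ℂ) (j + 2)) := rfl
  have h1 : (j = k - 2) ↔ (j + 2 = k) := by omega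
  have h2 : j + -2 = j - 2 := by omega
  rw [e, Mstar]
  simp only [Pi.single_apply, h1, h2]
  split_ifs <;> push_cast <;> ring

/-- The entry `R⋆_{j,l}(z)` of `R⋆(z) = (M⋆ - z I)⁻¹`. -/
def Rstar (θ : ℝ) (z : ℂ) (j l : ℤ) : ℂ :=
  (Ring.inverse (MstarOp θ - z • (1 : L2Z →L[ℂ] L2Z)) (lp.single 2 l (1 : ℂ)) : ℤ → ℂ) j

/-- The function `r_{k,y}(x)`, where `z = -x + i y`. -/
def rky (V : ℝ → ℝ) (θ s : ℝ) (n : ℕ) (k : ℤ) (y x : ℝ) : ℝ :=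
  min
    (y⁻¹ * ∑' t : ℤ, ‖Rstar θ (-x + y * Complex.I) (2 * t) 0‖ ^ 2 * S V θ s n (k + 2 * t))
    ((Metric.infDist (-x + y * Complex.I : ℂ) ((fun t : ℝ => (t : ℂ)) '' Icc (-1) 1))⁻¹
      + y⁻¹ * (Rstar θ (-x + y * Complex.I) 0 0).im)

end OPUC

end

/-!
The weight `e^{-nV(cos x)}` is even, so the orthogonal polynomials have real coefficients, and in
the CMV basis (`cmvFun`, shifted by `n`: `psi`) the matrices `M̃` and `L̃` are those of the
multiplications by `cos x` and `i sin x` (`cos_mul_psi`, `sin_mul_psi`). Integrating a derivative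
over the circle gives the exact equation
`∑_d L̃_{k,k+d} V'(M̃)_{k+d,k-1} = (-1)^{n+k} (α/ρ) (1 + k/n)` (`string_equation_matrix`).

*Linear part.* Let `v_m` be the cosine coefficients of `V'(a + c cos ψ)` and
`E_p = v_{p+1} + v_{p+3} + …`. Since `V'` has three derivatives, `E_p = O(p^{-5/2})`
(`exists_Ev_bound`), which is the source of the weights `|l|^{-5/2}`. Expanding the divided
difference in Chebyshev polynomials gives `B_{α,β} = (2/c) E_{(|α|+|β|)/2}` for even `α, β`
(`Bcoef_eq`). In the integral `P` the substitution `sin (y/2) = sin (θ/2) sin τ` removes `χ`, and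
symmetrization turns the integrand into a divided difference of `V'(x)(1 - x)/2` (`symbol_eq`), so
that the Fourier coefficients `A_l` of the symbol are combinations of the same `E_p`
(`hasSum_symbol`, `Dcoef_eq`). Comparing coefficients shows that the linear part of the string
equation is the convolution with `A_l` (`linear_coefficient`, `hasSum_linear_part`).

This comparison, as well as the vanishing of the terms of order zero, needs `v_1 = v_0 + 1/c`
(`vc_one_eq`), the only place where the equilibrium measure enters. By symmetrization, the
constancy of the effective potential on the support expresses the cosine coefficients of
`V(a + c cos ψ)` by moments of `ρ` (`integral_V_cos`). They are summed in Abel's sense at `ψ = π`;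
as `ρ` is bounded by a multiple of `χ`, no mass of `ρ` is lost in the limit, and the total mass `1`
appears (`tendsto_density_poisson`).

The quadratic errors are collected in `exists_linearized_string_equation`. The expansions assume
small `x̃` near `k`; otherwise `S_k` is bounded below and the trivial bound suffices. This case also
covers the rows near the corner of the CMV matrix, because `α_0 = 1` (`le_sq_xt_neg`).

*Remainder.* `r_k` is a combination of the values at `F = V'` of functionals `secondOrder`: an
entry of `F(M̃)` minus its expansion to first order in `δM` (`stringRemainder_eq`). They commute
with Fourier representations (`FourierFunctional`), and for such functionals Plancherel's identity
and the Cauchy-Schwarz inequality bound `T(V')` by a weighted mean square of the values of `T` at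
the Poisson kernels (`exists_sobolev_duality`). At a Cauchy kernel `secondOrder` is the second order
term of the resolvent expansion (`secondOrder_cauchy`, `second_resolvent_identity`); estimating it
by `‖δM R⋆‖²`, respectively trivially, gives the two entries of the minimum that defines `r_{k,y}`
(`exists_secondOrder_bound`); here `R⋆` is explicit (`Rstar_eq`).
-/

open scoped ENNReal
open MeasureTheory Set Filter Topology

noncomputable section

namespace OPUC

open Real ComplexConjugate
open Complex (I conj_ofReal norm_real conj_conj continuous_ofReal ofReal_re ofReal_sin ofReal_cos ofReal_im ofReal_sub ofReal_div ofReal_tsum normSq_eq_norm_sq norm_conj norm_exp_ofReal_mul_I exp_ofReal_mul_I_re conj_eq_iff_im conj_ofNat mul_conj hasSum_ofReal measurable_ofReal re_ofReal_mul ofReal_mul exp_mul_I real_smul ofReal_zero ofRealCLM I_sq sub_im ofReal_exp norm_I hasSum_re continuous_conj conj_I)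
open Finset (sum_congr mul_sum sum_eq_zero sum_le_sum sum_const sum_eq_single sum_range_succ sum_mul sum_sub_distrib sum_add_distrib sum_image sum_nonneg)
open ENNReal (ofReal ofReal_pow ofReal_ne_top ofReal_le_ofReal)
open Filter.Eventually (of_forall)
open Continuous (intervalIntegrable)
open intervalIntegral (integral_of_le integral_congr hasSum_integral_of_dominated_convergence integral_eq_sub_of_hasDerivAt integral_comp_neg integral_finsetSum integral_comp_mul_left continuous_parametric_intervalIntegral_of_continuous')
open Function (Injective Periodic)
open Int (even_iff odd_iff natAbs_neg natAbs_odd natAbs_even natAbs_natCast emod_two_eq_zero_or_one)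

/-- The interval on which the potential lives. -/
local notation "𝕁" => Icc (-1 : ℝ) 1
/-- The complex exponential. -/
local notation "cexp" => Complex.exp
/-- The offsets of the nonzero diagonals of a five-diagonal matrix. -/
local notation "𝔹" => Finset.Icc (-2 : ℤ) 2

/-! ### Orthogonal polynomials and the Szegő recursion -/

/-- The weight `e^{-n V(cos x)}`. -/
def wt (V : ℝ → ℝ) (n : ℕ) (x : ℝ) : ℝ := exp (-(n * V (cos x)))

/-- The inner product of `L²(e^{-nV(cos x)} dx)` on functions of the angle. -/
def ip (V : ℝ → ℝ) (n : ℕ) (f g : ℝ → ℂ) : ℂ := ∫ x in (-π)..π, f x * conj (g x) * (wt V n x : ℂ)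

/-- The trigonometric monomial `e^{ijx}`. -/
def ez (j : ℤ) (x : ℝ) : ℂ := cexp (j * x * I)

lemma ez_zero (x : ℝ) : ez 0 x = 1 := by simp [ez]

lemma ez_add (i j : ℤ) (x : ℝ) : ez (i + j) x = ez i x * ez j x := by
  simp only [ez, ← Complex.exp_add]; congr 1; push_cast; ring

lemma conj_ez (j : ℤ) (x : ℝ) : conj (ez j x) = ez (-j) x := by
  simp only [ez, ← Complex.exp_conj]; congr 1; simp

lemma ez_neg_arg (j : ℤ) (x : ℝ) : ez j (-x) = ez (-j) x := by
  simp only [ez]; congr 1; push_cast; ring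

lemma norm_ez (j : ℤ) (x : ℝ) : ‖ez j x‖ = 1 := by
  rw [ez, show (j : ℂ) * x * I = ((j * x : ℝ) : ℂ) * I by push_cast; ring]
  exact norm_exp_ofReal_mul_I _

lemma continuous_ez (j : ℤ) : Continuous (ez j) := by unfold ez; fun_prop

lemma ez_pow (x : ℝ) (l : ℕ) : cexp (x * I) ^ l = ez l x := by
  rw [ez, ← Complex.exp_nat_mul]; congr 1; push_cast; ring

lemma ez_one (x : ℝ) : ez 1 x = cos x + sin x * I := by
  rw [ez]; push_cast; rw [one_mul, exp_mul_I]

lemma ez_neg_one (x : ℝ) : ez (-1) x = cos x - sin x * I := by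
  rw [← conj_ez, ez_one, map_add, map_mul, conj_I, conj_ofReal, conj_ofReal]
  ring

lemma hasDerivAt_ez (j : ℤ) (x : ℝ) : HasDerivAt (ez j) (j * I * ez j x) x := by
  have h : HasDerivAt (fun x : ℝ => (j : ℂ) * x * I) (j * I) x := by
    have := ((ofRealCLM.hasDerivAt (x := x)).const_mul (j : ℂ)).mul_const I
    simpa using this
  have := h.cexp
  rw [mul_comm] at this
  exact this

lemma ez_pi (j : ℤ) : ez j (-π) = ez j π := by
  have : ez j π = ez j (-π) * cexp (j * (2 * π * I)) := by
    simp only [ez, ← Complex.exp_add]; congr 1; push_cast; ring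
  rw [this, Complex.exp_int_mul_two_pi_mul_I, mul_one]

section Weight

variable {V : ℝ → ℝ} (hV : ContinuousOn V 𝕁) (n : ℕ)

include hV in
lemma continuous_V_cos : Continuous fun x => V (cos x) :=
  hV.comp_continuous continuous_cos fun x => ⟨neg_one_le_cos x, cos_le_one x⟩

include hV in
lemma continuous_wt : Continuous (wt V n) := by
  exact continuous_exp.comp ((continuous_V_cos hV).const_mul _).neg

lemma wt_pos (V : ℝ → ℝ) (n : ℕ) (x : ℝ) : 0 < wt V n x := exp_pos _

lemma wt_neg (V : ℝ → ℝ) (n : ℕ) (x : ℝ) : wt V n (-x) = wt V n x := by simp [wt]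

variable {n} {f g h : ℝ → ℂ}

include hV in
lemma ip_intervalIntegrable (hf : Continuous f) (hg : Continuous g) (a b : ℝ) :
    IntervalIntegrable (fun x => f x * conj (g x) * (wt V n x : ℂ)) volume a b := by
  have := continuous_wt hV n
  apply Continuous.intervalIntegrable
  fun_prop

include hV in
lemma ip_add_left (hf : Continuous f) (hg : Continuous g) (hh : Continuous h) :
    ip V n (fun x => f x + g x) h = ip V n f h + ip V n g h := by
  unfold ip
  rw [← intervalIntegral.integral_add (ip_intervalIntegrable hV hf hh _ _)
    (ip_intervalIntegrable hV hg hh _ _)]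
  congr 1; ext x; ring

lemma ip_smul_left (c : ℂ) : ip V n (fun x => c * f x) g = c * ip V n f g := by
  unfold ip
  rw [← intervalIntegral.integral_const_mul]
  congr 1; ext x; ring

include hV in
lemma ip_sub_left (hf : Continuous f) (hg : Continuous g) (hh : Continuous h) :
    ip V n (fun x => f x - g x) h = ip V n f h - ip V n g h := by
  unfold ip
  rw [← intervalIntegral.integral_sub (ip_intervalIntegrable hV hf hh _ _)
    (ip_intervalIntegrable hV hg hh _ _)]
  congr 1; ext x; ring

lemma ip_conj : ip V n g f = conj (ip V n f g) := by
  unfold ip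
  rw [integral_of_le (by linarith [pi_pos]), integral_of_le (by linarith [pi_pos]), ← integral_conj]
  congr 1; ext x
  simp only [map_mul, conj_conj, conj_ofReal]; ring

include hV in
lemma ip_sum_left {ι : Type*} (s : Finset ι) {F : ι → ℝ → ℂ} (hF : ∀ i ∈ s, Continuous (F i))
    (hg : Continuous g) : ip V n (fun x => ∑ i ∈ s, F i x) g = ∑ i ∈ s, ip V n (F i) g := by
  unfold ip
  rw [← integral_finsetSum (fun i hi => ip_intervalIntegrable hV (hF i hi) hg _ _)]
  congr 1; ext x; rw [sum_mul, sum_mul]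

lemma ip_ez_mul (j : ℤ) : ip V n (fun x => ez j x * f x) (fun x => ez j x * g x) = ip V n f g := by
  unfold ip
  congr 1; ext x
  have : ez j x * conj (ez j x) = 1 := by
    rw [conj_ez, ← ez_add, add_neg_cancel, ez_zero]
  rw [map_mul]; linear_combination (f x * conj (g x) * (wt V n x : ℂ)) * this

lemma ip_conj_conj_ez (k j : ℤ) : ip V n (fun x => ez k x * conj (f x)) (ez j)
    = conj (ip V n f (ez (k - j))) := by
  rw [← ip_conj]
  unfold ip
  congr 1; ext x
  rw [conj_ez, sub_eq_add_neg, ez_add]; ring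

lemma ip_self_eq (f : ℝ → ℂ) :
    ip V n f f = ((∫ x in (-π)..π, ‖f x‖ ^ 2 * wt V n x : ℝ) : ℂ) := by
  rw [ip, ← intervalIntegral.integral_ofReal]
  congr 1; ext x
  rw [mul_conj, normSq_eq_norm_sq]; push_cast; ring

include hV in
lemma eq_zero_of_ip_self (hf : Continuous f) (h0 : ip V n f f = 0) :
    ∀ x ∈ Icc (-π) π, f x = 0 := by
  rw [ip_self_eq] at h0
  have h0' : ∫ x in (-π)..π, ‖f x‖ ^ 2 * wt V n x = 0 := by exact_mod_cast h0
  have hc : Continuous fun x => ‖f x‖ ^ 2 * wt V n x := by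
    have := continuous_wt hV n
    fun_prop
  have hpos : ∀ x, 0 ≤ ‖f x‖ ^ 2 * wt V n x := fun x => by have := wt_pos V n x; positivity
  intro x hx
  by_contra hne
  have := intervalIntegral.integral_pos (a := -π) (b := π) (by linarith [pi_pos])
    hc.continuousOn (fun y _ => hpos y) ⟨x, hx, by have := wt_pos V n x; positivity⟩
  linarith

end Weight

section Polynomials

open Polynomial

variable {V : ℝ → ℝ} (hV : ContinuousOn V 𝕁) (n : ℕ)

/-- A polynomial as a function of the angle. -/
def ev (p : ℂ[X]) (x : ℝ) : ℂ := p.eval (cexp (x * I))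

lemma continuous_ev (p : ℂ[X]) : Continuous (ev p) := by
  unfold ev; fun_prop

lemma innerProd_eq_ip (p q : ℂ[X]) : innerProd V n p q = ip V n (ev p) (ev q) := rfl

lemma ev_X_pow (l : ℕ) : ev (X ^ l) = ez l := by
  ext x; simp [ev, ez_pow]

lemma ev_eq_sum (p : ℂ[X]) {N : ℕ} (h : p.natDegree < N) (x : ℝ) :
    ev p x = ∑ l ∈ Finset.range N, p.coeff l * ez l x := by
  simp only [ev, eval_eq_sum_range' h, ez_pow]

lemma monicOP_eq (k : ℕ) : monicOP V n k = X ^ k - ∑ j : Fin k,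
    C (innerProd V n (X ^ k) (monicOP V n j) / innerProd V n (monicOP V n j) (monicOP V n j))
      * monicOP V n j := by
  rw [monicOP]

lemma monicOP_degree_aux (k : ℕ) : (monicOP V n k).natDegree ≤ k ∧ (monicOP V n k).coeff k = 1 := by
  induction k using Nat.strong_induction_on with
  | _ k ih =>
    rw [monicOP_eq]
    refine ⟨?_, ?_⟩
    · refine (natDegree_sub_le _ _).trans (max_le (natDegree_X_pow_le _) ?_)
      refine natDegree_sum_le_of_forall_le _ _ fun j _ => ?_
      exact (natDegree_C_mul_le _ _).trans ((ih j j.isLt).1.trans j.isLt.le)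
    · rw [coeff_sub, coeff_X_pow_self, finsetSum_coeff, sum_eq_zero, sub_zero]
      intro j _
      rw [coeff_C_mul, coeff_eq_zero_of_natDegree_lt ((ih j j.isLt).1.trans_lt j.isLt), mul_zero]

lemma monicOP_natDegree_le (k : ℕ) : (monicOP V n k).natDegree ≤ k := (monicOP_degree_aux n k).1

lemma monicOP_coeff_self (k : ℕ) : (monicOP V n k).coeff k = 1 := (monicOP_degree_aux n k).2

lemma eq_zero_of_ev_eq_zero {p : ℂ[X]} (h : ∀ x ∈ Icc (-π) π, ev p x = 0) :
    p = 0 := by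
  by_contra hp
  have hfin : (p.rootSet ℂ).Finite := rootSet_finite p ℂ
  have hsub : (fun x : ℝ => cexp (x * I)) '' Ioc (-π) π ⊆ p.rootSet ℂ := by
    rintro _ ⟨x, hx, rfl⟩
    rw [mem_rootSet]
    exact ⟨hp, by simpa [ev] using h x (Ioc_subset_Icc_self hx)⟩
  have hinj : InjOn (fun x : ℝ => cexp (x * I)) (Ioc (-π) π) := fun x hx y hy hxy => by
    have := congrArg Complex.arg hxy
    simp only at this
    rwa [Complex.arg_exp_mul_I, Complex.arg_exp_mul_I,
      (toIocMod_eq_self _).2 (by simpa [two_mul] using hx),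
      (toIocMod_eq_self _).2 (by simpa [two_mul] using hy)] at this
  exact (Ioc_infinite (by linarith [pi_pos])) ((hfin.subset hsub).of_finite_image hinj)

/-- The squared norm of the `k`-th monic orthogonal polynomial. -/
def nrm (V : ℝ → ℝ) (n k : ℕ) : ℝ := (innerProd V n (monicOP V n k) (monicOP V n k)).re

include hV in
lemma ip_ev_self_ne_zero {p : ℂ[X]} (hp : p ≠ 0) : ip V n (ev p) (ev p) ≠ 0 := fun h =>
  hp (eq_zero_of_ev_eq_zero (eq_zero_of_ip_self hV (continuous_ev p) h))

lemma monicOP_ne_zero (k : ℕ) : monicOP V n k ≠ 0 := fun h => by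
  have := monicOP_coeff_self (V := V) n k
  simp [h] at this

lemma ofReal_nrm (k : ℕ) : (nrm V n k : ℂ) = ip V n (ev (monicOP V n k)) (ev (monicOP V n k)) := by
  rw [nrm, innerProd_eq_ip, ip_self_eq, ofReal_re]

include hV in
lemma nrm_pos (k : ℕ) : 0 < nrm V n k := by
  have h1 : nrm V n k ≠ 0 := fun h => by
    apply ip_ev_self_ne_zero hV n (monicOP_ne_zero n k)
    rw [← ofReal_nrm, h]; simp
  refine lt_of_le_of_ne ?_ h1.symm
  rw [nrm, innerProd_eq_ip, ip_self_eq, ofReal_re]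
  refine intervalIntegral.integral_nonneg (by linarith [pi_pos]) fun x _ => ?_
  have := wt_pos V n x
  positivity

include hV in
lemma ip_monicOP_of_lt {j k : ℕ} (hjk : j < k) :
    ip V n (ev (monicOP V n k)) (ev (monicOP V n j)) = 0 := by
  induction k using Nat.strong_induction_on generalizing j with
  | _ k ih =>
    have e : ev (monicOP V n k) = fun x => ev (X ^ k) x - ∑ i : Fin k,
        (innerProd V n (X ^ k) (monicOP V n i) / innerProd V n (monicOP V n i) (monicOP V n i))
          * ev (monicOP V n i) x := by
      ext x
      conv_lhs => rw [monicOP_eq]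
      simp [ev, eval_finsetSum]
    have hcont : ∀ i : Fin k, Continuous fun x =>
        (innerProd V n (X ^ k) (monicOP V n i) / innerProd V n (monicOP V n i) (monicOP V n i))
          * ev (monicOP V n i) x := fun i => (continuous_ev _).const_mul _
    rw [e, ip_sub_left hV (continuous_ev _) (continuous_finsetSum _ fun i _ => hcont i)
      (continuous_ev _), ip_sum_left hV _ (fun i _ => hcont i) (continuous_ev _),
      sum_eq_single (⟨j, hjk⟩ : Fin k)]
    · rw [ip_smul_left, innerProd_eq_ip, innerProd_eq_ip, div_mul_cancel₀, sub_self]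
      exact ip_ev_self_ne_zero hV n (monicOP_ne_zero n j)
    · intro i _ hij
      rw [ip_smul_left]
      have hij' : (i : ℕ) ≠ j := fun h => hij (Fin.ext h)
      rcases lt_or_gt_of_ne hij' with h | h
      · rw [ip_conj, ih j hjk h]; simp
      · rw [ih i i.isLt h]; simp
    · simp

include hV in
lemma ip_monicOP_ez {k : ℕ} {l : ℤ} (h0 : 0 ≤ l) (hl : l < k) :
    ip V n (ev (monicOP V n k)) (ez l) = 0 := by
  lift l to ℕ using h0
  have e : ez l = fun x => ev (monicOP V n l) x + ∑ i : Fin l,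
      (innerProd V n (X ^ l) (monicOP V n i) / innerProd V n (monicOP V n i) (monicOP V n i))
        * ev (monicOP V n i) x := by
    ext x
    rw [← ev_X_pow]
    conv_rhs => rw [monicOP_eq]
    simp [ev, eval_finsetSum]
  have hcont : ∀ i : Fin l, Continuous fun x =>
      (innerProd V n (X ^ l) (monicOP V n i) / innerProd V n (monicOP V n i) (monicOP V n i))
        * ev (monicOP V n i) x := fun i => (continuous_ev _).const_mul _
  rw [ip_conj, e, ip_add_left hV (continuous_ev _) (continuous_finsetSum _ fun i _ => hcont i)
    (continuous_ev _), ip_sum_left hV _ (fun i _ => hcont i) (continuous_ev _), ip_conj,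
    ip_monicOP_of_lt hV n (by exact_mod_cast hl), sum_eq_zero]
  · simp
  · intro i _
    rw [ip_smul_left, ip_conj, ip_monicOP_of_lt hV n (i.isLt.trans (by exact_mod_cast hl))]
    simp

lemma conj_ev (p : ℂ[X]) (x : ℝ) :
    conj (ev p x) = ev (p.map conj) (-x) := by
  rw [ev, ev, ← Polynomial.eval_map_apply, ← Complex.exp_conj]
  congr 2; simp

lemma conj_innerProd (p q : ℂ[X]) : conj (innerProd V n p q)
    = innerProd V n (p.map conj) (q.map conj) := by
  have h : ∀ r : ℂ[X], ∀ x : ℝ, ev (r.map conj) x = conj (ev r (-x)) := fun r x => by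
    rw [conj_ev, neg_neg]
  rw [innerProd_eq_ip, innerProd_eq_ip, ip, ip]
  have := integral_comp_neg (a := -π) (b := π)
    (fun x => conj (ev p x) * conj (conj (ev q x)) * (wt V n x : ℂ))
  simp only [neg_neg, wt_neg] at this
  simp only [h]
  rw [this, integral_of_le (by linarith [pi_pos]),
    integral_of_le (by linarith [pi_pos]), ← integral_conj]
  simp only [map_mul, conj_ofReal]

/-- The weight is even, so conjugating the coefficients preserves orthogonality. -/
lemma monicOP_map_conj (k : ℕ) : (monicOP V n k).map conj = monicOP V n k := by
  induction k using Nat.strong_induction_on with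
  | _ k ih =>
    rw [monicOP_eq, Polynomial.map_sub, Polynomial.map_sum]
    congr 1
    · simp
    · refine sum_congr rfl fun j _ => ?_
      rw [Polynomial.map_mul, ih j j.isLt, map_C, map_div₀, conj_innerProd, conj_innerProd,
        ih j j.isLt]
      simp

end Polynomials

section Szego

open Polynomial

variable {V : ℝ → ℝ} (hV : ContinuousOn V 𝕁) (n : ℕ)

/-- The real coefficients of the monic orthogonal polynomials. -/
def mc (V : ℝ → ℝ) (n k l : ℕ) : ℝ := ((monicOP V n k).coeff l).re

lemma ofReal_mc (k l : ℕ) : (mc V n k l : ℂ) = (monicOP V n k).coeff l := by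
  have := congrArg (fun p => Polynomial.coeff p l) (monicOP_map_conj (V := V) n k)
  simp only [coeff_map] at this
  exact Complex.conj_eq_iff_re.1 this

lemma mc_self (k : ℕ) : mc V n k k = 1 := by simp [mc, monicOP_coeff_self]

lemma ev_monicOP_eq (k : ℕ) (x : ℝ) :
    ev (monicOP V n k) x = ∑ l ∈ Finset.range (k + 1), (mc V n k l : ℂ) * ez l x := by
  rw [ev_eq_sum _ (Nat.lt_succ_of_le (monicOP_natDegree_le n k))]
  simp only [ofReal_mc]

lemma coeffOP_eq (k l : ℕ) : coeffOP V n k l = (√(nrm V n k))⁻¹ * mc V n k l := by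
  rw [coeffOP, orthoPoly, coeff_C_mul, ← ofReal_mc, nrm, ← ofReal_mul, ofReal_re]

include hV in
lemma sqrt_nrm_pos (k : ℕ) : 0 < √(nrm V n k) := sqrt_pos.2 (nrm_pos hV n k)

include hV in
lemma alpha_eq (k : ℕ) : alpha V n k = mc V n k 0 := by
  have := sqrt_nrm_pos hV n k
  rw [alpha, coeffOP_eq, coeffOP_eq, mc_self]; field_simp

include hV in
lemma alpha_zero : alpha V n 0 = 1 := by rw [alpha_eq hV, mc_self]

lemma rho_zero : rho V n 0 = 0 := by simp [rho]

lemma rho_succ (k : ℕ) :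
    rho V n (k + 1) = √(nrm V n (k + 1)) / √(nrm V n k) := by
  rw [rho, if_neg (by omega), coeffOP_eq, coeffOP_eq, Nat.add_sub_cancel, mc_self, mc_self]
  field_simp

include hV in
lemma rho_pos {j : ℕ} (hj : 1 ≤ j) : 0 < rho V n j := by
  obtain ⟨k, rfl⟩ : ∃ k, j = k + 1 := ⟨j - 1, by omega⟩
  rw [rho_succ]
  exact div_pos (sqrt_nrm_pos hV n _) (sqrt_nrm_pos hV n _)

/-- The reversed polynomial, as a function of the angle. -/
def evs (V : ℝ → ℝ) (n k : ℕ) (x : ℝ) : ℂ := ez k x * conj (ev (monicOP V n k) x)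

lemma continuous_evs (k : ℕ) : Continuous (evs V n k) :=
  (continuous_ez _).mul (continuous_conj.comp (continuous_ev _))

lemma evs_eq (k : ℕ) (x : ℝ) :
    evs V n k x = ∑ l ∈ Finset.range (k + 1), (mc V n k l : ℂ) * ez ((k : ℤ) - l) x := by
  rw [evs, ev_monicOP_eq, map_sum, mul_sum]
  refine sum_congr rfl fun l _ => ?_
  rw [map_mul, conj_ofReal, conj_ez, sub_eq_add_neg, ez_add]; ring

lemma ez_succ (j : ℤ) (x : ℝ) : ez (j + 1) x = ez 1 x * ez j x := by rw [add_comm, ez_add]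

/-- The Szegő recursion: `Φ_{k+1} - zΦ_k - α_{k+1}Φ_k^*` has exponents `1, …, k` only and is
orthogonal to all of them. -/
lemma szego (hV : ContinuousOn V 𝕁) (k : ℕ) {x : ℝ} (hx : x ∈ Icc (-π) π) :
    ev (monicOP V n (k + 1)) x
      = ez 1 x * ev (monicOP V n k) x + (alpha V n (k + 1) : ℂ) * evs V n k x := by
  set A : ℝ := alpha V n (k + 1) with hA
  have hA' : A = mc V n (k + 1) 0 := alpha_eq hV n (k + 1)
  set g : ℝ → ℂ := fun x => (ev (monicOP V n (k + 1)) x - ez 1 x * ev (monicOP V n k) x)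
    - (A : ℂ) * evs V n k x with hg
  have c1 : Continuous fun x => ev (monicOP V n (k + 1)) x - ez 1 x * ev (monicOP V n k) x :=
    (continuous_ev _).sub ((continuous_ez _).mul (continuous_ev _))
  have c2 : Continuous fun x => (A : ℂ) * evs V n k x := (continuous_evs n k).const_mul _
  have hgc : Continuous g := c1.sub c2
  have hexp : ∀ x, g x = ∑ l ∈ Finset.range k,
      ((mc V n (k + 1) (l + 1) - mc V n k l - A * mc V n k (k - 1 - l) : ℝ) : ℂ)
        * ez ((l : ℤ) + 1) x := fun x => by
    have e1 : ev (monicOP V n (k + 1)) x = ez ((k : ℤ) + 1) x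
        + ∑ l ∈ Finset.range k, (mc V n (k + 1) (l + 1) : ℂ) * ez ((l : ℤ) + 1) x + A := by
      rw [ev_monicOP_eq, Finset.sum_range_succ', sum_range_succ, mc_self, hA']
      push_cast
      rw [ez_zero]; ring
    have e2 : ez 1 x * ev (monicOP V n k) x = ez ((k : ℤ) + 1) x
        + ∑ l ∈ Finset.range k, (mc V n k l : ℂ) * ez ((l : ℤ) + 1) x := by
      rw [ev_monicOP_eq, mul_sum, sum_range_succ, mc_self, add_comm, ez_succ]
      congr 1
      · simp
      · refine sum_congr rfl fun l _ => ?_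
        rw [ez_succ]; ring
    have e3 : evs V n k x = 1
        + ∑ l ∈ Finset.range k, (mc V n k (k - 1 - l) : ℂ) * ez ((l : ℤ) + 1) x := by
      rw [evs_eq, sum_range_succ, mc_self, sub_self, ez_zero, add_comm]
      congr 1
      · simp
      · rw [← Finset.sum_range_reflect]
        refine sum_congr rfl fun l hl => ?_
        have := Finset.mem_range.1 hl
        congr 2
        omega
    simp only [hg, e1, e2, e3]
    rw [mul_add, mul_sum, add_sub_add_comm]
    simp only [ofReal_sub, ofReal_mul, sub_mul, sum_sub_distrib, mul_assoc]
    ring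
  have horth : ∀ l : ℤ, 1 ≤ l → l ≤ k → ip V n g (ez l) = 0 := fun l h1 h2 => by
    have c3 : Continuous fun x => ez 1 x * ev (monicOP V n k) x :=
      (continuous_ez _).mul (continuous_ev _)
    have e1 : ip V n (fun x => ez 1 x * ev (monicOP V n k) x) (ez l) = 0 := by
      have : ez l = fun x => ez 1 x * ez (l - 1) x := by
        ext x; rw [← ez_add]; congr 1; ring
      rw [this, ip_ez_mul, ip_monicOP_ez hV n (by omega) (by omega)]
    have e2 : ip V n (evs V n k) (ez l) = 0 := by
      unfold evs
      rw [ip_conj_conj_ez, ip_monicOP_ez hV n (by omega) (by omega), map_zero]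
    rw [hg, ip_sub_left hV c1 c2 (continuous_ez l), ip_smul_left, e2,
      ip_sub_left hV (continuous_ev _) c3 (continuous_ez l),
      e1, ip_monicOP_ez hV n (by omega) (by push_cast; omega)]
    ring
  have h0 : ip V n g g = 0 := by
    have e : g = fun x => ∑ l ∈ Finset.range k,
      ((mc V n (k + 1) (l + 1) - mc V n k l - A * mc V n k (k - 1 - l) : ℝ) : ℂ)
        * ez ((l : ℤ) + 1) x := funext hexp
    rw [ip_conj]
    nth_rewrite 1 [e]
    rw [ip_sum_left hV _ (fun i _ => (continuous_ez _).const_mul _) hgc, sum_eq_zero, map_zero]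
    intro l hl
    have := Finset.mem_range.1 hl
    rw [ip_smul_left, ip_conj, horth _ (by omega) (by omega)]
    simp
  have := eq_zero_of_ip_self hV hgc h0 x hx
  simp only [hg] at this
  linear_combination this

/-- The Szegő recursion for the reversed polynomials, by conjugation. -/
lemma szego_star (hV : ContinuousOn V 𝕁) (k : ℕ) {x : ℝ} (hx : x ∈ Icc (-π) π) :
    evs V n (k + 1) x
      = evs V n k x + (alpha V n (k + 1) : ℂ) * (ez 1 x * ev (monicOP V n k) x) := by
  have e : ez k x * ez (-k) x = 1 := by rw [← ez_add, add_neg_cancel, ez_zero]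
  have e1 : ez 1 x * ez (-1) x = 1 := by rw [← ez_add, add_neg_cancel, ez_zero]
  unfold evs
  rw [szego n hV k hx, map_add, map_mul, map_mul, conj_ofReal, evs, map_mul,
    conj_conj, conj_ez, conj_ez]
  push_cast
  rw [ez_succ]
  linear_combination (ez k x * conj (ev (monicOP V n k) x)) * e1
    + (alpha V n (k + 1) : ℂ) * ez 1 x * ev (monicOP V n k) x * e

include hV in
lemma nrm_succ (k : ℕ) : nrm V n (k + 1) = (1 - alpha V n (k + 1) ^ 2) * nrm V n k := by
  set A : ℝ := alpha V n (k + 1) with hA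
  have hdecomp : ∀ x ∈ Icc (-π) π,
      ez 1 x * ev (monicOP V n k) x = ev (monicOP V n (k + 1)) x - (A : ℂ) * evs V n k x := fun x hx => by
    rw [szego n hV k hx]; ring
  have hN : ip V n (fun x => ez 1 x * ev (monicOP V n k) x)
      (fun x => ez 1 x * ev (monicOP V n k) x) = nrm V n k := by
    rw [ip_ez_mul, ofReal_nrm]
  have hN' : ip V n (evs V n k) (evs V n k) = nrm V n k := by
    rw [ofReal_nrm, ip_self_eq, ip_self_eq]
    congr 2; ext x
    simp [evs, norm_ez]
  have hO : ip V n (evs V n k) (ev (monicOP V n (k + 1))) = 0 := by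
    have : evs V n k = fun x => ∑ l ∈ Finset.range (k + 1),
        (mc V n k l : ℂ) * ez ((k : ℤ) - l) x := funext (evs_eq n k)
    rw [this, ip_sum_left hV _ (fun i _ => (continuous_ez _).const_mul _) (continuous_ev _),
      sum_eq_zero]
    intro l hl
    have := Finset.mem_range.1 hl
    rw [ip_smul_left, ip_conj, ip_monicOP_ez hV n (by omega) (by push_cast; omega)]
    simp
  have hO' : ip V n (ev (monicOP V n (k + 1))) (evs V n k) = 0 := by
    rw [ip_conj, hO, map_zero]
  have key : ip V n (fun x => ez 1 x * ev (monicOP V n k) x)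
      (fun x => ez 1 x * ev (monicOP V n k) x)
      = nrm V n (k + 1) + A ^ 2 * nrm V n k := by
    have e : ip V n (fun x => ez 1 x * ev (monicOP V n k) x)
      (fun x => ez 1 x * ev (monicOP V n k) x)
      = ip V n (fun x => ev (monicOP V n (k + 1)) x - (A : ℂ) * evs V n k x)
        (fun x => ev (monicOP V n (k + 1)) x - (A : ℂ) * evs V n k x) := by
      unfold ip
      apply integral_congr
      intro x hx
      rw [uIcc_of_le (by linarith [pi_pos])] at hx
      simp only [hdecomp x hx]
    have cc : Continuous fun x => (A : ℂ) * evs V n k x := (continuous_evs n k).const_mul _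
    have cd : Continuous fun x => ev (monicOP V n (k + 1)) x - (A : ℂ) * evs V n k x :=
      (continuous_ev _).sub cc
    rw [e, ip_sub_left hV (continuous_ev _) cc cd, ip_conj,
      ip_sub_left hV (continuous_ev _) cc (continuous_ev _), ip_smul_left, hO, ← ofReal_nrm,
      ip_smul_left, ip_conj, ip_sub_left hV (continuous_ev _) cc (continuous_evs n k),
      ip_smul_left, hO', hN']
    simp only [map_sub, map_mul, conj_ofReal, mul_zero, sub_zero, map_zero]; ring
  rw [hN] at key
  have key' : nrm V n k = nrm V n (k + 1) + A ^ 2 * nrm V n k := by exact_mod_cast key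
  linarith

include hV in
lemma alpha_sq_add_rho_sq (j : ℕ) : alpha V n j ^ 2 + rho V n j ^ 2 = 1 := by
  rcases j with _ | k
  · rw [alpha_zero hV, rho_zero]; norm_num
  · have h1 := nrm_pos hV n k
    rw [rho_succ, div_pow, sq_sqrt (nrm_pos hV n _).le, sq_sqrt h1.le, nrm_succ hV]; field_simp
    ring

include hV in
lemma rho_nonneg (j : ℕ) : 0 ≤ rho V n j := by
  rcases j with _ | k
  · rw [rho_zero]
  · exact (rho_pos hV n (by omega)).le

include hV in
lemma abs_alpha_le_one (j : ℕ) : |alpha V n j| ≤ 1 := by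
  rw [← sq_le_one_iff_abs_le_one]
  nlinarith [alpha_sq_add_rho_sq hV n j, sq_nonneg (rho V n j)]

include hV in
lemma abs_rho_le_one (j : ℕ) : |rho V n j| ≤ 1 := by
  rw [← sq_le_one_iff_abs_le_one]
  nlinarith [alpha_sq_add_rho_sq hV n j, sq_nonneg (alpha V n j)]

/-- The normalized orthogonal polynomials as functions of the angle. -/
def phi (V : ℝ → ℝ) (n k : ℕ) (x : ℝ) : ℂ := (√(nrm V n k) : ℂ)⁻¹ * ev (monicOP V n k) x

lemma szego_phi (hV : ContinuousOn V 𝕁) (k : ℕ) {x : ℝ} (hx : x ∈ Icc (-π) π) :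
    (rho V n (k + 1) : ℂ) * phi V n (k + 1) x = ez 1 x * phi V n k x
      + (alpha V n (k + 1) : ℂ) * (ez k x * conj (phi V n k x)) := by
  have h2 : (√(nrm V n (k + 1)) : ℂ) ≠ 0 := by
    exact_mod_cast (sqrt_nrm_pos hV n (k + 1)).ne'
  have := szego n hV k hx
  rw [evs] at this
  rw [phi, this, rho_succ, phi, map_mul, map_inv₀, conj_ofReal]
  push_cast; field_simp

lemma szego_phi_star (hV : ContinuousOn V 𝕁) (k : ℕ) {x : ℝ} (hx : x ∈ Icc (-π) π) :
    (rho V n (k + 1) : ℂ) * (ez (k + 1) x * conj (phi V n (k + 1) x)) = ez k x * conj (phi V n k x)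
      + (alpha V n (k + 1) : ℂ) * (ez 1 x * phi V n k x) := by
  have h1 : (√(nrm V n k) : ℂ) ≠ 0 := by exact_mod_cast (sqrt_nrm_pos hV n k).ne'
  have h2 : (√(nrm V n (k + 1)) : ℂ) ≠ 0 := by
    exact_mod_cast (sqrt_nrm_pos hV n (k + 1)).ne'
  have := szego_star n hV k hx
  rw [evs, evs] at this
  push_cast at this
  rw [phi, rho_succ, phi, map_mul, map_inv₀, conj_ofReal, map_mul, map_inv₀,
    conj_ofReal]
  push_cast; field_simp
  linear_combination this

end Szego

/-! ### The CMV basis -/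

section CMV

variable {V : ℝ → ℝ} (hV : ContinuousOn V 𝕁) (n : ℕ)

/-- The exponent of `z` to which the `l`-th coefficient of `P_j` is attached in the `j`-th element
of the CMV basis. -/
def cmvExp (j l : ℕ) : ℤ := if Even j then (j / 2 : ℕ) - (l : ℤ) else l - (j / 2 : ℕ)

/-- The CMV basis `χ_{2m} = z^m conj P_{2m}`, `χ_{2m+1} = z^{-m} P_{2m+1}`, `z = e^{ix}`: the
orthonormalization of `1, z, z⁻¹, z², z⁻², …`. -/
def cmvFun (V : ℝ → ℝ) (n j : ℕ) (x : ℝ) : ℂ :=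
  ∑ l ∈ Finset.range (j + 1), (coeffOP V n j l : ℂ) * ez (cmvExp j l) x

lemma continuous_cmvFun (j : ℕ) : Continuous (cmvFun V n j) :=
  continuous_finsetSum _ fun _ _ => (continuous_ez _).const_mul _

lemma phi_eq (k : ℕ) (x : ℝ) :
    phi V n k x = ∑ l ∈ Finset.range (k + 1), (coeffOP V n k l : ℂ) * ez l x := by
  rw [phi, ev_monicOP_eq, mul_sum]
  refine sum_congr rfl fun l _ => ?_
  rw [coeffOP_eq]; push_cast; ring

lemma cmvFun_even (m : ℕ) (x : ℝ) :
    cmvFun V n (2 * m) x = ez m x * conj (phi V n (2 * m) x) := by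
  rw [cmvFun, phi_eq, map_sum, mul_sum]
  refine sum_congr rfl fun l _ => ?_
  rw [map_mul, conj_ofReal, conj_ez, cmvExp, if_pos (even_two_mul m),
    show 2 * m / 2 = m by omega, sub_eq_add_neg, ez_add]; ring

lemma cmvFun_odd (m : ℕ) (x : ℝ) :
    cmvFun V n (2 * m + 1) x = ez (-m) x * phi V n (2 * m + 1) x := by
  rw [cmvFun, phi_eq, mul_sum]
  refine sum_congr rfl fun l _ => ?_
  rw [cmvExp, if_neg (Nat.not_even_two_mul_add_one m),
    show (2 * m + 1) / 2 = m by omega, sub_eq_add_neg, ez_add]; ring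

include hV in
lemma phi_ip_ez {k : ℕ} {l : ℤ} (h0 : 0 ≤ l) (hl : l < k) : ip V n (phi V n k) (ez l) = 0 := by
  unfold phi
  rw [ip_smul_left, ip_monicOP_ez hV n h0 hl, mul_zero]

include hV in
lemma phi_ip_self (k : ℕ) : ip V n (phi V n k) (phi V n k) = 1 := by
  have h := sqrt_nrm_pos hV n k
  have h2 : (nrm V n k : ℂ) = (√(nrm V n k) : ℂ) * √(nrm V n k) := by
    rw [← ofReal_mul, mul_self_sqrt (nrm_pos hV n k).le]
  unfold phi
  rw [ip_smul_left, ip_conj, ip_smul_left, ← ofReal_nrm, map_mul, map_inv₀, conj_ofReal,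
    conj_ofReal]
  have : (√(nrm V n k) : ℂ) ≠ 0 := by exact_mod_cast h.ne'
  rw [h2]; field_simp

include hV in
lemma cmvFun_ip_self (j : ℕ) : ip V n (cmvFun V n j) (cmvFun V n j) = 1 := by
  rw [← phi_ip_self hV n j, ip_self_eq, ip_self_eq]
  congr 2; ext x
  obtain ⟨m, rfl | rfl⟩ := Nat.even_or_odd' j
  · rw [cmvFun_even]; simp [norm_ez]
  · rw [cmvFun_odd]; simp [norm_ez]

include hV in
lemma cmvFun_ip_ez_even {m : ℕ} {i : ℤ} (h0 : -m < i) (hl : i ≤ m) :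
    ip V n (cmvFun V n (2 * m)) (ez i) = 0 := by
  rw [funext (cmvFun_even n m), ip_conj_conj_ez, phi_ip_ez hV n (by omega) (by push_cast; omega),
    map_zero]

include hV in
lemma cmvFun_ip_ez_odd {m : ℕ} {i : ℤ} (h0 : -m ≤ i) (hl : i ≤ m) :
    ip V n (cmvFun V n (2 * m + 1)) (ez i) = 0 := by
  have : ez i = fun x => ez (-m) x * ez (i + m) x := by
    ext x; rw [← ez_add]; congr 1; ring
  rw [funext (cmvFun_odd n m), this, ip_ez_mul, phi_ip_ez hV n (by omega) (by push_cast; omega)]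

include hV in
/-- `χ_j` is orthogonal to all monomials of the preceding basis elements. -/
lemma cmvFun_ip_ez {j k l : ℕ} (hkj : k < j) (hl : l ≤ k) :
    ip V n (cmvFun V n j) (ez (cmvExp k l)) = 0 := by
  obtain ⟨m, rfl | rfl⟩ := Nat.even_or_odd' j
  · apply cmvFun_ip_ez_even hV n <;> unfold cmvExp <;> split_ifs with h
    · obtain ⟨q, rfl⟩ := h; omega
    · obtain ⟨q, rfl⟩ := Nat.not_even_iff_odd.1 h; omega
    · obtain ⟨q, rfl⟩ := h; omega
    · obtain ⟨q, rfl⟩ := Nat.not_even_iff_odd.1 h; omega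
  · apply cmvFun_ip_ez_odd hV n <;> unfold cmvExp <;> split_ifs with h <;> omega

include hV in
lemma cmvFun_ip_of_lt {j k : ℕ} (hkj : k < j) :
    ip V n (cmvFun V n j) (cmvFun V n k) = 0 := by
  rw [ip_conj]
  nth_rewrite 1 [show cmvFun V n k = fun x => ∑ l ∈ Finset.range (k + 1),
    (coeffOP V n k l : ℂ) * ez (cmvExp k l) x from rfl]
  rw [ip_sum_left hV _ (fun i _ => (continuous_ez _).const_mul _) (continuous_cmvFun n j),
    sum_eq_zero, map_zero]
  intro l hl
  rw [ip_smul_left, ip_conj, cmvFun_ip_ez hV n hkj (Nat.lt_succ_iff.1 (Finset.mem_range.1 hl))]; simp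

include hV in
lemma cmvFun_orthonormal (j k : ℕ) :
    ip V n (cmvFun V n j) (cmvFun V n k) = if j = k then 1 else 0 := by
  rcases lt_trichotomy j k with h | h | h
  · rw [if_neg h.ne, ip_conj, cmvFun_ip_of_lt hV n h, map_zero]
  · rw [if_pos h, h, cmvFun_ip_self hV]
  · rw [if_neg h.ne', cmvFun_ip_of_lt hV n h]

/-! The two block-diagonal factors of the CMV matrix. -/

lemma ez_conj_cmvFun_even (hV : ContinuousOn V 𝕁) (m : ℕ) {x : ℝ} (hx : x ∈ Icc (-π) π) :
    ez 1 x * conj (cmvFun V n (2 * m) x) = rho V n (2 * m + 1) * cmvFun V n (2 * m + 1) x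
        - alpha V n (2 * m + 1) * cmvFun V n (2 * m) x := by
  have h := szego_phi n hV (2 * m) hx
  rw [cmvFun_even, cmvFun_odd, map_mul, conj_conj, conj_ez]
  have e : ez (-m) x * ez ((2 * m : ℕ) : ℤ) x = ez m x := by
    rw [← ez_add]; congr 1; push_cast; ring
  linear_combination (-ez (-m) x) * h - (alpha V n (2 * m + 1)) * conj (phi V n (2 * m) x) * e

lemma ez_conj_cmvFun_odd (hV : ContinuousOn V 𝕁) (m : ℕ) {x : ℝ} (hx : x ∈ Icc (-π) π) :
    ez 1 x * conj (cmvFun V n (2 * m + 1) x) = rho V n (2 * m + 1) * cmvFun V n (2 * m) x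
        + alpha V n (2 * m + 1) * cmvFun V n (2 * m + 1) x := by
  have h := szego_phi_star n hV (2 * m) hx
  have h1 := ez_conj_cmvFun_even n hV m hx
  have hr : (rho V n (2 * m + 1) : ℂ) ≠ 0 := by
    exact_mod_cast (rho_pos hV n (by omega : 1 ≤ 2 * m + 1)).ne'
  have hs : (alpha V n (2 * m + 1) : ℂ) ^ 2 + (rho V n (2 * m + 1) : ℂ) ^ 2 = 1 := by
    exact_mod_cast alpha_sq_add_rho_sq hV n (2 * m + 1)
  apply mul_left_cancel₀ hr
  have e : ez (-m) x * ez ((2 * m : ℕ) : ℤ) x = ez m x := by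
    rw [← ez_add]; congr 1; push_cast; ring
  have e2 : ez (-m) x * ez (((2 * m : ℕ) : ℤ) + 1) x = ez 1 x * ez m x := by
    rw [← ez_add, ← ez_add]; congr 1; push_cast; ring
  have h2 : rho V n (2 * m + 1) * (ez 1 x * conj (cmvFun V n (2 * m + 1) x)) = cmvFun V n (2 * m) x
        + alpha V n (2 * m + 1) * (ez 1 x * conj (cmvFun V n (2 * m) x)) := by
    rw [cmvFun_even, cmvFun_odd, map_mul, map_mul, conj_conj, conj_ez, conj_ez, neg_neg]
    linear_combination ez (-m) x * h + conj (phi V n (2 * m) x) * e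
      - rho V n (2 * m + 1) * conj (phi V n (2 * m + 1) x) * e2
  rw [h2, h1]
  linear_combination -cmvFun V n (2 * m) x * hs

lemma conj_cmvFun_even_succ (hV : ContinuousOn V 𝕁) (m : ℕ) {x : ℝ}
    (hx : x ∈ Icc (-π) π) :
    conj (cmvFun V n (2 * m + 2) x) = rho V n (2 * m + 2) * cmvFun V n (2 * m + 1) x
        + alpha V n (2 * m + 2) * cmvFun V n (2 * m + 2) x
    ∧ conj (cmvFun V n (2 * m + 1) x) = rho V n (2 * m + 2) * cmvFun V n (2 * m + 2) x
        - alpha V n (2 * m + 2) * cmvFun V n (2 * m + 1) x := by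
  have h := szego_phi n hV (2 * m + 1) hx
  have h' := szego_phi_star n hV (2 * m + 1) hx
  have hr : (rho V n (2 * m + 2) : ℂ) ≠ 0 := by
    exact_mod_cast (rho_pos hV n (by omega : 1 ≤ 2 * m + 2)).ne'
  have hs : (alpha V n (2 * m + 2) : ℂ) ^ 2 + (rho V n (2 * m + 2) : ℂ) ^ 2 = 1 := by
    exact_mod_cast alpha_sq_add_rho_sq hV n (2 * m + 2)
  have f1 := cmvFun_odd (V := V) n m x
  have f2 := cmvFun_even (V := V) n (m + 1) x
  rw [show 2 * (m + 1) = 2 * m + 2 by ring] at f2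
  push_cast at h h' f2
  have e1 : ez (-(m + 1)) x * ez 1 x = ez (-m) x := by
    rw [← ez_add]; congr 1; ring
  have e2 : ez (-(m + 1)) x * ez (2 * m + 1) x = ez m x := by
    rw [← ez_add]; congr 1; ring
  have e3 : ez (-(m + 1)) x * ez (2 * m + 1 + 1) x = ez (m + 1) x := by
    rw [← ez_add]; congr 1; ring
  have a1 : rho V n (2 * m + 2) * conj (cmvFun V n (2 * m + 2) x) = cmvFun V n (2 * m + 1) x
        + alpha V n (2 * m + 2) * conj (cmvFun V n (2 * m + 1) x) := by
    rw [f1, f2, map_mul, map_mul, conj_conj, conj_ez, conj_ez, neg_neg]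
    linear_combination ez (-(m + 1)) x * h + phi V n (2 * m + 1) x * e1
      + alpha V n (2 * m + 2) * conj (phi V n (2 * m + 1) x) * e2
  have a2 : rho V n (2 * m + 2) * cmvFun V n (2 * m + 2) x = conj (cmvFun V n (2 * m + 1) x)
        + alpha V n (2 * m + 2) * cmvFun V n (2 * m + 1) x := by
    rw [f1, f2, map_mul, conj_ez, neg_neg]
    linear_combination ez (-(m + 1)) x * h'
      - rho V n (2 * m + 2) * conj (phi V n (2 * m + 2) x) * e3
      + alpha V n (2 * m + 2) * phi V n (2 * m + 1) x * e1
      + conj (phi V n (2 * m + 1) x) * e2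
  have a3 : conj (cmvFun V n (2 * m + 1) x) = rho V n (2 * m + 2) * cmvFun V n (2 * m + 2) x
        - alpha V n (2 * m + 2) * cmvFun V n (2 * m + 1) x := by
    linear_combination -a2
  refine ⟨?_, a3⟩
  apply mul_left_cancel₀ hr
  rw [a1, a3]
  linear_combination (-cmvFun V n (2 * m + 1) x) * hs

lemma conj_cmvFun_zero (x : ℝ) :
    conj (cmvFun V n 0 x) = cmvFun V n 0 x := by
  simp [cmvFun, cmvExp, ez_zero]

/-- `χ_{2m}` in terms of the conjugate basis; for `m = 0` the term with the truncated index
`2m - 1` has the coefficient `ρ_0 = 0`. -/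
lemma conj_cmvFun_even (hV : ContinuousOn V 𝕁) (m : ℕ) {x : ℝ} (hx : x ∈ Icc (-π) π) :
    conj (cmvFun V n (2 * m) x)
      = rho V n (2 * m) * cmvFun V n (2 * m - 1) x + alpha V n (2 * m) * cmvFun V n (2 * m) x := by
  rcases m with _ | m
  · rw [mul_zero, rho_zero, alpha_zero hV, conj_cmvFun_zero]; simp
  · exact (conj_cmvFun_even_succ n hV m hx).1

lemma ez_cmvFun_even (hV : ContinuousOn V 𝕁) (m : ℕ) {x : ℝ} (hx : x ∈ Icc (-π) π) :
    ez 1 x * cmvFun V n (2 * m) x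
      = rho V n (2 * m) * (rho V n (2 * m - 1) * cmvFun V n (2 * m - 2) x
          + alpha V n (2 * m - 1) * cmvFun V n (2 * m - 1) x)
        + alpha V n (2 * m) * (rho V n (2 * m + 1) * cmvFun V n (2 * m + 1) x
          - alpha V n (2 * m + 1) * cmvFun V n (2 * m) x) := by
  have h := congrArg conj (conj_cmvFun_even n hV m hx)
  rw [map_add, map_mul, map_mul, conj_conj, conj_ofReal, conj_ofReal] at h
  conv_lhs => rw [h]
  rw [mul_add, mul_left_comm, mul_left_comm (ez 1 x), ez_conj_cmvFun_even n hV m hx]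
  rcases m with _ | m
  · simp [rho_zero]
  · rw [show 2 * (m + 1) - 1 = 2 * m + 1 by omega, ez_conj_cmvFun_odd n hV m hx,
      show 2 * (m + 1) - 2 = 2 * m by omega]

lemma ez_cmvFun_odd (hV : ContinuousOn V 𝕁) (m : ℕ) {x : ℝ} (hx : x ∈ Icc (-π) π) :
    ez 1 x * cmvFun V n (2 * m + 1) x
      = rho V n (2 * m + 2) * (rho V n (2 * m + 3) * cmvFun V n (2 * m + 3) x
          - alpha V n (2 * m + 3) * cmvFun V n (2 * m + 2) x)
        - alpha V n (2 * m + 2) * (rho V n (2 * m + 1) * cmvFun V n (2 * m) x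
          + alpha V n (2 * m + 1) * cmvFun V n (2 * m + 1) x) := by
  have h := congrArg conj (conj_cmvFun_even_succ n hV m hx).2
  rw [map_sub, map_mul, map_mul, conj_conj, conj_ofReal, conj_ofReal] at h
  have h1 := ez_conj_cmvFun_even n hV (m + 1) hx
  rw [show 2 * (m + 1) = 2 * m + 2 by ring, show 2 * m + 2 + 1 = 2 * m + 3 by ring] at h1
  conv_lhs => rw [h]
  rw [mul_sub, mul_left_comm, mul_left_comm (ez 1 x) (alpha V n (2 * m + 2) : ℂ), h1,
    ez_conj_cmvFun_odd n hV m hx]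

lemma ez_neg_cmvFun_even (hV : ContinuousOn V 𝕁) (m : ℕ) {x : ℝ} (hx : x ∈ Icc (-π) π) :
    ez (-1) x * cmvFun V n (2 * m) x
      = rho V n (2 * m + 1) * (rho V n (2 * m + 2) * cmvFun V n (2 * m + 2) x
          - alpha V n (2 * m + 2) * cmvFun V n (2 * m + 1) x)
        - alpha V n (2 * m + 1) * (rho V n (2 * m) * cmvFun V n (2 * m - 1) x
          + alpha V n (2 * m) * cmvFun V n (2 * m) x) := by
  have h := congrArg conj (ez_conj_cmvFun_even n hV m hx)
  rw [map_mul, map_sub, map_mul, map_mul, conj_conj, conj_ofReal,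
    conj_ofReal, conj_ez] at h
  rw [h, (conj_cmvFun_even_succ n hV m hx).2, conj_cmvFun_even n hV m hx]

lemma ez_neg_cmvFun_odd (hV : ContinuousOn V 𝕁) (m : ℕ) {x : ℝ} (hx : x ∈ Icc (-π) π) :
    ez (-1) x * cmvFun V n (2 * m + 1) x
      = rho V n (2 * m + 1) * (rho V n (2 * m) * cmvFun V n (2 * m - 1) x
          + alpha V n (2 * m) * cmvFun V n (2 * m) x)
        + alpha V n (2 * m + 1) * (rho V n (2 * m + 2) * cmvFun V n (2 * m + 2) x
          - alpha V n (2 * m + 2) * cmvFun V n (2 * m + 1) x) := by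
  have h := congrArg conj (ez_conj_cmvFun_odd n hV m hx)
  rw [map_mul, map_add, map_mul, map_mul, conj_conj, conj_ofReal,
    conj_ofReal, conj_ez] at h
  rw [h, (conj_cmvFun_even_succ n hV m hx).2, conj_cmvFun_even n hV m hx]

/-- Multiplication by `cos x` in the CMV basis; terms with a truncated index have the coefficient
`ρ_0 = 0`. -/
lemma cos_mul_cmvFun (hV : ContinuousOn V 𝕁) (j : ℕ) {x : ℝ} (hx : x ∈ Icc (-π) π) :
    (cos x : ℂ) * cmvFun V n j x = (rho V n (j - 1) * rho V n j / 2 : ℝ) * cmvFun V n (j - 2) x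
        + (rho V n j * (alpha V n (j - 1) - alpha V n (j + 1)) / 2 : ℝ) * cmvFun V n (j - 1) x
        + (-(alpha V n j * alpha V n (j + 1)) : ℝ) * cmvFun V n j x
        + (rho V n (j + 1) * (alpha V n j - alpha V n (j + 2)) / 2 : ℝ) * cmvFun V n (j + 1) x
        + (rho V n (j + 1) * rho V n (j + 2) / 2 : ℝ) * cmvFun V n (j + 2) x := by
  have e : (cos x : ℂ) = (ez 1 x + ez (-1) x) / 2 := by rw [ez_one, ez_neg_one]; ring
  obtain ⟨m, rfl | rfl⟩ := Nat.even_or_odd' j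
  · rw [e]
    push_cast
    linear_combination (ez_cmvFun_even n hV m hx + ez_neg_cmvFun_even n hV m hx) / 2
  · rw [e, show 2 * m + 1 - 1 = 2 * m by omega, show 2 * m + 1 - 2 = 2 * m - 1 by omega,
      show 2 * m + 1 + 1 = 2 * m + 2 by omega, show 2 * m + 1 + 2 = 2 * m + 3 by omega]
    push_cast
    linear_combination (ez_cmvFun_odd n hV m hx + ez_neg_cmvFun_odd n hV m hx) / 2

/-- Multiplication by `i sin x` in the CMV basis. -/
lemma sin_mul_cmvFun (hV : ContinuousOn V 𝕁) (j : ℕ) {x : ℝ} (hx : x ∈ Icc (-π) π) :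
    (sin x : ℂ) * I * cmvFun V n j x
      = ((-1) ^ j * (rho V n (j - 1) * rho V n j / 2) : ℝ) * cmvFun V n (j - 2) x
        + ((-1) ^ j * (rho V n j * (alpha V n (j - 1) + alpha V n (j + 1)) / 2) : ℝ)
          * cmvFun V n (j - 1) x
        + ((-1) ^ j * (rho V n (j + 1) * (alpha V n j + alpha V n (j + 2)) / 2) : ℝ)
          * cmvFun V n (j + 1) x
        + (-((-1) ^ j * (rho V n (j + 1) * rho V n (j + 2) / 2)) : ℝ) * cmvFun V n (j + 2) x := by
  have e : (sin x : ℂ) * I = (ez 1 x - ez (-1) x) / 2 := by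
    rw [ez_one, ez_neg_one]; ring
  obtain ⟨m, rfl | rfl⟩ := Nat.even_or_odd' j
  · rw [e, (even_two_mul m).neg_one_pow]
    push_cast
    linear_combination (ez_cmvFun_even n hV m hx - ez_neg_cmvFun_even n hV m hx) / 2
  · rw [e, (odd_two_mul_add_one m).neg_one_pow,
      show 2 * m + 1 - 1 = 2 * m by omega, show 2 * m + 1 - 2 = 2 * m - 1 by omega,
      show 2 * m + 1 + 1 = 2 * m + 2 by omega, show 2 * m + 1 + 2 = 2 * m + 3 by omega]
    push_cast
    linear_combination (ez_cmvFun_odd n hV m hx - ez_neg_cmvFun_odd n hV m hx) / 2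

end CMV

/-! ### The string equations -/

lemma hasDerivAt_V_cos {V : ℝ → ℝ} (hd : DifferentiableOn ℝ V 𝕁) (x : ℝ) :
    HasDerivAt (fun t => V (cos t)) (-(dV V (cos x) * sin x)) x := by
  have h1 : HasDerivWithinAt V (dV V (cos x)) 𝕁 (cos x) :=
    (hd _ ⟨neg_one_le_cos x, cos_le_one x⟩).hasDerivWithinAt
  have := h1.comp_hasDerivAt x (hasDerivAt_cos x)
    (of_forall fun t => ⟨neg_one_le_cos t, cos_le_one t⟩)
  convert! this using 1
  ring

section StringEquation

variable {V : ℝ → ℝ} (n : ℕ)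

/-- The derivative of `χ_j` divided by `i`. -/
def cmvDer (V : ℝ → ℝ) (n j : ℕ) (x : ℝ) : ℂ :=
  ∑ l ∈ Finset.range (j + 1), (coeffOP V n j l * cmvExp j l : ℝ) * ez (cmvExp j l) x

lemma continuous_cmvDer (j : ℕ) : Continuous (cmvDer V n j) :=
  continuous_finsetSum _ fun _ _ => (continuous_ez _).const_mul _

lemma hasDerivAt_cmvFun (j : ℕ) (x : ℝ) :
    HasDerivAt (cmvFun V n j) (I * cmvDer V n j x) x := by
  have : HasDerivAt (fun x => ∑ l ∈ Finset.range (j + 1), (coeffOP V n j l : ℂ) * ez (cmvExp j l) x)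
      (∑ l ∈ Finset.range (j + 1), (coeffOP V n j l : ℂ)
        * (cmvExp j l * I * ez (cmvExp j l) x)) x :=
    HasDerivAt.fun_sum fun l _ => (hasDerivAt_ez _ x).const_mul _
  convert! this using 1
  rw [cmvDer, mul_sum]
  refine sum_congr rfl fun l _ => ?_
  push_cast; ring

lemma cmvFun_pi (j : ℕ) : cmvFun V n j (-π) = cmvFun V n j π := by
  simp only [cmvFun, ez_pi]

lemma ip_cmvFun_cmvDer (hV : ContinuousOn V 𝕁) {j k : ℕ} (h : k < j) :
    ip V n (cmvFun V n j) (cmvDer V n k) = 0 := by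
  rw [ip_conj]
  nth_rewrite 1 [show cmvDer V n k = fun x => ∑ l ∈ Finset.range (k + 1),
    ((coeffOP V n k l * cmvExp k l : ℝ) : ℂ) * ez (cmvExp k l) x from rfl]
  rw [ip_sum_left hV _ (fun i _ => (continuous_ez _).const_mul _) (continuous_cmvFun n j),
    sum_eq_zero, map_zero]
  intro l hl
  rw [ip_smul_left, ip_conj, cmvFun_ip_ez hV n h (Nat.lt_succ_iff.1 (Finset.mem_range.1 hl))]; simp

lemma coeffOP_self_pos (hV : ContinuousOn V 𝕁) (k : ℕ) : 0 < coeffOP V n k k := by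
  rw [coeffOP_eq, mc_self, mul_one]
  exact inv_pos.2 (sqrt_nrm_pos hV n k)

/-- The pairing of `χ_j` with the monomial that is new in the `j`-th step. -/
lemma ez_top_ip_cmvFun (hV : ContinuousOn V 𝕁) (j : ℕ) :
    ip V n (ez (cmvExp j j)) (cmvFun V n j) = (coeffOP V n j j : ℂ)⁻¹ := by
  -- only the monomial with the highest index pairs non-trivially
  have hlow : ∀ l < j, ip V n (ez (cmvExp j l)) (cmvFun V n j) = 0 := fun l hl => by
    rw [ip_conj]
    have : ip V n (cmvFun V n j) (ez (cmvExp j l)) = 0 := by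
      obtain ⟨m, rfl | rfl⟩ := Nat.even_or_odd' j
      · apply cmvFun_ip_ez_even hV n <;> rw [cmvExp, if_pos (even_two_mul m)] <;> omega
      · apply cmvFun_ip_ez_odd hV n <;>
          rw [cmvExp, if_neg (Nat.not_even_two_mul_add_one m)] <;> omega
    rw [this, map_zero]
  have h := cmvFun_ip_self hV n j
  nth_rewrite 1 [show cmvFun V n j = fun x => ∑ l ∈ Finset.range (j + 1),
    (coeffOP V n j l : ℂ) * ez (cmvExp j l) x from rfl] at h
  rw [ip_sum_left hV _ (fun i _ => (continuous_ez _).const_mul _) (continuous_cmvFun n j),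
    sum_range_succ, sum_eq_zero, zero_add, ip_smul_left] at h
  · exact eq_inv_of_mul_eq_one_right h
  · intro l hl
    rw [ip_smul_left, hlow l (Finset.mem_range.1 hl), mul_zero]

/-- Modulo `χ_j` itself, the derivative of `χ_j` has only one monomial that is not orthogonal to
`χ_{j-1}`; its coefficient is `c_{j,0}`. -/
lemma ip_cmvDer (hV : ContinuousOn V 𝕁) {j : ℕ} (hj : 1 ≤ j) :
    ip V n (cmvDer V n j) (cmvFun V n (j - 1))
      = ((-1) ^ j * (j * (alpha V n j / rho V n j)) : ℝ) := by
  set ε : ℝ := (-1) ^ j with hε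
  have hexp : ∀ l : ℕ, (cmvExp j l : ℝ) = ε * ((j / 2 : ℕ) - l) := fun l => by
    rcases Nat.even_or_odd j with h | h
    · rw [cmvExp, if_pos h, hε, h.neg_one_pow, Int.cast_sub, Int.cast_natCast,
        Int.cast_natCast]; ring
    · rw [cmvExp, if_neg (Nat.not_even_iff_odd.2 h), hε, h.neg_one_pow, Int.cast_sub, Int.cast_natCast,
        Int.cast_natCast]; ring
  have hdec : cmvDer V n j = fun x => (ε * ((j / 2 : ℕ) - j) : ℝ) * cmvFun V n j x
      + ∑ l ∈ Finset.range j, ((coeffOP V n j l * (ε * (j - l)) : ℝ) : ℂ) * ez (cmvExp j l) x := by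
    ext x
    have e : ∑ l ∈ Finset.range j, ((coeffOP V n j l * (ε * (j - l)) : ℝ) : ℂ) * ez (cmvExp j l) x
        = ∑ l ∈ Finset.range (j + 1),
          ((coeffOP V n j l * (ε * (j - l)) : ℝ) : ℂ) * ez (cmvExp j l) x := by
      rw [sum_range_succ]; simp
    rw [e, cmvDer, cmvFun, mul_sum, ← sum_add_distrib]
    refine sum_congr rfl fun l _ => ?_
    rw [hexp]; push_cast; ring
  have hz : ∀ l : ℕ, 1 ≤ l → l < j → ip V n (ez (cmvExp j l)) (cmvFun V n (j - 1)) = 0 := fun l h1 h2 => by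
    rw [ip_conj]
    have : ip V n (cmvFun V n (j - 1)) (ez (cmvExp j l)) = 0 := by
      obtain ⟨m, rfl | rfl⟩ := Nat.even_or_odd' j
      · obtain ⟨m, rfl⟩ : ∃ q, m = q + 1 := ⟨m - 1, by omega⟩
        rw [show 2 * (m + 1) - 1 = 2 * m + 1 by omega]
        apply cmvFun_ip_ez_odd hV n <;> rw [cmvExp, if_pos (even_two_mul _)] <;> omega
      · rw [show 2 * m + 1 - 1 = 2 * m by omega]
        apply cmvFun_ip_ez_even hV n <;>
          rw [cmvExp, if_neg (Nat.not_even_two_mul_add_one m)] <;> omega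
    rw [this, map_zero]
  have htop : cmvExp j 0 = cmvExp (j - 1) (j - 1) := by
    obtain ⟨m, rfl | rfl⟩ := Nat.even_or_odd' j
    · obtain ⟨m, rfl⟩ : ∃ q, m = q + 1 := ⟨m - 1, by omega⟩
      rw [show 2 * (m + 1) - 1 = 2 * m + 1 by omega, cmvExp, cmvExp, if_pos (even_two_mul _),
        if_neg (Nat.not_even_two_mul_add_one m)]
      omega
    · rw [show 2 * m + 1 - 1 = 2 * m by omega, cmvExp, cmvExp, if_pos (even_two_mul _),
        if_neg (Nat.not_even_two_mul_add_one m)]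
      omega
  have hk0 := (coeffOP_self_pos n hV j).ne'
  have hcont : ∀ l ∈ Finset.range j, Continuous fun x =>
      ((coeffOP V n j l * (ε * (j - l)) : ℝ) : ℂ) * ez (cmvExp j l) x :=
    fun l _ => (continuous_ez _).const_mul _
  rw [hdec, ip_add_left hV ((continuous_cmvFun n j).const_mul _) (continuous_finsetSum _ hcont)
    (continuous_cmvFun n _), ip_smul_left, cmvFun_ip_of_lt hV n (by omega), mul_zero, zero_add,
    ip_sum_left hV _ hcont (continuous_cmvFun n _), sum_eq_single 0]
  · rw [ip_smul_left, htop, ez_top_ip_cmvFun n hV, alpha, rho, if_neg (by omega)]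
    push_cast
    have h0 : (coeffOP V n j j : ℂ) ≠ 0 := by exact_mod_cast hk0
    field_simp; ring
  · intro l hl h0
    rw [ip_smul_left, hz l (by omega) (Finset.mem_range.1 hl), mul_zero]
  · intro h; exact absurd (Finset.mem_range.2 (by omega)) h

/-- The string equation, obtained by integrating the derivative of `χ_j χ̄_{j-1} e^{-nV(cos x)}`
over the circle. -/
lemma string_equation (hd : DifferentiableOn ℝ V 𝕁)
    (hdc : ContinuousOn (dV V) 𝕁) (hn : 1 ≤ n) {j : ℕ} (hj : 1 ≤ j) :
    ip V n (fun x => (dV V (cos x) : ℂ) * (sin x * I * cmvFun V n j x))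
      (cmvFun V n (j - 1)) = ((-1) ^ j * (alpha V n j / rho V n j * (j / n)) : ℝ) := by
  have hV := hd.continuousOn
  have hdcos : Continuous fun x => dV V (cos x) :=
    hdc.comp_continuous continuous_cos fun x => ⟨neg_one_le_cos x, cos_le_one x⟩
  have hw : ∀ x, HasDerivAt (wt V n) (n * (dV V (cos x) * sin x) * wt V n x) x := fun x => by
    have := (((hasDerivAt_V_cos hd x).const_mul (n : ℝ)).neg).exp
    convert! this using 1
    rw [wt]; simp only [Pi.neg_apply]; ring
  set f : ℝ → ℂ := fun x => cmvFun V n j x * conj (cmvFun V n (j - 1) x) * (wt V n x : ℂ)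
  set f' : ℝ → ℂ := fun x =>
    I * (cmvDer V n j x * conj (cmvFun V n (j - 1) x) * (wt V n x : ℂ))
    - I * (cmvFun V n j x * conj (cmvDer V n (j - 1) x) * (wt V n x : ℂ))
    + (-n * I) * ((dV V (cos x) : ℂ) * (sin x * I * cmvFun V n j x)
      * conj (cmvFun V n (j - 1) x) * (wt V n x : ℂ)) with hf'
  have hff' : ∀ x, HasDerivAt f (f' x) x := fun x => by
    have h2 : HasDerivAt (fun x => conj (cmvFun V n (j - 1) x))
        (conj (I * cmvDer V n (j - 1) x)) x := by
      exact (hasDerivAt_cmvFun n (j - 1) x).star_conj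
    have h3 : HasDerivAt (fun x => (wt V n x : ℂ)) _ x := (hw x).ofReal_comp
    have := ((hasDerivAt_cmvFun (V := V) n j x).mul h2).mul h3
    convert! this using 1
    rw [map_mul, conj_I, hf']
    push_cast
    simp only [Pi.mul_apply]
    linear_combination (-(n * (dV V (cos x) : ℂ) * Complex.sin x * cmvFun V n j x
      * conj (cmvFun V n (j - 1) x) * (wt V n x : ℂ))) * Complex.I_mul_I
  have hsn : Continuous fun x =>
      (dV V (cos x) : ℂ) * (sin x * I * cmvFun V n j x) := by
    have := continuous_cmvFun (V := V) n j
    have h1 : Continuous fun x => (dV V (cos x) : ℂ) := continuous_ofReal.comp hdcos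
    have h2 : Continuous fun x => (sin x : ℂ) := continuous_ofReal.comp continuous_sin
    exact h1.mul ((h2.mul continuous_const).mul this)
  have i1 := (ip_intervalIntegrable hV (n := n) (continuous_cmvDer (V := V) n j)
    (continuous_cmvFun (V := V) n (j - 1)) (-π) π).const_mul I
  have i2 := (ip_intervalIntegrable hV (n := n) (continuous_cmvFun (V := V) n j)
    (continuous_cmvDer (V := V) n (j - 1)) (-π) π).const_mul I
  have i3 := (ip_intervalIntegrable hV (n := n) hsn
    (continuous_cmvFun (V := V) n (j - 1)) (-π) π).const_mul (-n * I)
  have hint : ∫ x in (-π)..π, f' x = 0 := by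
    rw [integral_eq_sub_of_hasDerivAt (fun x _ => hff' x) ((i1.sub i2).add i3)]
    simp only [f, cmvFun_pi, wt, cos_neg, sub_self]
  rw [hf', intervalIntegral.integral_add (i1.sub i2) i3, intervalIntegral.integral_sub i1 i2,
    intervalIntegral.integral_const_mul, intervalIntegral.integral_const_mul,
    intervalIntegral.integral_const_mul] at hint
  have e1 := ip_cmvDer n hV hj
  have e2 := ip_cmvFun_cmvDer n hV (show j - 1 < j by omega)
  unfold ip at e1 e2
  rw [e1, e2] at hint
  have hn' : (n : ℂ) ≠ 0 := by exact_mod_cast (by omega : n ≠ 0)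
  change I * _ - I * 0 + _ * ip V n _ _ = 0 at hint
  have : (n : ℂ) * ip V n (fun x => (dV V (cos x) : ℂ)
      * (sin x * I * cmvFun V n j x)) (cmvFun V n (j - 1))
      = ((-1) ^ j * (j * (alpha V n j / rho V n j)) : ℝ) := by
    apply mul_left_cancel₀ Complex.I_ne_zero
    linear_combination -hint
  apply mul_left_cancel₀ hn'
  rw [this]
  push_cast; field_simp

end StringEquation

/-! ### The shifted matrices -/

section Entries

variable (V : ℝ → ℝ) (θ : ℝ) (n : ℕ)

lemma Mstar_symm (j k : ℤ) : Mstar θ j k = Mstar θ k j := by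
  unfold Mstar
  congr 1
  · simp only [eq_comm]
  · congr 2
    rw [add_comm]
    congr 2 <;> exact propext ⟨fun h => by omega, fun h => by omega⟩

lemma Mtilde_symm (j k : ℤ) : Mtilde V θ n j k = Mtilde V θ n k j := by
  unfold Mtilde
  split_ifs <;> first | omega | rfl | exact Mstar_symm θ j k | rw [add_comm]

lemma deltaM_symm (j k : ℤ) : deltaM V θ n j k = deltaM V θ n k j := by
  rw [deltaM, deltaM, Mtilde_symm, Mstar_symm]

lemma Ltilde_antisymm (j k : ℤ) : Ltilde V n j k = -Ltilde V n k j := by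
  unfold Ltilde
  split_ifs <;> first | omega | ring

lemma Mtilde_diag {k : ℤ} (h : 0 ≤ n + k) : Mtilde V θ n k k
    = -(alpha V n (n + k).toNat * alpha V n ((n + k).toNat + 1)) := by
  rw [Mtilde, if_pos ⟨h, h⟩]
  simp only [matC, cmv]
  split_ifs <;> first | omega | ring

lemma Mtilde_one {k : ℤ} (h : 0 ≤ n + k) : Mtilde V θ n k (k + 1) = rho V n ((n + k).toNat + 1)
      * (alpha V n (n + k).toNat - alpha V n ((n + k).toNat + 2)) / 2 := by
  rw [Mtilde, if_pos ⟨h, by omega⟩, show (n + (k + 1)).toNat = (n + k).toNat + 1 by omega]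
  simp only [matC, cmv, Nat.even_add_one]
  split_ifs <;> first | omega | ((try simp only [Nat.add_sub_cancel]); ring)

lemma Mtilde_two {k : ℤ} (h : 0 ≤ n + k) : Mtilde V θ n k (k + 2)
    = rho V n ((n + k).toNat + 1) * rho V n ((n + k).toNat + 2) / 2 := by
  rw [Mtilde, if_pos ⟨h, by omega⟩, show (n + (k + 2)).toNat = (n + k).toNat + 2 by omega]
  have : Even ((n + k).toNat + 2) ↔ Even (n + k).toNat := by simp [Nat.even_add]
  simp only [matC, cmv, this]
  split_ifs <;> first | omega | ((try simp only [show (n + k).toNat + 2 - 1 = (n + k).toNat + 1 by omega]); ring)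

lemma Ltilde_diag (k : ℤ) : Ltilde V n k k = 0 := by
  unfold Ltilde; split_ifs <;> ring

lemma Ltilde_one {k : ℤ} (h : 0 ≤ n + k) : Ltilde V n k (k + 1)
    = (-1) ^ (n + k).toNat * (rho V n ((n + k).toNat + 1)
      * (alpha V n (n + k).toNat + alpha V n ((n + k).toNat + 2)) / 2) := by
  rw [Ltilde, if_pos ⟨h, by omega⟩, show (n + (k + 1)).toNat = (n + k).toNat + 1 by omega]
  rcases Nat.even_or_odd (n + k).toNat with he | he
  · rw [he.neg_one_pow]
    simp only [matC, cmv, Nat.even_add_one]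
    split_ifs <;> first | omega | ring
  · rw [he.neg_one_pow]
    rw [← Nat.not_even_iff_odd] at he
    simp only [matC, cmv, Nat.even_add_one]
    split_ifs <;> first | omega | ((try simp only [Nat.add_sub_cancel]); ring)

lemma Ltilde_two {k : ℤ} (h : 0 ≤ n + k) : Ltilde V n k (k + 2)
    = -((-1) ^ (n + k).toNat * (rho V n ((n + k).toNat + 1) * rho V n ((n + k).toNat + 2) / 2)) := by
  rw [Ltilde, if_pos ⟨h, by omega⟩, show (n + (k + 2)).toNat = (n + k).toNat + 2 by omega]
  have : Even ((n + k).toNat + 2) ↔ Even (n + k).toNat := by simp [Nat.even_add]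
  rcases Nat.even_or_odd (n + k).toNat with he | he
  · rw [he.neg_one_pow]
    simp only [matC, cmv, this]
    split_ifs <;> first | omega | ((try simp only [show (n + k).toNat + 2 - 1 = (n + k).toNat + 1 by omega]); ring)
  · rw [he.neg_one_pow]
    rw [← Nat.not_even_iff_odd] at he
    simp only [matC, cmv, this]
    split_ifs <;> first | omega | ring

lemma Mtilde_eq_zero {j k : ℤ} (h : j + 2 < k ∨ k + 2 < j) : Mtilde V θ n j k = 0 := by
  unfold Mtilde Mstar
  split_ifs with h1 h2 <;> try first | omega | norm_num
  simp only [matC, cmv]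
  split_ifs <;> first | omega | norm_num

lemma Mtilde_low {j k : ℤ} (h : n + j < 0 ∧ 0 ≤ n + k) : Mtilde V θ n j k = 0 := by
  unfold Mtilde
  split_ifs <;> first | omega | rfl

/-- The CMV basis with the index shifted by `n`, extended by zero. -/
def psi (k : ℤ) (x : ℝ) : ℂ := if 0 ≤ n + k then cmvFun V n (n + k).toNat x else 0

lemma sum_Icc_two {M : Type*} [AddCommMonoid M] (f : ℤ → M) :
    ∑ d ∈ 𝔹, f d = f (-2) + (f (-1) + (f 0 + (f 1 + f 2))) := by
  rw [show 𝔹 = {-2, -1, 0, 1, 2} by decide]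
  simp

variable {V n}

lemma psi_of_nonneg {k : ℤ} (h : 0 ≤ n + k) : psi V n k = cmvFun V n (n + k).toNat := by
  ext x; rw [psi, if_pos h]

lemma psi_of_neg {k : ℤ} (h : n + k < 0) : psi V n k = 0 := by
  ext x; rw [psi, if_neg (by omega)]; rfl

lemma continuous_psi (k : ℤ) : Continuous (psi V n k) := by
  by_cases h : 0 ≤ n + k
  · rw [psi_of_nonneg h]; exact continuous_cmvFun n _
  · rw [psi_of_neg (by omega)]; exact continuous_const

lemma psi_orthonormal (hV : ContinuousOn V 𝕁) {j k : ℤ} (hj : 0 ≤ n + j) :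
    ip V n (psi V n j) (psi V n k) = if j = k then 1 else 0 := by
  by_cases hk : 0 ≤ n + k
  · rw [psi_of_nonneg hj, psi_of_nonneg hk, cmvFun_orthonormal hV]
    congr 1
    exact propext ⟨fun h => by omega, fun h => by rw [h]⟩
  · rw [psi_of_neg (by omega : (n : ℤ) + k < 0), if_neg (by omega)]
    simp [ip]

/-- `M̃` is the matrix of multiplication by `cos x`. -/
lemma cos_mul_psi (hV : ContinuousOn V 𝕁) {k : ℤ} (hk : 0 ≤ n + k) {x : ℝ}
    (hx : x ∈ Icc (-π) π) : (cos x : ℂ) * psi V n k x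
      = ∑ d ∈ 𝔹, (Mtilde V θ n k (k + d) : ℂ) * psi V n (k + d) x := by
  have h := cos_mul_cmvFun n hV (n + k).toNat hx
  have e1 : (Mtilde V θ n k (k + -1) : ℂ) * psi V n (k + -1) x = (rho V n (n + k).toNat
          * (alpha V n ((n + k).toNat - 1) - alpha V n ((n + k).toNat + 1)) / 2 : ℝ)
        * cmvFun V n ((n + k).toNat - 1) x := by
    by_cases h1 : 0 ≤ n + (k + -1)
    · have := Mtilde_one V θ n h1
      rw [show k + -1 + 1 = k by ring, show (n + (k + -1)).toNat = (n + k).toNat - 1 by omega,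
        show (n + k).toNat - 1 + 1 = (n + k).toNat by omega,
        show (n + k).toNat - 1 + 2 = (n + k).toNat + 1 by omega] at this
      rw [Mtilde_symm, this, psi_of_nonneg h1, show (n + (k + -1)).toNat = (n + k).toNat - 1 by omega]
    · rw [psi_of_neg (by omega), show (n + k).toNat = 0 by omega, rho_zero]; simp
  have e2 : (Mtilde V θ n k (k + -2) : ℂ) * psi V n (k + -2) x
      = (rho V n ((n + k).toNat - 1) * rho V n (n + k).toNat / 2 : ℝ)
        * cmvFun V n ((n + k).toNat - 2) x := by
    by_cases h1 : 0 ≤ n + (k + -2)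
    · have := Mtilde_two V θ n h1
      rw [show k + -2 + 2 = k by ring, show (n + (k + -2)).toNat = (n + k).toNat - 2 by omega,
        show (n + k).toNat - 2 + 1 = (n + k).toNat - 1 by omega,
        show (n + k).toNat - 2 + 2 = (n + k).toNat by omega] at this
      rw [Mtilde_symm, this, psi_of_nonneg h1, show (n + (k + -2)).toNat = (n + k).toNat - 2 by omega]
    · rw [psi_of_neg (by omega), show (n + k).toNat - 1 = 0 by omega, rho_zero]; simp
  rw [sum_Icc_two, e1, e2, add_zero, Mtilde_diag V θ n hk, Mtilde_one V θ n hk, Mtilde_two V θ n hk,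
    psi_of_nonneg hk, psi_of_nonneg (by omega : 0 ≤ n + (k + 1)),
    psi_of_nonneg (by omega : 0 ≤ n + (k + 2)), h,
    show (n + (k + 1)).toNat = (n + k).toNat + 1 by omega,
    show (n + (k + 2)).toNat = (n + k).toNat + 2 by omega]
  ring

/-- `L̃` is the matrix of multiplication by `i sin x`. -/
lemma sin_mul_psi (hV : ContinuousOn V 𝕁) {k : ℤ} (hk : 0 ≤ n + k) {x : ℝ}
    (hx : x ∈ Icc (-π) π) : (sin x : ℂ) * I * psi V n k x
      = ∑ d ∈ 𝔹, (Ltilde V n k (k + d) : ℂ) * psi V n (k + d) x := by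
  have h := sin_mul_cmvFun n hV (n + k).toNat hx
  have e1 : (Ltilde V n k (k + -1) : ℂ) * psi V n (k + -1) x
      = ((-1) ^ (n + k).toNat * (rho V n (n + k).toNat
          * (alpha V n ((n + k).toNat - 1) + alpha V n ((n + k).toNat + 1)) / 2) : ℝ)
        * cmvFun V n ((n + k).toNat - 1) x := by
    by_cases h1 : 0 ≤ n + (k + -1)
    · have := Ltilde_one V n h1
      obtain ⟨N, hN⟩ : ∃ N, (n + k).toNat = N + 1 := ⟨(n + k).toNat - 1, by omega⟩
      rw [show k + -1 + 1 = k by ring, show (n + (k + -1)).toNat = N by omega] at this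
      rw [Ltilde_antisymm, this, psi_of_nonneg h1, hN, show (n + (k + -1)).toNat = N by omega,
        Nat.add_sub_cancel, pow_succ]
      push_cast; ring
    · rw [psi_of_neg (by omega), show (n + k).toNat = 0 by omega, rho_zero]; simp
  have e2 : (Ltilde V n k (k + -2) : ℂ) * psi V n (k + -2) x
      = ((-1) ^ (n + k).toNat * (rho V n ((n + k).toNat - 1) * rho V n (n + k).toNat / 2) : ℝ)
        * cmvFun V n ((n + k).toNat - 2) x := by
    by_cases h1 : 0 ≤ n + (k + -2)
    · have := Ltilde_two V n h1
      obtain ⟨N, hN⟩ : ∃ N, (n + k).toNat = N + 2 := ⟨(n + k).toNat - 2, by omega⟩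
      rw [show k + -2 + 2 = k by ring, show (n + (k + -2)).toNat = N by omega] at this
      rw [Ltilde_antisymm, this, psi_of_nonneg h1, hN, show (n + (k + -2)).toNat = N by omega,
        show N + 2 - 1 = N + 1 by omega, Nat.add_sub_cancel, pow_add]
      push_cast; ring
    · rw [psi_of_neg (by omega), show (n + k).toNat - 1 = 0 by omega, rho_zero]; simp
  rw [sum_Icc_two, e1, e2, add_zero, Ltilde_diag, Ltilde_one V n hk, Ltilde_two V n hk,
    psi_of_nonneg hk, psi_of_nonneg (by omega : 0 ≤ n + (k + 1)),
    psi_of_nonneg (by omega : 0 ≤ n + (k + 2)), h,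
    show (n + (k + 1)).toNat = (n + k).toNat + 1 by omega,
    show (n + (k + 2)).toNat = (n + k).toNat + 2 by omega]
  push_cast; ring

/-- The string equation in terms of the matrix elements of `V'(M)`. -/
lemma string_equation_matrix (hd : DifferentiableOn ℝ V 𝕁)
    (hdc : ContinuousOn (dV V) 𝕁) (hn : 1 ≤ n) {k : ℤ} (hk : 1 ≤ n + k) :
    ∑ d ∈ 𝔹, (Ltilde V n k (k + d) : ℂ)
        * ip V n (fun x => (dV V (cos x) : ℂ) * psi V n (k + d) x) (psi V n (k - 1))
      = ((-1) ^ (n + k).toNat * (alpha V n (n + k).toNat / rho V n (n + k).toNat)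
          * (1 + k / n) : ℝ) := by
  have hV := hd.continuousOn
  have hdcos : Continuous fun x => (dV V (cos x) : ℂ) := continuous_ofReal.comp
    (hdc.comp_continuous continuous_cos fun x => ⟨neg_one_le_cos x, cos_le_one x⟩)
  have h := string_equation n hd hdc hn (j := (n + k).toNat) (by omega)
  have e : ip V n (fun x => (dV V (cos x) : ℂ)
        * (sin x * I * cmvFun V n (n + k).toNat x)) (cmvFun V n ((n + k).toNat - 1))
      = ip V n (fun x => ∑ d ∈ 𝔹, (Ltilde V n k (k + d) : ℂ)
        * ((dV V (cos x) : ℂ) * psi V n (k + d) x)) (psi V n (k - 1)) := by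
    rw [psi_of_nonneg (by omega : 0 ≤ n + (k - 1)),
      show (n + (k - 1)).toNat = (n + k).toNat - 1 by omega]
    unfold ip
    apply integral_congr
    intro x hx
    rw [uIcc_of_le (by linarith [pi_pos])] at hx
    have := sin_mul_psi hV (by omega : 0 ≤ n + k) hx
    rw [psi_of_nonneg (by omega : 0 ≤ n + k)] at this
    simp only
    rw [this, mul_sum]
    congr 2
    exact sum_congr rfl fun d _ => by ring
  have hc : ∀ d ∈ 𝔹, Continuous fun x => (Ltilde V n k (k + d) : ℂ)
      * ((dV V (cos x) : ℂ) * psi V n (k + d) x) :=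
    fun d _ => (hdcos.mul (continuous_psi _)).const_mul _
  rw [e, ip_sum_left hV _ hc (continuous_psi _)] at h
  simp only [ip_smul_left] at h
  rw [h]
  have : (((n + k).toNat : ℕ) : ℝ) = n + k := by
    have : (((n + k).toNat : ℕ) : ℤ) = n + k := by omega
    exact_mod_cast this
  rw [this]
  congr 1
  field_simp

end Entries

/-! ### Plancherel's identity and the extension of `V'` to the line -/

section Plancherel

open FourierTransform SchwartzMap

/-- Plancherel's identity for the Fourier integral on `L¹ ∩ L²`. -/
lemma lintegral_fourier_sq {f : ℝ → ℂ} (h1 : Integrable f) (h2 : MemLp f 2) :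
    ∫⁻ x, ‖𝓕 f x‖ₑ ^ 2 = ∫⁻ x, ‖f x‖ₑ ^ 2 := by
  set u : Lp ℂ 2 (volume : Measure ℝ) := h2.toLp f with hu
  have hcont : Continuous (𝓕 f) := VectorFourier.fourierIntegral_continuous
    continuous_fourierChar continuous_inner h1
  -- the two Fourier transforms agree when tested against Schwartz functions
  have hpair : ∀ g : 𝓢(ℝ, ℂ), ∫ x, g x • (𝓕 u : Lp ℂ 2 (volume : Measure ℝ)) x = ∫ x, g x • 𝓕 f x := fun g => by
    have e := DFunLike.congr_fun (Lp.fourier_toTemperedDistribution_eq u) g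
    rw [TemperedDistribution.fourier_apply, Lp.toTemperedDistribution_apply,
      Lp.toTemperedDistribution_apply] at e
    rw [← e]
    have e2 : ∫ x, (𝓕 g : 𝓢(ℝ, ℂ)) x • u x = ∫ x, (𝓕 g : 𝓢(ℝ, ℂ)) x • f x := by
      apply integral_congr_ae
      filter_upwards [h2.coeFn_toLp] with x hx
      rw [hx]
    rw [e2]
    have := VectorFourier.integral_fourierIntegral_smul_eq_flip (𝕜 := ℝ) (L := innerₗ ℝ)
      (μ := volume) (ν := volume)
      continuous_fourierChar continuous_inner g.integrable h1
    rw [flip_innerₗ] at this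
    simpa [SchwartzMap.fourier_coe] using! this
  have hae : (𝓕 u : Lp ℂ 2 (volume : Measure ℝ)) =ᵐ[volume] 𝓕 f := by
    apply ae_eq_of_integral_contDiff_smul_eq
      ((Lp.memLp (𝓕 u : Lp ℂ 2 (volume : Measure ℝ))).locallyIntegrable (by norm_num))
      hcont.locallyIntegrable
    intro g hg hgs
    have hs : HasCompactSupport fun x => (g x : ℂ) := hgs.comp_left (g := Complex.ofReal) (by simp)
    have hc : ContDiff ℝ ((⊤ : ℕ∞) : WithTop ℕ∞) fun x => (g x : ℂ) := ofRealCLM.contDiff.comp hg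
    have := hpair (hs.toSchwartzMap hc)
    simpa using! this
  have hnorm : eLpNorm (𝓕 f) 2 volume = eLpNorm f 2 volume := by
    rw [← eLpNorm_congr_ae hae, ← eLpNorm_congr_ae h2.coeFn_toLp]
    have := Lp.norm_fourier_eq u
    rw [Lp.norm_def, Lp.norm_def] at this
    exact (ENNReal.toReal_eq_toReal_iff' (Lp.eLpNorm_ne_top _) (Lp.eLpNorm_ne_top _)).1 this
  have key : ∀ g : ℝ → ℂ, ∫⁻ x, ‖g x‖ₑ ^ 2 = eLpNorm g 2 volume ^ (2 : ℝ) := fun g => by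
    rw [eLpNorm_eq_lintegral_rpow_enorm_toReal (by norm_num) (by norm_num), ← ENNReal.rpow_mul]
    simp
  rw [key, key, hnorm]

end Plancherel

section Extension

/-- A function with equal one-sided derivatives is differentiable. -/
lemma hasDerivAt_of_halves {f : ℝ → ℝ} {f' a : ℝ} (h1 : HasDerivWithinAt f f' (Iic a) a)
    (h2 : HasDerivWithinAt f f' (Ici a) a) : HasDerivAt f f' a := by
  have := h1.union h2
  rwa [Iic_union_Ici, hasDerivWithinAt_univ] at this

/-- The projection of `ℝ` onto `[-1, 1]`. -/
def clamp (t : ℝ) : ℝ := max (-1) (min 1 t)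

lemma clamp_mem (t : ℝ) : clamp t ∈ 𝕁 :=
  ⟨le_max_left _ _, max_le (by norm_num) (min_le_left _ _)⟩

lemma clamp_of_mem {t : ℝ} (h : t ∈ 𝕁) : clamp t = t := by
  rw [clamp, min_eq_right h.2, max_eq_right h.1]

lemma clamp_of_le {t : ℝ} (h : t ≤ -1) : clamp t = -1 := by
  rw [clamp, max_eq_left ((min_le_right _ _).trans h)]

lemma clamp_of_ge {t : ℝ} (h : 1 ≤ t) : clamp t = 1 := by
  rw [clamp, min_eq_left h, max_eq_right (by norm_num)]

/-- A function differentiable on `[-1, 1]` is continued by its tangents at the end points. -/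
lemma hasDerivAt_tangent_extension {h h' : ℝ → ℝ}
    (hh : ∀ x ∈ 𝕁, HasDerivWithinAt h (h' x) 𝕁 x) (t : ℝ) :
    HasDerivAt (fun t => h (clamp t) + h' (clamp t) * (t - clamp t)) (h' (clamp t)) t := by
  set f : ℝ → ℝ := fun t => h (clamp t) + h' (clamp t) * (t - clamp t) with hf
  have fl : ∀ t, t ≤ -1 → f t = h (-1) + h' (-1) * (t - -1) := fun t ht => by
    simp only [hf, clamp_of_le ht]
  have fr : ∀ t, 1 ≤ t → f t = h 1 + h' 1 * (t - 1) := fun t ht => by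
    simp only [hf, clamp_of_ge ht]
  have fm : ∀ t ∈ 𝕁, f t = h t := fun t ht => by
    simp only [hf, clamp_of_mem ht]; ring
  have aff : ∀ (c a b t : ℝ), HasDerivAt (fun t => a + c * (t - b)) c t := fun c a b t => by
    simpa using (((hasDerivAt_id t).sub_const b).const_mul c).const_add a
  rcases lt_trichotomy t (-1) with ht | rfl | ht
  · rw [clamp_of_le ht.le]
    refine (aff (h' (-1)) (h (-1)) (-1) t).congr_of_eventuallyEq ?_
    filter_upwards [Iio_mem_nhds ht] with s hs using fl s (le_of_lt hs)
  · rw [clamp_of_le le_rfl]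
    refine hasDerivAt_of_halves ?_ ?_
    · exact (aff (h' (-1)) (h (-1)) (-1) _).hasDerivWithinAt.congr (fun s hs => fl s hs) (fl _ le_rfl)
    · have h1 := (hh (-1) (by norm_num)).congr (fun s hs => fm s hs) (fm _ (by norm_num))
      refine h1.mono_of_mem_nhdsWithin ?_
      exact Icc_mem_nhdsGE (by norm_num)
  rcases lt_trichotomy t 1 with ht' | rfl | ht'
  · have hm : t ∈ 𝕁 := ⟨ht.le, ht'.le⟩
    rw [clamp_of_mem hm]
    refine ((hh t hm).hasDerivAt (Icc_mem_nhds ht ht')).congr_of_eventuallyEq ?_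
    filter_upwards [Icc_mem_nhds ht ht'] with s hs using fm s hs
  · rw [clamp_of_ge le_rfl]
    refine hasDerivAt_of_halves ?_ ?_
    · have h1 := (hh 1 (by norm_num)).congr (fun s hs => fm s hs) (fm _ (by norm_num))
      refine h1.mono_of_mem_nhdsWithin ?_
      exact Icc_mem_nhdsLE (by norm_num)
    · exact (aff (h' 1) (h 1) 1 _).hasDerivWithinAt.congr (fun s hs => fr s hs) (fr _ le_rfl)
  · rw [clamp_of_ge ht'.le]
    refine (aff (h' 1) (h 1) 1 t).congr_of_eventuallyEq ?_
    filter_upwards [Ioi_mem_nhds ht'] with s hs using fr s (le_of_lt hs)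

lemma hasDerivWithinAt_iteratedDerivWithin {V : ℝ → ℝ} (h3 : ConditionC3 V) {k : ℕ} (hk : k ≤ 3)
    {x : ℝ} (hx : x ∈ 𝕁) :
    HasDerivWithinAt (iteratedDerivWithin k V 𝕁)
      (iteratedDerivWithin (k + 1) V 𝕁 x) 𝕁 x := by
  rw [iteratedDerivWithin_succ]
  refine DifferentiableWithinAt.hasDerivWithinAt ?_
  rcases hk.lt_or_eq with h | rfl
  · exact h3.contDiffOn.differentiableOn_iteratedDerivWithin (by exact_mod_cast h)
      (uniqueDiffOn_Icc (by norm_num)) x hx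
  · exact h3.differentiableOn x hx

/-- Continuation of `V'` to the line, twice differentiable with a differentiable second derivative
whose derivative is bounded. -/
lemma exists_extension_aux {V : ℝ → ℝ} (h3 : ConditionC3 V) : ∃ f0 f1 f2 f3 : ℝ → ℝ,
    (∀ t, HasDerivAt f0 (f1 t) t) ∧ (∀ t, HasDerivAt f1 (f2 t) t) ∧ (∀ t, HasDerivAt f2 (f3 t) t) ∧
    (∃ K, ∀ t, |f3 t| ≤ K) ∧ ∀ t ∈ 𝕁, f0 t = dV V t := by
  set I : Set ℝ := 𝕁
  set f3 : ℝ → ℝ := fun t => iteratedDerivWithin 4 V I (clamp t)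
  set f2 : ℝ → ℝ := fun t => iteratedDerivWithin 3 V I (clamp t) + f3 t * (t - clamp t) with hf2
  have d2 : ∀ t, HasDerivAt f2 (f3 t) t := fun t =>
    hasDerivAt_tangent_extension (fun x hx => hasDerivWithinAt_iteratedDerivWithin h3 le_rfl hx) t
  have c2 : Continuous f2 := continuous_iff_continuousAt.2 fun t => (d2 t).continuousAt
  set f1 : ℝ → ℝ := fun t => iteratedDerivWithin 2 V I (-1) + ∫ s in (-1 : ℝ)..t, f2 s with hf1
  have d1 : ∀ t, HasDerivAt f1 (f2 t) t := fun t =>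
    (intervalIntegral.integral_hasDerivAt_right (c2.intervalIntegrable _ _)
      c2.aestronglyMeasurable.stronglyMeasurableAtFilter c2.continuousAt).const_add _
  have c1 : Continuous f1 := continuous_iff_continuousAt.2 fun t => (d1 t).continuousAt
  set f0 : ℝ → ℝ := fun t => iteratedDerivWithin 1 V I (-1) + ∫ s in (-1 : ℝ)..t, f1 s with hf0
  have d0 : ∀ t, HasDerivAt f0 (f1 t) t := fun t =>
    (intervalIntegral.integral_hasDerivAt_right (c1.intervalIntegrable _ _)
      c1.aestronglyMeasurable.stronglyMeasurableAtFilter c1.continuousAt).const_add _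
  have hu : UniqueDiffOn ℝ I := uniqueDiffOn_Icc (by norm_num)
  have step : ∀ (g g' : ℝ → ℝ) (k : ℕ), k ≤ 3 → (∀ t, HasDerivAt g (g' t) t) →
      (∀ t ∈ I, g' t = iteratedDerivWithin (k + 1) V I t) → g (-1) = iteratedDerivWithin k V I (-1) →
      ∀ t ∈ I, g t = iteratedDerivWithin k V I t := fun g g' k hk hg hg' h0 => by
    refine eq_of_derivWithin_eq (fun t _ => (hg t).differentiableAt.differentiableWithinAt)
      (fun t ht => (hasDerivWithinAt_iteratedDerivWithin h3 hk ht).differentiableWithinAt) ?_ h0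
    intro t ht
    have ht' : t ∈ I := Ico_subset_Icc_self ht
    rw [(hg t).hasDerivWithinAt.derivWithin (hu t ht'),
      (hasDerivWithinAt_iteratedDerivWithin h3 hk ht').derivWithin (hu t ht'), hg' t ht']
  have e2 : ∀ t ∈ I, f2 t = iteratedDerivWithin 3 V I t := fun t ht => by
    simp only [hf2, clamp_of_mem ht]; ring
  have e1 := step f1 f2 2 (by norm_num) d1 e2 (by simp [hf1])
  have e0 := step f0 f1 1 (by norm_num) d0 e1 (by simp [hf0])
  obtain ⟨K, hK⟩ := h3.bounded
  refine ⟨f0, f1, f2, f3, d0, d1, d2, ⟨K, fun t => hK _ (clamp_mem t)⟩, fun t ht => ?_⟩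
  rw [e0 t ht, iteratedDerivWithin_one, dV]

/-- Continuation of `V'` to a compactly supported function on the line. -/
lemma exists_extension {V : ℝ → ℝ} (h3 : ConditionC3 V) : ∃ F0 F1 F2 F3 : ℝ → ℝ,
    (∀ t, HasDerivAt F0 (F1 t) t) ∧ (∀ t, HasDerivAt F1 (F2 t) t) ∧ (∀ t, HasDerivAt F2 (F3 t) t) ∧
    (∃ K, ∀ t, |F3 t| ≤ K) ∧ (∀ t ∈ 𝕁, F0 t = dV V t) ∧
    (∀ t ∉ Icc (-2 : ℝ) 2, F0 t = 0 ∧ F1 t = 0 ∧ F2 t = 0 ∧ F3 t = 0) := by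
  obtain ⟨f0, f1, f2, f3, d0, d1, d2, ⟨K, hK⟩, he⟩ := exists_extension_aux h3
  let b : ContDiffBump (0 : ℝ) := ⟨1, 2, by norm_num, by norm_num⟩
  have cb : ContDiff ℝ 4 (fun t => b t) := b.contDiff
  set b0 : ℝ → ℝ := fun t => b t with hb0def
  have hb : ∀ k : ℕ, k < 4 → ∀ t, HasDerivAt (iteratedDeriv k b0) (iteratedDeriv (k + 1) b0 t) t := fun k hk t => by
    rw [iteratedDeriv_succ]
    exact (cb.differentiable_iteratedDeriv k (by exact_mod_cast hk) t).hasDerivAt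
  have hbc : ∀ k : ℕ, k ≤ 4 → Continuous (iteratedDeriv k b0) := fun k hk =>
    cb.continuous_iteratedDeriv k (by exact_mod_cast hk)
  have hb0 := hb 0 (by norm_num)
  have hb1 := hb 1 (by norm_num)
  have hb2 := hb 2 (by norm_num)
  rw [iteratedDeriv_zero] at hb0
  have hz : ∀ k : ℕ, ∀ t ∉ Icc (-2 : ℝ) 2, iteratedDeriv k b0 t = 0 := fun k t ht => by
    have h0 : b0 =ᶠ[𝓝 t] fun _ => 0 := by
      filter_upwards [isClosed_Icc.isOpen_compl.mem_nhds ht] with s hs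
      refine b.zero_of_le_dist ?_
      rw [dist_eq, sub_zero]
      by_contra hlt
      exact hs (abs_le.1 (not_le.1 hlt).le)
    rw [h0.iteratedDeriv_eq]; simp
  have cf : ∀ {g g' : ℝ → ℝ}, (∀ t, HasDerivAt g (g' t) t) → Continuous g := fun h =>
    continuous_iff_continuousAt.2 fun t => (h t).continuousAt
  refine ⟨fun t => b0 t * f0 t, fun t => iteratedDeriv 1 b0 t * f0 t + b0 t * f1 t,
    fun t => iteratedDeriv 2 b0 t * f0 t + 2 * (iteratedDeriv 1 b0 t * f1 t) + b0 t * f2 t,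
    fun t => (iteratedDeriv 3 b0 t * f0 t + 3 * (iteratedDeriv 2 b0 t * f1 t)
      + 3 * (iteratedDeriv 1 b0 t * f2 t)) + b0 t * f3 t, ?_, ?_, ?_, ?_, ?_, ?_⟩
  · exact fun t => (hb0 t).mul (d0 t)
  · intro t
    refine (((hb1 t).mul (d0 t)).add ((hb0 t).mul (d1 t))).congr_deriv ?_
    ring
  · intro t
    refine ((((hb2 t).mul (d0 t)).add (((hb1 t).mul (d1 t)).const_mul 2)).add
      ((hb0 t).mul (d2 t))).congr_deriv ?_
    ring
  · have hc : Continuous fun t => iteratedDeriv 3 b0 t * f0 t + 3 * (iteratedDeriv 2 b0 t * f1 t)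
      + 3 * (iteratedDeriv 1 b0 t * f2 t) :=
      (((hbc 3 (by norm_num)).mul (cf d0)).add (((hbc 2 (by norm_num)).mul (cf d1)).const_mul 3)).add
        (((hbc 1 (by norm_num)).mul (cf d2)).const_mul 3)
    obtain ⟨K', hK'⟩ := isCompact_Icc.exists_bound_of_continuousOn
      (hc.continuousOn (s := Icc (-2 : ℝ) 2))
    have hKpos : 0 ≤ K := (abs_nonneg _).trans (hK 0)
    have hK'pos : 0 ≤ K' := (norm_nonneg _).trans (hK' 0 (by norm_num))
    refine ⟨K' + K, fun t => ?_⟩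
    by_cases ht : t ∈ Icc (-2 : ℝ) 2
    · refine (abs_add_le _ _).trans (add_le_add (hK' t ht) ?_)
      rw [abs_mul, abs_of_nonneg b.nonneg]
      exact (mul_le_of_le_one_left (abs_nonneg _) b.le_one).trans (hK t)
    · have := hz 0 t ht
      rw [iteratedDeriv_zero] at this
      beta_reduce
      rw [hz 3 t ht, hz 2 t ht, hz 1 t ht, this]; simp; positivity
  · intro t ht
    have : b0 t = 1 := b.one_of_mem_closedBall (by
      rw [mem_closedBall_zero_iff]; exact abs_le.2 ht)
    beta_reduce
    rw [this, one_mul, he t ht]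
  · intro t ht
    have := hz 0 t ht
    rw [iteratedDeriv_zero] at this
    beta_reduce
    rw [hz 3 t ht, hz 2 t ht, hz 1 t ht, this]; simp

end Extension

section FourierRepresentation

open FourierTransform

lemma integrable_of_zero_off {f : ℝ → ℂ} {K : ℝ} (hm : Measurable f) (hK : ∀ t, ‖f t‖ ≤ K)
    (h0 : ∀ t ∉ Icc (-2 : ℝ) 2, f t = 0) : Integrable f ∧ MemLp f 2 := by
  have hs : ∀ p : ℝ≥0∞, MemLp f p := fun p => by
    have h1 : MemLp f p (volume.restrict (Icc (-2 : ℝ) 2)) :=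
      MemLp.of_bound hm.aestronglyMeasurable K (of_forall hK)
    have h2 := (memLp_indicator_iff_restrict measurableSet_Icc).2 h1
    have e : (Icc (-2 : ℝ) 2).indicator f = f := indicator_eq_self.2 fun t ht => by
        by_contra hn
        exact ht (h0 t hn)
    rwa [e] at h2
  exact ⟨memLp_one_iff_integrable.1 (hs 1), hs 2⟩

/-- The derivative `V'` is, on `[-1, 1]`, the Fourier transform of a function whose third moment is
square integrable. -/
lemma exists_fourier_rep {V : ℝ → ℝ} (h3 : ConditionC3 V) : ∃ G : ℝ → ℂ, Continuous G ∧
    Integrable (fun w => (1 + w ^ 2) * ‖G w‖) ∧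
    (∫⁻ w, ‖G w‖ₑ ^ 2 * ofReal ((1 + 4 * π * |w|) ^ 6)) ≠ ⊤ ∧
    ∀ t ∈ 𝕁, (dV V t : ℂ) = ∫ w, G w * cexp ((2 * π * w * t : ℝ) * I) := by
  obtain ⟨F0, F1, F2, F3, d0, d1, d2, ⟨K, hK⟩, he, hz⟩ := exists_extension h3
  have cf : ∀ {g g' : ℝ → ℝ}, (∀ t, HasDerivAt g (g' t) t) → Continuous g := fun h =>
    continuous_iff_continuousAt.2 fun t => (h t).continuousAt
  have hbd : ∀ g : ℝ → ℝ, Continuous g → (∀ t ∉ Icc (-2 : ℝ) 2, g t = 0) →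
      Integrable (fun t => (g t : ℂ)) ∧ MemLp (fun t => (g t : ℂ)) 2 := fun g hg h0 => by
    obtain ⟨C, hC⟩ := isCompact_Icc.exists_bound_of_continuousOn (hg.continuousOn (s := Icc (-2 : ℝ) 2))
    have hC0 : 0 ≤ C := (norm_nonneg _).trans (hC 0 (by norm_num))
    refine integrable_of_zero_off (K := C) (measurable_ofReal.comp hg.measurable)
      (fun t => ?_) (fun t ht => by simp [h0 t ht])
    by_cases ht : t ∈ Icc (-2 : ℝ) 2
    · simpa using hC t ht
    · simpa [h0 t ht] using hC0
  obtain ⟨i0, l0⟩ := hbd F0 (cf d0) fun t ht => (hz t ht).1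
  obtain ⟨i1, -⟩ := hbd F1 (cf d1) fun t ht => (hz t ht).2.1
  obtain ⟨i2, -⟩ := hbd F2 (cf d2) fun t ht => (hz t ht).2.2.1
  have hF3 : F3 = deriv F2 := funext fun t => (d2 t).deriv.symm
  obtain ⟨i3, l3⟩ := integrable_of_zero_off (f := fun t => (F3 t : ℂ))
    (measurable_ofReal.comp (by rw [hF3]; exact measurable_deriv F2))
    (fun t => by simpa using hK t) (fun t ht => by simp [(hz t ht).2.2.2])
  have hder : ∀ g g' : ℝ → ℝ, (∀ t, HasDerivAt g (g' t) t) → Integrable (fun t => (g t : ℂ)) →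
      Integrable (fun t => (g' t : ℂ)) → ∀ w : ℝ,
      ‖𝓕 (fun t => (g' t : ℂ)) w‖ = 2 * π * |w| * ‖𝓕 (fun t => (g t : ℂ)) w‖ := fun g g' hg hi hi' w => by
    have e : (fun t => (g' t : ℂ)) = deriv fun t => (g t : ℂ) :=
      funext fun t => (hg t).ofReal_comp.deriv.symm
    have := congrFun (fourier_deriv hi (fun t => (hg t).ofReal_comp.differentiableAt)
      (by rw [← e]; exact hi')) w
    rw [e, this, norm_smul]
    simp [abs_of_pos pi_pos]
  set G : ℝ → ℂ := 𝓕 fun t => (F0 t : ℂ) with hG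
  have hcont : ∀ {f : ℝ → ℂ}, Integrable f → Continuous (𝓕 f) := fun hf =>
    VectorFourier.fourierIntegral_continuous continuous_fourierChar continuous_inner hf
  have hGc : Continuous G := hcont i0
  have hG3 : ∀ w, ‖𝓕 (fun t => (F3 t : ℂ)) w‖ = (2 * π * |w|) ^ 3 * ‖G w‖ := fun w => by
    rw [hder _ _ d2 i2 i3, hder _ _ d1 i1 i2, hder _ _ d0 i0 i1]; ring
  have hfin : (∫⁻ w, ‖G w‖ₑ ^ 2 * ofReal ((1 + 4 * π * |w|) ^ 6)) ≠ ⊤ := by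
    have p0 := lintegral_fourier_sq i0 l0
    have p3 := lintegral_fourier_sq i3 l3
    have fin : ∀ f : ℝ → ℂ, MemLp f 2 → (∫⁻ x, ‖f x‖ₑ ^ 2) ≠ ⊤ := fun f hf => by
      have := hf.eLpNorm_lt_top
      rw [eLpNorm_lt_top_iff_lintegral_rpow_enorm_lt_top (by norm_num) (by norm_num)] at this
      simpa using this.ne
    have hle : ∀ w, ‖G w‖ₑ ^ 2 * ofReal ((1 + 4 * π * |w|) ^ 6)
        ≤ ofReal (2 ^ 11) * (‖G w‖ₑ ^ 2 + ‖𝓕 (fun t => (F3 t : ℂ)) w‖ₑ ^ 2) := fun w => by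
      rw [← ofReal_norm, ← ofReal_norm, hG3, ← ofReal_pow (by positivity),
        ← ofReal_pow (by positivity), ← ENNReal.ofReal_mul (by positivity),
        ← ENNReal.ofReal_add (by positivity) (by positivity), ← ENNReal.ofReal_mul (by positivity)]
      apply ofReal_le_ofReal
      set u : ℝ := 2 * π * |w| with hu
      have hu0 : 0 ≤ u := by positivity
      have e : 1 + 4 * π * |w| = 1 + 2 * u := by rw [hu]; ring
      have h6 : (1 + 2 * u) ^ 6 ≤ 2 ^ 5 * (1 ^ 6 + (2 * u) ^ 6) := by
        have := add_pow_le (zero_le_one) (by positivity : 0 ≤ 2 * u) 6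
        simpa using this
      rw [e]
      have : (1 + 2 * u) ^ 6 ≤ 2 ^ 11 * (1 + u ^ 6) := by
        refine h6.trans ?_
        rw [mul_pow]
        nlinarith [pow_nonneg hu0 6]
      calc ‖G w‖ ^ 2 * (1 + 2 * u) ^ 6 ≤ ‖G w‖ ^ 2 * (2 ^ 11 * (1 + u ^ 6)) := by gcongr
        _ = _ := by ring
    refine ne_top_of_le_ne_top ?_ (lintegral_mono hle)
    rw [lintegral_const_mul' _ _ ofReal_ne_top,
      lintegral_add_left (by have := hGc.measurable; fun_prop), p0, p3]
    exact ENNReal.mul_ne_top ofReal_ne_top (ENNReal.add_ne_top.2 ⟨fin _ l0, fin _ l3⟩)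
  have hint : Integrable (fun w => (1 + w ^ 2) * ‖G w‖) := by
    have m1 : MemLp (fun w : ℝ => ‖G w‖ * (1 + 4 * π * |w|) ^ 3) 2 := by
      have hc : Continuous fun w : ℝ => ‖G w‖ * (1 + 4 * π * |w|) ^ 3 := by fun_prop
      refine ⟨hc.aestronglyMeasurable, ?_⟩
      rw [eLpNorm_lt_top_iff_lintegral_rpow_enorm_lt_top (by norm_num) (by norm_num)]
      refine lt_of_le_of_lt (lintegral_mono fun w => ?_) hfin.lt_top
      rw [← ofReal_norm, ← ofReal_norm, ENNReal.toReal_ofNat, ENNReal.rpow_ofNat,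
        ← ofReal_pow (by positivity), ← ofReal_pow (by positivity),
        ← ENNReal.ofReal_mul (by positivity)]
      apply ofReal_le_ofReal
      rw [norm_mul, norm_norm, norm_of_nonneg (by positivity : 0 ≤ (1 + 4 * π * |w|) ^ 3)]
      apply le_of_eq; ring
    have m2 : MemLp (fun w : ℝ => (1 + |w|)⁻¹) 2 := by
      have hc : Continuous fun w : ℝ => (1 + |w|)⁻¹ :=
        Continuous.inv₀ (by fun_prop) fun w => by positivity
      rw [memLp_two_iff_integrable_sq hc.aestronglyMeasurable]
      have := integrable_one_add_norm (E := ℝ) (μ := volume) (r := 2) (by simp)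
      refine this.congr (of_forall fun w => ?_)
      simp only [norm_eq_abs]
      rw [rpow_neg (by positivity), rpow_two, inv_pow]
    have := m1.integrable_mul m2
    refine this.mono' (by fun_prop) (of_forall fun w => ?_)
    rw [norm_of_nonneg (by positivity)]
    simp only [Pi.mul_apply]
    have h4 : 1 + |w| ≤ 1 + 4 * π * |w| := by
      nlinarith [abs_nonneg w, pi_gt_three]
    have h5 : 1 + w ^ 2 ≤ (1 + |w|) ^ 2 := by nlinarith [abs_nonneg w, sq_abs w]
    calc (1 + w ^ 2) * ‖G w‖ ≤ (1 + |w|) ^ 2 * ‖G w‖ := by gcongr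
      _ = ‖G w‖ * (1 + |w|) ^ 3 * (1 + |w|)⁻¹ := by field_simp
      _ ≤ _ := by gcongr
  have hGi : Integrable G := by
    refine hint.mono' hGc.aestronglyMeasurable (of_forall fun w => ?_)
    nlinarith [norm_nonneg (G w), sq_nonneg w]
  refine ⟨G, hGc, hint, hfin, fun t ht => ?_⟩
  have hinv := congrFun (Continuous.fourierInv_fourier_eq
    (continuous_ofReal.comp (cf d0)) i0 hGi) t
  rw [fourierInv_eq'] at hinv
  simp only [Function.comp] at hinv
  rw [← he t ht, ← hinv]
  congr 1; ext w
  rw [smul_eq_mul, mul_comm]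
  congr 2
  simp [mul_comm, mul_left_comm, mul_assoc]

end FourierRepresentation

/-! ### Sobolev duality -/

/-- The exponential `t ↦ e^{2πiwt}`. -/
def ew (w t : ℝ) : ℂ := cexp ((2 * π * w * t : ℝ) * I)

lemma norm_ew (w t : ℝ) : ‖ew w t‖ = 1 := norm_exp_ofReal_mul_I _

lemma continuous_ew : Continuous fun p : ℝ × ℝ => ew p.1 p.2 := by
  unfold ew; fun_prop

/-- A functional on functions on `[-1, 1]` that may be exchanged with Fourier representations
`F(t) = ∫ G(w) e^{2πiwt} dw` with `(1 + w²) G` integrable. -/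
structure FourierFunctional (T : (ℝ → ℂ) → ℂ) (K : ℝ) : Prop where
  meas : Measurable fun w => T (ew w)
  bound : ∀ w, ‖T (ew w)‖ ≤ K * (1 + w ^ 2)
  rep : ∀ (G F : ℝ → ℂ), Integrable G → Integrable (fun w => (1 + w ^ 2) * ‖G w‖) →
    (∀ t ∈ 𝕁, F t = ∫ w, G w * ew w t) → T F = ∫ w, G w * T (ew w)

namespace FourierFunctional

variable {T T' : (ℝ → ℂ) → ℂ} {K K' : ℝ}

lemma integrable (h : FourierFunctional T K) {G : ℝ → ℂ} (hG : Integrable G)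
    (hG2 : Integrable fun w => (1 + w ^ 2) * ‖G w‖) : Integrable fun w => G w * T (ew w) := by
  refine (hG2.const_mul K).mono' (hG.aestronglyMeasurable.mul h.meas.aestronglyMeasurable)
    (of_forall fun w => ?_)
  rw [norm_mul]
  have := mul_le_mul_of_nonneg_left (h.bound w) (norm_nonneg (G w))
  linarith

lemma mono (h : FourierFunctional T K) (hb : ∀ w, ‖T (ew w)‖ ≤ K' * (1 + w ^ 2)) :
    FourierFunctional T K' := ⟨h.meas, hb, h.rep⟩

lemma zero : FourierFunctional (fun _ => 0) 0 :=
  ⟨measurable_const, fun w => by simp, fun G F _ _ _ => by simp⟩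

lemma const_mul (h : FourierFunctional T K) (c : ℂ) :
    FourierFunctional (fun F => c * T F) (‖c‖ * K) := by
  refine ⟨h.meas.const_mul c, fun w => ?_, fun G F h1 h2 h3 => ?_⟩
  · rw [norm_mul, mul_assoc]
    exact mul_le_mul_of_nonneg_left (h.bound w) (norm_nonneg c)
  · rw [h.rep G F h1 h2 h3, ← integral_const_mul]
    congr 1; ext w; ring

lemma sub (h : FourierFunctional T K) (h' : FourierFunctional T' K') :
    FourierFunctional (fun F => T F - T' F) (K + K') := by
  refine ⟨h.meas.sub h'.meas, fun w => ?_, fun G F h1 h2 h3 => ?_⟩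
  · refine (norm_sub_le _ _).trans ?_
    linarith [h.bound w, h'.bound w]
  · rw [h.rep G F h1 h2 h3, h'.rep G F h1 h2 h3,
      ← integral_sub (h.integrable h1 h2) (h'.integrable h1 h2)]
    congr 1; ext w; ring

lemma tsum {ι : Type*} [Countable ι] {U : ι → (ℝ → ℂ) → ℂ} {L : ι → ℝ}
    (h : ∀ i, FourierFunctional (U i) (L i)) (hL : Summable L) :
    FourierFunctional (fun F => ∑' i, U i F) (∑' i, L i) := by
  have hs : ∀ w, Summable fun i => ‖U i (ew w)‖ := fun w =>
    Summable.of_nonneg_of_le (fun i => norm_nonneg _) (fun i => (h i).bound w) (hL.mul_right _)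
  refine ⟨?_, fun w => ?_, fun G F h1 h2 h3 => ?_⟩
  · refine measurable_of_tendsto_metrizable' (u := (atTop : Filter (Finset ι)))
      (f := fun s w => ∑ i ∈ s, U i (ew w))
      (fun s => Finset.measurable_sum s fun i _ => (h i).meas) ?_
    rw [tendsto_pi_nhds]
    exact fun w => (hs w).of_norm.hasSum
  · refine (norm_tsum_le_tsum_norm (hs w)).trans ?_
    rw [← tsum_mul_right]
    exact (hs w).tsum_le_tsum (fun i => (h i).bound w) (hL.mul_right _)
  · have e : ∀ i, U i F = ∫ w, G w * U i (ew w) := fun i => (h i).rep G F h1 h2 h3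
    have hsum : Summable fun i => ∫ w, ‖G w * U i (ew w)‖ := by
      refine Summable.of_nonneg_of_le (fun i => integral_nonneg fun w => norm_nonneg _)
        (fun i => ?_) (hL.mul_right (∫ w, (1 + w ^ 2) * ‖G w‖))
      rw [← integral_const_mul]
      refine integral_mono ((h i).integrable h1 h2).norm (h2.const_mul _) fun w => ?_
      have := mul_le_mul_of_nonneg_left ((h i).bound w) (norm_nonneg (G w))
      simp only [norm_mul]; linarith
    have := hasSum_integral_of_summable_integral_norm
      (F := fun i w => G w * U i (ew w)) (fun i => (h i).integrable h1 h2) hsum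
    simp only [e, this.tsum_eq, tsum_mul_left]

lemma sum {ι : Type*} (s : Finset ι) {U : ι → (ℝ → ℂ) → ℂ} {L : ι → ℝ}
    (h : ∀ i ∈ s, FourierFunctional (U i) (L i)) :
    FourierFunctional (fun F => ∑ i ∈ s, U i F) (∑ i ∈ s, L i) := by
  have := tsum (U := fun i : s => U i) (L := fun i : s => L i) (fun i => h i i.2)
    (Summable.of_finite)
  simpa [tsum_fintype, Finset.sum_coe_sort s fun i => L i, Finset.sum_attach, Finset.univ_eq_attach,
    s.sum_attach L, fun F => s.sum_attach fun i => U i F] using this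

/-- Integrals against continuous functions. -/
lemma of_integral {τ : ℝ → ℝ} {h : ℝ → ℂ} (hτ : Continuous τ) (hτ1 : ∀ x, τ x ∈ 𝕁)
    (hh : Continuous h) :
    FourierFunctional (fun F => ∫ x in (-π)..π, F (τ x) * h x) (∫ x in (-π)..π, ‖h x‖) := by
  have hpi : -π ≤ π := by linarith [pi_pos]
  refine ⟨Continuous.measurable ?_, fun w => ?_, fun G F h1 h2 h3 => ?_⟩
  · refine continuous_parametric_intervalIntegral_of_continuous' ?_ _ _
    have : Continuous fun p : ℝ × ℝ => ew p.1 (τ p.2) :=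
      continuous_ew.comp (continuous_fst.prodMk (hτ.comp continuous_snd))
    exact this.mul (hh.comp continuous_snd)
  · refine (intervalIntegral.norm_integral_le_integral_norm hpi).trans ?_
    simp only [norm_mul, norm_ew, one_mul]
    have : 0 ≤ ∫ x in (-π)..π, ‖h x‖ :=
      intervalIntegral.integral_nonneg hpi fun x _ => norm_nonneg _
    nlinarith [sq_nonneg w]
  · have e : ∀ x, F (τ x) * h x = ∫ w, G w * (ew w (τ x) * h x) := fun x => by
      rw [h3 _ (hτ1 x), ← integral_mul_const]
      congr 1; ext w; ring
    simp only [e, integral_of_le hpi]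
    rw [integral_integral_swap]
    · congr 1; ext w
      rw [← integral_const_mul]
    · have hc : Continuous fun p : ℝ × ℝ => ew p.2 (τ p.1) * h p.1 :=
        (continuous_ew.comp (continuous_snd.prodMk (hτ.comp continuous_fst))).mul
          (hh.comp continuous_fst)
      have hi : Integrable h (volume.restrict (Ioc (-π) π)) :=
        (hh.integrableOn_Icc (a := -π) (b := π)).mono_set Ioc_subset_Icc_self
      have hp := hi.norm.mul_prod h1.norm
      refine hp.mono' ?_ (of_forall fun p => ?_)
      · exact (h1.aestronglyMeasurable.comp_snd).mul hc.aestronglyMeasurable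
      · simp [Function.uncurry, norm_ew, mul_comm]

end FourierFunctional

/-- Coefficient of the Poisson kernel: the Fourier transform of `t ↦ (1/π) y / ((t - x)² + y²)`. -/
def poissonFour (x y w : ℝ) : ℂ :=
  cexp ((-(2 * π * w * x) : ℝ) * I) * (exp (-(2 * π * y * |w|)) : ℝ)

lemma integrable_exp_abs {b : ℝ} (hb : 0 < b) : Integrable fun w : ℝ => exp (-(b * |w|)) := by
  have h1 : IntegrableOn (fun w : ℝ => exp (-(b * |w|))) (Ioi 0) := by
    refine (exp_neg_integrableOn_Ioi 0 hb).congr_fun (fun w hw => ?_) measurableSet_Ioi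
    beta_reduce
    rw [abs_of_pos hw, neg_mul]
  have h2 : IntegrableOn (fun w : ℝ => exp (-(b * |w|))) (Iic 0) := by
    refine (integrableOn_exp_mul_Iic hb 0).congr_fun (fun w hw => ?_) measurableSet_Iic
    beta_reduce
    rw [abs_of_nonpos hw, mul_neg, neg_neg]
  have := h2.union h1
  rwa [Iic_union_Ioi, integrableOn_univ] at this

lemma exists_sq_mul_exp_le {b : ℝ} (hb : 0 < b) : ∃ C : ℝ, ∀ w : ℝ,
    (1 + w ^ 2) * exp (-(2 * b * |w|)) ≤ C * exp (-(b * |w|)) := by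
  refine ⟨1 + 2 / b ^ 2, fun w => ?_⟩
  have e : exp (-(2 * b * |w|)) = exp (-(b * |w|)) * exp (-(b * |w|)) := by
    rw [← exp_add]; congr 1; ring
  have h1 : 1 + (b * |w|) ^ 2 / 2 ≤ exp (b * |w|) := by
    have := quadratic_le_exp_of_nonneg (x := b * |w|) (by positivity)
    have : 0 ≤ b * |w| := by positivity
    linarith
  have h2 : 1 + w ^ 2 ≤ (1 + 2 / b ^ 2) * exp (b * |w|) := by
    refine le_trans ?_ (mul_le_mul_of_nonneg_left h1 (by positivity))
    have : (b * |w|) ^ 2 = b ^ 2 * w ^ 2 := by rw [mul_pow, sq_abs]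
    rw [this]
    have : (1 + 2 / b ^ 2) * (1 + b ^ 2 * w ^ 2 / 2) = 1 + w ^ 2 + 2 / b ^ 2 + b ^ 2 * w ^ 2 / 2 := by
      field_simp; ring
    rw [this]
    have : 0 ≤ 2 / b ^ 2 + b ^ 2 * w ^ 2 / 2 := by positivity
    linarith
  rw [e, ← mul_assoc]
  refine mul_le_mul_of_nonneg_right ?_ (exp_nonneg _)
  have h3 : exp (b * |w|) * exp (-(b * |w|)) = 1 := by
    rw [← exp_add]; simp
  calc (1 + w ^ 2) * exp (-(b * |w|)) ≤ ((1 + 2 / b ^ 2) * exp (b * |w|)) * exp (-(b * |w|)) :=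
        mul_le_mul_of_nonneg_right h2 (exp_nonneg _)
    _ = 1 + 2 / b ^ 2 := by rw [mul_assoc, h3, mul_one]

lemma integrable_sq_mul_exp_abs {b : ℝ} (hb : 0 < b) :
    Integrable fun w : ℝ => (1 + w ^ 2) * exp (-(b * |w|)) := by
  obtain ⟨C, hC⟩ := exists_sq_mul_exp_le (half_pos hb)
  refine ((integrable_exp_abs (half_pos hb)).const_mul C).mono' (by fun_prop)
    (of_forall fun w => ?_)
  rw [norm_of_nonneg (by positivity)]
  have := hC w
  rwa [mul_div_cancel₀ _ two_ne_zero] at this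

lemma norm_poissonFour (x y w : ℝ) :
    ‖poissonFour x y w‖ = exp (-(2 * π * y * |w|)) := by
  rw [poissonFour, norm_mul, norm_exp_ofReal_mul_I, one_mul, norm_real,
    norm_of_nonneg (exp_nonneg _)]

/-- The Cauchy kernels `t ↦ 1/(t - z)` and `t ↦ 1/(t - z̄)` have Fourier representations whose
difference is that of the Poisson kernel. -/
lemma cauchy_fourier {x y : ℝ} (hy : 0 < y) (t : ℝ) : ((t : ℂ) - (x + y * I))⁻¹
      = ∫ w, (2 * π * I * (Iic (0 : ℝ)).indicator (poissonFour x y) w) * ew w t ∧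
    ((t : ℂ) - (x - y * I))⁻¹ = ∫ w, (-(2 * π * I) * (Ioi (0 : ℝ)).indicator (poissonFour x y) w)
          * ew w t := by
  have ne : ∀ u v : ℝ, v ≠ 0 → (u : ℂ) + v * I ≠ 0 := fun u v hv h => by
    have := congrArg Complex.im h
    simp at this
    exact hv this
  constructor
  · have e : ∀ w : ℝ, (2 * π * I * (Iic (0 : ℝ)).indicator (poissonFour x y) w) * ew w t
        = (Iic (0 : ℝ)).indicator (fun w : ℝ => 2 * π * I *
          cexp (2 * π * (y + (t - x) * I) * w)) w := fun w => by
      by_cases hw : w ∈ Iic (0 : ℝ)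
      · simp only [indicator_of_mem hw, poissonFour, ew]
        rw [abs_of_nonpos hw, ofReal_exp, mul_assoc, ← Complex.exp_add, ← Complex.exp_add]
        congr 2
        push_cast; ring
      · simp [indicator_of_notMem hw]
    simp only [e]
    rw [integral_indicator measurableSet_Iic, integral_const_mul, integral_exp_mul_complex_Iic]
    · have h1 := ne (t - x) (-y) (neg_ne_zero.2 hy.ne')
      simp only [ofReal_zero, mul_zero, Complex.exp_zero]
      have h4 : (y : ℂ) + (t - x) * I = I * (t - (x + y * I)) := by
        linear_combination (y : ℂ) * I_sq
      rw [h4]; field_simp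
    · have : (2 * π * (y + (t - x) * I) : ℂ).re = 2 * π * y := by simp
      rw [this]; positivity
  · have e : ∀ w : ℝ, (-(2 * π * I) * (Ioi (0 : ℝ)).indicator (poissonFour x y) w) * ew w t
        = (Ioi (0 : ℝ)).indicator (fun w : ℝ => -(2 * π * I) *
          cexp (2 * π * (-y + (t - x) * I) * w)) w := fun w => by
      by_cases hw : w ∈ Ioi (0 : ℝ)
      · simp only [indicator_of_mem hw, poissonFour, ew]
        rw [abs_of_pos hw, ofReal_exp, mul_assoc, ← Complex.exp_add, ← Complex.exp_add]
        congr 2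
        push_cast; ring
      · simp [indicator_of_notMem hw]
    simp only [e]
    rw [integral_indicator measurableSet_Ioi, integral_const_mul, integral_exp_mul_complex_Ioi]
    · have h1 := ne (t - x) y hy.ne'
      simp only [ofReal_zero, mul_zero, Complex.exp_zero]
      have h4 : -(y : ℂ) + (t - x) * I = I * (t - (x - y * I)) := by
        linear_combination -(y : ℂ) * I_sq
      rw [h4]; field_simp
    · have : (2 * π * (-y + (t - x) * I) : ℂ).re = -(2 * π * y) := by simp
      rw [this]
      have : 0 < 2 * π * y := by positivity
      linarith

lemma continuous_poissonFour (x y : ℝ) : Continuous (poissonFour x y) := by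
  unfold poissonFour; fun_prop

namespace FourierFunctional

variable {T : (ℝ → ℂ) → ℂ} {K : ℝ}

/-- The difference of the values at the two Cauchy kernels is a Fourier transform. -/
lemma cauchy_sub (h : FourierFunctional T K) {x y : ℝ} (hy : 0 < y) :
    T (fun t => ((t : ℂ) - (x + y * I))⁻¹) - T (fun t => ((t : ℂ) - (x - y * I))⁻¹)
      = 2 * π * I * ∫ w, poissonFour x y w * T (ew w) := by
  have hb : 0 < 2 * π * y := by have := pi_pos; positivity
  have ip : Integrable (poissonFour x y) :=
    (integrable_exp_abs hb).mono' (continuous_poissonFour x y).aestronglyMeasurable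
      (of_forall fun w => (norm_poissonFour x y w).le)
  have ip2 : Integrable fun w => (1 + w ^ 2) * ‖poissonFour x y w‖ := by
    simp only [norm_poissonFour]
    exact integrable_sq_mul_exp_abs hb
  have key : ∀ (s : Set ℝ), MeasurableSet s → ∀ c : ℂ,
      Integrable (fun w => c * s.indicator (poissonFour x y) w) ∧
      Integrable fun w => (1 + w ^ 2) * ‖c * s.indicator (poissonFour x y) w‖ := fun s hs c => by
    refine ⟨(ip.indicator hs).const_mul c, ?_⟩
    have := (ip2.indicator hs).const_mul ‖c‖
    refine this.congr (of_forall fun w => ?_)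
    by_cases hw : w ∈ s
    · simp only [indicator_of_mem hw, norm_mul]; ring
    · simp [indicator_of_notMem hw]
  obtain ⟨a1, a2⟩ := key (Iic 0) measurableSet_Iic (2 * π * I)
  obtain ⟨b1, b2⟩ := key (Ioi 0) measurableSet_Ioi (-(2 * π * I))
  rw [h.rep _ _ a1 a2 fun t _ => (cauchy_fourier hy t).1,
    h.rep _ _ b1 b2 fun t _ => (cauchy_fourier hy t).2,
    ← integral_sub (h.integrable a1 a2) (h.integrable b1 b2), ← integral_const_mul]
  congr 1; ext w
  by_cases hw : w ∈ Iic (0 : ℝ)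
  · have hw' : w ∉ Ioi (0 : ℝ) := by simpa using hw
    rw [indicator_of_mem hw, indicator_of_notMem hw']; ring
  · have hw' : w ∈ Ioi (0 : ℝ) := by simpa using hw
    rw [indicator_of_notMem hw, indicator_of_mem hw']; ring

open FourierTransform in
/-- Plancherel's identity in `x` on a fixed line `Im z = y`. -/
lemma lintegral_cauchy_sub (h : FourierFunctional T K) {y : ℝ} (hy : 0 < y) :
    ∫⁻ x : ℝ, ‖T (fun t => ((t : ℂ) - (x + y * I))⁻¹) - T (fun t => ((t : ℂ) - (x - y * I))⁻¹)‖ₑ ^ 2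
      = ofReal (2 * π) ^ 2
        * ∫⁻ w, ‖T (ew w)‖ₑ ^ 2 * ofReal (exp (-(4 * π * y * |w|))) := by
  have hb : 0 < 2 * π * y := by have := pi_pos; positivity
  set f : ℝ → ℂ := fun w => (exp (-(2 * π * y * |w|)) : ℂ) * T (ew w) with hf
  have hm : Measurable f := by
    refine Measurable.mul ?_ h.meas
    exact (Continuous.measurable (by fun_prop))
  have hK : 0 ≤ K := by
    have := (norm_nonneg _).trans (h.bound 0)
    simpa using this
  have hle : ∀ w, ‖f w‖ ≤ K * ((1 + w ^ 2) * exp (-(2 * π * y * |w|))) := fun w => by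
    rw [hf, norm_mul, norm_real, norm_of_nonneg (exp_nonneg _)]
    have := mul_le_mul_of_nonneg_left (h.bound w) (exp_nonneg (-(2 * π * y * |w|)))
    linarith
  have i1 : Integrable f :=
    ((integrable_sq_mul_exp_abs hb).const_mul K).mono' hm.aestronglyMeasurable
      (of_forall hle)
  have i2 : MemLp f 2 := by
    obtain ⟨C, hC⟩ := exists_sq_mul_exp_le (half_pos hb)
    have hbd : ∀ w, ‖f w‖ ≤ K * C := fun w => by
      refine (hle w).trans (mul_le_mul_of_nonneg_left ?_ hK)
      have := hC w
      rw [mul_div_cancel₀ _ two_ne_zero] at this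
      refine this.trans ?_
      have hC0 : 0 ≤ C := by have := hC 0; simp at this; linarith
      have : exp (-(2 * π * y / 2 * |w|)) ≤ 1 := by
        apply exp_le_one_iff.2
        have : 0 ≤ 2 * π * y / 2 * |w| := by positivity
        linarith
      nlinarith
    rw [memLp_two_iff_integrable_sq_norm hm.aestronglyMeasurable]
    refine (i1.norm.const_mul (K * C)).mono' (hm.norm.pow_const 2).aestronglyMeasurable
      (of_forall fun w => ?_)
    rw [norm_of_nonneg (by positivity), sq]
    exact mul_le_mul_of_nonneg_right (hbd w) (norm_nonneg _)
  have hF : ∀ x : ℝ, (∫ w, poissonFour x y w * T (ew w)) = 𝓕 f x := fun x => by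
    rw [fourier_real_eq_integral_exp_smul]
    congr 1; ext w
    simp only [hf, poissonFour, smul_eq_mul]
    rw [mul_assoc]
    congr 3
    push_cast; ring
  have e : ∀ x : ℝ, ‖T (fun t => ((t : ℂ) - (x + y * I))⁻¹)
        - T (fun t => ((t : ℂ) - (x - y * I))⁻¹)‖ₑ ^ 2
      = ofReal (2 * π) ^ 2 * ‖𝓕 f x‖ₑ ^ 2 := fun x => by
    rw [h.cauchy_sub hy, hF, enorm_mul, mul_pow]
    congr 2
    rw [← ofReal_norm]
    simp [abs_of_pos pi_pos]
  simp only [e]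
  rw [lintegral_const_mul' _ _ (by finiteness), lintegral_fourier_sq i1 i2]
  congr 1
  refine lintegral_congr fun w => ?_
  rw [hf]
  simp only [enorm_mul, mul_pow]
  rw [mul_comm]
  congr 1
  rw [← ofReal_norm, norm_real, norm_of_nonneg (exp_nonneg _),
    ← ofReal_pow (exp_nonneg _), ← exp_nat_mul]
  congr 2; push_cast; ring

end FourierFunctional

lemma lintegral_pow_mul_exp {b : ℝ} (hb : 0 < b) :
    ∫⁻ y in Ioi (0 : ℝ), ofReal (exp (-y) * y ^ 5) * ofReal (exp (-((b - 1) * y)))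
      = ofReal (120 / b ^ 6) := by
  have e : ∀ y ∈ Ioi (0 : ℝ), ofReal (exp (-y) * y ^ 5)
        * ofReal (exp (-((b - 1) * y)))
      = ofReal (y ^ ((6 : ℝ) - 1) * exp (-(b * y))) := fun y hy => by
    have hy0 : (0 : ℝ) < y := hy
    rw [← ENNReal.ofReal_mul (by positivity)]
    congr 1
    have : exp (-(b * y)) = exp (-y) * exp (-((b - 1) * y)) := by
      rw [← exp_add]; congr 1; ring
    rw [this]
    have : y ^ ((6 : ℝ) - 1) = y ^ 5 := by
      rw [show (6 : ℝ) - 1 = ((5 : ℕ) : ℝ) by norm_num, rpow_natCast]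
    rw [this]; ring
  rw [setLIntegral_congr_fun measurableSet_Ioi e]
  have hI := integral_rpow_mul_exp_neg_mul_Ioi (a := 6) (by norm_num) hb
  have hG : Gamma 6 = 120 := by
    rw [show (6 : ℝ) = ((5 : ℕ) : ℝ) + 1 by norm_num, Gamma_nat_eq_factorial]
    norm_num [Nat.factorial]
  rw [hG] at hI
  have hv : (1 / b) ^ (6 : ℝ) * 120 = 120 / b ^ 6 := by
    rw [show (6 : ℝ) = ((6 : ℕ) : ℝ) by norm_num, rpow_natCast]; field_simp
  rw [hv] at hI
  have hint : IntegrableOn (fun y : ℝ => y ^ ((6 : ℝ) - 1) * exp (-(b * y))) (Ioi 0) := by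
    by_contra hn
    rw [integral_undef hn] at hI
    have : 0 < 120 / b ^ 6 := by positivity
    linarith
  rw [← ofReal_integral_eq_lintegral_ofReal hint, hI]
  filter_upwards [ae_restrict_mem measurableSet_Ioi] with y hy
  have hy0 : (0 : ℝ) < y := hy
  positivity

/-- Sobolev duality: for `V'` with three derivatives, the value `T(V')` is controlled by a weighted
square mean of the values of `T` at the Poisson kernels. -/
lemma exists_sobolev_duality {V : ℝ → ℝ} (h3 : ConditionC3 V) : ∃ C : ℝ, 0 < C ∧
    ∀ (T : (ℝ → ℂ) → ℂ) (K : ℝ), FourierFunctional T K →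
      ‖T fun t => (dV V t : ℂ)‖ₑ ^ 2 ≤ ofReal C *
        ∫⁻ y in Ioi (0 : ℝ), ofReal (exp (-y) * y ^ 5) *
          ∫⁻ x : ℝ, ‖T (fun t => ((t : ℂ) - (x + y * I))⁻¹)
            - T (fun t => ((t : ℂ) - (x - y * I))⁻¹)‖ₑ ^ 2 := by
  obtain ⟨G, hGc, hG2, hG6, hrep⟩ := exists_fourier_rep h3
  set J := ∫⁻ w, ‖G w‖ₑ ^ 2 * ofReal ((1 + 4 * π * |w|) ^ 6) with hJ
  refine ⟨J.toReal + 1, by positivity, fun T K h => ?_⟩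
  have hG1 : Integrable G := hG2.mono' hGc.aestronglyMeasurable (of_forall fun w => by
    nlinarith [norm_nonneg (G w), mul_nonneg (sq_nonneg w) (norm_nonneg (G w))])
  have hb0 : ∀ w : ℝ, 0 < 1 + 4 * π * |w| := fun w => by positivity
  have e1 : T (fun t => (dV V t : ℂ)) = ∫ w, G w * T (ew w) := h.rep G _ hG1 hG2 hrep
  set Q := ∫⁻ w, ‖T (ew w)‖ₑ ^ 2 * ofReal (120 / (1 + 4 * π * |w|) ^ 6) with hQ
  have e2 : (∫⁻ y in Ioi (0 : ℝ), ofReal (exp (-y) * y ^ 5) *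
          ∫⁻ x : ℝ, ‖T (fun t => ((t : ℂ) - (x + y * I))⁻¹)
            - T (fun t => ((t : ℂ) - (x - y * I))⁻¹)‖ₑ ^ 2)
      = ofReal (2 * π) ^ 2 * Q := by
    have : ∀ y ∈ Ioi (0 : ℝ), ofReal (exp (-y) * y ^ 5) *
          ∫⁻ x : ℝ, ‖T (fun t => ((t : ℂ) - (x + y * I))⁻¹)
            - T (fun t => ((t : ℂ) - (x - y * I))⁻¹)‖ₑ ^ 2
        = ofReal (2 * π) ^ 2 * ∫⁻ w, ‖T (ew w)‖ₑ ^ 2 * (ofReal (exp (-y) * y ^ 5)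
            * ofReal (exp (-((1 + 4 * π * |w| - 1) * y)))) := fun y hy => by
      rw [h.lintegral_cauchy_sub hy, mul_left_comm, ← lintegral_const_mul' _ _ (by finiteness)]
      congr 1
      refine lintegral_congr fun w => ?_
      rw [mul_left_comm]
      congr 5; ring
    rw [setLIntegral_congr_fun measurableSet_Ioi this, lintegral_const_mul' _ _ (by finiteness),
      lintegral_lintegral_swap]
    · congr 1
      refine lintegral_congr fun w => ?_
      rw [lintegral_const_mul' _ _ (by finiteness), lintegral_pow_mul_exp (hb0 w)]
    · refine Measurable.aemeasurable ?_
      refine ((h.meas.comp measurable_snd).enorm.pow_const 2).mul ?_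
      exact (Measurable.ennreal_ofReal (Continuous.measurable (by fun_prop))).mul
        (Measurable.ennreal_ofReal (Continuous.measurable (by fun_prop)))
  rw [e2, e1]
  -- the Cauchy-Schwarz inequality with the weight `(1 + 4π|w|)^3`
  have hCS : (∫⁻ w, ‖G w‖ₑ * ‖T (ew w)‖ₑ) ^ 2 ≤ J * Q := by
    have hc : Continuous fun w : ℝ => (1 + 4 * π * |w|) ^ 3 := by fun_prop
    have := ENNReal.lintegral_mul_le_Lp_mul_Lq (μ := volume) (p := 2) (q := 2)
      (by constructor <;> norm_num)
      (f := fun w => ‖G w‖ₑ * ofReal ((1 + 4 * π * |w|) ^ 3))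
      (g := fun w => ‖T (ew w)‖ₑ * ofReal (((1 + 4 * π * |w|) ^ 3)⁻¹))
      ((hGc.measurable.enorm.mul hc.measurable.ennreal_ofReal).aemeasurable)
      ((h.meas.enorm.mul (hc.measurable.inv.ennreal_ofReal)).aemeasurable)
    have e3 : ∀ w : ℝ, ‖G w‖ₑ * ‖T (ew w)‖ₑ
        = ((fun w => ‖G w‖ₑ * ofReal ((1 + 4 * π * |w|) ^ 3))
          * fun w => ‖T (ew w)‖ₑ * ofReal (((1 + 4 * π * |w|) ^ 3)⁻¹)) w := fun w => by
      simp only [Pi.mul_apply]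
      rw [mul_mul_mul_comm, ← ENNReal.ofReal_mul (by positivity), mul_inv_cancel₀ (by positivity)]
      simp
    rw [lintegral_congr e3]
    have hp := pow_le_pow_left' this 2
    refine hp.trans ?_
    rw [mul_pow, ← ENNReal.rpow_natCast, ← ENNReal.rpow_mul, ← ENNReal.rpow_natCast,
      ← ENNReal.rpow_mul]
    norm_num
    refine mul_le_mul' (le_of_eq ?_) ?_
    · rw [hJ]
      refine lintegral_congr fun w => ?_
      rw [mul_pow, ← ofReal_pow (by positivity)]
      congr 2; ring
    · rw [hQ]
      refine lintegral_mono fun w => ?_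
      beta_reduce
      rw [mul_pow]
      gcongr
      rw [← ofReal_pow (by positivity)]
      apply ofReal_le_ofReal
      rw [inv_pow, ← one_div]
      have : ((1 + 4 * π * |w|) ^ 3) ^ 2 = (1 + 4 * π * |w|) ^ 6 := by ring
      rw [this]
      gcongr
      norm_num
  have h4 : ‖∫ w, G w * T (ew w)‖ₑ ≤ ∫⁻ w, ‖G w‖ₑ * ‖T (ew w)‖ₑ := by
    refine (enorm_integral_le_lintegral_enorm _).trans (le_of_eq ?_)
    refine lintegral_congr fun w => enorm_mul _ _
  refine (pow_le_pow_left' h4 2).trans (hCS.trans ?_)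
  have hJ1 : J ≤ ofReal (J.toReal + 1) := by
    rw [ENNReal.le_ofReal_iff_toReal_le hG6 (by positivity)]; linarith
  have h2pi : (1 : ℝ≥0∞) ≤ ofReal (2 * π) ^ 2 := by
    rw [← ofReal_pow (by positivity), ENNReal.one_le_ofReal]
    nlinarith [two_le_pi]
  calc J * Q ≤ ofReal (J.toReal + 1) * Q := mul_le_mul' hJ1 le_rfl
    _ = ofReal (J.toReal + 1) * (1 * Q) := by rw [one_mul]
    _ ≤ _ := by gcongr

/-! ### Decay of Fourier coefficients -/

/-- Fourier coefficient of a function on `[-π, π]`. -/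
def fhat (H : ℝ → ℂ) (m : ℤ) : ℂ := 1 / (2 * π) * ∫ x in (-π)..π, H x * ez (-m) x

lemma fhat_eq (H : ℝ → ℂ) (m : ℤ) :
    fhat H m = fourierCoeffOn (neg_lt_self pi_pos) H m := by
  rw [fourierCoeffOn_eq_integral, fhat]
  have hp : π - -π = 2 * π := by ring
  rw [hp]
  rw [real_smul]
  push_cast
  congr 1
  refine integral_congr fun x _ => ?_
  rw [smul_eq_mul, mul_comm, fourier_coe_apply, ez]
  congr 2
  push_cast; field_simp

lemma sum_fhat_sq_le {H : ℝ → ℂ} {B : ℝ}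
    (hm : AEStronglyMeasurable H (volume.restrict (Ioc (-π) π)))
    (hB : ∀ x, ‖H x‖ ≤ B) (u : Finset ℤ) : ∑ m ∈ u, ‖fhat H m‖ ^ 2 ≤ B ^ 2 := by
  have hp := pi_pos
  have hL : MemLp H 2 (volume.restrict (Ioc (-π) π)) :=
    MemLp.of_bound hm B (of_forall hB)
  have hs := hasSum_sq_fourierCoeffOn (neg_lt_self pi_pos) hL
  have h1 := sum_le_hasSum u (fun i _ => by positivity) hs
  simp only [← fhat_eq] at h1
  refine h1.trans ?_
  have h2 : ∫ x in (-π)..π, ‖H x‖ ^ 2 ≤ ∫ x in (-π)..π, B ^ 2 := by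
    refine intervalIntegral.integral_mono_on (by linarith) ?_ (by simp) fun x _ =>
      pow_le_pow_left₀ (norm_nonneg _) (hB x) 2
    rw [intervalIntegrable_iff_integrableOn_Ioc_of_le (by linarith)]
    exact (memLp_two_iff_integrable_sq_norm hm).1 hL
  rw [intervalIntegral.integral_const, smul_eq_mul] at h2
  rw [smul_eq_mul, inv_mul_le_iff₀ (by linarith)]
  exact h2

lemma norm_fhat_deriv {H H' : ℝ → ℂ} (hd : ∀ x, HasDerivAt H (H' x) x) (he : H (-π) = H π)
    (hi : IntervalIntegrable H' volume (-π) π) (m : ℤ) :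
    ‖fhat H' m‖ = |(m : ℝ)| * ‖fhat H m‖ := by
  rcases eq_or_ne m 0 with rfl | hm
  · have : fhat H' 0 = 0 := by
      rw [fhat]
      simp only [neg_zero, ez_zero, mul_one]
      rw [integral_eq_sub_of_hasDerivAt (fun x _ => hd x) hi, he]
      simp
    simp [this]
  · have h := fourierCoeffOn_of_hasDerivAt (neg_lt_self pi_pos) hm (fun x _ => hd x) hi
    rw [← fhat_eq, ← fhat_eq, he, sub_self, mul_zero, zero_sub] at h
    have h2 : fhat H' m = I * m * fhat H m := by
      rw [h]
      push_cast; field_simp; ring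
    rw [h2, norm_mul, norm_mul]; simp

/-- A weighted `ℓ²` bound gives a bound for the tails of a series. -/
lemma tail_sum_le {c : ℕ → ℝ} (hc : ∀ m, 0 ≤ c m) {B : ℝ} (hB0 : 0 ≤ B) {s : ℕ}
    (hB : ∀ u : Finset ℕ, ∑ m ∈ u, ((m : ℝ) ^ (s + 1) * c m) ^ 2 ≤ B ^ 2) {p : ℕ} {f : ℕ → ℕ}
    (hf : Injective f) (hp : ∀ j, p + 1 ≤ f j) :
    Summable (fun j => c (f j)) ∧ ∑' j, c (f j) ≤ 2 * B / (((p : ℝ) + 1) ^ s * √((p : ℝ) + 1)) := by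
  have hp0 : (0 : ℝ) < (p : ℝ) + 1 := by positivity
  have key : ∀ u : Finset ℕ, ∑ j ∈ u, c (f j) ≤ 2 * B / (((p : ℝ) + 1) ^ s * √((p : ℝ) + 1)) := fun u => by
    rw [← sum_image hf.injOn]
    set t := u.image f with ht
    have htp : ∀ m ∈ t, p + 1 ≤ m := fun m hm => by
      obtain ⟨j, -, rfl⟩ := Finset.mem_image.1 hm
      exact hp j
    have h1 : (∑ m ∈ t, c m) ^ 2
        ≤ (∑ m ∈ t, ((m : ℝ) ^ (s + 1) * c m) ^ 2) * ∑ m ∈ t, (((m : ℝ) ^ (s + 1))⁻¹) ^ 2 := by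
      refine le_trans (le_of_eq ?_) (Finset.sum_mul_sq_le_sq_mul_sq t _ _)
      congr 1
      refine sum_congr rfl fun m hm => ?_
      have : (0 : ℝ) < m := by
        have := htp m hm
        exact_mod_cast (by omega : 0 < m)
      field_simp
    have h2 : ∑ m ∈ t, (((m : ℝ) ^ (s + 1))⁻¹) ^ 2
        ≤ ((((p : ℝ) + 1) ^ s)⁻¹) ^ 2 * (2 / ((p : ℝ) + 1)) := by
      have h3 : ∀ m ∈ t, (((m : ℝ) ^ (s + 1))⁻¹) ^ 2
          ≤ ((((p : ℝ) + 1) ^ s)⁻¹) ^ 2 * ((m : ℝ) ^ 2)⁻¹ := fun m hm => by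
        have hm1 : (p : ℝ) + 1 ≤ m := by exact_mod_cast htp m hm
        have e : (((m : ℝ) ^ (s + 1))⁻¹) ^ 2 = (((m : ℝ) ^ s)⁻¹) ^ 2 * ((m : ℝ) ^ 2)⁻¹ := by
          rw [pow_succ (m : ℝ) s, mul_inv, mul_pow, inv_pow (m : ℝ) 2]
        rw [e]
        gcongr
      refine (sum_le_sum h3).trans ?_
      rw [← mul_sum]
      refine mul_le_mul_of_nonneg_left ?_ (by positivity)
      have h4 : t ⊆ Finset.Ioo p (t.sup id + 1) := fun m hm => by
        have h5 := htp m hm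
        have h6 : m ≤ t.sup id := Finset.le_sup (f := id) hm
        rw [Finset.mem_Ioo]; omega
      refine (Finset.sum_le_sum_of_subset_of_nonneg h4 fun _ _ _ => by positivity).trans ?_
      exact sum_Ioo_inv_sq_le p _
    have h3 : (∑ m ∈ t, c m) ^ 2 ≤ (2 * B / (((p : ℝ) + 1) ^ s * √((p : ℝ) + 1))) ^ 2 := by
      refine h1.trans ((mul_le_mul (hB t) h2 (sum_nonneg fun _ _ => by positivity)
        (by positivity)).trans ?_)
      rw [div_pow, mul_pow, mul_pow, sq_sqrt hp0.le, inv_pow]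
      have h0 : 0 ≤ B ^ 2 / ((((p : ℝ) + 1) ^ s) ^ 2 * ((p : ℝ) + 1)) := by positivity
      calc B ^ 2 * (((((p : ℝ) + 1) ^ s) ^ 2)⁻¹ * (2 / ((p : ℝ) + 1)))
          = 2 * (B ^ 2 / ((((p : ℝ) + 1) ^ s) ^ 2 * ((p : ℝ) + 1))) := by field_simp
        _ ≤ 4 * (B ^ 2 / ((((p : ℝ) + 1) ^ s) ^ 2 * ((p : ℝ) + 1))) := by linarith
        _ = _ := by ring
    exact (abs_le_of_sq_le_sq' h3 (by positivity)).2
  have hs : Summable fun j => c (f j) := summable_of_sum_le (fun j => hc _) key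
  exact ⟨hs, hs.tsum_le_of_sum_le key⟩

/-! ### Coefficients of functions of `a + c cos ψ` -/

/-- The cosine coefficients of `ψ ↦ F(a + c cos ψ)`. -/
def fcf (θ : ℝ) (m : ℕ) (F : ℝ → ℂ) : ℂ := 1 / (2 * π) * ∫ x in (-π)..π,
    F (ca θ + cc θ * cos x) * (cos (m * x) : ℝ)

/-- The sum of the coefficients with index `p + 1, p + 3, …`. -/
def Etail (θ : ℝ) (p : ℕ) (F : ℝ → ℂ) : ℂ := ∑' j : ℕ, fcf θ (p + 1 + 2 * j) F

lemma ca_add_cc (θ : ℝ) : ca θ + cc θ = 1 := by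
  rw [ca, cc]; linarith [sin_sq_add_cos_sq (θ / 2)]

lemma sin_half_pos {θ : ℝ} (h0 : 0 < θ) (hpi : θ < π) : 0 < sin (θ / 2) :=
  sin_pos_of_pos_of_lt_pi (by linarith) (by linarith)

lemma cc_pos {θ : ℝ} (h0 : 0 < θ) (hpi : θ < π) : 0 < cc θ := pow_pos (sin_half_pos h0 hpi) 2

lemma cc_nonneg (θ : ℝ) : 0 ≤ cc θ := sq_nonneg _

lemma ca_nonneg (θ : ℝ) : 0 ≤ ca θ := sq_nonneg _

lemma arg_mem (θ x : ℝ) : ca θ + cc θ * cos x ∈ 𝕁 := by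
  have h1 := ca_add_cc θ
  have h2 := cc_nonneg θ
  have h3 := ca_nonneg θ
  have h4 := neg_one_le_cos x
  have h5 := cos_le_one x
  constructor <;> nlinarith

lemma fcf_eq_fhat {θ : ℝ} {F : ℝ → ℂ}
    (hi : IntervalIntegrable (fun x => F (ca θ + cc θ * cos x)) volume (-π) π)
    (m : ℕ) :
    fcf θ m F = (fhat (fun x => F (ca θ + cc θ * cos x)) m
      + fhat (fun x => F (ca θ + cc θ * cos x)) (-m)) / 2 := by
  rw [fhat, fhat, fcf, ← mul_add, ← intervalIntegral.integral_add, mul_div_assoc]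
  · congr 1
    rw [eq_div_iff two_ne_zero, ← intervalIntegral.integral_mul_const]
    refine integral_congr fun x _ => ?_
    rw [mul_assoc, ← mul_add]
    congr 1
    push_cast
    rw [Complex.cos, ez, ez]
    push_cast
    rw [div_mul_cancel₀ _ two_ne_zero, add_comm]
    congr 2 <;> ring
  · exact hi.mul_continuousOn (continuous_ez _).continuousOn
  · exact hi.mul_continuousOn (continuous_ez _).continuousOn

lemma sum_fcf_sq_le {θ : ℝ} {F : ℝ → ℂ} {s : ℕ} {B : ℝ}
    (hi : IntervalIntegrable (fun x => F (ca θ + cc θ * cos x)) volume (-π) π)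
    (hB : ∀ u : Finset ℤ, ∑ m ∈ u, (|(m : ℝ)| ^ s
      * ‖fhat (fun x => F (ca θ + cc θ * cos x)) m‖) ^ 2 ≤ B ^ 2) (u : Finset ℕ) :
    ∑ m ∈ u, ((m : ℝ) ^ s * ‖fcf θ m F‖) ^ 2 ≤ B ^ 2 := by
  set H := fun x => F (ca θ + cc θ * cos x)
  have h1 := hB (u.map ⟨fun m : ℕ => (m : ℤ), Nat.cast_injective⟩)
  have h2 := hB (u.map ⟨fun m : ℕ => -(m : ℤ), fun a b h => by simpa using h⟩)
  rw [Finset.sum_map] at h1 h2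
  have h3 : ∀ m ∈ u, ((m : ℝ) ^ s * ‖fcf θ m F‖) ^ 2 ≤ ((|((m : ℤ) : ℝ)| ^ s * ‖fhat H m‖) ^ 2
        + (|((-(m : ℤ) : ℤ) : ℝ)| ^ s * ‖fhat H (-m)‖) ^ 2) / 2 := fun m _ => by
    have e1 : |((m : ℤ) : ℝ)| = m := by simp
    have e2 : |((-(m : ℤ) : ℤ) : ℝ)| = m := by simp
    rw [e1, e2, fcf_eq_fhat hi, norm_div, Complex.norm_two]
    have h4 := norm_add_le (fhat H m) (fhat H (-m))
    have h5 : ‖fhat H m + fhat H (-m)‖ ^ 2 ≤ 2 * (‖fhat H m‖ ^ 2 + ‖fhat H (-m)‖ ^ 2) :=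
      (pow_le_pow_left₀ (norm_nonneg _) h4 2).trans add_sq_le
    simp only [mul_pow, div_pow]
    nlinarith
  refine (sum_le_sum h3).trans ?_
  rw [← Finset.sum_div, sum_add_distrib]
  have h1' : ∑ m ∈ u, (|((m : ℤ) : ℝ)| ^ s * ‖fhat H m‖) ^ 2 ≤ B ^ 2 := h1
  have h2' : ∑ m ∈ u, (|((-(m : ℤ) : ℤ) : ℝ)| ^ s * ‖fhat H (-m)‖) ^ 2 ≤ B ^ 2 := h2
  linarith

/-- Second derivative bound for the coefficients of `t ↦ e^{2πiwt}`. -/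
lemma sum_fcf_ew_le (θ w : ℝ) (u : Finset ℕ) :
    ∑ m ∈ u, ((m : ℝ) ^ 2 * ‖fcf θ m (ew w)‖) ^ 2 ≤ (60 * (1 + w ^ 2)) ^ 2 := by
  set H : ℝ → ℂ := fun x => ew w (ca θ + cc θ * cos x) with hH
  set κ : ℂ := 2 * π * w * cc θ * I with hκ
  have hκn : ‖κ‖ ≤ 2 * π * |w| := by
    rw [hκ]
    simp only [norm_mul, norm_real, norm_I, mul_one, Complex.norm_two,
      norm_eq_abs, abs_of_pos pi_pos, abs_of_nonneg (cc_nonneg θ)]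
    have : cc θ ≤ 1 := by linarith [ca_add_cc θ, ca_nonneg θ]
    have h0 : 0 ≤ 2 * π * |w| := by have := pi_pos; positivity
    nlinarith
  have d1 : ∀ x, HasDerivAt H (-(κ * (sin x : ℝ)) * H x) x := fun x => by
    have := (((((hasDerivAt_cos x).const_mul (cc θ)).const_add (ca θ)).const_mul
      (2 * π * w)).ofReal_comp.mul_const I).cexp
    refine this.congr_deriv ?_
    rw [hH, hκ]; simp only [ew]; push_cast; ring
  have d2 : ∀ x, HasDerivAt (fun x => -(κ * (sin x : ℝ)) * H x)
      ((-(κ * (cos x : ℝ)) + (κ * (sin x : ℝ)) ^ 2) * H x) x := fun x => by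
    have := (((hasDerivAt_sin x).ofReal_comp.const_mul κ).neg).mul (d1 x)
    refine this.congr_deriv ?_
    simp only [Pi.neg_apply]; ring
  have hHc : Continuous H := continuous_iff_continuousAt.2 fun x => (d1 x).continuousAt
  have c1 : Continuous fun x => -(κ * (sin x : ℝ)) * H x :=
    continuous_iff_continuousAt.2 fun x => (d2 x).continuousAt
  have c2 : Continuous fun x => (-(κ * (cos x : ℝ)) + (κ * (sin x : ℝ)) ^ 2) * H x := by
    refine Continuous.mul ?_ hHc
    fun_prop
  have n2 : ∀ x, ‖(-(κ * (cos x : ℝ)) + (κ * (sin x : ℝ)) ^ 2) * H x‖ ≤ 60 * (1 + w ^ 2) := fun x => by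
    have hs : ‖((sin x : ℝ) : ℂ)‖ ≤ 1 := by
      rw [norm_real]; exact abs_sin_le_one x
    have hc : ‖((cos x : ℝ) : ℂ)‖ ≤ 1 := by
      rw [norm_real]; exact abs_cos_le_one x
    have hn : ‖H x‖ = 1 := norm_ew _ _
    rw [norm_mul, hn, mul_one]
    have h1 : ‖κ * (sin x : ℝ)‖ ≤ ‖κ‖ := by
      rw [norm_mul]; exact mul_le_of_le_one_right (norm_nonneg _) hs
    have h2 : ‖κ * (cos x : ℝ)‖ ≤ ‖κ‖ := by
      rw [norm_mul]; exact mul_le_of_le_one_right (norm_nonneg _) hc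
    have h3 : ‖-(κ * (cos x : ℝ)) + (κ * (sin x : ℝ)) ^ 2‖ ≤ ‖κ‖ + ‖κ‖ ^ 2 := by
      refine (norm_add_le _ _).trans ?_
      rw [norm_neg, norm_pow]
      exact add_le_add h2 (pow_le_pow_left₀ (norm_nonneg _) h1 2)
    refine h3.trans ?_
    have h4 : ‖κ‖ ≤ 7 * |w| := hκn.trans (by nlinarith [pi_lt_d2, abs_nonneg w])
    have h5 : ‖κ‖ ^ 2 ≤ 49 * w ^ 2 := by
      have := pow_le_pow_left₀ (norm_nonneg κ) h4 2
      rw [mul_pow, sq_abs] at this; linarith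
    nlinarith [sq_nonneg w]
  refine sum_fcf_sq_le (hHc.intervalIntegrable _ _) (fun t => ?_) u
  have h1 := norm_fhat_deriv d1 (by simp [hH]) (c1.intervalIntegrable _ _)
  have h2 := norm_fhat_deriv d2 (by simp [hH]) (c2.intervalIntegrable _ _)
  refine le_trans (le_of_eq ?_) (sum_fhat_sq_le c2.aestronglyMeasurable n2 t)
  refine sum_congr rfl fun m _ => ?_
  rw [h2, h1]; ring

lemma fourierFunctional_fcf (θ : ℝ) (m : ℕ) : ∃ K, FourierFunctional (fcf θ m) K :=
  ⟨_, (FourierFunctional.of_integral (τ := fun x => ca θ + cc θ * cos x)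
    (h := fun x => (cos (m * x) : ℝ)) (by fun_prop) (arg_mem θ) (by fun_prop)).const_mul
      (1 / (2 * π))⟩

lemma fourierFunctional_Etail (θ : ℝ) (p : ℕ) :
    FourierFunctional (Etail θ p) (120 / (((p : ℝ) + 1) * √((p : ℝ) + 1))) := by
  have hb : ∀ (m : ℕ) (w : ℝ), (m : ℝ) ^ 2 * ‖fcf θ m (ew w)‖ ≤ 60 * (1 + w ^ 2) := fun m w => by
    have := sum_fcf_ew_le θ w {m}
    rw [Finset.sum_singleton] at this
    exact (abs_le_of_sq_le_sq' this (by positivity)).2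
  have hinj : Injective fun j : ℕ => p + 1 + 2 * j := fun a b h => by
    simp only at h; omega
  have h1 : ∀ j : ℕ, FourierFunctional (fcf θ (p + 1 + 2 * j))
      (60 * (((p + 1 + 2 * j : ℕ) : ℝ) ^ 2)⁻¹) := fun j => by
    obtain ⟨K, hK⟩ := fourierFunctional_fcf θ (p + 1 + 2 * j)
    refine hK.mono fun w => ?_
    have := hb (p + 1 + 2 * j) w
    have hpos : (0 : ℝ) < ((p + 1 + 2 * j : ℕ) : ℝ) ^ 2 := by positivity
    rw [mul_right_comm, ← div_eq_mul_inv, le_div_iff₀ hpos]; linarith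
  have h2 : Summable fun j : ℕ => 60 * (((p + 1 + 2 * j : ℕ) : ℝ) ^ 2)⁻¹ :=
    ((summable_nat_pow_inv.2 (by norm_num : 1 < 2)).comp_injective hinj).mul_left 60
  refine (FourierFunctional.tsum h1 h2).mono fun w => ?_
  obtain ⟨h3, h4⟩ := tail_sum_le (c := fun m => ‖fcf θ m (ew w)‖) (fun m => norm_nonneg _)
    (by positivity : (0 : ℝ) ≤ 60 * (1 + w ^ 2)) (sum_fcf_ew_le θ w) (p := p) hinj
    (fun j => by omega)
  refine (norm_tsum_le_tsum_norm h3).trans (h4.trans (le_of_eq ?_))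
  rw [pow_one]; ring

/-! ### Coefficients of `V'` -/

/-- `v_m`, the cosine coefficients of `V'(a + c cos ψ)`. -/
def vc (V : ℝ → ℝ) (θ : ℝ) (m : ℕ) : ℝ := 1 / (2 * π) * ∫ x in (-π)..π,
    dV V (ca θ + cc θ * cos x) * cos (m * x)

/-- `E_p = v_{p+1} + v_{p+3} + …`. -/
def Ev (V : ℝ → ℝ) (θ : ℝ) (p : ℕ) : ℝ := ∑' j : ℕ, vc V θ (p + 1 + 2 * j)

lemma fcf_dV (V : ℝ → ℝ) (θ : ℝ) (m : ℕ) : fcf θ m (fun t => (dV V t : ℂ)) = (vc V θ m : ℂ) := by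
  rw [fcf, vc]
  push_cast
  rw [← intervalIntegral.integral_ofReal]
  congr 1
  refine integral_congr fun x _ => ?_
  push_cast; ring

lemma Etail_dV (V : ℝ → ℝ) (θ : ℝ) (p : ℕ) :
    Etail θ p (fun t => (dV V t : ℂ)) = (Ev V θ p : ℂ) := by
  rw [Etail, Ev, ofReal_tsum]
  exact tsum_congr fun j => fcf_dV V θ _

lemma continuous_dV_arg {V : ℝ → ℝ} (h3 : ConditionC3 V) (θ : ℝ) :
    Continuous fun x => dV V (ca θ + cc θ * cos x) := by
  obtain ⟨F0, F1, F2, F3, d0, d1, d2, ⟨K, hK⟩, he, hz⟩ := exists_extension h3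
  have e : (fun x => dV V (ca θ + cc θ * cos x))
      = fun x => F0 (ca θ + cc θ * cos x) := funext fun x => (he _ (arg_mem θ x)).symm
  rw [e]
  have : Continuous F0 := continuous_iff_continuousAt.2 fun t => (d0 t).continuousAt
  fun_prop

/-- Three derivatives of `V'` give a weighted square-summability of `v_m`. -/
lemma exists_sum_vc_sq_le {V : ℝ → ℝ} (h3 : ConditionC3 V) (θ : ℝ) : ∃ B : ℝ, 0 ≤ B ∧
    ∀ u : Finset ℕ, ∑ m ∈ u, ((m : ℝ) ^ 3 * |vc V θ m|) ^ 2 ≤ B ^ 2 := by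
  obtain ⟨F0, F1, F2, F3, d0, d1, d2, ⟨K3, hK3⟩, he, hz⟩ := exists_extension h3
  have cf : ∀ {g g' : ℝ → ℝ}, (∀ t, HasDerivAt g (g' t) t) → Continuous g := fun h =>
    continuous_iff_continuousAt.2 fun t => (h t).continuousAt
  obtain ⟨K1, hK1⟩ := isCompact_Icc.exists_bound_of_continuousOn
    ((cf d1).continuousOn (s := 𝕁))
  obtain ⟨K2, hK2⟩ := isCompact_Icc.exists_bound_of_continuousOn
    ((cf d2).continuousOn (s := 𝕁))
  have hF3 : Measurable F3 := by
    have : F3 = deriv F2 := funext fun t => (d2 t).deriv.symm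
    rw [this]; exact measurable_deriv F2
  set a := ca θ
  set c := cc θ with hc
  set τ : ℝ → ℝ := fun x => a + c * cos x with hτ
  have dτ : ∀ x, HasDerivAt τ (-(c * sin x)) x := fun x =>
    (((hasDerivAt_cos x).const_mul c).const_add a).congr_deriv (by ring)
  have hc1 : |c| ≤ 1 := by
    rw [hc, abs_of_nonneg (cc_nonneg θ)]; linarith [ca_add_cc θ, ca_nonneg θ]
  set H1 : ℝ → ℝ := fun x => -(c * sin x) * F1 (τ x)
  set H2 : ℝ → ℝ := fun x => -(c * cos x) * F1 (τ x) + (c * sin x) ^ 2 * F2 (τ x)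
  set H3 : ℝ → ℝ := fun x => c * sin x * F1 (τ x) + 3 * (c * cos x) * (c * sin x)
    * F2 (τ x) - (c * sin x) ^ 3 * F3 (τ x) with hH3
  have e0 : ∀ x, HasDerivAt (fun x => F0 (τ x)) (H1 x) x := fun x =>
    ((d0 (τ x)).comp x (dτ x)).congr_deriv (by simp only [H1]; ring)
  have sd : ∀ x, HasDerivAt (fun x => c * sin x) (c * cos x) x := fun x =>
    (hasDerivAt_sin x).const_mul c
  have cd : ∀ x, HasDerivAt (fun x => c * cos x) (-(c * sin x)) x := fun x =>
    ((hasDerivAt_cos x).const_mul c).congr_deriv (by ring)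
  have f1 : ∀ x, HasDerivAt (fun x => F1 (τ x)) (-(c * sin x) * F2 (τ x)) x := fun x =>
    ((d1 (τ x)).comp x (dτ x)).congr_deriv (by ring)
  have f2 : ∀ x, HasDerivAt (fun x => F2 (τ x)) (-(c * sin x) * F3 (τ x)) x := fun x =>
    ((d2 (τ x)).comp x (dτ x)).congr_deriv (by ring)
  have e1 : ∀ x, HasDerivAt H1 (H2 x) x := fun x =>
    ((sd x).neg.mul (f1 x)).congr_deriv (by simp only [H2, Pi.neg_apply]; ring)
  have e2 : ∀ x, HasDerivAt H2 (H3 x) x := fun x =>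
    (((cd x).neg.mul (f1 x)).add (((sd x).pow 2).mul (f2 x))).congr_deriv (by
      simp only [H3, Pi.neg_apply, Pi.pow_apply]; push_cast; ring)
  have hK10 : 0 ≤ K1 := (norm_nonneg _).trans (hK1 0 (by norm_num))
  have hK20 : 0 ≤ K2 := (norm_nonneg _).trans (hK2 0 (by norm_num))
  have hK30 : 0 ≤ K3 := (abs_nonneg _).trans (hK3 0)
  have hbd : ∀ x, ‖((H3 x : ℝ) : ℂ)‖ ≤ K1 + 3 * K2 + K3 := fun x => by
    rw [norm_real, norm_eq_abs]
    have hs : |c * sin x| ≤ 1 := by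
      rw [abs_mul]; exact mul_le_one₀ hc1 (abs_nonneg _) (abs_sin_le_one x)
    have hcs : |c * cos x| ≤ 1 := by
      rw [abs_mul]; exact mul_le_one₀ hc1 (abs_nonneg _) (abs_cos_le_one x)
    have g1 := hK1 (τ x) (arg_mem θ x)
    have g2 := hK2 (τ x) (arg_mem θ x)
    have g3 := hK3 (τ x)
    rw [norm_eq_abs] at g1 g2
    have t1 : |c * sin x * F1 (τ x)| ≤ K1 := by
      rw [abs_mul]; nlinarith [abs_nonneg (F1 (τ x))]
    have t2 : |3 * (c * cos x) * (c * sin x) * F2 (τ x)| ≤ 3 * K2 := by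
      rw [abs_mul, abs_mul, abs_mul, abs_of_pos (by norm_num : (0 : ℝ) < 3)]
      have : |c * cos x| * |c * sin x| ≤ 1 := mul_le_one₀ hcs (abs_nonneg _) hs
      nlinarith [abs_nonneg (F2 (τ x))]
    have t3 : |(c * sin x) ^ 3 * F3 (τ x)| ≤ K3 := by
      rw [abs_mul, abs_pow]
      have : |c * sin x| ^ 3 ≤ 1 := pow_le_one₀ (abs_nonneg _) hs
      nlinarith [abs_nonneg (F3 (τ x))]
    have t4 := abs_add_le (c * sin x * F1 (τ x)) (3 * (c * cos x) * (c * sin x) * F2 (τ x))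
    calc |H3 x| ≤ |c * sin x * F1 (τ x) + 3 * (c * cos x) * (c * sin x) * F2 (τ x)|
          + |(c * sin x) ^ 3 * F3 (τ x)| := abs_sub _ _
      _ ≤ _ := by linarith
  have m3 : Measurable fun x => ((H3 x : ℝ) : ℂ) := by
    refine measurable_ofReal.comp ?_
    have c1 : Continuous fun x => c * sin x * F1 (τ x)
        + 3 * (c * cos x) * (c * sin x) * F2 (τ x) := by
      have hs : Continuous fun x => c * sin x := by fun_prop
      have hcs : Continuous fun x => c * cos x := by fun_prop
      exact (hs.mul (cf f1)).add (((continuous_const.mul hcs).mul hs).mul (cf f2))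
    refine c1.measurable.sub (Measurable.mul (Continuous.measurable (by fun_prop)) ?_)
    exact hF3.comp (Continuous.measurable (by fun_prop))
  have ii : IntervalIntegrable (fun x => ((H3 x : ℝ) : ℂ)) volume (-π) π := by
    rw [intervalIntegrable_iff]
    exact Measure.integrableOn_of_bounded (by simp) m3.aestronglyMeasurable
      (of_forall hbd)
  refine ⟨K1 + 3 * K2 + K3, by positivity, fun u => ?_⟩
  have q0 : ∀ x, HasDerivAt (fun x => ((F0 (τ x) : ℝ) : ℂ)) (H1 x : ℂ) x := fun x =>
    (e0 x).ofReal_comp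
  have q1 : ∀ x, HasDerivAt (fun x => ((H1 x : ℝ) : ℂ)) (H2 x : ℂ) x := fun x => (e1 x).ofReal_comp
  have q2 : ∀ x, HasDerivAt (fun x => ((H2 x : ℝ) : ℂ)) (H3 x : ℂ) x := fun x => (e2 x).ofReal_comp
  have n0 := norm_fhat_deriv q0 (by simp [hτ])
    ((continuous_ofReal.comp (cf e1)).intervalIntegrable _ _)
  have n1 := norm_fhat_deriv q1 (by simp [H1])
    ((continuous_ofReal.comp (cf e2)).intervalIntegrable _ _)
  have n2 := norm_fhat_deriv q2 (by simp [H2, hτ]) ii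
  have hfc : ∀ m : ℕ, |vc V θ m| = ‖fcf θ m (fun t => (F0 t : ℂ))‖ := fun m => by
    have : fcf θ m (fun t => (F0 t : ℂ)) = fcf θ m (fun t => (dV V t : ℂ)) := by
      rw [fcf, fcf]
      congr 1
      refine integral_congr fun x _ => ?_
      rw [he _ (arg_mem θ x)]
    rw [this, fcf_dV, norm_real, norm_eq_abs]
  simp only [hfc]
  refine sum_fcf_sq_le ((continuous_ofReal.comp (cf e0)).intervalIntegrable _ _)
    (fun t => ?_) u
  refine le_trans (le_of_eq ?_) (sum_fhat_sq_le m3.aestronglyMeasurable hbd t)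
  refine sum_congr rfl fun m _ => ?_
  rw [n2, n1, n0]; ring

/-- Summability and decay of the coefficients of `V'`. -/
lemma exists_Ev_bound {V : ℝ → ℝ} (h3 : ConditionC3 V) (θ : ℝ) : ∃ B : ℝ, 0 ≤ B ∧
    (Summable fun m : ℕ => (m : ℝ) ^ 2 * |vc V θ m|) ∧
    (∀ p : ℕ, Summable fun j : ℕ => vc V θ (p + 1 + 2 * j)) ∧
    ∀ p : ℕ, |Ev V θ p| ≤ B / (((p : ℝ) + 1) ^ 2 * √((p : ℝ) + 1)) := by
  obtain ⟨B, hB0, hB⟩ := exists_sum_vc_sq_le h3 θ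
  have h1 : ∀ p : ℕ, _ := fun p : ℕ =>
    tail_sum_le (c := fun m => |vc V θ m|) (fun m => abs_nonneg _) hB0 hB
    (p := p) (f := fun j => p + 1 + 2 * j) (fun a b h => by simp only at h; omega)
    (fun j => by omega)
  refine ⟨2 * B, by positivity, ?_, fun p => (h1 p).1.of_abs, fun p => ?_⟩
  · have h2 := (tail_sum_le (c := fun m => (m : ℝ) ^ 2 * |vc V θ m|) (fun m => by positivity) hB0
      (s := 0) (fun u => by
        refine le_trans (le_of_eq (sum_congr rfl fun m _ => ?_)) (hB u)
        ring) (p := 0) (f := fun j => j + 1) (fun a b h => by simpa using h)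
      (fun j => by omega)).1
    exact (summable_nat_add_iff 1).1 h2
  · refine le_trans ?_ (h1 p).2
    have := norm_tsum_le_tsum_norm (f := fun j => vc V θ (p + 1 + 2 * j)) (h1 p).1
    exact this

lemma v0_eq_vc {V : ℝ → ℝ} (h3 : ConditionC3 V) (θ : ℝ) : v0 V θ = vc V θ 0 := by
  rw [v0, vc]
  congr 1
  simp only [Nat.cast_zero, zero_mul, cos_zero, mul_one]
  have hper : Periodic (fun x => dV V (ca θ + cc θ * cos x)) (2 * π) := by
    intro x; simp
  rw [integral_comp_mul_left (fun x => dV V (ca θ + cc θ * cos x))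
    two_ne_zero, smul_eq_mul]
  have hi : ∀ x y : ℝ, IntervalIntegrable (fun x => dV V (ca θ + cc θ * cos x)) volume x y :=
    fun x y => (continuous_dV_arg h3 θ).intervalIntegrable x y
  have e1 := hper.intervalIntegral_add_eq (2 * -π) (-π)
  have e2 := hper.intervalIntegral_add_eq 0 (-π)
  rw [show 2 * -π + 2 * π = 0 by ring, show -π + 2 * π = π by ring]
    at e1
  rw [zero_add, show -π + 2 * π = π by ring] at e2
  rw [← intervalIntegral.integral_add_adjacent_intervals (hi _ 0) (hi 0 _), e1, e2]; ring

/-! ### Cosine series and the coefficients `B_{α,β}` -/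

/-- A continuous even periodic function is the sum of its cosine series, if that converges
absolutely. -/
lemma hasSum_cos_series {H : ℝ → ℝ} (hc : Continuous H) (hper : Periodic H (2 * π))
    (heven : ∀ x, H (-x) = H x)
    (hs : Summable fun m : ℕ => 1 / (2 * π) * ∫ x in (-π)..π, H x * cos (m * x))
    (x : ℝ) :
    HasSum (fun m : ℤ => (1 / (2 * π) * ∫ x in (-π)..π,
      H x * cos (m.natAbs * x)) * cos (m * x)) (H x) := by
  have : Fact (0 < 2 * π) := ⟨by positivity⟩
  set c : ℕ → ℝ := fun m => 1 / (2 * π) * ∫ x in (-π)..π, H x * cos (m * x)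
    with hcdef
  have hperC : Periodic (fun x => (H x : ℂ)) (2 * π) := fun x => by
    simp only [hper x]
  have hcont : Continuous hperC.lift := by
    refine continuous_coinduced_dom.2 ?_
    exact continuous_ofReal.comp hc
  set f : C(AddCircle (2 * π), ℂ) := ⟨hperC.lift, hcont⟩ with hf
  have hfx : ∀ x : ℝ, f (x : AddCircle (2 * π)) = H x := fun x => hperC.lift_coe x
  have hfour : ∀ (m : ℤ) (x : ℝ), fourier m (x : AddCircle (2 * π)) = ez m x := fun m x => by
    rw [fourier_coe_apply, ez]
    congr 1
    push_cast; field_simp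
  have hcoef : ∀ m : ℤ, fourierCoeff f m = (c m.natAbs : ℂ) := fun m => by
    rw [fourierCoeff_eq_intervalIntegral _ _ (-π), show -π + 2 * π = π by ring]
    simp only [hfx, hfour, smul_eq_mul]
    have hodd : ∫ x in (-π)..π, H x * sin (m * x) = 0 := by
      have h1 : ∫ x in (-π)..π, H x * sin (m * x) = ∫ x in (-π)..π, -(H x * sin (m * x)) := by
        have := integral_comp_neg (a := -π) (b := π) (fun x => H x * sin (m * x))
        rw [neg_neg] at this
        rw [← this]
        refine integral_congr fun x _ => ?_
        rw [heven, mul_neg, sin_neg]; ring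
      rw [intervalIntegral.integral_neg] at h1; linarith
    have e : ∀ x : ℝ, ez (-m) x * (H x : ℂ)
        = ((H x * cos (m.natAbs * x) : ℝ) : ℂ) - ((H x * sin (m * x) : ℝ) : ℂ) * I := fun x => by
      have hcos : cos (m.natAbs * x) = cos (m * x) := by
        rcases Int.natAbs_eq m with h | h
        · conv_rhs => rw [h]
          simp
        · conv_rhs => rw [h]
          simp
      rw [hcos, ez, show ((-m : ℤ) : ℂ) * x * I = ((-(m * x) : ℝ) : ℂ) * I by
        push_cast; ring, exp_mul_I, ← ofReal_cos, ← ofReal_sin, cos_neg,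
        sin_neg]
      push_cast; ring
    simp only [e]
    rw [intervalIntegral.integral_sub, intervalIntegral.integral_mul_const,
      intervalIntegral.integral_ofReal, intervalIntegral.integral_ofReal, hodd, hcdef,
      real_smul]
    · push_cast; ring
    · exact intervalIntegrable (by fun_prop) _ _
    · exact intervalIntegrable (by fun_prop) _ _
  have hsum : Summable (fourierCoeff f) := by
    have : Summable fun m : ℤ => c m.natAbs := by
      refine Summable.of_nat_of_neg ?_ ?_ <;> simpa using hs
    exact (ofRealCLM.summable this).congr fun m => (hcoef m).symm
  have h1 := has_pointwise_sum_fourier_series_of_summable hsum (x : AddCircle (2 * π))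
  simp only [hcoef, hfour, hfx, smul_eq_mul] at h1
  have h2 := hasSum_re h1
  rw [ofReal_re] at h2
  convert! h2 using 2 with m
  rw [re_ofReal_mul, ez, show ((m : ℤ) : ℂ) * x * I = ((m * x : ℝ) : ℂ) * I by
        push_cast; ring, exp_ofReal_mul_I_re]

lemma summable_abs_vc {V : ℝ → ℝ} (h3 : ConditionC3 V) (θ : ℝ) : Summable fun m => |vc V θ m| := by
  obtain ⟨B, -, h, -⟩ := exists_Ev_bound h3 θ
  refine (summable_nat_add_iff 1).1 (Summable.of_nonneg_of_le (fun m => abs_nonneg _) (fun m => ?_)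
    ((summable_nat_add_iff 1).2 h))
  have : (1 : ℝ) ≤ ((m + 1 : ℕ) : ℝ) ^ 2 := one_le_pow₀ (by push_cast; linarith [Nat.cast_nonneg (α := ℝ) m])
  nlinarith [abs_nonneg (vc V θ (m + 1))]

lemma hasSum_dV_series {V : ℝ → ℝ} (h3 : ConditionC3 V) (θ x : ℝ) :
    HasSum (fun m : ℤ => vc V θ m.natAbs * cos (m * x)) (dV V (ca θ + cc θ * cos x)) :=
  hasSum_cos_series (H := fun x => dV V (ca θ + cc θ * cos x)) (continuous_dV_arg h3 θ)
    (fun x => by simp) (fun x => by simp) (summable_abs_vc h3 θ).of_abs x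

lemma hasSum_dV_sub {V : ℝ → ℝ} (h3 : ConditionC3 V) (θ x y : ℝ) :
    HasSum (fun m : ℕ => 2 * vc V θ m * (cos (m * x) - cos (m * y)))
      (dV V (ca θ + cc θ * cos x) - dV V (ca θ + cc θ * cos y)) := by
  have h := ((hasSum_dV_series h3 θ x).sub (hasSum_dV_series h3 θ y)).nat_add_neg
  simp only [natAbs_neg, natAbs_natCast, Int.cast_neg, neg_mul, cos_neg, Int.cast_natCast,
    Int.cast_zero, zero_mul, cos_zero, sub_self, add_zero] at h
  convert! h using 2 with m
  ring

/-- `U_{m-1}(cos x) = ∑_{i<m} e^{i(2i-m+1)x}`, the Chebyshev polynomials of the second kind. -/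
def chebU (m : ℕ) (x : ℝ) : ℂ := ∑ i ∈ Finset.range m, ez (2 * i - m + 1) x

lemma ez_add_arg (j : ℤ) (x y : ℝ) : ez j (x + y) = ez j x * ez j y := by
  rw [ez, ez, ez, ← Complex.exp_add]; congr 1; push_cast; ring

lemma chebU_mul (m : ℕ) (x : ℝ) : (ez 1 x - ez (-1) x) * chebU m x = ez m x - ez (-m) x := by
  rw [chebU, mul_sum]
  have e : ∀ i ∈ Finset.range m, (ez 1 x - ez (-1) x) * ez (2 * i - m + 1) x
      = ez (2 * (i + 1 : ℕ) - m) x - ez (2 * (i : ℕ) - m) x := fun i _ => by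
    rw [sub_mul, ← ez_add, ← ez_add]
    congr 2 <;> (push_cast; ring)
  rw [sum_congr rfl e, Finset.sum_range_sub fun i : ℕ => ez (2 * (i : ℕ) - m) x]
  congr 2 <;> (push_cast; ring)

lemma norm_chebU_le (m : ℕ) (x : ℝ) : ‖chebU m x‖ ≤ m := by
  refine (norm_sum_le _ _).trans ?_
  simp [norm_ez]

lemma continuous_chebU (m : ℕ) : Continuous (chebU m) :=
  continuous_finsetSum _ fun _ _ => continuous_ez _

lemma two_cos_eq (m : ℤ) (x : ℝ) : ((2 * cos (m * x) : ℝ) : ℂ) = ez m x + ez (-m) x := by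
  rw [ez, ez]
  push_cast
  rw [Complex.cos, mul_div_cancel₀ _ two_ne_zero]
  congr 2 <;> ring

/-- Divided differences of cosines. -/
lemma cos_sub_cos_eq (m : ℕ) (u v : ℝ) : ((cos (m * (2 * u)) - cos (m * (2 * v)) : ℝ) : ℂ)
      = (cos (2 * u) - cos (2 * v) : ℝ) * (chebU m (u + v) * chebU m (u - v)) := by
  have key : ∀ m : ℕ, (ez m (u + v) - ez (-m) (u + v)) * (ez m (u - v) - ez (-m) (u - v))
      = ((2 * (cos (m * (2 * u)) - cos (m * (2 * v))) : ℝ) : ℂ) := fun m => by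
    have h1 := two_cos_eq m (2 * u)
    have h2 := two_cos_eq m (2 * v)
    simp only [Int.cast_natCast] at h1 h2
    rw [show (2 * (cos (m * (2 * u)) - cos (m * (2 * v))) : ℝ)
      = 2 * cos (m * (2 * u)) - 2 * cos (m * (2 * v)) by ring,
      ofReal_sub, h1, h2, two_mul u, two_mul v]
    simp only [sub_eq_add_neg, ez_add_arg, ez_neg_arg, neg_neg]
    have h3 : ez m v * ez (-m) v = 1 := by rw [← ez_add]; simp [ez_zero]
    have h4 : ez m u * ez (-m) u = 1 := by rw [← ez_add]; simp [ez_zero]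
    linear_combination (ez m u * ez m u + ez (-m) u * ez (-m) u) * h3
      - (ez m v * ez m v + ez (-m) v * ez (-m) v) * h4
  have h1 := key m
  rw [← chebU_mul, ← chebU_mul] at h1
  have h2 := key 1
  simp only [Nat.cast_one, one_mul] at h2
  have h5 : (ez 1 (u + v) - ez (-1) (u + v)) * chebU m (u + v)
      * ((ez 1 (u - v) - ez (-1) (u - v)) * chebU m (u - v))
      = (ez 1 (u + v) - ez (-1) (u + v)) * (ez 1 (u - v) - ez (-1) (u - v))
        * (chebU m (u + v) * chebU m (u - v)) := by ring
  rw [h5, h2] at h1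
  push_cast at h1 ⊢
  linear_combination -(1 / 2) * h1

lemma integral_ez (j : ℤ) :
    ∫ x in (-π)..π, ez j x = if j = 0 then (2 * π : ℂ) else 0 := by
  split_ifs with h
  · subst h
    simp only [ez_zero, intervalIntegral.integral_const, real_smul]; push_cast; ring
  · have hd : ∀ x : ℝ, HasDerivAt (fun x => ez j x / (j * I)) (ez j x) x := fun x => by
      refine ((hasDerivAt_ez j x).div_const _).congr_deriv ?_
      field_simp
    rw [integral_eq_sub_of_hasDerivAt (fun x _ => hd x)
      ((continuous_ez j).intervalIntegrable _ _), ez_pi, sub_self]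

lemma integral_double_sum {ι κ : Type*} (s : Finset ι) (t : Finset κ) {g : ι → κ → ℝ → ℂ}
    (hg : ∀ i j, Continuous (g i j)) (a b : ℝ) :
    ∫ x in a..b, ∑ i ∈ s, ∑ j ∈ t, g i j x = ∑ i ∈ s, ∑ j ∈ t, ∫ x in a..b, g i j x := by
  rw [integral_finsetSum fun i _ =>
    (continuous_finsetSum t fun j _ => hg i j).intervalIntegrable a b]
  refine sum_congr rfl fun i _ => ?_
  rw [integral_finsetSum fun j _ => (hg i j).intervalIntegrable a b]

open Classical in
lemma integral_chebU (m : ℕ) (α β : ℤ) :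
    ∫ u in (-π)..π, ∫ v in (-π)..π, chebU m (u + v) * chebU m (u - v) * (ez α u * ez β v)
      = if Even α ∧ Even β ∧ ∃ j : ℕ, m = (α.natAbs + β.natAbs) / 2 + 1 + 2 * j
        then (4 * π ^ 2 : ℂ) else 0 := by
  have e : ∀ u v : ℝ, chebU m (u + v) * chebU m (u - v) * (ez α u * ez β v)
      = ∑ i ∈ Finset.range m, ∑ j ∈ Finset.range m,
        ez (2 * i + 2 * j - 2 * m + 2 + α) u * ez (2 * i - 2 * j + β) v := fun u v => by
    rw [chebU, chebU, Finset.sum_mul_sum, sum_mul]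
    refine sum_congr rfl fun i _ => ?_
    rw [sum_mul]
    refine sum_congr rfl fun j _ => ?_
    rw [sub_eq_add_neg u v, ez_add_arg, ez_add_arg, ez_neg_arg,
      show (2 * i + 2 * j - 2 * m + 2 + α : ℤ) = (2 * i - m + 1) + (2 * j - m + 1) + α by ring,
      show (2 * i - 2 * j + β : ℤ) = (2 * i - m + 1) + -(2 * j - m + 1) + β by ring]
    simp only [ez_add]; ring
  have e2 : ∀ u : ℝ, (∫ v in (-π)..π, chebU m (u + v) * chebU m (u - v) * (ez α u * ez β v))
      = ∑ i ∈ Finset.range m, ∑ j ∈ Finset.range m, ez (2 * i + 2 * j - 2 * m + 2 + α) u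
          * (if (2 * i - 2 * j + β : ℤ) = 0 then (2 * π : ℂ) else 0) := fun u => by
    simp only [e]
    rw [integral_double_sum (g := fun (i j : ℕ) v =>
      ez (2 * i + 2 * j - 2 * m + 2 + α) u * ez (2 * i - 2 * j + β) v)
      _ _ fun i j => continuous_const.mul (continuous_ez _)]
    refine sum_congr rfl fun i _ => sum_congr rfl fun j _ => ?_
    rw [intervalIntegral.integral_const_mul, integral_ez]
  simp only [e2]
  rw [integral_double_sum (g := fun (i j : ℕ) u =>
      ez (2 * i + 2 * j - 2 * m + 2 + α) u
          * (if (2 * i - 2 * j + β : ℤ) = 0 then (2 * π : ℂ) else 0))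
      _ _ fun i j => (continuous_ez _).mul continuous_const]
  have e3 : ∀ i ∈ Finset.range m, ∀ j ∈ Finset.range m, (∫ u in (-π)..π,
        ez (2 * i + 2 * j - 2 * m + 2 + α) u
          * (if (2 * i - 2 * j + β : ℤ) = 0 then (2 * π : ℂ) else 0))
      = if (2 * i + 2 * j - 2 * m + 2 + α : ℤ) = 0 ∧ (2 * i - 2 * j + β : ℤ) = 0
        then (4 * π ^ 2 : ℂ) else 0 := fun i _ j _ => by
    rw [intervalIntegral.integral_mul_const, integral_ez]
    split_ifs <;> first | (exfalso; tauto) | ring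
  rw [sum_congr rfl fun i hi => sum_congr rfl (e3 i hi), ← Finset.sum_product']
  split_ifs with h
  · obtain ⟨⟨α', hα⟩, ⟨β', hβ⟩, t, ht⟩ := h
    have hn : (m : ℤ) = |α'| + |β'| + 1 + 2 * t := by
      have : (α.natAbs + β.natAbs) / 2 = α'.natAbs + β'.natAbs := by omega
      rw [this] at ht
      zify at ht; rw [ht]
    -- the unique pair `(i, j)`
    obtain ⟨r, hr⟩ : ∃ r : ℤ, |α'| + |β'| = α' + β' + 2 * r := by
      rcases abs_cases α' with ⟨h1, -⟩ | ⟨h1, -⟩ <;> rcases abs_cases β' with ⟨h2, -⟩ | ⟨h2, -⟩ <;>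
        rw [h1, h2]
      exacts [⟨0, by ring⟩, ⟨-β', by ring⟩, ⟨-α', by ring⟩, ⟨-α' - β', by ring⟩]
    rw [sum_eq_single ((r + t).toNat, (r + t + β').toNat)]
    · rw [if_pos]
      constructor <;> (simp only; omega)
    · rintro ⟨i, j⟩ hij hne
      rw [if_neg]
      rintro ⟨g1, g2⟩
      apply hne
      simp only at g1 g2
      ext <;> (simp only; omega)
    · intro hn'
      exfalso
      apply hn'
      rw [Finset.mem_product, Finset.mem_range, Finset.mem_range]
      constructor <;> (simp only; omega)
  · refine sum_eq_zero ?_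
    rintro ⟨i, j⟩ hij
    rw [Finset.mem_product, Finset.mem_range, Finset.mem_range] at hij
    simp only at hij
    rw [if_neg]
    rintro ⟨g1, g2⟩
    simp only at g1 g2
    apply h
    refine ⟨⟨(m : ℤ) - 1 - i - j, by omega⟩, ⟨(j : ℤ) - i, by omega⟩,
      (m - 1 - (α.natAbs + β.natAbs) / 2) / 2, ?_⟩
    omega

/-- The diagonal, where the divided difference is `0 / 0`, is a null set. -/
lemma ae_cos_ne (u : ℝ) : ∀ᵐ v : ℝ, cos (2 * u) ≠ cos (2 * v) := by
  have hc : Set.Countable {v : ℝ | cos (2 * u) = cos (2 * v)} := by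
    refine Set.Countable.mono (s₂ := (range fun k : ℤ => k * π + u)
      ∪ range fun k : ℤ => k * π - u) ?_
      ((countable_range _).union (countable_range _))
    intro v hv
    obtain ⟨k, hk | hk⟩ := cos_eq_cos_iff.1 (show cos (2 * u) = cos (2 * v) from hv)
    · exact Or.inl ⟨k, by simp only; linarith⟩
    · exact Or.inr ⟨k, by simp only; linarith⟩
  exact hc.ae_notMem volume

/-- Closed form of the coefficients `B_{α,β}`. -/
lemma Bcoef_eq {V : ℝ → ℝ} (h3 : ConditionC3 V) {θ : ℝ} (hc : cc θ ≠ 0) (α β : ℤ) :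
    Bcoef V θ α β = if Even α ∧ Even β then 2 / cc θ * Ev V θ ((α.natAbs + β.natAbs) / 2) else 0 := by
  classical
  obtain ⟨B, -, hs2, hsE, -⟩ := exists_Ev_bound h3 θ
  set W : ℝ → ℝ := fun u => dV V (ca θ + cc θ * cos (2 * u)) with hW
  set g : ℕ → ℝ → ℝ → ℂ := fun m u v =>
    2 * vc V θ m * (chebU m (u + v) * chebU m (u - v) * (ez α u * ez β v)) with hg
  have gn : ∀ m u v, ‖g m u v‖ ≤ 2 * ((m : ℝ) ^ 2 * |vc V θ m|) := fun m u v => by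
    simp only [hg, norm_mul, norm_ez, mul_one, norm_real, Complex.norm_two, norm_eq_abs]
    have := mul_le_mul (norm_chebU_le m (u + v)) (norm_chebU_le m (u - v)) (norm_nonneg _)
      (Nat.cast_nonneg m)
    nlinarith [abs_nonneg (vc V θ m)]
  have hsum : Summable fun m : ℕ => 2 * ((m : ℝ) ^ 2 * |vc V θ m|) := hs2.mul_left 2
  have gc : ∀ m, Continuous fun p : ℝ × ℝ => g m p.1 p.2 := fun m => by
    have c1 := continuous_chebU m
    have c2 := continuous_ez α
    have c3 := continuous_ez β
    simp only [hg]
    fun_prop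
  have gcu : ∀ m u, Continuous fun v => g m u v := fun m u => by
    have c1 := continuous_chebU m
    have c3 := continuous_ez β
    simp only [hg]
    fun_prop
  -- the integrand is almost everywhere the real part of a uniformly convergent series
  have hae : ∀ u, ∀ᵐ v : ℝ, (W u - W v) / (cos (2 * u) - cos (2 * v))
      * cos (α * u + β * v) = (∑' m, g m u v).re := fun u => by
    filter_upwards [ae_cos_ne u] with v hv
    have hne : ((cos (2 * u) - cos (2 * v) : ℝ) : ℂ) ≠ 0 := by
      exact_mod_cast sub_ne_zero.2 hv
    have h1 := (hasSum_ofReal.2 (hasSum_dV_sub h3 θ (2 * u) (2 * v)))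
    have h2 : HasSum (fun m => (cos (2 * u) - cos (2 * v) : ℝ)
        * (2 * vc V θ m * (chebU m (u + v) * chebU m (u - v))) : ℕ → ℂ) ((W u - W v : ℝ) : ℂ) := by
      convert! h1 using 2 with m
      rw [ofReal_mul, cos_sub_cos_eq]; push_cast; ring
    have h3' := ((h2.mul_left (((cos (2 * u) - cos (2 * v) : ℝ) : ℂ)⁻¹)).mul_right
      (ez α u * ez β v))
    have h4 : ∑' m, g m u v = (((W u - W v) / (cos (2 * u) - cos (2 * v)) : ℝ) : ℂ)
        * (ez α u * ez β v) := by
      have h5 : ∀ m, ((cos (2 * u) - cos (2 * v) : ℝ) : ℂ)⁻¹ * ((cos (2 * u) - cos (2 * v) : ℝ)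
            * (2 * vc V θ m * (chebU m (u + v) * chebU m (u - v)))) * (ez α u * ez β v)
          = g m u v := fun m => by
        simp only [hg]
        rw [inv_mul_cancel_left₀ hne]; ring
      simp only [h5] at h3'
      rw [h3'.tsum_eq]; push_cast; ring
    rw [h4, re_ofReal_mul]
    congr 1
    rw [ez, ez, ← Complex.exp_add, show (α : ℂ) * u * I + β * v * I
      = ((α * u + β * v : ℝ) : ℂ) * I by push_cast; ring, exp_ofReal_mul_I_re]
  have hG : Continuous fun p : ℝ × ℝ => ∑' m, g m p.1 p.2 :=
    continuous_tsum gc hsum fun m p => gn m p.1 p.2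
  have hGu : ∀ u, Continuous fun v => ∑' m, g m u v := fun u =>
    continuous_tsum (fun m => gcu m u) hsum fun m v => gn m u v
  have hin : ∀ u, HasSum (fun m => ∫ v in (-π)..π, g m u v) (∫ v in (-π)..π, ∑' m, g m u v) := fun u => by
    refine hasSum_integral_of_dominated_convergence
      (fun m _ => 2 * ((m : ℝ) ^ 2 * |vc V θ m|)) (fun m => ?_) (fun m => ?_) ?_ ?_ ?_
    · exact (gcu m u).aestronglyMeasurable
    · exact of_forall fun v _ => gn m u v
    · exact of_forall fun v _ => hsum
    · simp
    · exact of_forall fun v _ =>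
        (Summable.of_norm_bounded hsum fun m => gn m u v).hasSum
  have hin2 : ∀ m u, ‖∫ v in (-π)..π, g m u v‖
      ≤ 2 * ((m : ℝ) ^ 2 * |vc V θ m|) * |π - -π| := fun m u =>
    intervalIntegral.norm_integral_le_of_norm_le_const fun v _ => gn m u v
  have hout : HasSum (fun m => ∫ u in (-π)..π, ∫ v in (-π)..π, g m u v)
      (∫ u in (-π)..π, ∫ v in (-π)..π, ∑' m, g m u v) := by
    refine hasSum_integral_of_dominated_convergence
      (fun m _ => 2 * ((m : ℝ) ^ 2 * |vc V θ m|) * |π - -π|) (fun m => ?_) (fun m => ?_)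
      ?_ ?_ ?_
    · exact (continuous_parametric_intervalIntegral_of_continuous' (gc m)
        _ _).aestronglyMeasurable
    · exact of_forall fun u _ => hin2 m u
    · exact of_forall fun v _ => hsum.mul_right _
    · simp
    · exact of_forall fun u _ => hin u
  have hval : ∀ m, (∫ u in (-π)..π, ∫ v in (-π)..π, g m u v)
      = 2 * vc V θ m * (if Even α ∧ Even β ∧ ∃ j : ℕ, m = (α.natAbs + β.natAbs) / 2 + 1 + 2 * j
        then (4 * π ^ 2 : ℂ) else 0) := fun m => by
    simp only [hg, intervalIntegral.integral_const_mul]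
    rw [integral_chebU]
  have hB : Bcoef V θ α β = 1 / (4 * π ^ 2 * cc θ) * (∫ u in (-π)..π, ∫ v in (-π)..π,
      (W u - W v) / (cos (2 * u) - cos (2 * v)) * cos (α * u + β * v)) := rfl
  clear_value g W
  have hI : (∫ u in (-π)..π, ∫ v in (-π)..π,
      (W u - W v) / (cos (2 * u) - cos (2 * v)) * cos (α * u + β * v))
      = (∫ u in (-π)..π, ∫ v in (-π)..π, ∑' m, g m u v).re := by
    have hcu : Continuous fun u => ∫ v in (-π)..π, ∑' m, g m u v :=
      continuous_parametric_intervalIntegral_of_continuous' hG _ _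
    have hre : ∀ (f : ℝ → ℂ), Continuous f → (∫ v in (-π)..π, f v).re
        = ∫ v in (-π)..π, (f v).re := fun f hf => by
      have := Complex.reCLM.intervalIntegral_comp_comm (hf.intervalIntegrable (μ := volume) (-π) π)
      exact this.symm
    rw [hre _ hcu]
    refine integral_congr fun u _ => ?_
    rw [hre _ (hGu u)]
    refine intervalIntegral.integral_congr_ae ?_
    filter_upwards [hae u] with v hv _
    exact hv
  rw [hB]
  rw [hI, ← hout.tsum_eq]
  simp only [hval]
  split_ifs with hpar
  · have e : ∀ m : ℕ, (2 * (vc V θ m : ℂ) * (if Even α ∧ Even β ∧ ∃ j : ℕ,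
        m = (α.natAbs + β.natAbs) / 2 + 1 + 2 * j then (4 * π ^ 2 : ℂ) else 0))
        = ((8 * π ^ 2 * (if ∃ j : ℕ, m = (α.natAbs + β.natAbs) / 2 + 1 + 2 * j
          then vc V θ m else 0) : ℝ) : ℂ) := fun m => by
      by_cases hm : ∃ j : ℕ, m = (α.natAbs + β.natAbs) / 2 + 1 + 2 * j
      · rw [if_pos ⟨hpar.1, hpar.2, hm⟩, if_pos hm]; push_cast; ring
      · rw [if_neg (fun h => hm h.2.2), if_neg hm]; simp
    simp only [e]
    rw [← ofReal_tsum, ofReal_re, tsum_mul_left]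
    have hinj : Injective fun j : ℕ => (α.natAbs + β.natAbs) / 2 + 1 + 2 * j :=
      fun a b h => by simp only at h; omega
    have h5 : ∑' m : ℕ, (if ∃ j : ℕ, m = (α.natAbs + β.natAbs) / 2 + 1 + 2 * j
          then vc V θ m else 0) = Ev V θ ((α.natAbs + β.natAbs) / 2) := by
      rw [Ev, ← hinj.tsum_eq]
      · refine tsum_congr fun j => ?_
        rw [if_pos ⟨j, rfl⟩]
      · intro m hm
        rw [Function.mem_support] at hm
        by_contra hn
        apply hm
        rw [if_neg]
        rintro ⟨j, hj⟩
        exact hn ⟨j, hj.symm⟩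
    rw [h5]; field_simp; ring
  · have e : ∀ m : ℕ, (2 * (vc V θ m : ℂ) * (if Even α ∧ Even β ∧ ∃ j : ℕ,
        m = (α.natAbs + β.natAbs) / 2 + 1 + 2 * j then (4 * π ^ 2 : ℂ) else 0)) = 0 := fun m => by
      rw [if_neg (fun h => hpar ⟨h.1, h.2.1⟩), mul_zero]
    simp only [e]; simp

/-! ### The logarithmic kernel -/

/-- `log |1 - e^{it}| = log |2 sin (t/2)|`. -/
def ell (t : ℝ) : ℝ := log (2 * sin (t / 2))

lemma ell_neg (t : ℝ) : ell (-t) = ell t := by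
  rw [ell, neg_div, sin_neg, mul_neg, log_neg_eq_log, ell]

lemma ell_periodic : Periodic ell (2 * π) := fun t => by
  rw [ell, add_div, mul_div_cancel_left₀ _ (two_ne_zero' ℝ), sin_add_pi, mul_neg,
    log_neg_eq_log, ell]

lemma measurable_ell : Measurable ell := by
  unfold ell
  exact measurable_log.comp (Continuous.measurable (by fun_prop))

lemma intervalIntegrable_ell (a b : ℝ) : IntervalIntegrable ell volume a b := by
  have h : MeromorphicOn (fun t : ℝ => 2 * sin (t / 2)) (uIcc a b) := fun t _ => by
    have : AnalyticAt ℝ (fun t : ℝ => 2 * sin (t / 2)) t := by fun_prop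
    exact this.meromorphicAt
  exact h.intervalIntegrable_log

lemma sin_nat_mul_eq (m : ℕ) (t : ℝ) :
    sin (m * t) = 2 * sin (t / 2) * ∑ j ∈ Finset.range m, cos ((j + 1 / 2) * t) := by
  rw [mul_sum]
  have e : ∀ j ∈ Finset.range m, 2 * sin (t / 2) * cos ((j + 1 / 2) * t)
      = sin ((j + 1 : ℕ) * t) - sin ((j : ℕ) * t) := fun j _ => by
    rw [show ((j + 1 : ℕ) : ℝ) * t = (j + 1 / 2) * t + t / 2 by push_cast; ring,
      show ((j : ℕ) : ℝ) * t = (j + 1 / 2) * t - t / 2 by ring, sin_add, sin_sub]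
    ring
  rw [sum_congr rfl e, Finset.sum_range_sub fun j : ℕ => sin (j * t)]
  simp

lemma integral_cos_int (j : ℕ) :
    ∫ t in (-π)..π, cos (j * t) = if j = 0 then 2 * π else 0 := by
  split_ifs with h
  · subst h
    simp; ring
  · have hj : (j : ℝ) ≠ 0 := by exact_mod_cast h
    rw [integral_comp_mul_left (fun t => cos t) hj, integral_cos]
    simp [sin_nat_mul_pi]

/-- The Fourier coefficients of the logarithmic kernel. -/
lemma integral_ell_cos {m : ℕ} (hm : m ≠ 0) :
    ∫ t in (-π)..π, ell t * cos (m * t) = -(π / m) := by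
  have hp := pi_pos
  set Q : ℝ → ℝ := fun t => ∑ j ∈ Finset.range m, (cos (j * t) + cos ((j + 1 : ℕ) * t))
    with hQ
  have hQs : ∀ t, Q t = 2 * cos (t / 2) * ∑ j ∈ Finset.range m, cos ((j + 1 / 2) * t) := fun t => by
    rw [hQ, mul_sum]
    refine sum_congr rfl fun j _ => ?_
    rw [show ((j + 1 : ℕ) : ℝ) * t = (j + 1 / 2) * t + t / 2 by push_cast; ring,
      show ((j : ℕ) : ℝ) * t = (j + 1 / 2) * t - t / 2 by ring, cos_add, cos_sub]
    ring
  have hQc : Continuous Q := by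
    simp only [hQ]; fun_prop
  have hQi : ∫ t in (-π)..π, Q t = 2 * π := by
    simp only [hQ]
    rw [integral_finsetSum fun j _ =>
      intervalIntegrable (by fun_prop) _ _]
    have : ∀ j ∈ Finset.range m, ∫ t in (-π)..π,
        (cos (j * t) + cos ((j + 1 : ℕ) * t)) = if j = 0 then 2 * π else 0 := fun j _ => by
      rw [intervalIntegral.integral_add (intervalIntegrable (by fun_prop) _ _)
        (intervalIntegrable (by fun_prop) _ _), integral_cos_int, integral_cos_int]
      simp
    rw [sum_congr rfl this, Finset.sum_ite_eq' ]
    rw [if_pos (Finset.mem_range.2 (Nat.pos_of_ne_zero hm))]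
  have hFe : (fun t => sin (m * t) * ell t) = fun t => (2 * sin (t / 2)
      * log (2 * sin (t / 2))) * ∑ j ∈ Finset.range m, cos ((j + 1 / 2) * t) := by
    ext t
    rw [sin_nat_mul_eq, ell]; ring
  have hFc : Continuous fun t => sin (m * t) * ell t := by
    rw [hFe]
    refine Continuous.mul ?_ (by fun_prop)
    exact continuous_mul_log.comp (by fun_prop : Continuous fun t : ℝ => 2 * sin (t / 2))
  have hint : IntervalIntegrable (fun t => m * (ell t * cos (m * t)) + Q t / 2) volume (-π) π :=
    (((intervalIntegrable_ell _ _).mul_continuousOn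
      (by fun_prop : Continuous fun t : ℝ => cos (m * t)).continuousOn).const_mul _).add
      ((hQc.intervalIntegrable _ _).div_const 2)
  have h := MeasureTheory.integral_eq_of_hasDerivAt_off_countable
    (fun t => sin (m * t) * ell t) (fun t => m * (ell t * cos (m * t)) + Q t / 2)
    (a := -π) (b := π) (s := {0}) (countable_singleton 0) hFc.continuousOn
    (fun t ht => by
      have hs : sin (t / 2) ≠ 0 := by
        have ht1 := ht.1
        rw [min_eq_left (by linarith), max_eq_right (by linarith)] at ht1
        have h0 : t / 2 ≠ 0 := fun h => ht.2 (by simpa using h)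
        intro hs
        rw [sin_eq_zero_iff_of_lt_of_lt (by linarith [ht1.1]) (by linarith [ht1.2])] at hs
        exact h0 hs
      have d1 : HasDerivAt (fun t : ℝ => sin (m * t)) (cos (m * t) * m) t :=
        ((hasDerivAt_id t).const_mul (m : ℝ)).sin.congr_deriv (by simp)
      have d2 : HasDerivAt ell ((2 * (cos (t / 2) * (1 / 2))) / (2 * sin (t / 2))) t :=
        ((((hasDerivAt_id t).div_const 2).sin).const_mul 2).log (mul_ne_zero two_ne_zero hs)
      refine (d1.mul d2).congr_deriv ?_
      rw [hQs, sin_nat_mul_eq]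
      field_simp)
    hint
  rw [intervalIntegral.integral_add (((intervalIntegrable_ell _ _).mul_continuousOn
      (by fun_prop : Continuous fun t : ℝ => cos (m * t)).continuousOn).const_mul _)
      ((hQc.intervalIntegrable _ _).div_const 2), intervalIntegral.integral_const_mul,
      intervalIntegral.integral_div, hQi] at h
  simp only [mul_neg, sin_neg, sin_nat_mul_pi] at h; field_simp; linarith

lemma integral_ell_cos_shift {m : ℕ} (hm : m ≠ 0) (ω : ℝ) :
    ∫ ψ in (-π)..π, ell (ψ - ω) * cos (m * ψ) = -(π / m) * cos (m * ω) := by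
  set g : ℝ → ℝ := fun ψ => ell (ψ - ω) * cos (m * ψ) with hg
  have hper : Periodic g (2 * π) := fun ψ => by
    simp only [hg]
    rw [add_sub_right_comm, ell_periodic, mul_add, cos_add_nat_mul_two_pi]
  have h1 := hper.intervalIntegral_add_eq (-π) (-π + ω)
  rw [show -π + 2 * π = π by ring, show -π + ω + 2 * π = π + ω by ring,
    ← intervalIntegral.integral_comp_add_right] at h1
  rw [h1]
  have e : ∀ t : ℝ, g (t + ω) = cos (m * ω) * (ell t * cos (m * t))
      - sin (m * ω) * (ell t * sin (m * t)) := fun t => by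
    simp only [hg]
    rw [add_sub_cancel_right, mul_add, cos_add]; ring
  simp only [e]
  have i1 : IntervalIntegrable (fun t => ell t * cos (m * t)) volume (-π) π :=
    (intervalIntegrable_ell _ _).mul_continuousOn (by fun_prop)
  have i2 : IntervalIntegrable (fun t => ell t * sin (m * t)) volume (-π) π :=
    (intervalIntegrable_ell _ _).mul_continuousOn (by fun_prop)
  have hodd : ∫ t in (-π)..π, ell t * sin (m * t) = 0 := by
    have h2 := integral_comp_neg (a := -π) (b := π) (fun t => ell t * sin (m * t))
    rw [neg_neg] at h2
    simp only [ell_neg, mul_neg, sin_neg, intervalIntegral.integral_neg] at h2; linarith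
  rw [intervalIntegral.integral_sub (i1.const_mul _) (i2.const_mul _),
    intervalIntegral.integral_const_mul, intervalIntegral.integral_const_mul, hodd,
    integral_ell_cos hm]
  ring

lemma integral_abs_ell_shift (ω : ℝ) :
    ∫ ψ in (-π)..π, |ell (ψ - ω)| = ∫ ψ in (-π)..π, |ell ψ| := by
  have hper : Periodic (fun ψ => |ell ψ|) (2 * π) := fun ψ => by
    simp only [ell_periodic ψ]
  have h1 := hper.intervalIntegral_add_eq (-π) (-π - ω)
  rw [show -π + 2 * π = π by ring, show -π - ω + 2 * π = π - ω by ring] at h1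
  rw [intervalIntegral.integral_comp_sub_right fun ψ => |ell ψ|, h1]

lemma ell_add_ell {x y : ℝ} (h : cos y ≠ cos x) :
    ell (x - y) + ell (x + y) = log 2 + log (cos y - cos x) := by
  have e : cos y - cos x = 2 * sin ((x + y) / 2) * sin ((x - y) / 2) := by
    rw [cos_sub_cos, show (y + x) / 2 = (x + y) / 2 by ring,
      show (y - x) / 2 = -((x - y) / 2) by ring, sin_neg]
    ring
  have h0 := sub_ne_zero.2 h
  rw [e] at h0
  have s1 : sin ((x + y) / 2) ≠ 0 := fun hs => h0 (by rw [hs]; ring)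
  have s2 : sin ((x - y) / 2) ≠ 0 := fun hs => h0 (by rw [hs]; ring)
  rw [ell, ell, e, ← log_mul (by positivity) (by positivity),
    ← log_mul (by positivity) (by positivity)]
  congr 1; ring

lemma norm_exp_sub_exp (x y : ℝ) :
    ‖cexp (x * I) - cexp (y * I)‖ = |2 * sin ((x - y) / 2)| := by
  have h : cexp (x * I) - cexp (y * I)
      = cexp (((x + y) / 2 : ℝ) * I) * ((2 * sin ((x - y) / 2) : ℝ) * I) := by
    have e1 : cexp (x * I) = cexp (((x + y) / 2 : ℝ) * I)
        * cexp (((x - y) / 2 : ℝ) * I) := by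
      rw [← Complex.exp_add]; congr 1; push_cast; ring
    have e2 : cexp (y * I) = cexp (((x + y) / 2 : ℝ) * I)
        * cexp (((-((x - y) / 2) : ℝ)) * I) := by
      rw [← Complex.exp_add]; congr 1; push_cast; ring
    rw [e1, e2, ← mul_sub, exp_mul_I, ← ofReal_cos,
      ← ofReal_sin, exp_mul_I, ← ofReal_cos, ← ofReal_sin,
      exp_mul_I, ← ofReal_cos, ← ofReal_sin, cos_neg, sin_neg]
    push_cast; ring
  rw [h, norm_mul, norm_exp_ofReal_mul_I, one_mul, norm_mul, norm_I, mul_one,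
    norm_real, norm_eq_abs]

lemma log_norm_exp_sub (x y : ℝ) :
    log ‖cexp (x * I) - cexp (y * I)‖ = ell (x - y) := by
  rw [norm_exp_sub_exp, log_abs, ell]

/-! ### The equilibrium measure -/

section Equilibrium

variable {V ρ : ℝ → ℝ} {θ : ℝ}

lemma density_integrableOn (hρ : IsEquilibriumDensity V ρ) (h1 : ConditionC1 ρ θ) :
    IntegrableOn ρ (Icc (-θ) θ) ∧ ∫ y in Icc (-θ) θ, ρ y = 1 := by
  have hprob := hρ.equilibrium.1.prob
  have hs : densityMeasure ρ (Icc (-θ) θ)ᶜ = 0 := by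
    rw [← h1.support_eq]
    exact Measure.measure_compl_support
  have h2 : ∫⁻ y in Icc (-θ) θ, ofReal (ρ y) = 1 := by
    have := prob_compl_eq_zero_iff (μ := densityMeasure ρ) (measurableSet_Icc (a := -θ) (b := θ))
    rw [← this.1 hs, densityMeasure, withDensity_apply _ measurableSet_Icc]
  have hi : IntegrableOn ρ (Icc (-θ) θ) := by
    refine ⟨hρ.measurable.aestronglyMeasurable, ?_⟩
    rw [hasFiniteIntegral_iff_ofReal (of_forall hρ.nonneg), h2]
    exact ENNReal.one_lt_top
  refine ⟨hi, ?_⟩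
  rw [integral_eq_lintegral_of_nonneg_ae (of_forall hρ.nonneg)
    hρ.measurable.aestronglyMeasurable, h2, ENNReal.toReal_one]

lemma ca_sub_cc (θ : ℝ) : ca θ - cc θ = cos θ := by
  rw [ca, cc, ← cos_two_mul', mul_div_cancel₀ _ two_ne_zero]

/-- The density is bounded by a multiple of `χ`. -/
lemma density_le_chi (h1 : ConditionC1 ρ θ) (h2 : ConditionC2 V ρ θ) :
    ∃ C : ℝ, ∀ y ∈ Ioo (-θ) θ, ρ y ≤ C * chi θ y := by
  have hθ := h1.pos
  have hθ' := h1.lt_pi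
  have hsin : 0 < sin θ := sin_pos_of_pos_of_lt_pi hθ hθ'
  obtain ⟨K, hK, e1, e2⟩ := h2.edges
  have hpos : ∀ y ∈ Ioo (-θ) θ, 0 < cos y - cos θ := fun y hy => by
    have : cos θ < cos |y| := cos_lt_cos_of_nonneg_of_le_pi (abs_nonneg y) hθ'.le (abs_lt.2 hy)
    rw [cos_abs] at this; linarith
  have hchi : ∀ y ∈ Ioo (-θ) θ, 0 < chi θ y := fun y hy =>
    sqrt_pos.2 (abs_pos.2 (hpos y hy).ne')
  have key : ∀ e : ℝ, cos e = cos θ → |sin e| = sin θ → ∀ l : Filter ℝ, l ≤ 𝓝[≠] e →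
      Tendsto (fun x => ρ x / √|x - e|) l (𝓝 K) →
      (∀ᶠ x in l, x ∈ Ioo (-θ) θ) →
      Tendsto (fun x => ρ x / chi θ x) l (𝓝 (K / √(sin θ))) := fun e he hse l hl ht hev => by
    have d := (hasDerivAt_iff_tendsto_slope.1 (hasDerivAt_cos e)).mono_left hl
    have d2 : Tendsto (fun x => √|slope cos e x|) l (𝓝 (√(sin θ))) := by
      have := (continuous_sqrt.tendsto _).comp d.abs
      rwa [abs_neg, hse] at this
    refine (ht.div d2 (sqrt_pos.2 hsin).ne').congr' ?_
    filter_upwards [hev, hl (self_mem_nhdsWithin)] with x hx hxe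
    have hxe' : 0 < |x - e| := abs_pos.2 (sub_ne_zero.2 hxe)
    simp only [Pi.div_apply]
    rw [slope_def_field, he, abs_div, sqrt_div' _ (abs_nonneg _), chi]
    field_simp
  have l1 : Tendsto (fun x => ρ x / chi θ x) (𝓝[<] θ) (𝓝 (K / √(sin θ))) :=
    key θ rfl (abs_of_pos hsin) _ (nhdsWithin_mono _ fun x hx => ne_of_lt hx) e1
      (Ioo_mem_nhdsLT (by linarith))
  have l2 : Tendsto (fun x => ρ x / chi θ x) (𝓝[>] (-θ)) (𝓝 (K / √(sin θ))) :=
    key (-θ) (cos_neg θ) (by rw [sin_neg, abs_neg, abs_of_pos hsin]) _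
      (nhdsWithin_mono _ fun x hx => ne_of_gt hx)
      (by simpa only [sub_neg_eq_add] using e2) (Ioo_mem_nhdsGT (by linarith))
  have hcont : ContinuousOn (fun x => ρ x / chi θ x) (Ioo (-θ) θ) := by
    refine h2.continuousOn.div ?_ fun y hy => (hchi y hy).ne'
    unfold chi
    fun_prop
  have hext := continuousOn_Icc_extendFrom_Ioo hcont l2 l1
  obtain ⟨C, hC⟩ := isCompact_Icc.exists_bound_of_continuousOn hext
  refine ⟨C, fun y hy => ?_⟩
  have h3 := hC y (Ioo_subset_Icc_self hy)
  rw [extendFrom_eq (subset_closure hy) ((hcont y hy).tendsto)] at h3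
  rw [← div_le_iff₀ (hchi y hy)]
  exact (le_abs_self _).trans h3

lemma effectivePotential_const (h1 : ConditionC1 ρ θ) (h2 : ConditionC2 V ρ θ) :
    ∃ U : ℝ, ∀ x ∈ Icc (-θ) θ, V (cos x) - 2 * ∫ y in Icc (-θ) θ, ell (x - y) * ρ y = U := by
  have hsub : Icc (-θ) θ ⊆ Icc (-π) π := Icc_subset_Icc (by linarith [h1.lt_pi]) h1.lt_pi.le
  refine ⟨effectivePotential V ρ θ 0, fun x hx => ?_⟩
  have h0 : (0 : ℝ) ∈ Icc (-θ) θ := ⟨by linarith [h1.pos], h1.pos.le⟩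
  have e : V (cos x) - 2 * ∫ y in Icc (-θ) θ, ell (x - y) * ρ y = effectivePotential V ρ θ x := by
    simp only [effectivePotential, log_norm_exp_sub]
  rw [e]
  exact le_antisymm ((h2.minimum_iff x (hsub hx)).2 hx 0 (hsub h0))
    ((h2.minimum_iff 0 (hsub h0)).2 h0 x (hsub hx))

/-- The angle `ω` with `cos y = a + c cos ω`. -/
def omega (θ y : ℝ) : ℝ := arccos ((cos y - ca θ) / cc θ)

lemma measurable_omega (θ : ℝ) : Measurable (omega θ) := by
  unfold omega
  exact (Continuous.measurable (by fun_prop))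

lemma cos_omega (h1 : ConditionC1 ρ θ) {y : ℝ} (hy : y ∈ Icc (-θ) θ) :
    ca θ + cc θ * cos (omega θ y) = cos y := by
  have hc := cc_pos h1.pos h1.lt_pi
  have h3 : cos θ ≤ cos y := by
    rw [← cos_abs y]
    exact cos_le_cos_of_nonneg_of_le_pi (abs_nonneg y) h1.lt_pi.le (abs_le.2 hy)
  have h4 := ca_sub_cc θ
  have h5 := ca_add_cc θ
  have h6 := cos_le_one y
  rw [omega, cos_arccos]
  · field_simp; ring
  · rw [le_div_iff₀ hc]; linarith
  · rw [div_le_iff₀ hc]; linarith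

/-- Integrability on the product, for exchanging the integrals over `ψ` and `y`. -/
lemma integrable_ell_prod (hρ : IsEquilibriumDensity V ρ) (h1 : ConditionC1 ρ θ) {σ : ℝ → ℝ}
    (hσ : Measurable σ) :
    Integrable (fun p : ℝ × ℝ => ell (p.2 - σ p.1) * ρ p.1)
      ((volume.restrict (Icc (-θ) θ)).prod (volume.restrict (Ioc (-π) π))) := by
  have hp : -π ≤ π := by linarith [pi_pos]
  have hm : Measurable fun p : ℝ × ℝ => ell (p.2 - σ p.1) * ρ p.1 :=
    (measurable_ell.comp (measurable_snd.sub (hσ.comp measurable_fst))).mul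
      (hρ.measurable.comp measurable_fst)
  have hsh : ∀ y, IntegrableOn (fun ψ => ell (ψ - σ y)) (Ioc (-π) π) := fun y => by
    rw [← intervalIntegrable_iff_integrableOn_Ioc_of_le hp]
    have := (intervalIntegrable_ell (-π - σ y) (π - σ y)).comp_sub_right (σ y)
    simpa using this
  rw [integrable_prod_iff hm.aestronglyMeasurable]
  refine ⟨of_forall fun y => (hsh y).mul_const (ρ y), ?_⟩
  have e : (fun y => ∫ ψ, ‖ell (ψ - σ y) * ρ y‖ ∂volume.restrict (Ioc (-π) π))
      = fun y => (∫ ψ in (-π)..π, |ell ψ|) * ρ y := by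
    ext y
    rw [← integral_abs_ell_shift (σ y), integral_of_le hp, ← integral_mul_const]
    congr 1; ext ψ
    rw [norm_mul, norm_eq_abs, norm_of_nonneg (hρ.nonneg y)]
  rw [e]
  exact (density_integrableOn hρ h1).1.const_mul _

lemma ae_cos_ne' (x : ℝ) : ∀ᵐ y : ℝ, cos y ≠ cos x := by
  have hc : Set.Countable {y : ℝ | cos y = cos x} := by
    refine Set.Countable.mono (s₂ := (range fun k : ℤ => 2 * k * π + x)
      ∪ range fun k : ℤ => 2 * k * π - x) ?_
      ((countable_range _).union (countable_range _))
    intro y hy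
    obtain ⟨k, hk | hk⟩ := cos_eq_cos_iff.1 (show cos x = cos y from hy.symm)
    · exact Or.inl ⟨k, hk.symm⟩
    · exact Or.inr ⟨k, hk.symm⟩
  exact hc.ae_notMem volume

lemma integrableOn_ell_mul (hρ : IsEquilibriumDensity V ρ) (h1 : ConditionC1 ρ θ)
    (h2 : ConditionC2 V ρ θ) (x : ℝ) : IntegrableOn (fun y => ell (x - y) * ρ y) (Icc (-θ) θ) := by
  obtain ⟨C, hC⟩ := density_le_chi h1 h2
  have hi : IntegrableOn (fun y => ell (x - y)) (Icc (-θ) θ) := by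
    rw [integrableOn_Icc_iff_integrableOn_Ioc,
      ← intervalIntegrable_iff_integrableOn_Ioc_of_le (by linarith [h1.pos])]
    have := (intervalIntegrable_ell (x - -θ) (x - θ)).comp_sub_left x
    simpa using this
  rw [integrableOn_Icc_iff_integrableOn_Ioo] at hi ⊢
  refine hi.mul_bdd (c := |C| * 2) hρ.measurable.aestronglyMeasurable ?_
  filter_upwards [ae_restrict_mem measurableSet_Ioo] with y hy
  rw [norm_of_nonneg (hρ.nonneg y)]
  refine (hC y hy).trans ?_
  have h3 : chi θ y ≤ 2 := by
    rw [chi, sqrt_le_left (by norm_num), abs_le]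
    constructor <;> nlinarith [cos_le_one y, neg_one_le_cos y, cos_le_one θ, neg_one_le_cos θ]
  have h4 : 0 ≤ chi θ y := sqrt_nonneg _
  nlinarith [le_abs_self C, abs_nonneg C]

/-- The potential on the support as a logarithmic potential in the variables `ψ`, `ω`. -/
lemma V_arg_eq (hρ : IsEquilibriumDensity V ρ) (h1 : ConditionC1 ρ θ) (h2 : ConditionC2 V ρ θ) :
    ∃ U : ℝ, ∀ ψ, V (ca θ + cc θ * cos ψ)
      = U + ∫ y in Icc (-θ) θ, (ell (ψ - omega θ y) + ell (ψ + omega θ y)) * ρ y := by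
  have hc := cc_pos h1.pos h1.lt_pi
  obtain ⟨U, hU⟩ := effectivePotential_const h1 h2
  obtain ⟨hi, hone⟩ := density_integrableOn hρ h1
  refine ⟨U + log (cc θ), fun ψ => ?_⟩
  obtain ⟨x, hx, hxψ⟩ : ∃ x ∈ Icc (-θ) θ, cos x = ca θ + cc θ * cos ψ := by
    have h3 := arg_mem θ ψ
    refine ⟨arccos (ca θ + cc θ * cos ψ), ⟨?_, ?_⟩, cos_arccos h3.1 h3.2⟩
    · linarith [arccos_nonneg (ca θ + cc θ * cos ψ), h1.pos]
    · have h4 : cos θ ≤ ca θ + cc θ * cos ψ := by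
        rw [← ca_sub_cc]
        nlinarith [neg_one_le_cos ψ]
      have h5 := arccos_le_arccos h4
      rwa [arccos_cos h1.pos.le h1.lt_pi.le] at h5
  have e1 := hU x hx
  have e2 := hU (-x) ⟨by linarith [hx.2], by linarith [hx.1]⟩
  rw [cos_neg] at e2
  have i1 := integrableOn_ell_mul hρ h1 h2 x
  have i2 : IntegrableOn (fun y => ell (x + y) * ρ y) (Icc (-θ) θ) := by
    refine (integrableOn_ell_mul hρ h1 h2 (-x)).congr_fun (fun y _ => ?_) measurableSet_Icc
    beta_reduce
    rw [← ell_neg]; congr 2; ring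
  have e3 : ∫ y in Icc (-θ) θ, ell (-x - y) * ρ y = ∫ y in Icc (-θ) θ, ell (x + y) * ρ y := by
    refine integral_congr_ae (of_forall fun y => ?_)
    beta_reduce
    rw [← ell_neg]; congr 2; ring
  rw [e3] at e2
  have e4 : (∫ y in Icc (-θ) θ, ell (x - y) * ρ y) + ∫ y in Icc (-θ) θ, ell (x + y) * ρ y
      = log (cc θ) + ∫ y in Icc (-θ) θ, (ell (ψ - omega θ y) + ell (ψ + omega θ y)) * ρ y := by
    have e5 : ∀ᵐ y ∂volume.restrict (Icc (-θ) θ), (ell (ψ - omega θ y) + ell (ψ + omega θ y)) * ρ y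
        = (ell (x - y) * ρ y + ell (x + y) * ρ y) - log (cc θ) * ρ y := by
      filter_upwards [ae_restrict_mem measurableSet_Icc, ae_restrict_of_ae (ae_cos_ne' x)]
        with y hy hne
      have h3 := cos_omega h1 hy
      have h4 : cos y - cos x = cc θ * (cos (omega θ y) - cos ψ) := by
        rw [hxψ, ← h3]; ring
      have h5 : cos (omega θ y) - cos ψ ≠ 0 := fun h0 => by
        rw [h0, mul_zero] at h4
        exact hne (sub_eq_zero.1 h4)
      rw [ell_add_ell (sub_ne_zero.1 h5), ← add_mul, ell_add_ell hne, h4, log_mul hc.ne' h5]; ring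
    have h6 : ∫ y in Icc (-θ) θ, ((ell (x - y) * ρ y + ell (x + y) * ρ y) - log (cc θ) * ρ y)
        = (∫ y in Icc (-θ) θ, ell (x - y) * ρ y) + (∫ y in Icc (-θ) θ, ell (x + y) * ρ y)
          - log (cc θ) * 1 := by
      have i12 : Integrable (fun y => ell (x - y) * ρ y + ell (x + y) * ρ y)
        (volume.restrict (Icc (-θ) θ)) := i1.add i2
      rw [integral_sub i12 (hi.const_mul _), integral_add i1 i2, integral_const_mul, hone]
    rw [integral_congr_ae e5, h6]; ring
  rw [← hxψ]; linarith

/-- The cosine coefficients of the potential are moments of the equilibrium density. -/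
lemma integral_V_cos (hρ : IsEquilibriumDensity V ρ) (h1 : ConditionC1 ρ θ)
    (h2 : ConditionC2 V ρ θ) {m : ℕ} (hm : m ≠ 0) :
    ∫ ψ in (-π)..π, V (ca θ + cc θ * cos ψ) * cos (m * ψ)
      = -(2 * π / m) * ∫ y in Icc (-θ) θ, cos (m * omega θ y) * ρ y := by
  have hp : -π ≤ π := by linarith [pi_pos]
  obtain ⟨U, hU⟩ := V_arg_eq hρ h1 h2
  have i1 := integrable_ell_prod hρ h1 (measurable_omega θ)
  have i2 := integrable_ell_prod hρ h1 (measurable_omega θ).neg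
  have i3 : Integrable (fun p : ℝ × ℝ =>
      (ell (p.2 - omega θ p.1) + ell (p.2 + omega θ p.1)) * ρ p.1 * cos (m * p.2))
      ((volume.restrict (Icc (-θ) θ)).prod (volume.restrict (Ioc (-π) π))) := by
    refine Integrable.mul_bdd ?_ (Continuous.aestronglyMeasurable (by fun_prop))
      (of_forall fun p => abs_cos_le_one _)
    refine (i1.add i2).congr (of_forall fun p => ?_)
    simp only [Pi.add_apply, Pi.neg_apply, sub_neg_eq_add]; ring
  have i5 : Integrable (Function.uncurry fun ψ y =>
      (ell (ψ - omega θ y) + ell (ψ + omega θ y)) * ρ y * cos (m * ψ))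
      ((volume.restrict (Ioc (-π) π)).prod (volume.restrict (Icc (-θ) θ))) := i3.swap
  have i4 : Integrable (fun ψ => ∫ y in Icc (-θ) θ,
      (ell (ψ - omega θ y) + ell (ψ + omega θ y)) * ρ y * cos (m * ψ))
      (volume.restrict (Ioc (-π) π)) := i5.integral_prod_left
  have e1 : ∀ ψ, V (ca θ + cc θ * cos ψ) * cos (m * ψ) = U * cos (m * ψ)
      + ∫ y in Icc (-θ) θ, (ell (ψ - omega θ y) + ell (ψ + omega θ y)) * ρ y * cos (m * ψ) := fun ψ => by
    rw [hU, integral_mul_const]; ring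
  simp only [e1]
  rw [intervalIntegral.integral_add (intervalIntegrable (by fun_prop) _ _)
    ((intervalIntegrable_iff_integrableOn_Ioc_of_le hp).2 i4),
    intervalIntegral.integral_const_mul, integral_cos_int, if_neg hm, mul_zero, zero_add,
    integral_of_le hp, integral_integral_swap i5, ← integral_const_mul]
  refine integral_congr_ae (of_forall fun y => ?_)
  beta_reduce
  rw [← integral_of_le hp]
  have e2 : ∀ ψ, (ell (ψ - omega θ y) + ell (ψ + omega θ y)) * ρ y * cos (m * ψ)
      = ρ y * (ell (ψ - omega θ y) * cos (m * ψ) + ell (ψ - -omega θ y) * cos (m * ψ)) := by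
    intro ψ; rw [sub_neg_eq_add]; ring
  have hsh : ∀ w, IntervalIntegrable (fun ψ => ell (ψ - w) * cos (m * ψ)) volume (-π) π := fun w => by
    refine IntervalIntegrable.mul_continuousOn ?_
      (by fun_prop : Continuous fun ψ : ℝ => cos (m * ψ)).continuousOn
    have := (intervalIntegrable_ell (-π - w) (π - w)).comp_sub_right w
    simpa using this
  simp only [e2]
  rw [intervalIntegral.integral_const_mul, intervalIntegral.integral_add (hsh _) (hsh _),
    integral_ell_cos_shift hm, integral_ell_cos_shift hm, mul_neg, cos_neg]
  ring

lemma hasDerivAt_V_arg (hd : DifferentiableOn ℝ V 𝕁) (θ ψ : ℝ) :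
    HasDerivAt (fun ψ => V (ca θ + cc θ * cos ψ))
      (-(dV V (ca θ + cc θ * cos ψ) * (cc θ * sin ψ))) ψ := by
  have h := (hd _ (arg_mem θ ψ)).hasDerivWithinAt
  have h2 : HasDerivAt (fun ψ => ca θ + cc θ * cos ψ) (-(cc θ * sin ψ)) ψ :=
    (((hasDerivAt_cos ψ).const_mul (cc θ)).const_add (ca θ)).congr_deriv (by ring)
  have h3 := h.comp_hasDerivAt ψ h2 (of_forall fun ψ => arg_mem θ ψ)
  refine h3.congr_deriv ?_
  rw [dV]; ring

lemma integral_dV_sin (hρ : IsEquilibriumDensity V ρ) (h1 : ConditionC1 ρ θ)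
    (h2 : ConditionC2 V ρ θ) (h3 : ConditionC3 V) {m : ℕ} (hm : m ≠ 0) :
    ∫ ψ in (-π)..π, -(cc θ * sin ψ * dV V (ca θ + cc θ * cos ψ)) * sin (m * ψ)
      = 2 * π * ∫ y in Icc (-θ) θ, cos (m * omega θ y) * ρ y := by
  have hd := h3.contDiffOn.differentiableOn (by norm_num)
  have hc := continuous_dV_arg h3 θ
  have hp := intervalIntegral.integral_mul_deriv_eq_deriv_mul (a := -π) (b := π)
    (u := fun ψ => V (ca θ + cc θ * cos ψ))
    (u' := fun ψ => -(dV V (ca θ + cc θ * cos ψ) * (cc θ * sin ψ)))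
    (v := fun ψ => sin (m * ψ)) (v' := fun ψ => cos (m * ψ) * m)
    (fun ψ _ => hasDerivAt_V_arg hd θ ψ)
    (fun ψ _ => ((hasDerivAt_id ψ).const_mul (m : ℝ)).sin.congr_deriv (by simp))
    (intervalIntegrable (by fun_prop) _ _)
    (intervalIntegrable (by fun_prop) _ _)
  simp only [mul_neg, sin_neg, sin_nat_mul_pi, neg_zero, mul_zero, sub_zero, zero_sub] at hp
  have e : ∀ ψ : ℝ, V (ca θ + cc θ * cos ψ) * (cos (m * ψ) * m)
      = m * (V (ca θ + cc θ * cos ψ) * cos (m * ψ)) := fun ψ => by ring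
  simp only [e] at hp
  rw [intervalIntegral.integral_const_mul, integral_V_cos hρ h1 h2 hm,
    ← intervalIntegral.integral_neg] at hp
  have e2 : ∀ ψ : ℝ, -(cc θ * sin ψ * dV V (ca θ + cc θ * cos ψ)) * sin (m * ψ)
      = -(-(-(dV V (ca θ + cc θ * cos ψ) * (cc θ * sin ψ)) * sin (m * ψ))) :=
    fun ψ => by ring
  simp only [e2]
  rw [intervalIntegral.integral_neg, ← hp]; field_simp

/-! ### Abel summation -/

lemma one_add_two_mul_pos {r : ℝ} (hr : r ∈ Ico (1 / 2 : ℝ) 1) (t : ℝ) :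
    0 < 1 + 2 * r * cos t + r ^ 2 := by
  nlinarith [neg_one_le_cos t, hr.1, hr.2, sq_nonneg (1 - r), mul_pos (by linarith [hr.2] : 0 < 1 - r) (by linarith [hr.2] : 0 < 1 - r)]

/-- The conjugate Poisson kernel and the Poisson kernel at radius `-r`. -/
lemma hasSum_conj_poisson {r : ℝ} (hr : r ∈ Ico (1 / 2 : ℝ) 1) (t : ℝ) :
    HasSum (fun m : ℕ => 2 * r * (-r) ^ m * sin ((m + 1 : ℕ) * t))
      (2 * r * sin t / (1 + 2 * r * cos t + r ^ 2)) ∧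
    HasSum (fun m : ℕ => 2 * r * (-r) ^ m * cos ((m + 1 : ℕ) * t))
      (1 - (1 - r ^ 2) / (1 + 2 * r * cos t + r ^ 2)) := by
  have hpos := one_add_two_mul_pos hr t
  have hn : ‖(-r : ℂ) * ez 1 t‖ < 1 := by
    rw [norm_mul, norm_ez, norm_neg, norm_real, mul_one,
      norm_of_nonneg (by linarith [hr.1])]
    exact hr.2
  have h := (hasSum_geometric_of_norm_lt_one hn).mul_left (2 * r * ez 1 t)
  have e : ∀ m : ℕ, 2 * r * ez 1 t * ((-r : ℂ) * ez 1 t) ^ m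
      = ((2 * r * (-r) ^ m : ℝ) : ℂ) * cexp (((m + 1 : ℕ) * t : ℝ) * I) := fun m => by
    have : cexp (((m + 1 : ℕ) * t : ℝ) * I) = ez 1 t * ez 1 t ^ m := by
      rw [← pow_succ', ez, ← Complex.exp_nat_mul]; congr 1; push_cast; ring
    rw [this]; push_cast; ring
  have hne : (1 : ℂ) + r * ez 1 t ≠ 0 := fun h0 => by
    have h4 : (-r : ℂ) * ez 1 t = 1 := by linear_combination -h0
    rw [h4, norm_one] at hn
    exact lt_irrefl _ hn
  have hv : 2 * r * ez 1 t * (1 - (-r : ℂ) * ez 1 t)⁻¹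
      = ((1 - (1 - r ^ 2) / (1 + 2 * r * cos t + r ^ 2) : ℝ) : ℂ)
        + ((2 * r * sin t / (1 + 2 * r * cos t + r ^ 2) : ℝ) : ℂ) * I := by
    have h5 : (1 : ℂ) - (-r : ℂ) * ez 1 t = 1 + r * ez 1 t := by ring
    have hpc : ((1 + 2 * r * cos t + r ^ 2 : ℝ) : ℂ) ≠ 0 := by exact_mod_cast hpos.ne'
    have h6 : ((1 + 2 * r * cos t + r ^ 2 : ℝ) : ℂ) = (1 + r * ez 1 t) * (1 + r * ez (-1) t) := by
      have h7 : ez 1 t * ez (-1) t = 1 := by rw [← ez_add]; simp [ez_zero]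
      have h8 := two_cos_eq 1 t
      simp only [Int.cast_one, one_mul] at h8
      push_cast at h8 ⊢
      linear_combination (r : ℂ) * h8 - (r : ℂ) ^ 2 * h7
    rw [h5, ← div_eq_mul_inv, div_eq_iff hne]
    rw [ofReal_sub, ofReal_div, ofReal_div]
    have h9 : (1 : ℂ) + r * ez (-1) t ≠ 0 := by
      intro h0; rw [h6, h0, mul_zero] at hpc; exact hpc rfl
    rw [h6]; field_simp
    rw [ez_one, ez_neg_one]
    have h10 : ((sin t : ℝ) : ℂ) ^ 2 + ((cos t : ℝ) : ℂ) ^ 2 = 1 := by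
      exact_mod_cast sin_sq_add_cos_sq t
    push_cast at h10 ⊢; ring_nf
    rw [I_sq]
    linear_combination (r : ℂ) ^ 2 * h10
  simp only [e] at h
  rw [hv] at h
  constructor
  · have h2 := Complex.hasSum_im h
    simpa only [Complex.im_ofReal_mul, Complex.exp_ofReal_mul_I_im, Complex.add_im,
      ofReal_im, Complex.I_im, mul_one, zero_add] using h2
  · have h2 := hasSum_re h
    simpa only [re_ofReal_mul, exp_ofReal_mul_I_re, Complex.add_re,
      ofReal_re, Complex.I_re, mul_zero, add_zero] using h2

/-- `integral_dV_sin`, summed against `2r(-r)^m`. -/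
lemma abel_identity (hρ : IsEquilibriumDensity V ρ) (h1 : ConditionC1 ρ θ)
    (h2 : ConditionC2 V ρ θ) (h3 : ConditionC3 V) {r : ℝ} (hr : r ∈ Ico (1 / 2 : ℝ) 1) :
    ∫ ψ in (-π)..π, -(cc θ * sin ψ * dV V (ca θ + cc θ * cos ψ))
        * (2 * r * sin ψ / (1 + 2 * r * cos ψ + r ^ 2))
      = 2 * π * ∫ y in Icc (-θ) θ,
          (1 - (1 - r ^ 2) / (1 + 2 * r * cos (omega θ y) + r ^ 2)) * ρ y := by
  have hc := continuous_dV_arg h3 θ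
  obtain ⟨hi, -⟩ := density_integrableOn hρ h1
  have hr0 : 0 ≤ r := by linarith [hr.1]
  have hgs : Summable fun m : ℕ => 2 * r * r ^ m :=
    (summable_geometric_of_lt_one hr0 hr.2).mul_left _
  have hL : HasSum (fun m : ℕ => ∫ ψ in (-π)..π, -(cc θ * sin ψ * dV V (ca θ + cc θ * cos ψ))
        * (2 * r * (-r) ^ m * sin ((m + 1 : ℕ) * ψ)))
      (∫ ψ in (-π)..π, -(cc θ * sin ψ * dV V (ca θ + cc θ * cos ψ))
        * (2 * r * sin ψ / (1 + 2 * r * cos ψ + r ^ 2))) := by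
    refine hasSum_integral_of_dominated_convergence
      (fun m ψ => |cc θ * sin ψ * dV V (ca θ + cc θ * cos ψ)| * (2 * r * r ^ m))
      (fun m => ?_) (fun m => ?_) ?_ ?_ ?_
    · exact Continuous.aestronglyMeasurable (by fun_prop)
    · refine of_forall fun ψ _ => ?_
      rw [norm_mul, norm_neg, norm_eq_abs]
      refine mul_le_mul_of_nonneg_left ?_ (abs_nonneg _)
      rw [norm_eq_abs, abs_mul, abs_mul, abs_pow, abs_neg, abs_of_nonneg hr0, abs_of_nonneg
        (by positivity : 0 ≤ 2 * r)]
      exact mul_le_of_le_one_right (by positivity) (abs_sin_le_one _)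
    · exact of_forall fun ψ _ => hgs.mul_left _
    · simp only [tsum_mul_left]
      exact intervalIntegrable (by fun_prop) _ _
    · exact of_forall fun ψ _ => (hasSum_conj_poisson hr ψ).1.mul_left _
  have hR : HasSum (fun m : ℕ => ∫ y in Icc (-θ) θ,
      2 * r * (-r) ^ m * cos ((m + 1 : ℕ) * omega θ y) * ρ y)
      (∫ y in Icc (-θ) θ, (1 - (1 - r ^ 2) / (1 + 2 * r * cos (omega θ y) + r ^ 2)) * ρ y) := by
    refine hasSum_integral_of_dominated_convergence
      (fun m y => 2 * r * r ^ m * ρ y) (fun m => ?_) (fun m => ?_) ?_ ?_ ?_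
    · have h4 := measurable_omega θ
      have h5 := hρ.measurable
      exact Measurable.aestronglyMeasurable (by fun_prop)
    · refine of_forall fun y => ?_
      rw [norm_mul, norm_of_nonneg (hρ.nonneg y)]
      refine mul_le_mul_of_nonneg_right ?_ (hρ.nonneg y)
      rw [norm_eq_abs, abs_mul, abs_mul, abs_pow, abs_neg, abs_of_nonneg hr0, abs_of_nonneg
        (by positivity : 0 ≤ 2 * r)]
      exact mul_le_of_le_one_right (by positivity) (abs_cos_le_one _)
    · exact of_forall fun y => hgs.mul_right _
    · simp only [tsum_mul_right]
      exact hi.const_mul _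
    · exact of_forall fun y => (hasSum_conj_poisson hr _).2.mul_right _
  refine hL.unique ?_
  convert! hR.mul_left (2 * π) using 2 with m
  have e1 := integral_dV_sin hρ h1 h2 h3 (Nat.succ_ne_zero m)
  have e2 : ∀ ψ : ℝ, -(cc θ * sin ψ * dV V (ca θ + cc θ * cos ψ))
        * (2 * r * (-r) ^ m * sin ((m + 1 : ℕ) * ψ))
      = 2 * r * (-r) ^ m * (-(cc θ * sin ψ * dV V (ca θ + cc θ * cos ψ))
        * sin ((m + 1 : ℕ) * ψ)) := fun ψ => by ring
  have e3 : ∀ y : ℝ, 2 * r * (-r) ^ m * cos ((m + 1 : ℕ) * omega θ y) * ρ y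
      = 2 * r * (-r) ^ m * (cos ((m + 1 : ℕ) * omega θ y) * ρ y) := fun y => by ring
  simp only [e2, e3]
  rw [intervalIntegral.integral_const_mul, integral_const_mul, e1]; ring

/-- The Poisson integral of `ρ` at the edge vanishes in the limit: there `ρ ≤ C χ` compensates the
singularity of the kernel. -/
lemma tendsto_density_poisson (hρ : IsEquilibriumDensity V ρ) (h1 : ConditionC1 ρ θ)
    (h2 : ConditionC2 V ρ θ) :
    Tendsto (fun r : ℝ => ∫ y in Icc (-θ) θ,
      (1 - (1 - r ^ 2) / (1 + 2 * r * cos (omega θ y) + r ^ 2)) * ρ y) (𝓝[<] 1) (𝓝 1) := by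
  obtain ⟨hi, hone⟩ := density_integrableOn hρ h1
  obtain ⟨C, hC⟩ := density_le_chi h1 h2
  have hc := cc_pos h1.pos h1.lt_pi
  have hrr : ∀ᶠ r : ℝ in 𝓝[<] 1, r ∈ Ico (1 / 2 : ℝ) 1 := Ico_mem_nhdsLT (by norm_num)
  have hg : ∀ y ∈ Ioo (-θ) θ, 0 < 1 + cos (omega θ y)
      ∧ chi θ y = √(cc θ) * √(1 + cos (omega θ y)) := fun y hy => by
    have h4 := cos_omega h1 (Ioo_subset_Icc_self hy)
    have h5 := ca_sub_cc θ
    have h6 : cos y - cos θ = cc θ * (1 + cos (omega θ y)) := by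
      rw [← h4, ← h5]; ring
    have h7 : cos θ < cos |y| :=
      cos_lt_cos_of_nonneg_of_le_pi (abs_nonneg y) h1.lt_pi.le (abs_lt.2 hy)
    rw [cos_abs] at h7
    have h8 : 0 < 1 + cos (omega θ y) := by
      by_contra hn
      nlinarith
    refine ⟨h8, ?_⟩
    rw [chi, h6, abs_of_pos (by positivity), sqrt_mul hc.le]
  rw [show 𝓝 (1 : ℝ) = 𝓝 (∫ y in Icc (-θ) θ, ρ y) by rw [hone]]
  refine tendsto_integral_filter_of_dominated_convergence (fun y => ρ y + |C| * √(cc θ)) ?_ ?_ ?_ ?_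
  · refine of_forall fun r => ?_
    have h4 := measurable_omega θ
    have h5 := hρ.measurable
    exact Measurable.aestronglyMeasurable (by fun_prop)
  · filter_upwards [hrr] with r hr
    rw [restrict_Ioo_eq_restrict_Icc.symm]
    filter_upwards [ae_restrict_mem measurableSet_Ioo] with y hy
    obtain ⟨h4, h5⟩ := hg y hy
    have hpos := one_add_two_mul_pos hr (omega θ y)
    have hr2 := hr.2
    have hr1 := hr.1
    set w := 1 + cos (omega θ y) with hw
    have hsq := sq_sqrt h4.le
    have hden : 1 + 2 * r * cos (omega θ y) + r ^ 2 = (1 - r) ^ 2 + 2 * r * w := by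
      rw [hw]; ring
    have hP0 : 0 ≤ (1 - r ^ 2) / (1 + 2 * r * cos (omega θ y) + r ^ 2) :=
      div_nonneg (by nlinarith) hpos.le
    have hP : (1 - r ^ 2) / (1 + 2 * r * cos (omega θ y) + r ^ 2) * √w ≤ 1 := by
      rw [hden, div_mul_eq_mul_div, div_le_one (by rw [← hden]; exact hpos)]
      have h6 : 2 * (1 - r) * √w ≤ (1 - r) ^ 2 + w := by
        nlinarith [sq_nonneg (1 - r - √w)]
      nlinarith
    have hbd : (1 - r ^ 2) / (1 + 2 * r * cos (omega θ y) + r ^ 2) * ρ y ≤ |C| * √(cc θ) := by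
      have h7 : ρ y ≤ |C| * (√(cc θ) * √w) := by
        rw [← h5]
        exact (hC y hy).trans (mul_le_mul_of_nonneg_right (le_abs_self C) (sqrt_nonneg _))
      calc _ ≤ (1 - r ^ 2) / (1 + 2 * r * cos (omega θ y) + r ^ 2)
            * (|C| * (√(cc θ) * √w)) := mul_le_mul_of_nonneg_left h7 hP0
        _ = |C| * √(cc θ) * ((1 - r ^ 2) / (1 + 2 * r * cos (omega θ y) + r ^ 2) * √w) := by ring
        _ ≤ _ := mul_le_of_le_one_right (by positivity) hP
    have h8 := hρ.nonneg y
    have h9 := mul_nonneg hP0 h8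
    rw [norm_eq_abs, sub_mul, one_mul, abs_le]
    constructor
    · linarith
    · have : 0 ≤ |C| * √(cc θ) := by positivity
      linarith
  · exact hi.add (integrableOn_const (by simp))
  · rw [restrict_Ioo_eq_restrict_Icc.symm]
    filter_upwards [ae_restrict_mem measurableSet_Ioo] with y hy
    obtain ⟨h4, -⟩ := hg y hy
    have hcont : ContinuousAt (fun r : ℝ =>
        (1 - (1 - r ^ 2) / (1 + 2 * r * cos (omega θ y) + r ^ 2)) * ρ y) 1 := by
      refine ContinuousAt.mul (ContinuousAt.sub continuousAt_const (ContinuousAt.div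
        (by fun_prop) (by fun_prop) ?_)) continuousAt_const
      nlinarith
    have := hcont.tendsto.mono_left (nhdsWithin_le_nhds (s := Iio 1))
    simpa using this

/-- The normalization of the equilibrium measure: `v_1 = v_0 + 1/c`. -/
lemma vc_one_eq (hρ : IsEquilibriumDensity V ρ) (h1 : ConditionC1 ρ θ)
    (h2 : ConditionC2 V ρ θ) (h3 : ConditionC3 V) : vc V θ 1 = vc V θ 0 + 1 / cc θ := by
  have hc := cc_pos h1.pos h1.lt_pi
  have hW := continuous_dV_arg h3 θ
  have hrr : ∀ᶠ r : ℝ in 𝓝[<] 1, r ∈ Ico (1 / 2 : ℝ) 1 := Ico_mem_nhdsLT (by norm_num)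
  have hR := (tendsto_density_poisson hρ h1 h2).const_mul (2 * π)
  have hL : Tendsto (fun r : ℝ => ∫ ψ in (-π)..π, -(cc θ * sin ψ * dV V (ca θ + cc θ * cos ψ))
        * (2 * r * sin ψ / (1 + 2 * r * cos ψ + r ^ 2))) (𝓝[<] 1)
      (𝓝 (∫ ψ in (-π)..π, -(cc θ * dV V (ca θ + cc θ * cos ψ) * (1 - cos ψ)))) := by
    refine intervalIntegral.tendsto_integral_filter_of_dominated_convergence
      (fun ψ => |cc θ * dV V (ca θ + cc θ * cos ψ)| * 2) ?_ ?_ ?_ ?_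
    · exact of_forall fun r => Measurable.aestronglyMeasurable
        (by have := hW.measurable; fun_prop)
    · filter_upwards [hrr] with r hr
      refine of_forall fun ψ _ => ?_
      have hpos := one_add_two_mul_pos hr ψ
      have e : -(cc θ * sin ψ * dV V (ca θ + cc θ * cos ψ))
        * (2 * r * sin ψ / (1 + 2 * r * cos ψ + r ^ 2))
        = -(cc θ * dV V (ca θ + cc θ * cos ψ))
          * (2 * r * sin ψ ^ 2 / (1 + 2 * r * cos ψ + r ^ 2)) := by ring
      have h0 : 0 ≤ 2 * r * sin ψ ^ 2 / (1 + 2 * r * cos ψ + r ^ 2) := by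
        have := hr.1
        positivity
      rw [e, norm_mul, norm_neg, norm_eq_abs, norm_of_nonneg h0]
      refine mul_le_mul_of_nonneg_left ?_ (abs_nonneg _)
      rw [div_le_iff₀ hpos]
      have h4 := sin_sq_add_cos_sq ψ
      have h5 := neg_one_le_cos ψ
      have h6 := cos_le_one ψ
      have h7 := hr.1
      have h8 : sin ψ ^ 2 = (1 - cos ψ) * (1 + cos ψ) := by linarith
      rw [h8]
      nlinarith [sq_nonneg (1 - r)]
    · exact intervalIntegrable (by fun_prop) _ _
    · filter_upwards [ae_cos_ne' π] with ψ hψ _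
      rw [cos_pi] at hψ
      have h4 : 0 < 1 + cos ψ := by
        have := neg_one_le_cos ψ
        rcases lt_or_eq_of_le this with h | h
        · linarith
        · exact absurd h.symm hψ
      have hcont : ContinuousAt (fun r : ℝ =>
          -(cc θ * sin ψ * dV V (ca θ + cc θ * cos ψ))
            * (2 * r * sin ψ / (1 + 2 * r * cos ψ + r ^ 2))) 1 := by
        refine ContinuousAt.mul continuousAt_const (ContinuousAt.div (by fun_prop) (by fun_prop) ?_)
        nlinarith
      have h5 := hcont.tendsto.mono_left (nhdsWithin_le_nhds (s := Iio 1))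
      have h6 : -(cc θ * sin ψ * dV V (ca θ + cc θ * cos ψ))
            * (2 * 1 * sin ψ / (1 + 2 * 1 * cos ψ + 1 ^ 2))
          = -(cc θ * dV V (ca θ + cc θ * cos ψ) * (1 - cos ψ)) := by
        have h7 : 1 + 2 * 1 * cos ψ + 1 ^ 2 = 2 * (1 + cos ψ) := by ring
        have h8 : sin ψ ^ 2 = (1 - cos ψ) * (1 + cos ψ) := by
          linarith [sin_sq_add_cos_sq ψ]
        rw [h7]; field_simp
        rw [h8]; ring
      rw [h6] at h5
      exact h5
  have heq := tendsto_nhds_unique hL (hR.congr' (by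
    filter_upwards [hrr] with r hr
    exact (abel_identity hρ h1 h2 h3 hr).symm))
  have i0 : IntervalIntegrable (fun ψ => dV V (ca θ + cc θ * cos ψ)) volume
    (-π) π := hW.intervalIntegrable _ _
  have i1 : IntervalIntegrable (fun ψ => dV V (ca θ + cc θ * cos ψ) * cos ψ) volume
    (-π) π := intervalIntegrable (by fun_prop) _ _
  have e : ∀ ψ : ℝ, -(cc θ * dV V (ca θ + cc θ * cos ψ) * (1 - cos ψ))
      = cc θ * (dV V (ca θ + cc θ * cos ψ) * cos ψ - dV V (ca θ + cc θ * cos ψ)) := fun ψ => by ring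
  simp only [e] at heq
  rw [intervalIntegral.integral_const_mul, intervalIntegral.integral_sub i1 i0] at heq
  simp only [vc, Nat.cast_one, one_mul, Nat.cast_zero, zero_mul, cos_zero, mul_one]
  generalize (∫ ψ in (-π)..π, dV V (ca θ + cc θ * cos ψ) * cos ψ) = I1 at *
  generalize (∫ ψ in (-π)..π, dV V (ca θ + cc θ * cos ψ)) = I0 at *
  field_simp; linarith

end Equilibrium

/-! ### The symbol -/

/-- The cosine coefficients of `V'(x)(1 - x)/2` at `x = a + c cos ψ`. -/
def wc (V : ℝ → ℝ) (θ : ℝ) (m : ℕ) : ℝ :=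
  cc θ / 2 * (vc V θ m - (vc V θ (m + 1) + vc V θ ((m : ℤ) - 1).natAbs) / 2)

/-- The function `V'(x)(1 - x)/2` at `x = a + c cos ψ`. -/
def wfun (V : ℝ → ℝ) (θ x : ℝ) : ℝ := dV V (ca θ + cc θ * cos x) * (1 - (ca θ + cc θ * cos x)) / 2

lemma wc_eq_integral {V : ℝ → ℝ} (h3 : ConditionC3 V) (θ : ℝ) (m : ℕ) :
    1 / (2 * π) * ∫ x in (-π)..π, wfun V θ x * cos (m * x) = wc V θ m := by
  have hW := continuous_dV_arg h3 θ
  have hv : ∀ j : ℕ, ∫ x in (-π)..π, dV V (ca θ + cc θ * cos x) * cos (j * x)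
      = 2 * π * vc V θ j := fun j => by
    rw [vc]; have := pi_ne_zero; field_simp
  have e : ∀ x : ℝ, wfun V θ x * cos (m * x) = cc θ / 2 * (dV V (ca θ + cc θ * cos x) * cos (m * x)
        - (dV V (ca θ + cc θ * cos x) * cos ((m + 1 : ℕ) * x)
          + dV V (ca θ + cc θ * cos x) * cos (((m : ℤ) - 1).natAbs * x)) / 2) := fun x => by
    have h1 : cos (((m : ℤ) - 1).natAbs * x) = cos (m * x - x) := by
      rcases Nat.eq_zero_or_pos m with rfl | hm
      · simp
      · rw [show ((m : ℤ) - 1).natAbs = m - 1 by omega, Nat.cast_sub hm]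
        congr 1; push_cast; ring
    have h2 : cos ((m + 1 : ℕ) * x) = cos (m * x + x) := by
      congr 1; push_cast; ring
    have h5 := ca_add_cc θ
    rw [h1, h2, cos_add, cos_sub, wfun, show 1 - (ca θ + cc θ * cos x)
      = cc θ - cc θ * cos x by rw [← h5]; ring]
    ring
  simp only [e]
  rw [intervalIntegral.integral_const_mul, intervalIntegral.integral_sub
    (intervalIntegrable (by fun_prop) _ _)
    (intervalIntegrable (by fun_prop) _ _), intervalIntegral.integral_div,
    intervalIntegral.integral_add (intervalIntegrable (by fun_prop) _ _)
    (intervalIntegrable (by fun_prop) _ _), hv, hv, hv, wc]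
  field_simp

lemma summable_sq_wc {V : ℝ → ℝ} (h3 : ConditionC3 V) (θ : ℝ) :
    Summable fun m : ℕ => (m : ℝ) ^ 2 * |wc V θ m| := by
  obtain ⟨B, -, hs, -⟩ := exists_Ev_bound h3 θ
  rw [← summable_nat_add_iff 2]
  have s1 := (summable_nat_add_iff 2).2 hs
  have s2 := (summable_nat_add_iff 3).2 hs
  have s3 := (summable_nat_add_iff 1).2 hs
  refine Summable.of_nonneg_of_le (fun m => by positivity) (fun m => ?_)
    ((s1.add (s2.add (s3.mul_left 4))).mul_left (cc θ))
  have hc := cc_nonneg θ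
  have e1 : (((m + 2 : ℕ) : ℤ) - 1).natAbs = m + 1 := by omega
  rw [wc, e1, abs_mul, abs_of_nonneg (by positivity : 0 ≤ cc θ / 2)]
  have t1 : |vc V θ (m + 2) - (vc V θ (m + 2 + 1) + vc V θ (m + 1)) / 2|
      ≤ |vc V θ (m + 2)| + (|vc V θ (m + 3)| + |vc V θ (m + 1)|) / 2 := by
    refine (abs_sub _ _).trans ?_
    rw [abs_div, abs_two]
    have := abs_add_le (vc V θ (m + 2 + 1)) (vc V θ (m + 1))
    have e2 : m + 2 + 1 = m + 3 := rfl
    rw [e2] at this ⊢; linarith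
  have p1 : ((m + 2 : ℕ) : ℝ) ^ 2 ≤ ((m + 3 : ℕ) : ℝ) ^ 2 := by
    gcongr; omega
  have p2 : ((m + 2 : ℕ) : ℝ) ^ 2 ≤ 4 * ((m + 1 : ℕ) : ℝ) ^ 2 := by
    have : ((m + 2 : ℕ) : ℝ) ≤ 2 * ((m + 1 : ℕ) : ℝ) := by push_cast; linarith [Nat.cast_nonneg (α := ℝ) m]
    calc ((m + 2 : ℕ) : ℝ) ^ 2 ≤ (2 * ((m + 1 : ℕ) : ℝ)) ^ 2 := by gcongr
      _ = _ := by ring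
  have p0 : 0 ≤ ((m + 2 : ℕ) : ℝ) ^ 2 := by positivity
  have q1 : ((m + 2 : ℕ) : ℝ) ^ 2 * |vc V θ (m + 3)| ≤ ((m + 3 : ℕ) : ℝ) ^ 2 * |vc V θ (m + 3)| :=
    mul_le_mul_of_nonneg_right p1 (abs_nonneg _)
  have q2 : ((m + 2 : ℕ) : ℝ) ^ 2 * |vc V θ (m + 1)|
      ≤ 4 * ((m + 1 : ℕ) : ℝ) ^ 2 * |vc V θ (m + 1)| :=
    mul_le_mul_of_nonneg_right p2 (abs_nonneg _)
  have q3 := mul_le_mul_of_nonneg_left t1 p0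
  have q0 : 0 ≤ ((m + 2 : ℕ) : ℝ) ^ 2 * |vc V θ (m + 2)| := by positivity
  have q4 : 0 ≤ ((m + 3 : ℕ) : ℝ) ^ 2 * |vc V θ (m + 3)| := by positivity
  have q5 : 0 ≤ 4 * ((m + 1 : ℕ) : ℝ) ^ 2 * |vc V θ (m + 1)| := by positivity
  nlinarith

lemma summable_abs_wc {V : ℝ → ℝ} (h3 : ConditionC3 V) (θ : ℝ) :
    Summable fun m : ℕ => |wc V θ m| := by
  refine (summable_nat_add_iff 1).1 (Summable.of_nonneg_of_le (fun m => abs_nonneg _) (fun m => ?_)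
      ((summable_nat_add_iff 1).2 (summable_sq_wc h3 θ)))
  have : (1 : ℝ) ≤ ((m + 1 : ℕ) : ℝ) ^ 2 :=
    one_le_pow₀ (by push_cast; linarith [Nat.cast_nonneg (α := ℝ) m])
  nlinarith [abs_nonneg (wc V θ (m + 1))]

lemma hasSum_wfun_sub {V : ℝ → ℝ} (h3 : ConditionC3 V) (θ x y : ℝ) :
    HasSum (fun m : ℕ => 2 * wc V θ m * (cos (m * x) - cos (m * y))) (wfun V θ x - wfun V θ y) := by
  have hW := continuous_dV_arg h3 θ
  have hs : Summable fun m : ℕ => wc V θ m := by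
    exact (summable_abs_wc h3 θ).of_abs
  have key : ∀ x, HasSum (fun m : ℤ => wc V θ m.natAbs * cos (m * x)) (wfun V θ x) := fun x => by
    have := hasSum_cos_series (H := wfun V θ) (by unfold wfun; fun_prop) (fun x => by simp [wfun])
      (fun x => by simp [wfun]) (by simpa only [wc_eq_integral h3] using hs) x
    simpa only [wc_eq_integral h3] using this
  have h := ((key x).sub (key y)).nat_add_neg
  simp only [natAbs_neg, natAbs_natCast, Int.cast_neg, neg_mul, cos_neg, Int.cast_natCast,
    Int.cast_zero, zero_mul, cos_zero, sub_self, add_zero] at h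
  convert! h using 2 with m
  ring

lemma integral_chebU_half (m : ℕ) (ψ : ℝ) :
    ∫ t in (-π)..π, chebU m (t / 2 + ψ / 2) * chebU m (t / 2 - ψ / 2) = 2 * π * chebU m ψ := by
  have half : ∀ (j : ℤ) (x : ℝ), ez (2 * j) (x / 2) = ez j x := by
    intro j x; rw [ez, ez]; congr 1; push_cast; ring
  have e : ∀ t : ℝ, chebU m (t / 2 + ψ / 2) * chebU m (t / 2 - ψ / 2)
      = ∑ i ∈ Finset.range m, ∑ j ∈ Finset.range m, ez (i + j - m + 1) t * ez (i - j) ψ := fun t => by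
    rw [chebU, chebU, Finset.sum_mul_sum]
    refine sum_congr rfl fun i _ => sum_congr rfl fun j _ => ?_
    rw [sub_eq_add_neg (t / 2), ez_add_arg, ez_add_arg, ez_neg_arg, ← half _ t, ← half _ ψ,
      show (2 * (i + j - m + 1) : ℤ) = (2 * i - m + 1) + (2 * j - m + 1) by ring,
      show (2 * (i - j) : ℤ) = (2 * i - m + 1) + -(2 * j - m + 1) by ring]
    generalize (2 * i - m + 1 : ℤ) = p
    generalize (2 * j - m + 1 : ℤ) = q
    rw [ez_add, ez_add]; ring
  simp only [e]
  rw [integral_double_sum (g := fun (i j : ℕ) t => ez (i + j - m + 1) t * ez (i - j) ψ)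
    _ _ fun i j => (continuous_ez _).mul continuous_const, chebU, mul_sum]
  refine sum_congr rfl fun i hi => ?_
  rw [Finset.mem_range] at hi
  rw [sum_eq_single (m - 1 - i)]
  · rw [intervalIntegral.integral_mul_const, integral_ez, if_pos (by omega)]
    congr 2; omega
  · intro j hj hne
    rw [Finset.mem_range] at hj
    rw [intervalIntegral.integral_mul_const, integral_ez, if_neg (by omega), zero_mul]
  · intro h
    exact absurd (Finset.mem_range.2 (by omega)) h

/-- Expansion of the divided difference, integrated term by term. -/
lemma hasSum_divided_difference {V : ℝ → ℝ} (h3 : ConditionC3 V) (θ ψ : ℝ) :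
    HasSum (fun m : ℕ => 4 * π * ((wc V θ m : ℂ) * chebU m ψ))
      ((∫ t in (-π)..π, (wfun V θ t - wfun V θ ψ) / (cos t - cos ψ) : ℝ) : ℂ) := by
  set g : ℕ → ℝ → ℂ := fun m t =>
    2 * wc V θ m * (chebU m (t / 2 + ψ / 2) * chebU m (t / 2 - ψ / 2)) with hg
  have gn : ∀ m t, ‖g m t‖ ≤ 2 * ((m : ℝ) ^ 2 * |wc V θ m|) := fun m t => by
    simp only [hg, norm_mul, norm_real, Complex.norm_two, norm_eq_abs]
    have := mul_le_mul (norm_chebU_le m (t / 2 + ψ / 2)) (norm_chebU_le m (t / 2 - ψ / 2))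
      (norm_nonneg _) (Nat.cast_nonneg m)
    nlinarith [abs_nonneg (wc V θ m)]
  have hsum : Summable fun m : ℕ => 2 * ((m : ℝ) ^ 2 * |wc V θ m|) := (summable_sq_wc h3 θ).mul_left 2
  have gc : ∀ m, Continuous (g m) := fun m => by
    have c1 := continuous_chebU m
    simp only [hg]
    fun_prop
  have hin : HasSum (fun m => ∫ t in (-π)..π, g m t) (∫ t in (-π)..π,
        (((wfun V θ t - wfun V θ ψ) / (cos t - cos ψ) : ℝ) : ℂ)) := by
    refine hasSum_integral_of_dominated_convergence
      (fun m _ => 2 * ((m : ℝ) ^ 2 * |wc V θ m|)) (fun m => (gc m).aestronglyMeasurable)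
      (fun m => of_forall fun t _ => gn m t) (of_forall fun t _ => hsum)
      (by simp) ?_
    filter_upwards [ae_cos_ne' ψ] with t ht _
    have hne : ((cos t - cos ψ : ℝ) : ℂ) ≠ 0 := by exact_mod_cast sub_ne_zero.2 ht
    have h1 := (hasSum_ofReal.2 (hasSum_wfun_sub h3 θ t ψ)).mul_left
      (((cos t - cos ψ : ℝ) : ℂ)⁻¹)
    have e : ∀ m : ℕ, ((cos t - cos ψ : ℝ) : ℂ)⁻¹
        * ((2 * wc V θ m * (cos (m * t) - cos (m * ψ)) : ℝ) : ℂ) = g m t := fun m => by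
      have h2 := cos_sub_cos_eq m (t / 2) (ψ / 2)
      simp only [mul_div_cancel₀ _ (two_ne_zero' ℝ)] at h2
      rw [ofReal_mul, h2, hg]
      push_cast at hne ⊢; field_simp
    simp only [e] at h1
    convert! h1 using 1
    push_cast
    rw [div_eq_inv_mul]
  rw [intervalIntegral.integral_ofReal] at hin
  convert! hin using 2 with m
  simp only [hg, intervalIntegral.integral_const_mul]
  rw [integral_chebU_half]; ring

/-- The coefficients of the divided difference. -/
def Dcoef (V : ℝ → ℝ) (θ : ℝ) (p : ℤ) : ℝ := ∑' j : ℕ, wc V θ (p.natAbs + 1 + 2 * j)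

lemma hasSum_Dcoef {V : ℝ → ℝ} (h3 : ConditionC3 V) (θ ψ : ℝ) :
    HasSum (fun p : ℤ => (Dcoef V θ p : ℂ) * ez p ψ) (∑' m : ℕ, (wc V θ m : ℂ) * chebU m ψ) := by
  classical
  set s : ℕ → Finset ℤ := fun m => (Finset.range m).image fun i : ℕ => (2 * i - m + 1 : ℤ) with hs
  have hinj : ∀ m : ℕ, Injective fun i : ℕ => (2 * i - m + 1 : ℤ) := fun m a b h => by
    simp only at h; omega
  have hmem : ∀ (m : ℕ) (p : ℤ), p ∈ s m ↔ ∃ j : ℕ, m = p.natAbs + 1 + 2 * j := fun m p => by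
    simp only [hs, Finset.mem_image, Finset.mem_range]
    constructor
    · rintro ⟨i, hi, rfl⟩
      exact ⟨(m - 1 - (2 * (i : ℤ) - m + 1).natAbs) / 2, by omega⟩
    · rintro ⟨j, rfl⟩
      exact ⟨((p + p.natAbs) / 2 + j).toNat, by omega, by omega⟩
  set F : ℕ × ℤ → ℂ := fun x => if x.2 ∈ s x.1 then (wc V θ x.1 : ℂ) * ez x.2 ψ else 0 with hF
  have hrow : ∀ m : ℕ, HasSum (fun p => F (m, p)) ((wc V θ m : ℂ) * chebU m ψ) := fun m => by
    have h1 : HasSum (fun p => F (m, p)) (∑ p ∈ s m, F (m, p)) := hasSum_sum_of_ne_finset_zero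
      fun p hp => by simp only [hF]; rw [if_neg hp]
    convert! h1 using 1
    rw [sum_image (hinj m).injOn, chebU, mul_sum]
    refine sum_congr rfl fun i hi => ?_
    simp only [hF]
    rw [if_pos (Finset.mem_image_of_mem _ hi)]
  have hnorm : ∀ m : ℕ, HasSum (fun p => ‖F (m, p)‖) (m * |wc V θ m|) := fun m => by
    have h1 : HasSum (fun p => ‖F (m, p)‖) (∑ p ∈ s m, ‖F (m, p)‖) := hasSum_sum_of_ne_finset_zero
      fun p hp => by simp only [hF]; rw [if_neg hp, norm_zero]
    convert! h1 using 1
    rw [sum_image (hinj m).injOn]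
    have : ∀ i ∈ Finset.range m, ‖F (m, (2 * i - m + 1 : ℤ))‖ = |wc V θ m| := fun i hi => by
      simp only [hF]
      rw [if_pos (Finset.mem_image_of_mem _ hi), norm_mul, norm_ez, mul_one, norm_real,
        norm_eq_abs]
    rw [sum_congr rfl this]; simp
  have hFs : Summable F := by
    refine Summable.of_norm ?_
    rw [summable_prod_of_nonneg fun _ => norm_nonneg _]
    refine ⟨fun m => (hnorm m).summable, ?_⟩
    simp only [fun m => (hnorm m).tsum_eq]
    refine Summable.of_nonneg_of_le (fun m => by positivity) (fun m => ?_) (summable_sq_wc h3 θ)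
    have : (m : ℝ) ≤ (m : ℝ) ^ 2 := by
      exact_mod_cast Nat.le_self_pow (by norm_num) m
    exact mul_le_mul_of_nonneg_right this (abs_nonneg _)
  have htot : HasSum F (∑' m : ℕ, (wc V θ m : ℂ) * chebU m ψ) := by
    have h1 := hFs.hasSum.prod_fiberwise hrow
    rw [h1.tsum_eq]
    exact hFs.hasSum
  have hcol : ∀ p : ℤ, HasSum (fun m => F (m, p)) ((Dcoef V θ p : ℂ) * ez p ψ) := fun p => by
    have hinj2 : Injective fun j : ℕ => p.natAbs + 1 + 2 * j := fun a b h => by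
      simp only at h; omega
    have hsw : Summable fun j : ℕ => wc V θ (p.natAbs + 1 + 2 * j) := by
      exact ((summable_abs_wc h3 θ).comp_injective hinj2).of_abs
    have h1 := (hasSum_ofReal.2 hsw.hasSum).mul_right (ez p ψ)
    have hz : ∀ m ∉ Set.range fun j : ℕ => p.natAbs + 1 + 2 * j, F (m, p) = 0 := fun m hm => by
      simp only [hF]
      rw [if_neg]
      intro h2
      obtain ⟨j, hj⟩ := (hmem _ _).1 h2
      exact hm ⟨j, hj.symm⟩
    refine (Injective.hasSum_iff (f := fun m => F (m, p)) hinj2 hz).1 ?_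
    have e : (fun m => F (m, p)) ∘ (fun j : ℕ => p.natAbs + 1 + 2 * j)
        = fun j => (wc V θ (p.natAbs + 1 + 2 * j) : ℂ) * ez p ψ := by
      funext j
      have : p ∈ s (p.natAbs + 1 + 2 * j) := (hmem _ _).2 ⟨j, rfl⟩
      simp only [Function.comp, hF]
      rw [if_pos this]
    rw [e]
    exact h1
  have hswap : HasSum (F ∘ Prod.swap) (∑' m : ℕ, (wc V θ m : ℂ) * chebU m ψ) :=
    (Equiv.prodComm ℤ ℕ).hasSum_iff.2 htot
  exact hswap.prod_fiberwise hcol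

/-- The Fourier coefficients of the symbol. -/
def Acoef (V : ℝ → ℝ) (θ : ℝ) (l : ℤ) : ℝ :=
  (-1) ^ l.natAbs * (4 / cc θ) * ((1 + ca θ) * Dcoef V θ l
    + cc θ / 2 * (Dcoef V θ (l - 1) + Dcoef V θ (l + 1)))

lemma hasSum_Acoef {V : ℝ → ℝ} (h3 : ConditionC3 V) {θ : ℝ} (φ : ℝ) :
    HasSum (fun l : ℤ => (Acoef V θ l : ℂ) * cexp (I * l * φ))
      (4 / cc θ * (1 + ca θ + cc θ * cos (φ - π))
        * ∑' m : ℕ, (wc V θ m : ℂ) * chebU m (φ - π)) := by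
  set ψ := φ - π with hψ
  have h := hasSum_Dcoef h3 θ ψ
  have h1 := ((Equiv.subRight (1 : ℤ)).hasSum_iff.2 h).mul_left (ez 1 ψ)
  have h2 := ((Equiv.addRight (1 : ℤ)).hasSum_iff.2 h).mul_left (ez (-1) ψ)
  have h4 := (((h.mul_left ((1 + ca θ : ℝ) : ℂ)).add ((h1.add h2).mul_left ((cc θ / 2 : ℝ) : ℂ))).mul_left
    ((4 / cc θ : ℝ) : ℂ))
  convert! h4 using 1
  · ext l
    simp only [Function.comp, Equiv.subRight_apply, Equiv.coe_addRight]
    have e1 : ez 1 ψ * ((Dcoef V θ (l - 1) : ℂ) * ez (l - 1) ψ) = Dcoef V θ (l - 1) * ez l ψ := by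
      rw [mul_left_comm, ← ez_add]; congr 2; ring
    have e2 : ez (-1) ψ * ((Dcoef V θ (l + 1) : ℂ) * ez (l + 1) ψ) = Dcoef V θ (l + 1) * ez l ψ := by
      rw [mul_left_comm, ← ez_add]; congr 2; ring
    have e3 : ez l ψ = (-1) ^ l.natAbs * cexp (I * l * φ) := by
      have h5 : ez l ψ = cexp (-π * I) ^ l * cexp (I * l * φ) := by
        rw [ez, hψ, ← Complex.exp_int_mul, ← Complex.exp_add]; congr 1; push_cast; ring
      rw [h5, neg_mul, Complex.exp_neg, Complex.exp_pi_mul_I, inv_neg, inv_one]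
      congr 1
      rcases Int.natAbs_eq l with h | h
      · conv_lhs => rw [h]
        rw [zpow_natCast]
      · conv_lhs => rw [h]
        rw [zpow_neg, zpow_natCast, ← inv_pow, inv_neg, inv_one]
    rw [e1, e2, e3, Acoef]; push_cast; ring
  · have h5 := two_cos_eq 1 ψ
    simp only [Int.cast_one, one_mul] at h5
    have h6 : (cos ψ : ℂ) = (ez 1 ψ + ez (-1) ψ) / 2 := by
      rw [← h5]; push_cast; ring
    rw [h6]; push_cast; ring

section Symbol

variable {V : ℝ → ℝ} {θ : ℝ}

lemma exists_dV_lipschitz (h3 : ConditionC3 V) : ∃ K : ℝ, 0 ≤ K ∧ ∀ x ∈ 𝕁,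
    ∀ y ∈ 𝕁, |dV V x - dV V y| ≤ K * |x - y| := by
  obtain ⟨F0, F1, F2, F3, d0, d1, d2, ⟨K3, hK3⟩, he, hz⟩ := exists_extension h3
  have c1 : Continuous F1 := continuous_iff_continuousAt.2 fun t => (d1 t).continuousAt
  obtain ⟨K, hK⟩ := isCompact_Icc.exists_bound_of_continuousOn (c1.continuousOn (s := 𝕁))
  refine ⟨K, (norm_nonneg _).trans (hK 0 (by norm_num)), fun x hx y hy => ?_⟩
  rw [← he x hx, ← he y hy]
  have := (convex_Icc (-1 : ℝ) 1).norm_image_sub_le_of_norm_hasDerivWithin_le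
    (fun t _ => (d0 t).hasDerivWithinAt) hK hy hx
  simpa [norm_eq_abs] using this

/-- The integrand of `P` without the factor `1/χ`. -/
def Pquot (V : ℝ → ℝ) (x y : ℝ) : ℝ :=
  (-(dV V (cos y) * sin y) - -(dV V (cos x) * sin x)) / sin ((y - x) / 2)

lemma exists_Pquot_bound (h3 : ConditionC3 V) (x : ℝ) : ∃ K : ℝ, ∀ y, |Pquot V x y| ≤ K := by
  obtain ⟨K, hK0, hK⟩ := exists_dV_lipschitz h3
  refine ⟨2 * K + 2 * |dV V (cos x)|, fun y => ?_⟩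
  have hpos : 0 ≤ 2 * K + 2 * |dV V (cos x)| := by positivity
  rcases eq_or_ne (sin ((y - x) / 2)) 0 with h0 | h0
  · rw [Pquot, h0, div_zero, abs_zero]; exact hpos
  have e1 : cos y - cos x = -2 * sin ((y + x) / 2) * sin ((y - x) / 2) := cos_sub_cos y x
  have e2 : sin y - sin x = 2 * sin ((y - x) / 2) * cos ((y + x) / 2) := sin_sub_sin y x
  rw [Pquot, abs_div, div_le_iff₀ (abs_pos.2 h0)]
  have e3 : -(dV V (cos y) * sin y) - -(dV V (cos x) * sin x)
      = -((dV V (cos y) - dV V (cos x)) * sin y + dV V (cos x) * (sin y - sin x)) := by ring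
  rw [e3, abs_neg]
  refine (abs_add_le _ _).trans ?_
  rw [abs_mul, abs_mul, e2]
  have t1 := hK _ ⟨neg_one_le_cos y, cos_le_one y⟩ _ ⟨neg_one_le_cos x, cos_le_one x⟩
  rw [e1, abs_mul, abs_mul, abs_neg, abs_two] at t1
  have t2 := abs_sin_le_one y
  have t3 := abs_sin_le_one ((y + x) / 2)
  have t4 := abs_cos_le_one ((y + x) / 2)
  rw [abs_mul, abs_mul, abs_two]
  have u1 : K * (2 * |sin ((y + x) / 2)| * |sin ((y - x) / 2)|)
      ≤ K * (2 * 1 * |sin ((y - x) / 2)|) := by gcongr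
  have u2 : |dV V (cos y) - dV V (cos x)| * |sin y| ≤ |dV V (cos y) - dV V (cos x)| * 1 := by gcongr
  have u3 : |dV V (cos x)| * (2 * |sin ((y - x) / 2)| * |cos ((y + x) / 2)|)
      ≤ |dV V (cos x)| * (2 * |sin ((y - x) / 2)| * 1) := by gcongr
  linarith

/-- The angle `y` with `sin (y/2) = sin (θ/2) sin τ`. -/
def eta (θ τ : ℝ) : ℝ := 2 * arcsin (sin (θ / 2) * sin τ)

lemma eta_facts (h0 : 0 < θ) (hpi : θ < π) (τ : ℝ) :
    sin (eta θ τ / 2) = sin (θ / 2) * sin τ ∧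
    cos (eta θ τ) = ca θ + cc θ * cos (2 * τ) ∧
    0 < cos (eta θ τ / 2) ∧
    cos (eta θ τ / 2) ^ 2 = 1 - cc θ * sin τ ^ 2 ∧
    HasDerivAt (eta θ) (2 * (sin (θ / 2) * cos τ) / cos (eta θ τ / 2)) τ := by
  have hs0 := sin_half_pos h0 hpi
  have hs1 : sin (θ / 2) < 1 := by
    have : sin (θ / 2) < sin (π / 2) :=
      sin_lt_sin_of_lt_of_le_pi_div_two (by linarith) le_rfl (by linarith)
    rwa [sin_pi_div_two] at this
  have hab : |sin (θ / 2) * sin τ| < 1 := by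
    rw [abs_mul, abs_of_pos hs0]
    have := abs_sin_le_one τ
    nlinarith [abs_nonneg (sin τ)]
  obtain ⟨hl, hu⟩ := abs_lt.1 hab
  have e0 : eta θ τ / 2 = arcsin (sin (θ / 2) * sin τ) := by rw [eta]; ring
  have e1 : sin (eta θ τ / 2) = sin (θ / 2) * sin τ := by
    rw [e0, sin_arcsin hl.le hu.le]
  have e2 : cos (eta θ τ / 2) ^ 2 = 1 - cc θ * sin τ ^ 2 := by
    rw [cos_sq', e1, cc]; ring
  have e3 : 0 < cos (eta θ τ / 2) := by
    rw [e0, cos_arcsin]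
    exact sqrt_pos.2 (by nlinarith)
  refine ⟨e1, ?_, e3, e2, ?_⟩
  · rw [show eta θ τ = 2 * (eta θ τ / 2) by ring, cos_two_mul, e2, cos_two_mul τ, cos_sq' τ]
    linear_combination (-1 : ℝ) * ca_add_cc θ
  · have h1 := (hasDerivAt_arcsin hl.ne' hu.ne).comp τ ((hasDerivAt_sin τ).const_mul (sin (θ / 2)))
    refine (h1.const_mul 2).congr_deriv ?_
    rw [e0, cos_arcsin]; field_simp

/-- The change of variables `y = eta θ τ` maps `(-π/2, π/2)` onto `(-θ, θ)`. -/
lemma image_eta (h0 : 0 < θ) (hpi : θ < π) :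
    InjOn (eta θ) (Ioo (-(π / 2)) (π / 2)) ∧
    eta θ '' Ioo (-(π / 2)) (π / 2) = Ioo (-θ) θ := by
  have hs0 := sin_half_pos h0 hpi
  constructor
  · intro x hx y hy h
    have h1 := (eta_facts h0 hpi x).1
    rw [h, (eta_facts h0 hpi y).1] at h1
    exact injOn_sin (Ioo_subset_Icc_self hx) (Ioo_subset_Icc_self hy)
      (mul_left_cancel₀ hs0.ne' h1.symm)
  · ext y
    constructor
    · rintro ⟨τ, hτ, rfl⟩
      have h2 := sin_lt_sin_of_lt_of_le_pi_div_two (x := -(π / 2)) le_rfl hτ.2.le hτ.1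
      have h3 := sin_lt_sin_of_lt_of_le_pi_div_two hτ.1.le le_rfl hτ.2
      rw [sin_neg, sin_pi_div_two] at h2
      rw [sin_pi_div_two] at h3
      have a1 : arcsin (sin (θ / 2) * sin τ) < θ / 2 := by
        rw [arcsin_lt_iff_lt_sin' ⟨by linarith, by linarith⟩]
        nlinarith
      have a2 : -(θ / 2) < arcsin (sin (θ / 2) * sin τ) := by
        rw [lt_arcsin_iff_sin_lt' ⟨by linarith, by linarith⟩, sin_neg]
        nlinarith
      rw [eta]
      constructor <;> linarith
    · intro hy
      have b1 : sin (y / 2) < sin (θ / 2) :=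
        sin_lt_sin_of_lt_of_le_pi_div_two (by linarith [hy.1]) (by linarith) (by linarith [hy.2])
      have b2 : sin (-(θ / 2)) < sin (y / 2) :=
        sin_lt_sin_of_lt_of_le_pi_div_two (by linarith) (by linarith [hy.2]) (by linarith [hy.1])
      rw [sin_neg] at b2
      have c1 : sin (y / 2) / sin (θ / 2) < 1 := by rwa [div_lt_one hs0]
      have c2 : -1 < sin (y / 2) / sin (θ / 2) := by
        rw [lt_div_iff₀ hs0]; linarith
      refine ⟨arcsin (sin (y / 2) / sin (θ / 2)),
        ⟨neg_pi_div_two_lt_arcsin.2 c2, arcsin_lt_pi_div_two.2 c1⟩, ?_⟩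
      rw [eta, sin_arcsin c2.le c1.le, mul_div_cancel₀ _ hs0.ne',
        arcsin_sin (by linarith [hy.1]) (by linarith [hy.2])]
      ring

lemma P_eq_integral_eta (hd : DifferentiableOn ℝ V 𝕁) (h0 : 0 < θ) (hpi : θ < π)
    (x : ℝ) : P V θ x = ∫ τ in (-(π / 2))..(π / 2),
      √2 / cos (eta θ τ / 2) * Pquot V x (eta θ τ) := by
  have hs0 := sin_half_pos h0 hpi
  have hPd : ∀ y, deriv (fun t => V (cos t)) y = -(dV V (cos y) * sin y) :=
    fun y => (hasDerivAt_V_cos hd y).deriv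
  obtain ⟨hinj, himg⟩ := image_eta h0 hpi
  rw [P, integral_of_le (by linarith), integral_Ioc_eq_integral_Ioo, ← himg,
    integral_image_eq_integral_abs_deriv_smul measurableSet_Ioo
      (fun τ _ => (eta_facts h0 hpi τ).2.2.2.2.hasDerivWithinAt) hinj,
    integral_of_le (by linarith), integral_Ioc_eq_integral_Ioo]
  refine setIntegral_congr_fun measurableSet_Ioo fun τ hτ => ?_
  obtain ⟨-, e2, e3, -, -⟩ := eta_facts h0 hpi τ
  have hcos : 0 < cos τ := cos_pos_of_mem_Ioo hτ
  have hchi : chi θ (eta θ τ) = √2 * (sin (θ / 2) * cos τ) := by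
    have : cos (eta θ τ) - cos θ = 2 * (sin (θ / 2) * cos τ) ^ 2 := by
      rw [e2, ← ca_sub_cc θ, cos_two_mul, cc]; ring
    rw [chi, this, abs_of_pos (by positivity), sqrt_mul (by norm_num), sqrt_sq (by positivity)]
  rw [hPd, hPd, hchi, abs_of_pos (by positivity), smul_eq_mul, Pquot]
  have h2 : √2 * √2 = 2 := mul_self_sqrt (by norm_num)
  rw [show (2 : ℝ) * (sin (θ / 2) * cos τ) / cos (eta θ τ / 2)
    = √2 * √2 * (sin (θ / 2) * cos τ) / cos (eta θ τ / 2) by rw [h2]]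
  field_simp

lemma eta_neg (θ τ : ℝ) : eta θ (-τ) = -eta θ τ := by
  rw [eta, sin_neg, mul_neg, arcsin_neg, eta]; ring

/-- Symmetrization of the integrand of `P`. -/
lemma Pquot_symm {x y : ℝ} (hne : cos y ≠ cos x) (hy : cos (y / 2) ≠ 0) :
    (Pquot V x y + Pquot V x (-y)) / cos (y / 2)
      = 8 * cos (x / 2) * ((dV V (cos y) * (1 - cos y) / 2
        - dV V (cos x) * (1 - cos x) / 2) / (cos y - cos x)) := by
  have e1 : cos y - cos x = -2 * sin ((y + x) / 2) * sin ((y - x) / 2) := cos_sub_cos y x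
  have h0 := sub_ne_zero.2 hne
  rw [e1] at h0
  have s1 : sin ((y + x) / 2) ≠ 0 := fun hs => h0 (by rw [hs]; ring)
  have s2 : sin ((y - x) / 2) ≠ 0 := fun hs => h0 (by rw [hs]; ring)
  have e2 : sin ((-y - x) / 2) = -sin ((y + x) / 2) := by
    rw [← sin_neg]; congr 1; ring
  have a1 : sin ((y + x) / 2) = sin (y / 2) * cos (x / 2)
      + cos (y / 2) * sin (x / 2) := by rw [add_div, sin_add]
  have a2 : sin ((y - x) / 2) = sin (y / 2) * cos (x / 2)
      - cos (y / 2) * sin (x / 2) := by rw [sub_div, sin_sub]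
  have b1 : ∀ z : ℝ, sin z = 2 * sin (z / 2) * cos (z / 2) := fun z => by
    conv_lhs => rw [show z = 2 * (z / 2) by ring, sin_two_mul]
  have b2 : ∀ z : ℝ, 1 - cos z = 2 * sin (z / 2) ^ 2 := fun z => by
    conv_lhs => rw [show z = 2 * (z / 2) by ring, cos_two_mul, cos_sq']
    ring
  rw [Pquot, Pquot, e2, cos_neg, sin_neg, e1, b2 y, b2 x, b1 y, b1 x]; field_simp
  rw [a1, a2]; ring

/-- The symbol as an integral of a divided difference over a full period. -/
lemma symbol_eq (h3 : ConditionC3 V) (h0 : 0 < θ) (hpi : θ < π) (φ : ℝ) :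
    symbol V θ φ = (1 + ca θ + cc θ * cos (φ - π)) / (π * cc θ)
      * ∫ t in (-π)..π, (wfun V θ t - wfun V θ (φ - π)) / (cos t - cos (φ - π)) := by
  set ψ := φ - π with hψ
  have hd := h3.contDiffOn.differentiableOn (by norm_num)
  have hs0 := sin_half_pos h0 hpi
  have hc := cc_pos h0 hpi
  -- the evaluation point is `eta θ (ψ / 2)`
  have hx : -2 * arcsin (sin (θ / 2) * cos (φ / 2)) = eta θ (ψ / 2) := by
    have : sin (ψ / 2) = -cos (φ / 2) := by
      rw [hψ, sub_div, sin_sub_pi_div_two]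
    rw [eta, this, mul_neg, arcsin_neg]; ring
  set x := eta θ (ψ / 2) with hxdef
  obtain ⟨-, ex2, ex3, ex4, -⟩ := eta_facts h0 hpi (ψ / 2)
  rw [mul_div_cancel₀ _ (two_ne_zero' ℝ), ← hxdef] at ex2
  rw [← hxdef] at ex3 ex4
  have hsq : √(1 - cc θ * cos (φ / 2) ^ 2) = cos (x / 2) := by
    have : sin (ψ / 2) ^ 2 = cos (φ / 2) ^ 2 := by
      rw [hψ, sub_div, sin_sub_pi_div_two, neg_sq]
    rw [← this, ← ex4, sqrt_sq ex3.le]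
  rw [symbol, hx, hsq, P_eq_integral_eta hd h0 hpi]
  set h : ℝ → ℝ := fun τ => √2 / cos (eta θ τ / 2) * Pquot V x (eta θ τ) with hh
  -- integrability
  have hcη : Continuous (eta θ) := continuous_iff_continuousAt.2 fun τ =>
    (eta_facts h0 hpi τ).2.2.2.2.continuousAt
  have hint : IntervalIntegrable h volume (-(π / 2)) (π / 2) := by
    obtain ⟨K, hK⟩ := exists_Pquot_bound h3 x
    have hc1 : Continuous fun τ => √2 / cos (eta θ τ / 2) := by
      refine continuous_const.div (by fun_prop) fun τ => (eta_facts h0 hpi τ).2.2.1.ne'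
    have hdc : Continuous fun y => dV V (cos y) := by
      obtain ⟨F0, F1, F2, F3, d0, d1, d2, -, he, -⟩ := exists_extension h3
      have e : (fun y => dV V (cos y)) = fun y => F0 (cos y) :=
        funext fun y => (he _ ⟨neg_one_le_cos y, cos_le_one y⟩).symm
      rw [e]
      have : Continuous F0 := continuous_iff_continuousAt.2 fun t => (d0 t).continuousAt
      fun_prop
    have hm : Measurable (Pquot V x) := by
      unfold Pquot
      fun_prop
    have h1 : IntervalIntegrable (fun τ => Pquot V x (eta θ τ)) volume (-(π / 2)) (π / 2) := by
      rw [intervalIntegrable_iff]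
      exact Measure.integrableOn_of_bounded (by simp) (hm.comp hcη.measurable).aestronglyMeasurable
        (of_forall fun τ => hK _)
    exact h1.continuousOn_mul hc1.continuousOn
  -- only the even part of the integrand contributes
  have hsym : ∫ τ in (-(π / 2))..(π / 2), h τ
      = 1 / 2 * ∫ τ in (-(π / 2))..(π / 2), (h τ + h (-τ)) := by
    have hint2 : IntervalIntegrable (fun τ => h (-τ)) volume (-(π / 2)) (π / 2) := by
      have := (hint.comp_sub_left 0).symm
      simpa using this
    have h2 := integral_comp_neg (a := -(π / 2)) (b := π / 2) h
    rw [neg_neg] at h2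
    rw [intervalIntegral.integral_add hint hint2, h2]; ring
  have hae : ∀ᵐ τ : ℝ, h τ + h (-τ) = √2 * (8 * cos (x / 2)) / cc θ
      * ((wfun V θ (2 * τ) - wfun V θ ψ) / (cos (2 * τ) - cos ψ)) := by
    have h4 := ae_cos_ne (ψ / 2)
    filter_upwards [h4] with τ hτ
    rw [mul_div_cancel₀ _ (two_ne_zero' ℝ)] at hτ
    obtain ⟨-, f2, f3, -, -⟩ := eta_facts h0 hpi τ
    have hne : cos (eta θ τ) ≠ cos x := by
      rw [f2, ex2]
      intro heq
      exact hτ (mul_left_cancel₀ hc.ne' (add_left_cancel heq)).symm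
    have h5 := Pquot_symm (V := V) hne f3.ne'
    have h6 : h τ + h (-τ) = √2 * ((Pquot V x (eta θ τ) + Pquot V x (-eta θ τ))
        / cos (eta θ τ / 2)) := by
      simp only [hh, eta_neg, neg_div, cos_neg]; ring
    rw [h6, h5, f2, ex2, wfun, wfun]
    have h7 : ca θ + cc θ * cos (2 * τ) - (ca θ + cc θ * cos ψ)
        = cc θ * (cos (2 * τ) - cos ψ) := by ring
    rw [h7]
    field_simp
  rw [hsym, intervalIntegral.integral_congr_ae (hae.mono fun τ h _ => h),
    intervalIntegral.integral_const_mul,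
    integral_comp_mul_left (fun t => (wfun V θ t - wfun V θ ψ)
      / (cos t - cos ψ)) two_ne_zero, smul_eq_mul]
  have e9 : 2 * -(π / 2) = -π := by ring
  have e10 : 2 * (π / 2) = π := by ring
  rw [e9, e10]
  have e11 : cos (x / 2) ^ 2 = (1 + ca θ + cc θ * cos ψ) / 2 := by
    rw [add_assoc, ← ex2, cos_sq]
    rw [mul_div_cancel₀ _ (two_ne_zero' ℝ)]; ring
  generalize (∫ t in (-π)..π, (wfun V θ t - wfun V θ ψ) / (cos t - cos ψ)) = J
  have e12 : 1 + ca θ + cc θ * cos ψ = 2 * cos (x / 2) ^ 2 := by rw [e11]; ring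
  rw [e12]
  field_simp; ring

/-- The symbol is the sum of its Fourier series with coefficients `A_l`. -/
lemma hasSum_symbol (h3 : ConditionC3 V) (h0 : 0 < θ) (hpi : θ < π) (φ : ℝ) :
    HasSum (fun l : ℤ => (Acoef V θ l : ℂ) * cexp (I * l * φ)) (symbol V θ φ : ℂ) := by
  have hs0 := sin_half_pos h0 hpi
  have h1 := hasSum_Acoef h3 (θ := θ) φ
  have h2 := (hasSum_divided_difference h3 θ (φ - π)).tsum_eq
  rw [tsum_mul_left] at h2
  rw [symbol_eq h3 h0 hpi, ofReal_mul, ← h2]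
  convert! h1 using 1
  push_cast; field_simp

end Symbol

/-! ### The linear part of the string equation -/

section LinearPart

variable {V : ℝ → ℝ} {θ : ℝ}

lemma Dcoef_eq (h3 : ConditionC3 V) (p : ℤ) : Dcoef V θ p = cc θ / 2 * (Ev V θ p.natAbs
    - (Ev V θ (p.natAbs + 1) + if p = 0 then vc V θ 0 + Ev V θ 1 else Ev V θ (p.natAbs - 1)) / 2) := by
  obtain ⟨B, -, hs2, hsE, -⟩ := exists_Ev_bound h3 θ
  have hs0 := summable_abs_vc h3 θ
  have hinj : ∀ q : ℕ, Injective fun j : ℕ => q + 2 * j := fun q a b h => by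
    simp only at h; omega
  have hs : ∀ q : ℕ, Summable fun j : ℕ => vc V θ (q + 2 * j) := fun q =>
    (hs0.comp_injective (hinj q)).of_abs
  have h1 : ∑' j : ℕ, vc V θ (p.natAbs + 2 * j)
      = if p = 0 then vc V θ 0 + Ev V θ 1 else Ev V θ (p.natAbs - 1) := by
    split_ifs with h
    · rw [(hs _).tsum_eq_zero_add, h, Ev]
      simp only [Int.natAbs_zero, mul_zero, add_zero]
      congr 1
      refine tsum_congr fun j => ?_
      congr 1; ring
    · rw [Ev, Nat.sub_add_cancel (Nat.one_le_iff_ne_zero.2 (Int.natAbs_ne_zero.2 h))]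
  have h2 : ∀ j : ℕ, wc V θ (p.natAbs + 1 + 2 * j) = cc θ / 2 * (vc V θ (p.natAbs + 1 + 2 * j)
      - (vc V θ (p.natAbs + 1 + 1 + 2 * j) + vc V θ (p.natAbs + 2 * j)) / 2) := fun j => by
    rw [wc, show (((p.natAbs + 1 + 2 * j : ℕ) : ℤ) - 1).natAbs = p.natAbs + 2 * j by omega,
      show p.natAbs + 1 + 2 * j + 1 = p.natAbs + 1 + 1 + 2 * j by ring]
  rw [Dcoef]
  simp only [h2]
  rw [tsum_mul_left, (hs _).tsum_sub (((hs _).add (hs _)).div_const 2), tsum_div_const,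
    (hs _).tsum_add (hs _), h1]
  rfl

lemma Ev_succ (h3 : ConditionC3 V) (p : ℕ) : Ev V θ p = vc V θ (p + 1) + Ev V θ (p + 2) := by
  obtain ⟨B, -, -, hsE, -⟩ := exists_Ev_bound h3 θ
  rw [Ev, (hsE p).tsum_eq_zero_add, Ev]
  congr 1
  refine tsum_congr fun j => ?_
  congr 1; ring

/-- The coefficient with which `δM_{k+l,k+l+d'}` enters after `L̃_{k,k+d}`. -/
def Bw (V : ℝ → ℝ) (θ : ℝ) (d d' l : ℤ) : ℝ := Bcoef V θ (l - d) (l + d' + 1)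

lemma Bw_eq (h3 : ConditionC3 V) (hc : cc θ ≠ 0) {d d' l : ℤ} (p : ℕ) (h1 : (l - d) % 2 = 0)
    (h2 : (l + d' + 1) % 2 = 0) (h : (l - d).natAbs + (l + d' + 1).natAbs = 2 * p) :
    Bw V θ d d' l = 2 / cc θ * Ev V θ p := by
  rw [Bw, Bcoef_eq h3 hc, if_pos ⟨even_iff.2 h1, even_iff.2 h2⟩, h,
    Nat.mul_div_cancel_left _ two_pos]

lemma Bw_eq_zero (h3 : ConditionC3 V) (hc : cc θ ≠ 0) {d d' l : ℤ}
    (h : (l - d) % 2 ≠ 0 ∨ (l + d' + 1) % 2 ≠ 0) : Bw V θ d d' l = 0 := by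
  rw [Bw, Bcoef_eq h3 hc, if_neg]
  rintro ⟨h1, h2⟩
  rw [even_iff] at h1 h2; omega

/-- The contribution of `L⋆_{k,k±1}` to the coefficient of `x̃_{k+i}`. -/
def gOdd (V : ℝ → ℝ) (θ : ℝ) (d i : ℤ) : ℝ :=
  -Bw V θ d 0 i - Bw V θ d 0 (i - 1) + (Bw V θ d 2 (i - 1) + Bw V θ d 2 (i - 2)) / 2
    + (Bw V θ d (-2) (i + 1) + Bw V θ d (-2) i) / 2

/-- The contribution of `L⋆_{k,k±2}` to the coefficient of `x̃_{k+i}`. -/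
def gEven (V : ℝ → ℝ) (θ : ℝ) (d i : ℤ) : ℝ :=
  Bw V θ d 1 (i - 2) - Bw V θ d 1 i - (Bw V θ d (-1) (i - 1) - Bw V θ d (-1) (i + 1))

/-- The contribution of the terms outside the series to the coefficient of `x̃_{k+i}`. -/
def gFin (V : ℝ → ℝ) (θ : ℝ) (i : ℤ) : ℝ := 1 / cc θ * ((if i = 1 then ca θ else 0)
      - cc θ / 2 * ((if i = 0 then 1 else 0) + (if i = 2 then 1 else 0)) + (if i = 0 then 1 else 0))
    + vc V θ 0 * ((ca θ + cc θ / 2) * ((if i = 1 then 1 else 0) - (if i = 0 then 1 else 0))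
      - cc θ / 2 * ((if i = 2 then 1 else 0) - (if i = -1 then 1 else 0)))

/-- The coefficients of the linear part agree with the Fourier coefficients of the symbol. -/
lemma linear_coefficient (h3 : ConditionC3 V) (hc : cc θ ≠ 0)
    (hv : vc V θ 1 = vc V θ 0 + 1 / cc θ) (i : ℤ) :
    gFin V θ i + ca θ * cc θ * (gOdd V θ 1 i - gOdd V θ (-1) i)
      - cc θ ^ 2 / 4 * (gEven V θ 2 i - gEven V θ (-2) i) = Acoef V θ i := by
  have ha : ca θ = 1 - cc θ := by linarith [ca_add_cc θ]
  have hv0 : vc V θ 0 = Ev V θ 0 - Ev V θ 2 - 1 / cc θ := by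
    rw [Ev_succ h3 0, zero_add, hv]; ring
  -- absolute values inside the indices matter only for small `i`, which is checked case by case
  have hsmall : -4 ≤ i → i ≤ 4 → gFin V θ i + ca θ * cc θ * (gOdd V θ 1 i - gOdd V θ (-1) i)
      - cc θ ^ 2 / 4 * (gEven V θ 2 i - gEven V θ (-2) i) = Acoef V θ i := fun h4 h5 => by
    interval_cases i <;>
    · simp only [gFin, gOdd, gEven, Bw, Bcoef_eq h3 hc, even_iff, Acoef, Dcoef_eq h3, ha]
      norm_num [hv0]; field_simp; ring
  rcases (by omega : (-4 ≤ i ∧ i ≤ 4) ∨ (5 ≤ i ∨ i ≤ -5)) with h | hi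
  · exact hsmall h.1 h.2
  have be : ∀ d d' l q : ℤ, (-2 ≤ d ∧ d ≤ 2 ∧ -2 ≤ d' ∧ d' ≤ 2) ∧ (-2 ≤ l - i ∧ l - i ≤ 2) ∧
      (l - d) % 2 = 0 ∧ 2 * (q - l) = d' + 1 - d → Bw V θ d d' l = 2 / cc θ * Ev V θ q.natAbs :=
    fun d d' l q h1 => Bw_eq h3 hc _ h1.2.2.1 (by omega) (by omega)
  have bz : ∀ d d' l : ℤ, (l - d) % 2 ≠ 0 ∨ (l + d' + 1) % 2 ≠ 0 → Bw V θ d d' l = 0 :=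
    fun d d' l h => Bw_eq_zero h3 hc h
  have hD : ∀ p : ℤ, p ≠ 0 → Dcoef V θ p = cc θ / 2 * (Ev V θ p.natAbs
      - (Ev V θ (p + 1).natAbs + Ev V θ (p - 1).natAbs) / 2) := fun p hp => by
    rw [Dcoef_eq h3, if_neg hp]
    rcases lt_or_gt_of_ne hp with h | h
    · rw [show (p + 1).natAbs = p.natAbs - 1 by omega, show (p - 1).natAbs = p.natAbs + 1 by omega]
      ring
    · rw [show (p + 1).natAbs = p.natAbs + 1 by omega, show (p - 1).natAbs = p.natAbs - 1 by omega]
  have hF : gFin V θ i = 0 := by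
    rw [gFin]
    split_ifs <;> first | omega | ring
  rw [hF, Acoef, hD i (by omega), hD (i - 1) (by omega), hD (i + 1) (by omega), gOdd, gOdd, gEven, gEven,
    show i - 1 + 1 = i by ring, show i + 1 - 1 = i by ring, show i - 1 - 1 = i - 2 by ring,
    show i + 1 + 1 = i + 2 by ring]
  clear hsmall hi hF hD hv0
  -- the parity of `i` decides which coefficients vanish
  rcases emod_two_eq_zero_or_one i with h | h
  · rw [bz 1 0 i (by omega), be 1 0 (i - 1) (i - 1) (by omega), be 1 2 (i - 1) i (by omega),
      bz 1 2 (i - 2) (by omega), be 1 (-2) (i + 1) i (by omega), bz 1 (-2) i (by omega),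
      bz (-1) 0 i (by omega), be (-1) 0 (i - 1) i (by omega), be (-1) 2 (i - 1) (i + 1) (by omega),
      bz (-1) 2 (i - 2) (by omega), be (-1) (-2) (i + 1) (i + 1) (by omega),
      bz (-1) (-2) i (by omega), be 2 1 (i - 2) (i - 2) (by omega), be 2 1 i i (by omega),
      bz 2 (-1) (i - 1) (by omega), bz 2 (-1) (i + 1) (by omega), be (-2) 1 (i - 2) i (by omega),
      be (-2) 1 i (i + 2) (by omega), bz (-2) (-1) (i - 1) (by omega),
      bz (-2) (-1) (i + 1) (by omega), (natAbs_even.2 (even_iff.2 h)).neg_one_pow, ha]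
    field_simp; ring
  · rw [be 1 0 i i (by omega), bz 1 0 (i - 1) (by omega), bz 1 2 (i - 1) (by omega),
      be 1 2 (i - 2) (i - 1) (by omega), bz 1 (-2) (i + 1) (by omega),
      be 1 (-2) i (i - 1) (by omega), be (-1) 0 i (i + 1) (by omega), bz (-1) 0 (i - 1) (by omega),
      bz (-1) 2 (i - 1) (by omega), be (-1) 2 (i - 2) i (by omega),
      bz (-1) (-2) (i + 1) (by omega), be (-1) (-2) i i (by omega), bz 2 1 (i - 2) (by omega),
      bz 2 1 i (by omega), be 2 (-1) (i - 1) (i - 2) (by omega), be 2 (-1) (i + 1) i (by omega),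
      bz (-2) 1 (i - 2) (by omega), bz (-2) 1 i (by omega), be (-2) (-1) (i - 1) i (by omega),
      be (-2) (-1) (i + 1) (i + 2) (by omega), (natAbs_odd.2 (odd_iff.2 h)).neg_one_pow,
      ha]
    field_simp; ring

end LinearPart

/-! ### Linearization of the matrix elements -/

section Linearization

lemma abs_sin_sub_self_le (x : ℝ) : |sin x - x| ≤ 2 * x ^ 2 := by
  wlog hx : 0 ≤ x generalizing x
  · have := this (-x) (by linarith)
    rw [sin_neg, neg_sq, ← neg_sub', abs_neg] at this
    convert this using 2
  have h1 := sin_le hx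
  rw [abs_le]
  refine ⟨?_, by nlinarith⟩
  rcases le_or_gt x 1 with h | h
  · rcases hx.eq_or_lt with rfl | h0
    · simp
    · have := sin_gt_sub_cube h0
      nlinarith [pow_pos h0 2]
  · nlinarith [neg_one_le_sin x]

lemma abs_cos_add_sub_le (u x : ℝ) :
    |cos (u + x) - (cos u - sin u * x)| ≤ 3 * x ^ 2 := by
  have e : cos (u + x) - (cos u - sin u * x) = cos u * (cos x - 1) - sin u * (sin x - x) := by
    rw [cos_add]; ring
  have h1 : |cos x - 1| ≤ x ^ 2 / 2 := by
    rw [abs_le]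
    constructor <;> nlinarith [one_sub_sq_div_two_le_cos (x := x), cos_le_one x]
  rw [e]
  refine (abs_sub _ _).trans ?_
  rw [abs_mul, abs_mul]
  have := mul_le_mul (abs_cos_le_one u) h1 (abs_nonneg _) zero_le_one
  have := mul_le_mul (abs_sin_le_one u) (abs_sin_sub_self_le x) (abs_nonneg _) zero_le_one
  nlinarith [sq_nonneg x]

lemma abs_sin_add_sub_le (u x : ℝ) :
    |sin (u + x) - (sin u + cos u * x)| ≤ 3 * x ^ 2 := by
  have := abs_cos_add_sub_le (u - π / 2) x
  rwa [cos_sub_pi_div_two, sin_sub_pi_div_two, sub_add_eq_add_sub,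
    cos_sub_pi_div_two, neg_mul, sub_neg_eq_add] at this

/-- Linearization of a product. -/
lemma abs_mul_sub_le {A B α β α' β' x y : ℝ} (hA : |A - (α + α' * x)| ≤ 3 * x ^ 2)
    (hB : |B - (β + β' * y)| ≤ 3 * y ^ 2) (hB1 : |B| ≤ 1) (h1 : |α| ≤ 1) (h2 : |α'| ≤ 1)
    (h4 : |β'| ≤ 1) (hx : |x| ≤ 4) :
    |A * B - (α * β + α' * β * x + α * β' * y)| ≤ 20 * (x ^ 2 + y ^ 2) := by
  have e : A * B - (α * β + α' * β * x + α * β' * y)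
      = (A - (α + α' * x)) * B + (α + α' * x) * (B - (β + β' * y)) + α' * β' * (x * y) := by ring
  have e1 : |α + α' * x| ≤ 5 := by
    refine (abs_add_le _ _).trans ?_
    rw [abs_mul]
    nlinarith [abs_nonneg α', abs_nonneg x]
  have e2 : |x * y| ≤ (x ^ 2 + y ^ 2) / 2 := by
    rw [abs_le]; constructor <;> nlinarith [sq_nonneg (x + y), sq_nonneg (x - y)]
  rw [e]
  refine (abs_add_le _ _).trans ((add_le_add (abs_add_le _ _) le_rfl).trans ?_)
  rw [abs_mul, abs_mul, abs_mul (α' * β'), abs_mul α']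
  have m1 := mul_le_mul hA hB1 (abs_nonneg _) (by positivity)
  have m2 := mul_le_mul e1 hB (abs_nonneg _) (by positivity)
  have m3 := mul_le_mul (mul_le_mul h2 h4 (abs_nonneg _) zero_le_one) e2 (abs_nonneg _) (by norm_num)
  nlinarith [sq_nonneg x, sq_nonneg y]

variable {V : ℝ → ℝ} {θ s : ℝ} {n : ℕ}

lemma sign_sq (hs : s = 1 ∨ s = -1) : s * s = 1 := by rcases hs with rfl | rfl <;> norm_num

/-- Well-definedness of `x̃_l`: `θ/2 + x̃_l ∈ [0, π]`, with the required cosine and sine. -/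
lemma xt_facts (hV : ContinuousOn V 𝕁) (hs : s = 1 ∨ s = -1) {l : ℤ} (h : 0 ≤ n + l) :
    0 ≤ θ / 2 + xt V θ s n l ∧ θ / 2 + xt V θ s n l ≤ π ∧
    alpha V n (n + l).toNat = (-1) ^ (n + l).toNat * s * cos (θ / 2 + xt V θ s n l) ∧
    rho V n (n + l).toNat = sin (θ / 2 + xt V θ s n l) := by
  set N := (n + l).toNat with hN
  have e : θ / 2 + xt V θ s n l = arccos ((-1) ^ N * s * alpha V n N) := by
    rw [xt, if_pos h]; ring
  have h1 := abs_le.1 (abs_alpha_le_one hV n N)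
  have h2 : ((-1 : ℝ) ^ N * s) * ((-1) ^ N * s) = 1 := by
    have : ((-1 : ℝ) ^ N) * (-1) ^ N = 1 := by rw [← mul_pow]; norm_num
    linear_combination s * s * this + sign_sq hs
  have h4 : (-1 : ℝ) ^ N * s = 1 ∨ (-1 : ℝ) ^ N * s = -1 := mul_self_eq_one_iff.1 h2
  have h5 : -1 ≤ (-1) ^ N * s * alpha V n N ∧ (-1) ^ N * s * alpha V n N ≤ 1 := by
    rcases h4 with h | h <;> rw [h] <;> constructor <;> linarith [h1.1, h1.2]
  rw [e]
  refine ⟨arccos_nonneg _, arccos_le_pi _, ?_, ?_⟩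
  · rw [cos_arccos h5.1 h5.2, ← mul_assoc, h2, one_mul]
  · rw [sin_arccos, show 1 - ((-1) ^ N * s * alpha V n N) ^ 2 = rho V n N ^ 2 by
      linear_combination (-(alpha V n N) ^ 2) * h2 - alpha_sq_add_rho_sq hV n N,
      sqrt_sq (rho_nonneg hV n N)]

lemma xt_low {l : ℤ} (h : n + l < 0) : xt V θ s n l = 0 := by
  rw [xt, if_neg (by omega)]

lemma xt_abs_le (hV : ContinuousOn V 𝕁) (hs : s = 1 ∨ s = -1) (h0 : 0 < θ)
    (hpi : θ < π) (l : ℤ) : |xt V θ s n l| ≤ π := by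
  have hp := pi_pos
  by_cases h : 0 ≤ n + l
  · obtain ⟨h1, h2, -⟩ := xt_facts (θ := θ) hV hs h
    rw [abs_le]; constructor <;> linarith
  · rw [xt_low (by omega), abs_zero]; exact hp.le

/-- At the index `-n`, where `α_0 = 1`, the deviation is not small. -/
lemma le_sq_xt_neg (hV : ContinuousOn V 𝕁) (hs : s = 1 ∨ s = -1) (h0 : 0 < θ)
    (hpi : θ < π) : (min (θ / 2) (π - θ / 2)) ^ 2 ≤ xt V θ s n (-n) ^ 2 := by
  have h1 : 0 ≤ min (θ / 2) (π - θ / 2) := le_min (by linarith) (by linarith)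
  rw [sq_le_sq, abs_of_nonneg h1, xt, if_pos (by omega), show ((n : ℤ) + -n).toNat = 0 by omega,
    alpha_zero hV, pow_zero, one_mul, mul_one]
  rcases hs with rfl | rfl
  · rw [arccos_one, zero_sub, abs_neg, abs_of_pos (by linarith)]
    exact min_le_left _ _
  · rw [arccos_neg_one, abs_of_pos (by linarith)]
    exact min_le_right _ _

/-- The linear part of `δM_{j,j+d'}`. -/
def linM (θ s : ℝ) (n : ℕ) (x : ℤ → ℝ) (d' j : ℤ) : ℝ := if d' = 0 then -cb θ * (x j + x (j + 1))
  else if d' = 1 then (-1) ^ (n + j).natAbs * s * (cc θ / 2) * (x (j + 2) - x j)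
  else if d' = 2 then cb θ / 2 * (x (j + 1) + x (j + 2))
  else if d' = -1 then (-1) ^ (n + (j - 1)).natAbs * s * (cc θ / 2) * (x (j + 1) - x (j - 1))
  else cb θ / 2 * (x (j - 1) + x j)

lemma abs_cb_le (θ : ℝ) : |cb θ| ≤ 1 := by
  rw [cb, abs_mul]
  nlinarith [abs_cos_le_one (θ / 2), abs_sin_le_one (θ / 2), abs_nonneg (cos (θ / 2)),
    abs_nonneg (sin (θ / 2))]

lemma cc_le_one (θ : ℝ) : cc θ ≤ 1 := by linarith [ca_add_cc θ, ca_nonneg θ]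

lemma abs_Mstar_le (θ : ℝ) (j k : ℤ) : |Mstar θ j k| ≤ 1 := by
  have h1 := ca_add_cc θ
  have h2 := cc_nonneg θ
  have h3 := ca_nonneg θ
  rw [Mstar, abs_le]
  split_ifs <;> first | omega | (constructor <;> linarith)

lemma neg_one_pow_add_one_mul (N : ℕ) (s : ℝ) (hs : s = 1 ∨ s = -1) (A B : ℝ) :
    -((-1) ^ N * s * A * ((-1) ^ (N + 1) * s * B)) = A * B := by
  have h1 : ((-1 : ℝ) ^ N) * (-1) ^ N = 1 := by rw [← mul_pow]; norm_num
  rw [pow_succ]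
  linear_combination (s * s * A * B) * h1 + A * B * sign_sq hs

lemma abs_sign (N : ℕ) (hs : s = 1 ∨ s = -1) : |(-1 : ℝ) ^ N * s| = 1 := by
  rw [abs_mul, abs_pow, abs_neg, abs_one, one_pow, one_mul]
  rcases hs with rfl | rfl <;> norm_num

/-- The three non-trivial diagonals of `δM` on the block `j, k ≥ -n`. -/
lemma deltaM_sub_linM_of_nonneg (hV : ContinuousOn V 𝕁) (hs : s = 1 ∨ s = -1)
    (h0 : 0 < θ) (hpi : θ < π) {j : ℤ} (hj : 0 ≤ n + j) {d : ℤ} (hd : 0 ≤ d ∧ d ≤ 2) :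
    |deltaM V θ n j (j + d) - linM θ s n (xt V θ s n) d j|
      ≤ 60 * (xt V θ s n j ^ 2 + xt V θ s n (j + 1) ^ 2 + xt V θ s n (j + 2) ^ 2) := by
  have hx : ∀ l, |xt V θ s n l| ≤ 4 := fun l =>
    (xt_abs_le hV hs h0 hpi l).trans (by linarith [pi_lt_d2])
  obtain ⟨-, -, a0, -⟩ := xt_facts hV hs hj
  obtain ⟨-, -, a1, r1⟩ := xt_facts (n := n) (l := j + 1) hV hs (by omega)
  obtain ⟨-, -, a2, r2⟩ := xt_facts (n := n) (l := j + 2) hV hs (by omega)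
  set x := xt V θ s n with hxdef
  set N := (n + j).toNat with hN
  rw [show (n + (j + 1)).toNat = N + 1 by omega] at a1 r1
  rw [show (n + (j + 2)).toNat = N + 2 by omega] at a2 r2
  have hCx : ∀ l, |cos (θ / 2 + x l) - (cos (θ / 2) + -sin (θ / 2) * x l)|
      ≤ 3 * x l ^ 2 := fun l => by
    have := abs_cos_add_sub_le (θ / 2) (x l)
    rwa [sub_eq_add_neg (cos (θ / 2)), ← neg_mul] at this
  have hSx : ∀ l, |sin (θ / 2 + x l) - (sin (θ / 2) + cos (θ / 2) * x l)|
      ≤ 3 * x l ^ 2 := fun l => abs_sin_add_sub_le (θ / 2) (x l)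
  have hC1 := abs_cos_le_one (θ / 2)
  have hS1 := abs_sin_le_one (θ / 2)
  have hS1' : |-sin (θ / 2)| ≤ 1 := by rwa [abs_neg]
  have q0 := sq_nonneg (x j)
  have q1 := sq_nonneg (x (j + 1))
  have q2 := sq_nonneg (x (j + 2))
  have hd' : d = 0 ∨ d = 1 ∨ d = 2 := by omega
  rcases hd' with rfl | rfl | rfl
  · have h := abs_mul_sub_le (hCx j) (hCx (j + 1)) (abs_cos_le_one _) hC1 hS1' hS1' (hx j)
    have e : deltaM V θ n j (j + 0) - linM θ s n x 0 j = cos (θ / 2 + x j) * cos (θ / 2 + x (j + 1))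
          - (cos (θ / 2) * cos (θ / 2) + -sin (θ / 2) * cos (θ / 2) * x j
            + cos (θ / 2) * -sin (θ / 2) * x (j + 1)) := by
      rw [add_zero, deltaM, Mtilde_diag V θ n hj, ← hN, a0, a1, neg_one_pow_add_one_mul _ _ hs, linM,
        if_pos rfl, Mstar, if_pos rfl, if_neg (by omega), if_neg (by omega), ca, cb]
      ring
    rw [e]; linarith
  · have h := abs_mul_sub_le (hSx (j + 1)) (hCx j) (abs_cos_le_one _) hS1 hC1 hS1' (hx _)
    have h' := abs_mul_sub_le (hSx (j + 1)) (hCx (j + 2)) (abs_cos_le_one _) hS1 hC1 hS1' (hx _)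
    set E1 := sin (θ / 2 + x (j + 1)) * cos (θ / 2 + x j)
          - (sin (θ / 2) * cos (θ / 2) + cos (θ / 2) * cos (θ / 2) * x (j + 1)
            + sin (θ / 2) * -sin (θ / 2) * x j) with hE1
    set E2 := sin (θ / 2 + x (j + 1)) * cos (θ / 2 + x (j + 2))
          - (sin (θ / 2) * cos (θ / 2) + cos (θ / 2) * cos (θ / 2) * x (j + 1)
            + sin (θ / 2) * -sin (θ / 2) * x (j + 2)) with hE2
    have e : deltaM V θ n j (j + 1) - linM θ s n x 1 j = (-1) ^ N * s * ((E1 - E2) / 2) := by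
      rw [deltaM, Mtilde_one V θ n hj, ← hN, a0, a2, r1, linM, if_neg (by norm_num), if_pos rfl, Mstar,
        if_neg (by omega), if_neg (by omega), if_neg (by omega),
        show (n + j).natAbs = N by omega, pow_add, cc, hE1, hE2]
      ring
    rw [e, abs_mul, abs_sign _ hs, one_mul, abs_div, abs_two]
    have := abs_sub E1 E2
    linarith
  · have h := abs_mul_sub_le (hSx (j + 1)) (hSx (j + 2)) (abs_sin_le_one _) hS1 hC1 hC1 (hx _)
    have e : deltaM V θ n j (j + 2) - linM θ s n x 2 j
        = (sin (θ / 2 + x (j + 1)) * sin (θ / 2 + x (j + 2))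
          - (sin (θ / 2) * sin (θ / 2) + cos (θ / 2) * sin (θ / 2) * x (j + 1)
            + sin (θ / 2) * cos (θ / 2) * x (j + 2))) / 2 := by
      rw [deltaM, Mtilde_two V θ n hj, ← hN, r1, r2, linM, if_neg (by norm_num), if_neg (by norm_num),
        if_pos rfl, Mstar, if_neg (by omega), if_neg (by omega), if_pos (by omega), cc, cb]
      ring
    rw [e, abs_div, abs_two]; linarith

lemma abs_linM_le (hs : s = 1 ∨ s = -1) (x : ℤ → ℝ) {d : ℤ} (hd : 0 ≤ d ∧ d ≤ 2) (j : ℤ) :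
    |linM θ s n x d j| ≤ |x j| + |x (j + 1)| + |x (j + 2)| := by
  have hb := abs_cb_le θ
  have hc0 := cc_nonneg θ
  have hc1 := cc_le_one θ
  have p0 := abs_nonneg (x j)
  have p1 := abs_nonneg (x (j + 1))
  have p2 := abs_nonneg (x (j + 2))
  have hd' : d = 0 ∨ d = 1 ∨ d = 2 := by omega
  rcases hd' with rfl | rfl | rfl
  · rw [linM, if_pos rfl, abs_mul, abs_neg]
    nlinarith [abs_add_le (x j) (x (j + 1)), abs_nonneg (cb θ), abs_nonneg (x j + x (j + 1))]
  · rw [linM, if_neg (by norm_num), if_pos rfl, abs_mul, abs_mul, abs_sign _ hs,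
      abs_of_nonneg (by positivity : 0 ≤ cc θ / 2)]
    nlinarith [abs_sub (x (j + 2)) (x j), abs_nonneg (x (j + 2) - x j)]
  · rw [linM, if_neg (by norm_num), if_neg (by norm_num), if_pos rfl, abs_mul, abs_div, abs_two]
    nlinarith [abs_add_le (x (j + 1)) (x (j + 2)), abs_nonneg (cb θ), abs_nonneg (x (j + 1) + x (j + 2))]

lemma abs_deltaM_le (hV : ContinuousOn V 𝕁) (j k : ℤ) : |deltaM V θ n j k| ≤ 3 := by
  have h1 := abs_Mstar_le θ j k
  have h2 : |Mtilde V θ n j k| ≤ 2 := by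
    have ha := abs_alpha_le_one (n := n) hV
    have hr := abs_rho_le_one (n := n) hV
    wlog hjk : j ≤ k generalizing j k
    · rw [Mtilde_symm]
      exact this k j (abs_Mstar_le θ k j) (by omega)
    by_cases hk : j + 2 < k
    · rw [Mtilde_eq_zero V θ n (Or.inl hk), abs_zero]; norm_num
    by_cases hj : 0 ≤ n + j
    · have hm : ∀ a b : ℝ, |a| ≤ 1 → |b| ≤ 1 → |a * b| ≤ 1 := fun a b ha hb => by
        rw [abs_mul]; exact mul_le_one₀ ha (abs_nonneg _) hb
      have h5 : k = j ∨ k = j + 1 ∨ k = j + 2 := by omega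
      rcases h5 with rfl | rfl | rfl
      · rw [Mtilde_diag V θ n hj, abs_neg]
        exact (hm _ _ (ha _) (ha _)).trans (by norm_num)
      · rw [Mtilde_one V θ n hj, abs_div, abs_two, abs_mul]
        have := abs_sub (alpha V n (n + j).toNat) (alpha V n ((n + j).toNat + 2))
        have h6 := mul_le_mul (hr ((n + j).toNat + 1))
          (this.trans (add_le_add (ha _) (ha _))) (abs_nonneg _) zero_le_one
        linarith
      · rw [Mtilde_two V θ n hj, abs_div, abs_two]
        have := hm _ _ (hr ((n + j).toNat + 1)) (hr ((n + j).toNat + 2))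
        linarith
    · by_cases hk : 0 ≤ n + k
      · rw [Mtilde_low V θ n ⟨by omega, hk⟩, abs_zero]; norm_num
      · rw [Mtilde, if_neg (by omega), if_pos (by omega)]; linarith
  rw [deltaM]
  exact (abs_sub _ _).trans (by linarith)

/-- The local size of the deviations. -/
def locSq (x : ℤ → ℝ) (j : ℤ) : ℝ := ∑ i ∈ 𝔹, x (j + i) ^ 2

lemma locSq_eq (x : ℤ → ℝ) (j : ℤ) : locSq x j
    = x (j - 2) ^ 2 + (x (j - 1) ^ 2 + (x j ^ 2 + (x (j + 1) ^ 2 + x (j + 2) ^ 2))) := by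
  rw [locSq, sum_Icc_two, add_zero]; rfl

lemma locSq_nonneg (x : ℤ → ℝ) (j : ℤ) : 0 ≤ locSq x j := sum_nonneg fun _ _ => sq_nonneg _

/-- The bound holds across the corner `j < -n ≤ j + 2` too, since there `x̃_{-n}` is not small. -/
lemma exists_deltaM_sub_linM_bound (hV : ContinuousOn V 𝕁) (h0 : 0 < θ)
    (hpi : θ < π) : ∃ K : ℝ, 0 ≤ K ∧ ∀ (s : ℝ) (n : ℕ) (j d : ℤ), (s = 1 ∨ s = -1) →
    0 ≤ d → d ≤ 2 → |deltaM V θ n j (j + d) - linM θ s n (xt V θ s n) d j|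
      ≤ K * (xt V θ s n j ^ 2 + xt V θ s n (j + 1) ^ 2 + xt V θ s n (j + 2) ^ 2) := by
  set κ := (min (θ / 2) (π - θ / 2)) ^ 2 with hκ
  have hκ0 : 0 < κ := pow_pos (lt_min (by linarith) (by linarith)) 2
  refine ⟨60 + 15 / κ, by positivity, fun s n j d hs hd0 hd2 => ?_⟩
  have q0 := sq_nonneg (xt V θ s n j)
  have q1 := sq_nonneg (xt V θ s n (j + 1))
  have q2 := sq_nonneg (xt V θ s n (j + 2))
  have hκ1 : 0 ≤ 15 / κ := by positivity
  by_cases hj : 0 ≤ n + j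
  · refine (deltaM_sub_linM_of_nonneg hV hs h0 hpi hj ⟨hd0, hd2⟩).trans ?_
    exact mul_le_mul_of_nonneg_right (by linarith) (by linarith)
  have hlow := xt_low (V := V) (θ := θ) (s := s) (n := n) (l := j) (by omega)
  by_cases hj2 : n + (j + 2) < 0
  · have hM : deltaM V θ n j (j + d) = 0 := by
      rw [deltaM, Mtilde, if_neg (by omega), if_pos (by omega), sub_self]
    have hl := abs_linM_le (θ := θ) (n := n) hs (xt V θ s n) ⟨hd0, hd2⟩ j
    rw [hlow, xt_low (l := j + 1) (by omega), xt_low (l := j + 2) hj2] at hl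
    rw [hM, zero_sub, abs_neg, hlow, xt_low (l := j + 1) (by omega), xt_low (l := j + 2) hj2]
    simpa using hl
  · have h1 := abs_deltaM_le (θ := θ) (n := n) hV j (j + d)
    have h2 := abs_linM_le (θ := θ) (n := n) hs (xt V θ s n) ⟨hd0, hd2⟩ j
    have hx : ∀ l, |xt V θ s n l| ≤ 4 := fun l =>
      (xt_abs_le hV hs h0 hpi l).trans (by linarith [pi_lt_d2])
    -- the block boundary: one of the indices is `-n`
    have h3 : κ ≤ xt V θ s n j ^ 2 + xt V θ s n (j + 1) ^ 2 + xt V θ s n (j + 2) ^ 2 := by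
      have h4 := le_sq_xt_neg (n := n) hV hs h0 hpi
      have h5 : -(n : ℤ) = j + 1 ∨ -(n : ℤ) = j + 2 := by omega
      rcases h5 with h5 | h5 <;> rw [h5] at h4 <;> linarith
    have h5 : (15 : ℝ) ≤ 15 / κ
        * (xt V θ s n j ^ 2 + xt V θ s n (j + 1) ^ 2 + xt V θ s n (j + 2) ^ 2) := by
      rw [div_mul_eq_mul_div, le_div_iff₀ hκ0]; linarith
    refine (abs_sub _ _).trans ?_
    linarith [hx j, hx (j + 1), hx (j + 2)]

lemma linM_neg (x : ℤ → ℝ) (d j : ℤ) (h1 : -2 ≤ d) (h2 : d < 0) :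
    linM θ s n x d j = linM θ s n x (-d) (j + d) := by
  have hd' : d = -1 ∨ d = -2 := by omega
  rcases hd' with rfl | rfl
  · simp only [linM]
    norm_num
    rw [show j + -1 + 2 = j + 1 by ring, ← sub_eq_add_neg]
  · simp only [linM]
    norm_num
    left
    rw [show j + -2 + 1 = j - 1 by ring]

lemma sq_le_of_abs_le {a b c L : ℝ} (h : |L| ≤ |a| + |b| + |c|) :
    L ^ 2 ≤ 3 * (a ^ 2 + b ^ 2 + c ^ 2) := by
  rw [← sq_abs L, ← sq_abs a, ← sq_abs b, ← sq_abs c]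
  nlinarith [abs_nonneg L, sq_nonneg (|a| - |b|), sq_nonneg (|a| - |c|), sq_nonneg (|b| - |c|),
    abs_nonneg a, abs_nonneg b, abs_nonneg c]

lemma window_le_locSq (x : ℤ → ℝ) (j : ℤ) {d : ℤ} (hd : d = -2 ∨ d = -1 ∨ d = 0) :
    x (j + d) ^ 2 + x (j + d + 1) ^ 2 + x (j + d + 2) ^ 2 ≤ locSq x j := by
  have pp := fun l => sq_nonneg (x l)
  rw [locSq_eq]
  rcases hd with rfl | rfl | rfl
  · rw [show j + -2 + 1 = j - 1 by ring, show j + -2 + 2 = j by ring, ← sub_eq_add_neg]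
    linarith [pp (j + 1), pp (j + 2)]
  · rw [show j + -1 + 1 = j by ring, show j + -1 + 2 = j + 1 by ring, ← sub_eq_add_neg]
    linarith [pp (j - 2), pp (j + 2)]
  · rw [add_zero]; linarith [pp (j - 2), pp (j - 1)]

/-- First order expansion and size of the entries of `δM`. -/
lemma exists_deltaM_bound (hV : ContinuousOn V 𝕁) (h0 : 0 < θ) (hpi : θ < π) :
    ∃ K : ℝ, 0 ≤ K ∧ ∀ (s : ℝ) (n : ℕ) (j d : ℤ), (s = 1 ∨ s = -1) → -2 ≤ d → d ≤ 2 →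
    |deltaM V θ n j (j + d) - linM θ s n (xt V θ s n) d j| ≤ K * locSq (xt V θ s n) j ∧
    linM θ s n (xt V θ s n) d j ^ 2 ≤ K * locSq (xt V θ s n) j ∧
    deltaM V θ n j (j + d) ^ 2 ≤ K * locSq (xt V θ s n) j := by
  obtain ⟨K, hK0, hK⟩ := exists_deltaM_sub_linM_bound hV h0 hpi
  have hl : ∀ (s : ℝ) (n : ℕ) (j d : ℤ), (s = 1 ∨ s = -1) → -2 ≤ d → d ≤ 2 →
      linM θ s n (xt V θ s n) d j ^ 2 ≤ 3 * locSq (xt V θ s n) j ∧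
      |linM θ s n (xt V θ s n) d j| ≤ 12 := fun s n j d hs hd1 hd2 => by
    have hx : ∀ l, |xt V θ s n l| ≤ 4 := fun l =>
      (xt_abs_le hV hs h0 hpi l).trans (by linarith [pi_lt_d2])
    by_cases hd : 0 ≤ d
    · have h := abs_linM_le (θ := θ) (n := n) hs (xt V θ s n) ⟨hd, hd2⟩ j
      refine ⟨(sq_le_of_abs_le h).trans ?_, h.trans (by linarith [hx j, hx (j + 1), hx (j + 2)])⟩
      simpa using window_le_locSq (xt V θ s n) j (d := 0) (by simp)
    · have h := abs_linM_le (θ := θ) (n := n) (d := -d) hs (xt V θ s n) ⟨by omega, by omega⟩ (j + d)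
      rw [linM_neg _ d j hd1 (by omega)]
      refine ⟨(sq_le_of_abs_le h).trans
        (mul_le_mul_of_nonneg_left (window_le_locSq _ j (by omega)) (by norm_num)),
        h.trans (by linarith [hx (j + d), hx (j + d + 1), hx (j + d + 2)])⟩
  have hm : ∀ (s : ℝ) (n : ℕ) (j d : ℤ), (s = 1 ∨ s = -1) → -2 ≤ d → d ≤ 2 →
      |deltaM V θ n j (j + d) - linM θ s n (xt V θ s n) d j| ≤ K * locSq (xt V θ s n) j := fun s n j d hs hd1 hd2 => by
    by_cases hd : 0 ≤ d
    · refine (hK s n j d hs hd hd2).trans (mul_le_mul_of_nonneg_left ?_ hK0)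
      simpa using window_le_locSq (xt V θ s n) j (d := 0) (by simp)
    · have h := hK s n (j + d) (-d) hs (by omega) (by omega)
      rw [show j + d + -d = j by ring, deltaM_symm, ← linM_neg _ d j hd1 (by omega)] at h
      exact h.trans (mul_le_mul_of_nonneg_left (window_le_locSq _ j (by omega)) hK0)
  refine ⟨30 * K + 6, by positivity, fun s n j d hs hd1 hd2 => ?_⟩
  obtain ⟨h1, h2⟩ := hl s n j d hs hd1 hd2
  have h3 := hm s n j d hs hd1 hd2
  have hW := locSq_nonneg (xt V θ s n) j
  have hKW : 0 ≤ K * locSq (xt V θ s n) j := by positivity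
  refine ⟨by linarith, by linarith, ?_⟩
  have h4 : |deltaM V θ n j (j + d) - linM θ s n (xt V θ s n) d j| ≤ 15 :=
    (abs_sub _ _).trans (by linarith [abs_deltaM_le (θ := θ) (n := n) hV j (j + d)])
  have h5 : (deltaM V θ n j (j + d) - linM θ s n (xt V θ s n) d j) ^ 2
      ≤ 15 * (K * locSq (xt V θ s n) j) := by
    rw [← sq_abs, sq]
    exact mul_le_mul h4 h3 (abs_nonneg _) (by norm_num)
  nlinarith [sq_nonneg (deltaM V θ n j (j + d) - 2 * linM θ s n (xt V θ s n) d j)]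

end Linearization

/-! ### The string equation to first order in the deviations -/

section FirstOrder

/-- The decay rate `|m|^{-5/2}`, with the value `1` at `m = 0`. -/
def dec (m : ℤ) : ℝ := if m = 0 then 1 else |(m : ℝ)| ^ (-(5 / 2) : ℝ)

lemma dec_pos (m : ℤ) : 0 < dec m := by
  rw [dec]
  split_ifs with h
  · exact one_pos
  · exact rpow_pos_of_pos (abs_pos.2 (by exact_mod_cast h)) _

lemma summable_dec : Summable dec := by
  have h1 := summable_abs_int_rpow (b := 5 / 2) (by norm_num)
  refine ((hasSum_ite_eq (0 : ℤ) (1 : ℝ)).summable.add h1).of_nonneg_of_le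
    (fun m => (dec_pos m).le) (fun m => ?_)
  rw [dec]
  have : 0 ≤ |(m : ℝ)| ^ (-(5 / 2) : ℝ) := by positivity
  split_ifs <;> linarith

/-- A sum over `l` of values at `l / 2` runs twice through the values. -/
lemma hasSum_half {g : ℤ → ℝ} {a : ℝ} (hg : HasSum g a) : HasSum (fun l => g (l / 2)) (a + a) := by
  have i1 : Injective fun m : ℤ => 2 * m := fun a b h => by simp only at h; omega
  have i2 : Injective fun m : ℤ => 2 * m + 1 := fun a b h => by simp only at h; omega
  have hc : IsCompl (Set.range fun m : ℤ => 2 * m) (Set.range fun m : ℤ => 2 * m + 1) := by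
    constructor
    · rw [Set.disjoint_left]
      rintro _ ⟨a, rfl⟩ ⟨b, hb⟩
      simp only at hb; omega
    · rw [codisjoint_iff_le_sup]
      intro l _
      rcases emod_two_eq_zero_or_one l with h | h
      · exact Or.inl ⟨l / 2, by simp only; omega⟩
      · exact Or.inr ⟨l / 2, by simp only; omega⟩
  have f1 : (fun l => g (l / 2)) ∘ (fun m : ℤ => 2 * m) = g := by
    funext m
    exact congrArg g (by simp only; omega)
  have f2 : (fun l => g (l / 2)) ∘ (fun m : ℤ => 2 * m + 1) = g := by
    funext m
    exact congrArg g (by simp only; omega)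
  have g1 := (i1.hasSum_range_iff (f := fun l => g (l / 2))).2 (by rw [f1]; exact hg)
  have g2 := (i2.hasSum_range_iff (f := fun l => g (l / 2))).2 (by rw [f2]; exact hg)
  exact HasSum.add_isCompl hc g1 g2

lemma summable_dec_half : Summable fun l : ℤ => dec (l / 2) := (hasSum_half summable_dec.hasSum).summable

variable {V : ℝ → ℝ} {θ s : ℝ} {n : ℕ}

lemma exists_Bw_bound (h3 : ConditionC3 V) (hc : 0 < cc θ) : ∃ K : ℝ, 0 ≤ K ∧ ∀ d d' l : ℤ,
    -2 ≤ d → d ≤ 2 → -2 ≤ d' → d' ≤ 2 → |Bw V θ d d' l| ≤ K * dec (l / 2) := by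
  obtain ⟨B, hB0, -, -, hB⟩ := exists_Ev_bound h3 θ
  refine ⟨2 / cc θ * (B * 6), by positivity, fun d d' l h1 h2 h4 h5 => ?_⟩
  rw [Bw, Bcoef_eq h3 hc.ne']
  have hK : 0 ≤ 2 / cc θ * (B * 6) := by positivity
  split_ifs with h
  swap
  · rw [abs_zero]; exact mul_nonneg hK (dec_pos _).le
  rw [abs_mul, abs_of_nonneg (by positivity : 0 ≤ 2 / cc θ), mul_assoc, mul_assoc]
  refine mul_le_mul_of_nonneg_left ((hB _).trans ?_) (by positivity)
  rw [even_iff, even_iff] at h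
  set p := ((l - d).natAbs + (l + d' + 1).natAbs) / 2 with hp
  set m := l / 2 with hm
  have hpm : m.natAbs ≤ 2 * (p + 1) := by omega
  rw [div_eq_mul_inv]
  refine mul_le_mul_of_nonneg_left ?_ hB0
  have hq : (1 : ℝ) ≤ (p : ℝ) + 1 := by linarith [Nat.cast_nonneg (α := ℝ) p]
  have e1 : (((p : ℝ) + 1) ^ 2 * √((p : ℝ) + 1))⁻¹ = ((p : ℝ) + 1) ^ (-(5 / 2) : ℝ) := by
    rw [rpow_neg (by positivity), sqrt_eq_rpow, ← rpow_natCast, ← rpow_add (by positivity)]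
    norm_num
  rw [e1, dec]
  split_ifs with h0
  · have := rpow_le_one_of_one_le_of_nonpos hq (by norm_num : (-(5 / 2) : ℝ) ≤ 0)
    linarith
  · have hm0 : 0 < |(m : ℝ)| := abs_pos.2 (by exact_mod_cast h0)
    have hle : |(m : ℝ)| / 2 ≤ (p : ℝ) + 1 := by
      have : |(m : ℝ)| = ((m.natAbs : ℕ) : ℝ) := by
        rw [Nat.cast_natAbs, Int.cast_abs]
      rw [this]
      have : ((m.natAbs : ℕ) : ℝ) ≤ ((2 * (p + 1) : ℕ) : ℝ) := by exact_mod_cast hpm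
      push_cast at this; linarith
    refine (rpow_le_rpow_of_nonpos (by positivity) hle (by norm_num)).trans ?_
    rw [div_rpow hm0.le (by norm_num), div_eq_mul_inv, mul_comm]
    refine mul_le_mul_of_nonneg_right ?_ (by positivity)
    rw [← rpow_neg (by norm_num), neg_neg]
    have h6 : (2 : ℝ) ^ (5 / 2 : ℝ) = 4 * √2 := by
      rw [show (5 / 2 : ℝ) = 2 + 1 / 2 by norm_num, rpow_add (by norm_num), ← sqrt_eq_rpow]
      norm_num
    rw [h6]
    nlinarith [sq_sqrt (show (0 : ℝ) ≤ 2 by norm_num), sqrt_nonneg 2]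

/-- Reindexing a weighted sum of shifted values. -/
lemma hasSum_shift {w x : ℤ → ℝ} {K : ℝ} (hw : Summable w) (hx : ∀ l, |x l| ≤ K) (k r : ℤ) :
    Summable (fun l => w l * x (k + l + r)) ∧
    HasSum (fun i => w (i - r) * x (k + i)) (∑' l, w l * x (k + l + r)) := by
  have hs : Summable fun l => w l * x (k + l + r) := by
    refine Summable.of_norm_bounded (hw.abs.mul_right K) fun l => ?_
    rw [norm_eq_abs, abs_mul]
    exact mul_le_mul_of_nonneg_left (hx _) (abs_nonneg _)
  refine ⟨hs, ?_⟩
  have := (Equiv.subRight r).hasSum_iff.2 hs.hasSum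
  convert! this using 2 with i
  simp only [Function.comp, Equiv.subRight_apply]
  congr 2; ring

lemma summable_Bw (h3 : ConditionC3 V) (hc : 0 < cc θ) {d d' : ℤ}
    (h1 : -2 ≤ d ∧ d ≤ 2) (h2 : -2 ≤ d' ∧ d' ≤ 2) : Summable (Bw V θ d d') := by
  obtain ⟨K, hK0, hK⟩ := exists_Bw_bound h3 hc
  exact Summable.of_norm_bounded (summable_dec_half.mul_left K) fun l =>
    hK d d' l h1.1 h1.2 h2.1 h2.2

lemma hasSum_gOdd (h3 : ConditionC3 V) (hc : 0 < cc θ) {x : ℤ → ℝ} {K : ℝ} (hx : ∀ l, |x l| ≤ K)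
    {d : ℤ} (hd : d = 1 ∨ d = -1) (k : ℤ) :
    HasSum (fun i => cb θ * gOdd V θ d i * x (k + i))
      (∑ d' ∈ 𝔹, ∑' l, Bw V θ d d' l * linM θ s n x d' (k + l)) := by
  have hb : ∀ d', -2 ≤ d' ∧ d' ≤ 2 → Summable (Bw V θ d d') := fun d' h =>
    summable_Bw h3 hc (by omega) h
  have hz : ∀ d' : ℤ, d' % 2 ≠ 0 → ∑' l, Bw V θ d d' l * linM θ s n x d' (k + l) = 0 := fun d' h => by
    simp only [fun l => Bw_eq_zero (d := d) (d' := d') (l := l) h3 hc.ne' (by omega), zero_mul,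
      tsum_zero]
  have a0 := hasSum_shift (hb 0 (by norm_num)) hx k 0
  have a1 := hasSum_shift (hb 0 (by norm_num)) hx k 1
  have b1 := hasSum_shift (hb 2 (by norm_num)) hx k 1
  have b2 := hasSum_shift (hb 2 (by norm_num)) hx k 2
  have c1 := hasSum_shift (hb (-2) (by norm_num)) hx k (-1)
  have c0 := hasSum_shift (hb (-2) (by norm_num)) hx k 0
  rw [sum_Icc_two, hz (-1) (by norm_num), hz 1 (by norm_num)]
  have e0 : ∑' l, Bw V θ d 0 l * linM θ s n x 0 (k + l) = -cb θ *
      (∑' l, Bw V θ d 0 l * x (k + l + 0) + ∑' l, Bw V θ d 0 l * x (k + l + 1)) := by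
    rw [← a0.1.tsum_add a1.1, ← tsum_mul_left]
    refine tsum_congr fun l => ?_
    rw [linM, if_pos rfl, add_zero]; ring
  have e2 : ∑' l, Bw V θ d 2 l * linM θ s n x 2 (k + l) = cb θ / 2 *
      (∑' l, Bw V θ d 2 l * x (k + l + 1) + ∑' l, Bw V θ d 2 l * x (k + l + 2)) := by
    rw [← b1.1.tsum_add b2.1, ← tsum_mul_left]
    refine tsum_congr fun l => ?_
    rw [linM, if_neg (by norm_num), if_neg (by norm_num), if_pos rfl]; ring
  have e3 : ∑' l, Bw V θ d (-2) l * linM θ s n x (-2) (k + l) = cb θ / 2 *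
      (∑' l, Bw V θ d (-2) l * x (k + l + -1) + ∑' l, Bw V θ d (-2) l * x (k + l + 0)) := by
    rw [← c1.1.tsum_add c0.1, ← tsum_mul_left]
    refine tsum_congr fun l => ?_
    rw [linM, if_neg (by norm_num), if_neg (by norm_num), if_neg (by norm_num), if_neg (by norm_num),
      add_zero, ← sub_eq_add_neg]; ring
  rw [e0, e2, e3]
  convert! ((c1.2.add c0.2).mul_left (cb θ / 2)).add (((a0.2.add a1.2).mul_left (-cb θ)).add
    ((b1.2.add b2.2).mul_left (cb θ / 2))) using 1
  · ext i
    rw [gOdd]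
    simp only [sub_zero, sub_neg_eq_add]; ring
  · ring

lemma hasSum_gEven (h3 : ConditionC3 V) (hc : 0 < cc θ) {x : ℤ → ℝ} {K : ℝ} (hx : ∀ l, |x l| ≤ K)
    {d : ℤ} (hd : d = 2 ∨ d = -2) (k : ℤ) :
    HasSum (fun i => (-1) ^ (n + k).natAbs * s * (cc θ / 2) * gEven V θ d i * x (k + i))
      (∑ d' ∈ 𝔹, ∑' l, Bw V θ d d' l * linM θ s n x d' (k + l)) := by
  have hb : ∀ d', -2 ≤ d' ∧ d' ≤ 2 → Summable (Bw V θ d d') := fun d' h =>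
    summable_Bw h3 hc (by omega) h
  have hz : ∀ d' : ℤ, d' % 2 = 0 → ∑' l, Bw V θ d d' l * linM θ s n x d' (k + l) = 0 := fun d' h => by
    simp only [fun l => Bw_eq_zero (d := d) (d' := d') (l := l) h3 hc.ne' (by omega), zero_mul,
      tsum_zero]
  have a2 := hasSum_shift (hb 1 (by norm_num)) hx k 2
  have a0 := hasSum_shift (hb 1 (by norm_num)) hx k 0
  have b1 := hasSum_shift (hb (-1) (by norm_num)) hx k 1
  have b2 := hasSum_shift (hb (-1) (by norm_num)) hx k (-1)
  rw [sum_Icc_two, hz (-2) (by norm_num), hz 0 (by norm_num), hz 2 (by norm_num)]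
  -- only even `l` contribute, and the sign of the linear part depends on the parity of `l`
  have hsg : ∀ (d' l : ℤ) (y : ℝ), Bw V θ d d' l * ((-1) ^ (n + (k + l)).natAbs * y)
      = Bw V θ d d' l * ((-1) ^ (n + k).natAbs * y) := fun d' l y => by
    by_cases h : l % 2 = 0
    · congr 2
      rcases emod_two_eq_zero_or_one (n + k) with h1 | h1
      · rw [Even.neg_one_pow (natAbs_even.2 (even_iff.2 (by omega))),
          Even.neg_one_pow (natAbs_even.2 (even_iff.2 h1))]
      · rw [Odd.neg_one_pow (natAbs_odd.2 (odd_iff.2 (by omega))),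
          Odd.neg_one_pow (natAbs_odd.2 (odd_iff.2 h1))]
    · rw [Bw_eq_zero h3 hc.ne' (by omega), zero_mul, zero_mul]
  have hsg' : ∀ j : ℤ, (-1 : ℝ) ^ (n + (j - 1)).natAbs = -(-1) ^ (n + j).natAbs := fun j => by
    rcases emod_two_eq_zero_or_one (n + j) with h1 | h1
    · rw [Odd.neg_one_pow (natAbs_odd.2 (odd_iff.2 (by omega))),
        Even.neg_one_pow (natAbs_even.2 (even_iff.2 h1))]
    · rw [Even.neg_one_pow (natAbs_even.2 (even_iff.2 (by omega))),
        Odd.neg_one_pow (natAbs_odd.2 (odd_iff.2 h1)), neg_neg]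
  have e1 : ∑' l, Bw V θ d 1 l * linM θ s n x 1 (k + l) = (-1) ^ (n + k).natAbs * s * (cc θ / 2) *
      (∑' l, Bw V θ d 1 l * x (k + l + 2) - ∑' l, Bw V θ d 1 l * x (k + l + 0)) := by
    rw [← a2.1.tsum_sub a0.1, ← tsum_mul_left]
    refine tsum_congr fun l => ?_
    rw [linM, if_neg (by norm_num), if_pos rfl, mul_assoc, mul_assoc, hsg, add_zero]; ring
  have e2 : ∑' l, Bw V θ d (-1) l * linM θ s n x (-1) (k + l)
      = -((-1) ^ (n + k).natAbs * s * (cc θ / 2)) *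
      (∑' l, Bw V θ d (-1) l * x (k + l + 1) - ∑' l, Bw V θ d (-1) l * x (k + l + -1)) := by
    rw [← b1.1.tsum_sub b2.1, ← tsum_mul_left]
    refine tsum_congr fun l => ?_
    rw [linM, if_neg (by norm_num), if_neg (by norm_num), if_neg (by norm_num), if_pos rfl, hsg',
      neg_mul, neg_mul, neg_mul, mul_neg, mul_assoc ((-1) ^ _), mul_assoc ((-1) ^ _), hsg,
      ← sub_eq_add_neg]
    ring
  rw [e1, e2]
  convert! ((b1.2.sub b2.2).mul_left (-((-1) ^ (n + k).natAbs * s * (cc θ / 2)))).add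
    ((a2.2.sub a0.2).mul_left ((-1) ^ (n + k).natAbs * s * (cc θ / 2))) using 1
  · ext i
    rw [gEven]
    simp only [sub_zero, sub_neg_eq_add]; ring
  · ring

lemma hasSum_gFin (x : ℤ → ℝ) (k : ℤ) : HasSum (fun i => gFin V θ i * x (k + i))
    (1 / cc θ * (ca θ * x (k + 1) - cc θ / 2 * (x k + x (k + 2)) + x k)
      + vc V θ 0 * ((ca θ + cc θ / 2) * (x (k + 1) - x k) - cc θ / 2 * (x (k + 2) - x (k - 1)))) := by
  have h : ∀ j : ℤ, HasSum (fun i => if i = j then x (k + j) else 0) (x (k + j)) := fun j =>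
    hasSum_ite_eq j _
  have h0 := h 0
  have h1 := h 1
  have h2 := h 2
  have h4 := h (-1)
  rw [add_zero] at h0
  rw [← sub_eq_add_neg] at h4
  convert! ((((h1.mul_left (ca θ)).sub ((h0.add h2).mul_left (cc θ / 2))).add h0).mul_left
    (1 / cc θ)).add ((((h1.sub h0).mul_left (ca θ + cc θ / 2)).sub
      ((h2.sub h4).mul_left (cc θ / 2))).mul_left (vc V θ 0)) using 1
  ext i
  rw [gFin]
  split_ifs with q1 q2 q3 q4 q5 q6 q7 <;> first | omega | (subst_vars; simp [sub_eq_add_neg]; try ring)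

/-- The entries `L⋆_{k,k+d}`. -/
def Lst (θ s : ℝ) (n : ℕ) (k d : ℤ) : ℝ := if d = 1 then s * cb θ else if d = -1 then -(s * cb θ)
  else if d = 2 then -((-1) ^ (n + k).natAbs * (cc θ / 2))
  else if d = -2 then (-1) ^ (n + k).natAbs * (cc θ / 2) else 0

/-- The linear part of the string equation is the convolution with the coefficients `A_l`. -/
lemma hasSum_linear_part (h3 : ConditionC3 V) (hc : 0 < cc θ)
    (hv : vc V θ 1 = vc V θ 0 + 1 / cc θ) (hs : s = 1 ∨ s = -1) {x : ℤ → ℝ} {K : ℝ}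
    (hx : ∀ l, |x l| ≤ K) (k : ℤ) :
    HasSum (fun i => Acoef V θ i * x (k + i))
      ((1 / cc θ * (ca θ * x (k + 1) - cc θ / 2 * (x k + x (k + 2)) + x k)
      + vc V θ 0 * ((ca θ + cc θ / 2) * (x (k + 1) - x k) - cc θ / 2 * (x (k + 2) - x (k - 1))))
      + s * ∑ d ∈ 𝔹, Lst θ s n k d
        * ∑ d' ∈ 𝔹, ∑' l, Bw V θ d d' l * linM θ s n x d' (k + l)) := by
  have h1 := hasSum_gOdd (s := s) (n := n) h3 hc hx (Or.inl rfl) k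
  have h2 := hasSum_gOdd (s := s) (n := n) h3 hc hx (Or.inr rfl) k
  have h4 := hasSum_gEven (s := s) (n := n) h3 hc hx (Or.inl rfl) k
  have h5 := hasSum_gEven (s := s) (n := n) h3 hc hx (Or.inr rfl) k
  have hss := sign_sq hs
  set σ : ℝ := (-1) ^ (n + k).natAbs with hσ
  have hσσ : σ * σ = 1 := by rw [hσ, ← mul_pow]; norm_num
  have hb : cb θ * cb θ = ca θ * cc θ := by rw [cb, ca, cc]; ring
  rw [sum_Icc_two]
  simp only [Lst]
  norm_num only [if_true, if_false]
  convert! (hasSum_gFin x k).add (((h5.mul_left (σ * (cc θ / 2))).add ((h2.mul_left (-(s * cb θ))).add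
    ((h1.mul_left (s * cb θ)).add (h4.mul_left (-(σ * (cc θ / 2))))))).mul_left s) using 1
  · ext i
    rw [← linear_coefficient h3 hc.ne' hv i]
    linear_combination (-(gOdd V θ 1 i - gOdd V θ (-1) i) * x (k + i)) * hb
      - (cb θ * cb θ * (gOdd V θ 1 i - gOdd V θ (-1) i) * x (k + i)) * hss
      + (cc θ ^ 2 / 4 * (gEven V θ 2 i - gEven V θ (-2) i) * x (k + i)) * (σ * σ * hss + hσσ)
  · simp only [zero_mul, zero_add, hσ]

lemma abs_matC_le (hV : ContinuousOn V 𝕁) (j k : ℕ) : |matC V n j k| ≤ 1 := by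
  have ha := abs_alpha_le_one (n := n) hV
  have hr := abs_rho_le_one (n := n) hV
  have hm : ∀ a b : ℝ, |a| ≤ 1 → |b| ≤ 1 → |a * b| ≤ 1 := fun a b ha hb => by
    rw [abs_mul]; exact mul_le_one₀ ha (abs_nonneg _) hb
  rw [matC, cmv]
  split_ifs <;> first
    | (rw [abs_zero]; exact zero_le_one)
    | (try rw [abs_neg]
       apply hm <;> first | exact ha _ | exact hr _)

lemma abs_Ltilde_le (hV : ContinuousOn V 𝕁) (j k : ℤ) : |Ltilde V n j k| ≤ 1 := by
  rw [Ltilde]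
  split_ifs
  · rw [abs_div, abs_two]
    have := abs_sub (matC V n (n + j).toNat (n + k).toNat) (matC V n (n + k).toNat (n + j).toNat)
    linarith [abs_matC_le (n := n) hV (n + j).toNat (n + k).toNat,
      abs_matC_le (n := n) hV (n + k).toNat (n + j).toNat]
  · rw [abs_zero]; exact zero_le_one

lemma abs_cos_add_sub_cos_le (x y : ℝ) : |cos (x + y) - cos x| ≤ |y| := by
  have := Real.abs_cos_sub_cos_le (x + y) x
  simpa using this

lemma abs_sin_add_sub_sin_le (x y : ℝ) : |sin (x + y) - sin x| ≤ |y| := by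
  have := Real.abs_sin_sub_sin_le (x + y) x
  simpa using this

lemma Ltilde_one_eq (hV : ContinuousOn V 𝕁) (hs : s = 1 ∨ s = -1) {j : ℤ}
    (hj : 0 ≤ n + j) : Ltilde V n j (j + 1) = s * (sin (θ / 2 + xt V θ s n (j + 1))
      * (cos (θ / 2 + xt V θ s n j) + cos (θ / 2 + xt V θ s n (j + 2))) / 2) := by
  obtain ⟨-, -, a0, -⟩ := xt_facts hV hs hj
  obtain ⟨-, -, -, r1⟩ := xt_facts (n := n) (l := j + 1) hV hs (by omega)
  obtain ⟨-, -, a2, -⟩ := xt_facts (n := n) (l := j + 2) hV hs (by omega)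
  rw [show (n + (j + 1)).toNat = (n + j).toNat + 1 by omega] at r1
  rw [show (n + (j + 2)).toNat = (n + j).toNat + 2 by omega] at a2
  rw [Ltilde_one V n hj, a0, a2, r1, pow_add]
  have h1 : ((-1 : ℝ) ^ (n + j).toNat) * (-1) ^ (n + j).toNat = 1 := by rw [← mul_pow]; norm_num
  linear_combination (s * (sin (θ / 2 + xt V θ s n (j + 1))
      * (cos (θ / 2 + xt V θ s n j) + cos (θ / 2 + xt V θ s n (j + 2))) / 2)) * h1

lemma Ltilde_two_eq (hV : ContinuousOn V 𝕁) (hs : s = 1 ∨ s = -1) {j : ℤ}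
    (hj : 0 ≤ n + j) : Ltilde V n j (j + 2) = -((-1) ^ (n + j).natAbs
      * (sin (θ / 2 + xt V θ s n (j + 1)) * sin (θ / 2 + xt V θ s n (j + 2)) / 2)) := by
  obtain ⟨-, -, -, r1⟩ := xt_facts (n := n) (l := j + 1) hV hs (by omega)
  obtain ⟨-, -, -, r2⟩ := xt_facts (n := n) (l := j + 2) hV hs (by omega)
  rw [show (n + (j + 1)).toNat = (n + j).toNat + 1 by omega] at r1
  rw [show (n + (j + 2)).toNat = (n + j).toNat + 2 by omega] at r2
  rw [Ltilde_two V n hj, r1, r2, show (n + j).natAbs = (n + j).toNat by omega]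

lemma sq_Ltilde_sub_Lst_le (hV : ContinuousOn V 𝕁) (hs : s = 1 ∨ s = -1) {k d : ℤ}
    (hk : 2 ≤ n + k) (hd : -2 ≤ d ∧ d ≤ 2) :
    (Ltilde V n k (k + d) - Lst θ s n k d) ^ 2 ≤ 3 * locSq (xt V θ s n) k := by
  have hS1 := abs_sin_le_one (θ / 2)
  have hC1 := abs_cos_le_one (θ / 2)
  set x := xt V θ s n with hx
  have hsig : ∀ N : ℕ, |(-1 : ℝ) ^ N| = 1 := fun N => by
    rw [abs_pow, abs_neg, abs_one, one_pow]
  have hs1 : |s| = 1 := by rcases hs with rfl | rfl <;> norm_num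
  have one : ∀ j : ℤ, 0 ≤ n + j → |Ltilde V n j (j + 1) - s * cb θ|
      ≤ |x j| + |x (j + 1)| + |x (j + 2)| := fun j hj => by
    rw [Ltilde_one_eq hV hs hj, ← hx, cb, ← mul_sub, abs_mul, hs1, one_mul]
    have e : sin (θ / 2 + x (j + 1)) * (cos (θ / 2 + x j) + cos (θ / 2 + x (j + 2))) / 2
        - cos (θ / 2) * sin (θ / 2)
        = sin (θ / 2 + x (j + 1)) * ((cos (θ / 2 + x j) - cos (θ / 2))
          + (cos (θ / 2 + x (j + 2)) - cos (θ / 2))) / 2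
          + (sin (θ / 2 + x (j + 1)) - sin (θ / 2)) * cos (θ / 2) := by ring
    rw [e]
    refine (abs_add_le _ _).trans ?_
    rw [abs_div, abs_two, abs_mul, abs_mul]
    have t1 := abs_cos_add_sub_cos_le (θ / 2) (x j)
    have t2 := abs_cos_add_sub_cos_le (θ / 2) (x (j + 2))
    have t3 := abs_sin_add_sub_sin_le (θ / 2) (x (j + 1))
    have t4 := (abs_add_le (cos (θ / 2 + x j) - cos (θ / 2))
      (cos (θ / 2 + x (j + 2)) - cos (θ / 2))).trans (add_le_add t1 t2)
    have t5 := mul_le_mul (abs_sin_le_one (θ / 2 + x (j + 1))) t4 (abs_nonneg _) zero_le_one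
    have t6 := mul_le_mul t3 hC1 (abs_nonneg _) (abs_nonneg _)
    linarith [abs_nonneg (x j), abs_nonneg (x (j + 2))]
  have two : ∀ j : ℤ, 0 ≤ n + j → |Ltilde V n j (j + 2) + (-1) ^ (n + j).natAbs * (cc θ / 2)|
      ≤ |x j| + |x (j + 1)| + |x (j + 2)| := fun j hj => by
    rw [Ltilde_two_eq hV hs hj, ← hx, cc, neg_add_eq_sub, ← mul_sub, abs_mul, hsig, one_mul]
    have e : sin (θ / 2) ^ 2 / 2 - sin (θ / 2 + x (j + 1)) * sin (θ / 2 + x (j + 2)) / 2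
        = -(sin (θ / 2 + x (j + 1)) * (sin (θ / 2 + x (j + 2)) - sin (θ / 2))
          + (sin (θ / 2 + x (j + 1)) - sin (θ / 2)) * sin (θ / 2)) / 2 := by ring
    rw [e, abs_div, abs_neg, abs_two]
    have t1 := abs_sin_add_sub_sin_le (θ / 2) (x (j + 2))
    have t3 := abs_sin_add_sub_sin_le (θ / 2) (x (j + 1))
    have t5 := mul_le_mul (abs_sin_le_one (θ / 2 + x (j + 1))) t1 (abs_nonneg _) zero_le_one
    have t6 := mul_le_mul t3 hS1 (abs_nonneg _) (abs_nonneg _)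
    have t7 := abs_add_le (sin (θ / 2 + x (j + 1)) * (sin (θ / 2 + x (j + 2)) - sin (θ / 2)))
      ((sin (θ / 2 + x (j + 1)) - sin (θ / 2)) * sin (θ / 2))
    rw [abs_mul, abs_mul] at t7
    linarith [abs_nonneg (x j), abs_nonneg (x (j + 2)), abs_nonneg (x (j + 1))]
  have pp := fun l => sq_nonneg (x l)
  rw [locSq_eq]
  have hd' : d = -2 ∨ d = -1 ∨ d = 0 ∨ d = 1 ∨ d = 2 := by omega
  rcases hd' with rfl | rfl | rfl | rfl | rfl
  · have h := sq_le_of_abs_le (two (k - 2) (by omega))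
    rw [show k - 2 + 2 = k by ring, show k - 2 + 1 = k - 1 by ring] at h
    have hpar : (-1 : ℝ) ^ (n + (k - 2)).natAbs = (-1) ^ (n + k).natAbs := by
      rw [show (n + k).natAbs = (n + (k - 2)).natAbs + 2 by omega, pow_add]; norm_num
    rw [hpar] at h
    rw [Ltilde_antisymm, ← sub_eq_add_neg]
    norm_num [Lst]
    rw [← neg_add', neg_sq]
    linarith [pp (k + 1), pp (k + 2)]
  · have h := sq_le_of_abs_le (one (k - 1) (by omega))
    rw [show k - 1 + 1 = k by ring, show k - 1 + 2 = k + 1 by ring] at h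
    rw [Ltilde_antisymm, ← sub_eq_add_neg]
    norm_num [Lst]
    rw [show -Ltilde V n (k - 1) k + s * cb θ = -(Ltilde V n (k - 1) k - s * cb θ) by ring, neg_sq]
    linarith [pp (k - 2), pp (k + 2)]
  · norm_num [Lst, Ltilde_diag]
    linarith [pp (k - 2), pp (k - 1), pp k, pp (k + 1), pp (k + 2)]
  · have h := sq_le_of_abs_le (one k (by omega))
    rw [Lst, if_pos rfl]
    linarith [pp (k - 2), pp (k - 1)]
  · have h := sq_le_of_abs_le (two k (by omega))
    norm_num [Lst]
    linarith [pp (k - 2), pp (k - 1)]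

lemma abs_Ltilde_one_sub_le (hV : ContinuousOn V 𝕁) (hs : s = 1 ∨ s = -1)
    (h0 : 0 < θ) (hpi : θ < π) {j : ℤ} (hj : 0 ≤ n + j) :
    |s * Ltilde V n j (j + 1) - (cb θ + ca θ * xt V θ s n (j + 1)
      - cc θ / 2 * (xt V θ s n j + xt V θ s n (j + 2)))|
      ≤ 20 * (xt V θ s n j ^ 2 + 2 * xt V θ s n (j + 1) ^ 2 + xt V θ s n (j + 2) ^ 2) := by
  have hx4 : ∀ l, |xt V θ s n l| ≤ 4 := fun l =>
    (xt_abs_le hV hs h0 hpi l).trans (by linarith [pi_lt_d2])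
  rw [Ltilde_one_eq hV hs hj]
  set x := xt V θ s n with hxdef
  have hCx : ∀ l, |cos (θ / 2 + x l) - (cos (θ / 2) + -sin (θ / 2) * x l)|
      ≤ 3 * x l ^ 2 := fun l => by
    have := abs_cos_add_sub_le (θ / 2) (x l)
    rwa [sub_eq_add_neg (cos (θ / 2)), ← neg_mul] at this
  have hSx := abs_sin_add_sub_le (θ / 2) (x (j + 1))
  have hC1 := abs_cos_le_one (θ / 2)
  have hS1 := abs_sin_le_one (θ / 2)
  have hS1' : |-sin (θ / 2)| ≤ 1 := by rwa [abs_neg]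
  have h := abs_mul_sub_le hSx (hCx j) (abs_cos_le_one _) hS1 hC1 hS1' (hx4 _)
  have h' := abs_mul_sub_le hSx (hCx (j + 2)) (abs_cos_le_one _) hS1 hC1 hS1' (hx4 _)
  refine abs_le.2 ⟨?_, ?_⟩ <;> rw [← mul_assoc, sign_sq hs, one_mul, ca, cb, cc] <;>
    linarith [abs_le.1 h, abs_le.1 h', (abs_le.1 h).1, (abs_le.1 h).2, (abs_le.1 h').1, (abs_le.1 h').2]

/-- Expansion of the cotangent. -/
lemma abs_cot_sub_le (h0 : 0 < θ) (hpi : θ < π) {x : ℝ} (hx4 : |x| ≤ 4)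
    (hx : |x| ≤ sin (θ / 2) / 2) :
    |cos (θ / 2 + x) / sin (θ / 2 + x) - (cb θ / cc θ - x / cc θ)|
      ≤ 38 / (cc θ * sin (θ / 2)) * x ^ 2 := by
  have hs0 := sin_half_pos h0 hpi
  have hc := cc_pos h0 hpi
  have h1 := abs_cos_add_sub_le (θ / 2) x
  have h2 := abs_sin_add_sub_le (θ / 2) x
  have h4 : sin (θ / 2) / 2 ≤ sin (θ / 2 + x) := by
    have := (abs_le.1 (abs_sin_add_sub_sin_le (θ / 2) x)).1
    linarith
  have h5 : 0 < sin (θ / 2 + x) := by linarith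
  have hC1 := abs_cos_le_one (θ / 2)
  have hS1 := abs_sin_le_one (θ / 2)
  set e1 := cos (θ / 2 + x) - (cos (θ / 2) - sin (θ / 2) * x) with he1
  set e2 := sin (θ / 2 + x) - (sin (θ / 2) + cos (θ / 2) * x) with he2
  have hsc := sin_sq_add_cos_sq (θ / 2)
  have e : cos (θ / 2 + x) / sin (θ / 2 + x) - (cb θ / cc θ - x / cc θ)
      = (sin (θ / 2) ^ 2 * e1 - cos (θ / 2) * sin (θ / 2) * e2
        + cos (θ / 2) * x ^ 2 + x * e2) / (cc θ * sin (θ / 2 + x)) := by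
    have alg : ∀ S C T U : ℝ, S ≠ 0 → T ≠ 0 → S ^ 2 + C ^ 2 = 1 →
        U / T - (C * S / S ^ 2 - x / S ^ 2) = (S ^ 2 * (U - (C - S * x)) - C * S * (T - (S + C * x))
          + C * x ^ 2 + x * (T - (S + C * x))) / (S ^ 2 * T) := fun S C T U hS hT h => by
      field_simp
      linear_combination (-(S * x)) * h
    exact alg _ _ _ _ hs0.ne' h5.ne' hsc
  rw [e, abs_div, abs_of_pos (by positivity : 0 < cc θ * sin (θ / 2 + x)),
    div_mul_eq_mul_div, div_le_div_iff₀ (by positivity) (by positivity)]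
  have hn : |sin (θ / 2) ^ 2 * e1 - cos (θ / 2) * sin (θ / 2) * e2
      + cos (θ / 2) * x ^ 2 + x * e2| ≤ 19 * x ^ 2 := by
    have t1 : |sin (θ / 2) ^ 2 * e1| ≤ 1 * (3 * x ^ 2) := by
      rw [abs_mul, abs_pow]
      exact mul_le_mul (pow_le_one₀ (abs_nonneg _) hS1) h1 (abs_nonneg _) zero_le_one
    have t2 : |cos (θ / 2) * sin (θ / 2) * e2| ≤ 1 * (3 * x ^ 2) := by
      rw [abs_mul]
      exact mul_le_mul (abs_cb_le θ) h2 (abs_nonneg _) zero_le_one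
    have t3 : |cos (θ / 2) * x ^ 2| ≤ 1 * x ^ 2 := by
      rw [abs_mul, abs_pow, sq_abs]
      exact mul_le_mul_of_nonneg_right hC1 (sq_nonneg _)
    have t4 : |x * e2| ≤ 4 * (3 * x ^ 2) := by
      rw [abs_mul]
      exact mul_le_mul hx4 h2 (abs_nonneg _) (by norm_num)
    refine (abs_add_le _ _).trans ((add_le_add ((abs_add_le _ _).trans
      (add_le_add (abs_sub _ _) le_rfl)) le_rfl).trans ?_)
    linarith
  have m1 := mul_le_mul_of_nonneg_right hn (by positivity : 0 ≤ cc θ * sin (θ / 2))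
  have m2 := mul_le_mul_of_nonneg_left h4 (by positivity : 0 ≤ 38 * x ^ 2 * cc θ)
  linarith

lemma sq_xt_le_S {i : ℤ} (hi : -10 ≤ i ∧ i ≤ 10) (k : ℤ) : xt V θ s n (k + i) ^ 2 ≤ S V θ s n k :=
  Finset.single_le_sum (f := fun j => xt V θ s n (k + j) ^ 2) (fun _ _ => sq_nonneg _)
    (Finset.mem_Icc.2 hi)

lemma locSq_le_S {i : ℤ} (hi : -8 ≤ i ∧ i ≤ 8) (k : ℤ) :
    locSq (xt V θ s n) (k + i) ≤ 5 * S V θ s n k := by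
  have h : ∀ j ∈ 𝔹, xt V θ s n (k + i + j) ^ 2 ≤ S V θ s n k := fun j hj => by
    rw [Finset.mem_Icc] at hj
    rw [add_assoc]
    exact sq_xt_le_S (by omega) k
  have := sum_le_sum h
  rw [sum_const, show (𝔹).card = 5 by decide, nsmul_eq_mul] at this
  exact_mod_cast this

lemma S_nonneg (k : ℤ) : 0 ≤ S V θ s n k := sum_nonneg fun _ _ => sq_nonneg _

lemma S_le (hV : ContinuousOn V 𝕁) (hs : s = 1 ∨ s = -1) (h0 : 0 < θ)
    (hpi : θ < π) (k : ℤ) : S V θ s n k ≤ 336 := by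
  have h : ∀ j ∈ Finset.Icc (-10 : ℤ) 10, xt V θ s n (k + j) ^ 2 ≤ 16 := fun j _ => by
    have := (xt_abs_le (n := n) hV hs h0 hpi (k + j)).trans (by linarith [pi_lt_d2] : π ≤ 4)
    rw [← sq_abs]; nlinarith [abs_nonneg (xt V θ s n (k + j))]
  have := sum_le_sum h
  rw [sum_const, show (Finset.Icc (-10 : ℤ) 10).card = 21 by decide, nsmul_eq_mul] at this
  exact this.trans (by norm_num)

/-- The sum of the distant deviations with the weights `|l|^{-5/2}`. -/
def farSum (V : ℝ → ℝ) (θ s : ℝ) (n : ℕ) (k : ℤ) : ℝ :=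
  ∑' l : ℤ, if l = 0 then 0 else S V θ s n (k + 2 * l) * |(l : ℝ)| ^ (-(5 / 2) : ℝ)

lemma hasSum_dec_mul_S (hV : ContinuousOn V 𝕁) (hs : s = 1 ∨ s = -1) (h0 : 0 < θ)
    (hpi : θ < π) (k : ℤ) :
    HasSum (fun m : ℤ => dec m * S V θ s n (k + 2 * m)) (S V θ s n k + farSum V θ s n k) := by
  have hsum : Summable fun l : ℤ => if l = 0 then 0
      else S V θ s n (k + 2 * l) * |(l : ℝ)| ^ (-(5 / 2) : ℝ) := by
    refine (summable_dec.mul_left 336).of_nonneg_of_le (fun l => ?_) (fun l => ?_)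
    · split_ifs
      · exact le_rfl
      · exact mul_nonneg (S_nonneg _) (by positivity)
    · rw [dec]
      split_ifs
      · norm_num
      · exact mul_le_mul_of_nonneg_right (S_le hV hs h0 hpi _) (by positivity)
  convert! (hasSum_ite_eq (0 : ℤ) (S V θ s n k)).add hsum.hasSum using 1
  ext m
  rw [dec]
  split_ifs with h
  · rw [h]; simp
  · rw [zero_add, mul_comm]

lemma farSum_nonneg (k : ℤ) : 0 ≤ farSum V θ s n k := by
  refine tsum_nonneg fun l => ?_
  split_ifs
  · exact le_rfl
  · exact mul_nonneg (S_nonneg _) (by positivity)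

lemma summable_Acoef (h3 : ConditionC3 V) (hc : 0 < cc θ)
    (hv : vc V θ 1 = vc V θ 0 + 1 / cc θ) : Summable (Acoef V θ) := by
  have := (hasSum_linear_part (n := 0) h3 hc hv (Or.inl rfl) (x := fun _ => 1) (K := 1)
    (fun _ => by norm_num) 0).summable
  simpa using this

lemma Acoef_neg (l : ℤ) : Acoef V θ (-l) = Acoef V θ l := by
  have h : ∀ p, Dcoef V θ (-p) = Dcoef V θ p := fun p => by rw [Dcoef, natAbs_neg, Dcoef]
  rw [Acoef, natAbs_neg, h, show -l - 1 = -(l + 1) by ring, show -l + 1 = -(l - 1) by ring, h, h,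
    Acoef]
  ring

lemma abs_Lst_le (hs : s = 1 ∨ s = -1) (k d : ℤ) : |Lst θ s n k d| ≤ 1 := by
  have hs1 : |s| = 1 := by rcases hs with rfl | rfl <;> norm_num
  have hsig : |(-1 : ℝ) ^ (n + k).natAbs| = 1 := by rw [abs_pow, abs_neg, abs_one, one_pow]
  have hb := abs_cb_le θ
  have hc0 := cc_nonneg θ
  have hc := cc_le_one θ
  rw [Lst]
  split_ifs
  · rwa [abs_mul, hs1, one_mul]
  · rwa [abs_neg, abs_mul, hs1, one_mul]
  · rw [abs_neg, abs_mul, hsig, one_mul, abs_of_nonneg] <;> linarith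
  · rw [abs_mul, hsig, one_mul, abs_of_nonneg] <;> linarith
  · rw [abs_zero]; exact zero_le_one

/-- The error of replacing `L̃` and `δM` by their leading terms in the series of the string
equation. -/
lemma exists_series_error_bound (h3 : ConditionC3 V) (h0 : 0 < θ) (hpi : θ < π)
    (hc : 0 < cc θ) : ∃ K : ℝ, 0 ≤ K ∧ ∀ (s : ℝ) (n : ℕ) (k : ℤ), (s = 1 ∨ s = -1) → 2 ≤ n + k →
    |(∑ d ∈ 𝔹, ∑ d' ∈ 𝔹, ∑' l : ℤ,
          Ltilde V n k (k + d) * Bcoef V θ (l - d) (l + d' + 1) * deltaM V θ n (k + l) (k + l + d'))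
      - ∑ d ∈ 𝔹, Lst θ s n k d * ∑ d' ∈ 𝔹,
        ∑' l, Bw V θ d d' l * linM θ s n (xt V θ s n) d' (k + l)|
      ≤ K * (S V θ s n k + farSum V θ s n k) := by
  have hV := h3.contDiffOn.continuousOn
  obtain ⟨KB, hKB0, hKB⟩ := exists_Bw_bound h3 hc
  obtain ⟨KM, hKM0, hKM⟩ := exists_deltaM_bound hV h0 hpi
  set D := ∑' m, dec m with hD
  have hD0 : 0 ≤ D := tsum_nonneg fun m => (dec_pos m).le
  refine ⟨25 * (KB * (8 + 8 * KM) * (2 * D + 2)), by positivity, fun s n k hs hk => ?_⟩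
  set x := xt V θ s n with hx
  have hSk := S_nonneg (V := V) (θ := θ) (s := s) (n := n) k
  have hF := farSum_nonneg (V := V) (θ := θ) (s := s) (n := n) k
  have key : ∀ d ∈ 𝔹, ∀ d' ∈ 𝔹,
      |(∑' l : ℤ, Ltilde V n k (k + d) * Bcoef V θ (l - d) (l + d' + 1)
          * deltaM V θ n (k + l) (k + l + d'))
        - Lst θ s n k d * ∑' l, Bw V θ d d' l * linM θ s n x d' (k + l)|
      ≤ KB * (8 + 8 * KM) * (2 * D + 2) * (S V θ s n k + farSum V θ s n k) := fun d hd d' hd' => by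
    rw [Finset.mem_Icc] at hd hd'
    have hBs := summable_Bw h3 hc hd hd'
    have hlin : ∀ j, |linM θ s n x d' j| ≤ 1 + KM * (5 * 336) := fun j => by
      have h1 := (hKM s n j d' hs hd'.1 hd'.2).2.1
      have h2 := locSq_le_S (V := V) (θ := θ) (s := s) (n := n) (i := 0) (by norm_num) j
      rw [add_zero] at h2
      have h4 := S_le (n := n) hV hs h0 hpi j
      rw [abs_le]
      constructor <;> nlinarith [sq_nonneg (linM θ s n x d' j + 1 / 2), sq_nonneg (linM θ s n x d' j - 1 / 2)]
    have s1 : Summable fun l : ℤ => Ltilde V n k (k + d) * Bcoef V θ (l - d) (l + d' + 1)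
          * deltaM V θ n (k + l) (k + l + d') := by
      refine Summable.of_norm_bounded (hBs.abs.mul_left 3) fun l => ?_
      rw [norm_eq_abs, abs_mul, abs_mul]
      have a1 := abs_Ltilde_le (n := n) hV k (k + d)
      have a2 := abs_deltaM_le (θ := θ) (n := n) hV (k + l) (k + l + d')
      have a3 : 0 ≤ |Bcoef V θ (l - d) (l + d' + 1)| := abs_nonneg _
      have := mul_le_mul (mul_le_mul_of_nonneg_right a1 a3) a2 (abs_nonneg _) (by positivity)
      rw [Bw]; linarith
    have s2 : Summable fun l : ℤ => Bw V θ d d' l * linM θ s n x d' (k + l) := by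
      refine Summable.of_norm_bounded (hBs.abs.mul_right (1 + KM * (5 * 336))) fun l => ?_
      rw [norm_eq_abs, abs_mul]
      exact mul_le_mul_of_nonneg_left (hlin _) (abs_nonneg _)
    rw [← tsum_mul_left, ← s1.tsum_sub (s2.mul_left _), ← norm_eq_abs]
    have hb := ((hasSum_half summable_dec.hasSum).mul_right (S V θ s n k)).add
      (hasSum_half (hasSum_dec_mul_S (n := n) hV hs h0 hpi k))
    refine (tsum_of_norm_bounded (hb.mul_left (KB * (8 + 8 * KM))) fun l => ?_).trans ?_
    · have b1 := hKB d d' l hd.1 hd.2 hd'.1 hd'.2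
      obtain ⟨m1, -, m3⟩ := hKM s n (k + l) d' hs hd'.1 hd'.2
      have l1 := sq_Ltilde_sub_Lst_le (θ := θ) hV hs hk hd
      have l2 := abs_Lst_le (θ := θ) (n := n) hs k d
      have w1 := locSq_le_S (V := V) (θ := θ) (s := s) (n := n) (i := 0) (by norm_num) k
      rw [add_zero] at w1
      have w2 := locSq_le_S (V := V) (θ := θ) (s := s) (n := n) (i := l - 2 * (l / 2)) (by omega)
        (k + 2 * (l / 2))
      rw [show k + 2 * (l / 2) + (l - 2 * (l / 2)) = k + l by ring] at w2
      have e : Ltilde V n k (k + d) * Bcoef V θ (l - d) (l + d' + 1) * deltaM V θ n (k + l) (k + l + d')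
          - Lst θ s n k d * (Bw V θ d d' l * linM θ s n x d' (k + l))
          = Bw V θ d d' l * ((Ltilde V n k (k + d) - Lst θ s n k d) * deltaM V θ n (k + l) (k + l + d')
            + Lst θ s n k d * (deltaM V θ n (k + l) (k + l + d') - linM θ s n x d' (k + l))) := by
        rw [Bw]; ring
      rw [norm_eq_abs, e, abs_mul]
      set p := Ltilde V n k (k + d) - Lst θ s n k d
      set q := deltaM V θ n (k + l) (k + l + d')
      have t1 : |p * q| ≤ (p ^ 2 + q ^ 2) / 2 := by
        rw [abs_le]; constructor <;> nlinarith [sq_nonneg (p + q), sq_nonneg (p - q)]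
      have t2 : |Lst θ s n k d * (q - linM θ s n x d' (k + l))| ≤ 1 * (KM * locSq x (k + l)) := by
        rw [abs_mul]
        exact mul_le_mul l2 m1 (abs_nonneg _) zero_le_one
      have hS2 := S_nonneg (V := V) (θ := θ) (s := s) (n := n) (k + 2 * (l / 2))
      have t4 : |p * q + Lst θ s n k d * (q - linM θ s n x d' (k + l))|
          ≤ (8 + 8 * KM) * (S V θ s n k + S V θ s n (k + 2 * (l / 2))) := by
        refine (abs_add_le _ _).trans ?_
        nlinarith
      refine (mul_le_mul b1 t4 (abs_nonneg _) (by have := dec_pos (l / 2); positivity)).trans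
        (le_of_eq (by ring))
    · have e : KB * (8 + 8 * KM) * ((D + D) * S V θ s n k
          + (S V θ s n k + farSum V θ s n k + (S V θ s n k + farSum V θ s n k)))
          ≤ KB * (8 + 8 * KM) * ((2 * D + 2) * (S V θ s n k + farSum V θ s n k)) := by
        refine mul_le_mul_of_nonneg_left ?_ (by positivity)
        nlinarith [mul_nonneg hD0 hF]
      linarith
  have hsum : ∀ f g : ℤ → ℤ → ℝ, ∀ L : ℤ → ℝ, (∀ d ∈ 𝔹,
      ∀ d' ∈ 𝔹, |f d d' - L d * g d d'|
        ≤ KB * (8 + 8 * KM) * (2 * D + 2) * (S V θ s n k + farSum V θ s n k)) →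
      |(∑ d ∈ 𝔹, ∑ d' ∈ 𝔹, f d d')
        - ∑ d ∈ 𝔹, L d * ∑ d' ∈ 𝔹, g d d'|
      ≤ 25 * (KB * (8 + 8 * KM) * (2 * D + 2)) * (S V θ s n k + farSum V θ s n k) := fun f g L h => by
    simp only [mul_sum]
    rw [← sum_sub_distrib]
    simp only [← sum_sub_distrib]
    refine (Finset.abs_sum_le_sum_abs _ _).trans ((sum_le_sum fun d hd =>
      (Finset.abs_sum_le_sum_abs _ _).trans (sum_le_sum (h d hd))).trans (le_of_eq ?_))
    rw [sum_const, sum_const, show (𝔹).card = 5 by decide,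
      nsmul_eq_mul, nsmul_eq_mul]
    push_cast; ring
  exact hsum _ _ _ key

set_option maxHeartbeats 400000 in
/-- The string equation in linearized form. -/
lemma exists_linearized_string_equation (h3 : ConditionC3 V) (h0 : 0 < θ) (hpi : θ < π)
    (hv : vc V θ 1 = vc V θ 0 + 1 / cc θ) : ∃ K : ℝ, 0 ≤ K ∧
    ∀ (s : ℝ) (n : ℕ) (k : ℤ), (s = 1 ∨ s = -1) → 1 ≤ n → |(k : ℝ)| ≤ 1 / 2 * n →
    ∃ R : ℝ, HasSum (fun l : ℤ => Acoef V θ (k - l) * xt V θ s n l) (cb θ / cc θ * (k / n) + R) ∧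
      |R| ≤ K * ((k : ℝ) ^ 2 / (n : ℝ) ^ 2 + S V θ s n k + farSum V θ s n k)
        + |stringRemainder V θ n k| := by
  have hV := h3.contDiffOn.continuousOn
  have hs0 := sin_half_pos h0 hpi
  have hc := cc_pos h0 hpi
  obtain ⟨KE, hKE0, hKE⟩ := exists_series_error_bound h3 h0 hpi hc
  have hAs := (summable_Acoef h3 hc hv).abs
  set A0 := ∑' l, |Acoef V θ l| with hA0
  set κ := (min (θ / 2) (π - θ / 2)) ^ 2 with hκ
  have hκ0 : 0 < κ := pow_pos (lt_min (by linarith) (by linarith)) 2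
  -- threshold for `S_k`: away from the corner, and `|x̃_k|` small for the cotangent
  set η := min κ (sin (θ / 2) ^ 2 / 4) with hη
  have hη0 : 0 < η := lt_min hκ0 (by positivity)
  have hb0 := abs_nonneg (cb θ / cc θ)
  set v := vc V θ 0 with hvdef
  set K3 := 38 / (cc θ * sin (θ / 2)) with hK3
  have hK30 : 0 ≤ K3 := by positivity
  refine ⟨(A0 * 4 + |cb θ / cc θ|) / η + KE + 80 / cc θ + 160 * |v| + 2 * K3 + 1 / cc θ, by positivity,
    fun s n k hs hn hk => ?_⟩
  have hn0 : (0 : ℝ) < n := by exact_mod_cast hn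
  have hx4 : ∀ l, |xt V θ s n l| ≤ 4 := fun l =>
    (xt_abs_le hV hs h0 hpi l).trans (by linarith [pi_lt_d2])
  have hG := hasSum_linear_part (n := n) h3 hc hv hs hx4 k
  set x := xt V θ s n with hx
  set r := stringRemainder V θ n k with hr
  set sub := ∑ d ∈ 𝔹, Lst θ s n k d
        * ∑ d' ∈ 𝔹, ∑' l, Bw V θ d d' l * linM θ s n x d' (k + l) with hsub
  set G := (1 / cc θ * (ca θ * x (k + 1) - cc θ / 2 * (x k + x (k + 2)) + x k)
      + v * ((ca θ + cc θ / 2) * (x (k + 1) - x k) - cc θ / 2 * (x (k + 2) - x (k - 1))))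
      + s * sub with hGdef
  have hSk := S_nonneg (V := V) (θ := θ) (s := s) (n := n) k
  have hF := farSum_nonneg (V := V) (θ := θ) (s := s) (n := n) k
  have hkn : |(k : ℝ) / n| ≤ 1 / 2 := by
    rw [abs_div, abs_of_pos hn0, div_le_iff₀ hn0]; exact hk
  have hkk : (k : ℝ) ^ 2 / (n : ℝ) ^ 2 = ((k : ℝ) / n) ^ 2 := by rw [div_pow]
  refine ⟨G - cb θ / cc θ * (k / n), ?_, ?_⟩
  · rw [add_sub_cancel]
    have := (Equiv.subRight k).hasSum_iff.2 hG
    convert! this using 2 with l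
    simp only [Function.comp, Equiv.subRight_apply]
    rw [← Acoef_neg, neg_sub, add_sub_cancel]
  rw [hkk]
  have q0 := sq_nonneg ((k : ℝ) / n)
  have hr0 := abs_nonneg r
  rcases le_or_gt η (S V θ s n k) with hbig | hsmall
  · -- a deviation of size of order one: the trivial bound suffices
    have hGb : |G| ≤ A0 * 4 := by
      rw [← hG.tsum_eq, ← norm_eq_abs]
      refine tsum_of_norm_bounded (hAs.hasSum.mul_right 4) fun i => ?_
      rw [norm_eq_abs, abs_mul]
      exact mul_le_mul_of_nonneg_left (hx4 _) (abs_nonneg _)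
    have h1 : |G - cb θ / cc θ * (k / n)| ≤ A0 * 4 + |cb θ / cc θ| := by
      refine (abs_sub _ _).trans (add_le_add hGb ?_)
      rw [abs_mul]
      nlinarith
    have h2 : A0 * 4 + |cb θ / cc θ| ≤ (A0 * 4 + |cb θ / cc θ|) / η * S V θ s n k := by
      rw [div_mul_eq_mul_div, le_div_iff₀ hη0]
      exact mul_le_mul_of_nonneg_left hbig (by positivity)
    have h4 : 0 ≤ KE + 80 / cc θ + 160 * |v| + 2 * K3 + 1 / cc θ := by positivity
    have h5 : 0 ≤ (A0 * 4 + |cb θ / cc θ|) / η * (((k : ℝ) / n) ^ 2 + farSum V θ s n k) := by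
      positivity
    have h6 : 0 ≤ (KE + 80 / cc θ + 160 * |v| + 2 * K3 + 1 / cc θ)
      * (((k : ℝ) / n) ^ 2 + S V θ s n k + farSum V θ s n k) := by positivity
    linarith
  · have hxk : ∀ {i : ℤ}, -10 ≤ i ∧ i ≤ 10 → ∀ k, xt V θ s n (k + i) ^ 2 ≤ S V θ s n k := sq_xt_le_S
    -- otherwise the sum `S_k` contains the index `-n`
    have hNk : (11 : ℤ) ≤ n + k := by
      by_contra hlt
      have hlow : (0 : ℤ) ≤ n + k := by
        have := (abs_le.1 hk).1
        have h1 : (-(n : ℤ) : ℝ) ≤ (k : ℝ) := by push_cast; linarith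
        have : -(n : ℤ) ≤ k := by exact_mod_cast h1
        omega
      have h1 := hxk (i := -n - k) (by omega) k
      rw [show k + (-n - k) = -(n : ℤ) by ring] at h1
      have h2 := le_sq_xt_neg (n := n) hV hs h0 hpi
      have h4 : η ≤ κ := min_le_left _ _
      linarith
    have hxk' : |x k| ≤ sin (θ / 2) / 2 := by
      have h1 := hxk (i := 0) (by norm_num) k
      rw [add_zero] at h1
      have h2 : η ≤ sin (θ / 2) ^ 2 / 4 := min_le_right _ _
      refine abs_le_of_sq_le_sq (by rw [div_pow]; norm_num; linarith) (by positivity)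
    have y0 : x k ^ 2 ≤ S V θ s n k := by simpa using hxk (i := 0) (by norm_num) k
    have y1 : x (k + 1) ^ 2 ≤ S V θ s n k := hxk (by norm_num) k
    have y2 : x (k + 2) ^ 2 ≤ S V θ s n k := hxk (by norm_num) k
    have y3 : x (k - 1) ^ 2 ≤ S V θ s n k := hxk (i := -1) (by norm_num) k
    have d1 := abs_Ltilde_one_sub_le (j := k) hV hs h0 hpi (n := n) (by omega)
    have d2 := abs_Ltilde_one_sub_le (j := k - 1) hV hs h0 hpi (n := n) (by omega)
    rw [show k - 1 + 1 = k by ring, show k - 1 + 2 = k + 1 by ring] at d2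
    have d3 := abs_cot_sub_le h0 hpi (hx4 k) hxk'
    have d4 := hKE s n k hs (by omega)
    rw [← hx] at d1 d2 d4
    rw [← hsub] at d4
    obtain ⟨-, -, ea, er⟩ := xt_facts (θ := θ) (l := k) hV hs (n := n) (by omega)
    have hr' : r = _ := hr
    rw [stringRemainder, v0_eq_vc h3 θ, ← hvdef, ea, er, Ltilde_antisymm V n k (k - 1), ← hx] at hr'
    set T := ∑ d ∈ 𝔹, ∑ d' ∈ 𝔹, ∑' l : ℤ,
          Ltilde V n k (k + d) * Bcoef V θ (l - d) (l + d' + 1) * deltaM V θ n (k + l) (k + l + d')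
    set L1 := Ltilde V n k (k + 1)
    set L2 := Ltilde V n (k - 1) k
    set ct := cos (θ / 2 + x k) / sin (θ / 2 + x k) with hct
    have hr2 : r = s * ct * (1 + k / n) - (L1 / cc θ + (L1 - L2) * v + T) := by
      have h1 : ((-1 : ℝ) ^ (n + k).toNat) * (-1) ^ (n + k).toNat = 1 := by rw [← mul_pow]; norm_num
      rw [hr', hct]
      linear_combination (s * (cos (θ / 2 + x k) / sin (θ / 2 + x k)) * (1 + k / n)) * h1
    have hss := sign_sq hs
    set D1 := s * L1 - (cb θ + ca θ * x (k + 1) - cc θ / 2 * (x k + x (k + 2)))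
    set D2 := s * L2 - (cb θ + ca θ * x k - cc θ / 2 * (x (k - 1) + x (k + 1)))
    set D3 := ct - (cb θ / cc θ - x k / cc θ)
    -- the leading terms `b/c` of both sides cancel
    have hmain : G - cb θ / cc θ * (k / n) = -(s * r) - s * (T - sub)
        - (D1 / cc θ + (D1 - D2) * v - D3 * (1 + k / n) + x k * (k / n) / cc θ) := by
      rw [hr2]
      simp only [hGdef, D1, D2, D3]
      linear_combination (ct * (1 + k / n)) * hss
    have z1 : |D1| ≤ 80 * S V θ s n k := by linarith only [d1, y0, y1, y2]
    have z2 : |D2| ≤ 80 * S V θ s n k := by linarith only [d2, y0, y1, y3]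
    have z3 : |D3| ≤ K3 * S V θ s n k := d3.trans (mul_le_mul_of_nonneg_left y0 hK30)
    have hs1 : |s| = 1 := by rcases hs with rfl | rfl <;> norm_num
    have w1 : |D1 / cc θ| ≤ 80 / cc θ * S V θ s n k := by
      rw [abs_div, abs_of_pos hc, div_le_iff₀ hc]
      refine z1.trans (le_of_eq ?_)
      field_simp
    have w2 : |(D1 - D2) * v| ≤ 160 * S V θ s n k * |v| := by
      rw [abs_mul]
      exact mul_le_mul_of_nonneg_right ((abs_sub _ _).trans
        (by linarith only [z1, z2])) (abs_nonneg _)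
    have w3 : |D3 * (1 + k / n)| ≤ K3 * S V θ s n k * 2 := by
      rw [abs_mul]
      refine mul_le_mul z3 ?_ (abs_nonneg _) (by positivity)
      refine (abs_add_le _ _).trans ?_
      rw [abs_one]; linarith only [hkn]
    have w4 : |x k * (k / n) / cc θ| ≤ 1 / cc θ * (S V θ s n k + ((k : ℝ) / n) ^ 2) := by
      rw [abs_div, abs_of_pos hc, div_le_iff₀ hc, one_div, mul_right_comm, inv_mul_cancel₀ hc.ne', one_mul]
      rw [abs_le]
      constructor <;> nlinarith only [sq_nonneg (x k + k / n), sq_nonneg (x k - k / n), y0, q0, hSk]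
    rw [hmain]
    have w5 : |s * r| = |r| := by rw [abs_mul, hs1, one_mul]
    have w6 : |s * (T - sub)| ≤ KE * (S V θ s n k + farSum V θ s n k) := by
      rw [abs_mul, hs1, one_mul]; exact d4
    have w7 : |D1 / cc θ + (D1 - D2) * v - D3 * (1 + k / n) + x k * (k / n) / cc θ|
        ≤ 80 / cc θ * S V θ s n k + 160 * S V θ s n k * |v| + K3 * S V θ s n k * 2
          + 1 / cc θ * (S V θ s n k + ((k : ℝ) / n) ^ 2) :=
      (abs_add_le _ _).trans (add_le_add ((abs_sub _ _).trans
        (add_le_add ((abs_add_le _ _).trans (add_le_add w1 w2)) w3)) w4)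
    have w8 : |-(s * r) - s * (T - sub)
        - (D1 / cc θ + (D1 - D2) * v - D3 * (1 + k / n) + x k * (k / n) / cc θ)|
        ≤ |r| + KE * (S V θ s n k + farSum V θ s n k) + (80 / cc θ * S V θ s n k
          + 160 * S V θ s n k * |v| + K3 * S V θ s n k * 2
          + 1 / cc θ * (S V θ s n k + ((k : ℝ) / n) ^ 2)) := by
      refine (abs_sub _ _).trans (add_le_add ((abs_sub _ _).trans (add_le_add ?_ w6)) w7)
      rw [abs_neg, w5]
    refine w8.trans ?_
    have g1 : 0 ≤ (A0 * 4 + |cb θ / cc θ|) / η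
      * (((k : ℝ) / n) ^ 2 + S V θ s n k + farSum V θ s n k) := by positivity
    have g2 : 0 ≤ KE * ((k : ℝ) / n) ^ 2 := by positivity
    have g3 : 0 ≤ (80 / cc θ + 160 * |v| + 2 * K3) * (((k : ℝ) / n) ^ 2 + farSum V θ s n k) := by
      positivity
    have g4 : 0 ≤ 1 / cc θ * farSum V θ s n k := by positivity
    linarith only [g1, g2, g3, g4]

end FirstOrder

/-! ### Resolvents of banded operators -/

section Resolvent

lemma two_toReal_pos : 0 < (2 : ℝ≥0∞).toReal := by norm_num

lemma summable_sq (f : L2Z) : Summable fun j => ‖f j‖ ^ 2 := by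
  simpa using (lp.memℓp f).summable two_toReal_pos

lemma norm_sq_eq (f : L2Z) : ‖f‖ ^ 2 = ∑' j, ‖f j‖ ^ 2 := by
  simpa using lp.norm_rpow_eq_tsum two_toReal_pos f

lemma memlp_of_summable {f : ℤ → ℂ} (h : Summable fun j => ‖f j‖ ^ 2) : Memℓp f 2 :=
  memℓp_gen (by simpa using h)

/-- Multiplication by a bounded real sequence. -/
def mulOp (m : ℤ → ℝ) (K : ℝ) (hm : ∀ j, |m j| ≤ K) : L2Z →L[ℂ] L2Z :=
  have hle : ∀ f : L2Z, ∀ j, ‖(m j : ℂ) * f j‖ ^ 2 ≤ K ^ 2 * ‖f j‖ ^ 2 := fun f j => by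
    rw [norm_mul, mul_pow, norm_real, norm_eq_abs]
    have := hm j
    gcongr
  LinearMap.mkContinuous
    { toFun := fun f => ⟨fun j => (m j : ℂ) * f j, memlp_of_summable
        (((summable_sq f).mul_left (K ^ 2)).of_nonneg_of_le (fun _ => by positivity) (hle f))⟩
      map_add' := fun f g => by
        ext j; exact mul_add _ _ _
      map_smul' := fun c f => by
        ext j; exact mul_left_comm _ _ _ } K (by
    intro f
    have hK : 0 ≤ K := (abs_nonneg _).trans (hm 0)
    refine abs_le_of_sq_le_sq' ?_ (by positivity) |>.2
    rw [mul_pow, norm_sq_eq, norm_sq_eq, ← tsum_mul_left]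
    exact Summable.tsum_le_tsum (hle f)
      (((summable_sq f).mul_left (K ^ 2)).of_nonneg_of_le (fun _ => by positivity) (hle f))
      ((summable_sq f).mul_left (K ^ 2)))

/-- The five-diagonal operator with entries `m_{j,k}`, `|j - k| ≤ 2`. -/
def bandOp (m : ℤ → ℤ → ℝ) (K : ℝ) (hm : ∀ j k, |m j k| ≤ K) : L2Z →L[ℂ] L2Z :=
  ∑ d ∈ 𝔹, mulOp (fun j => m j (j + d)) K (fun j => hm j (j + d)) ∘L shift d

variable {m : ℤ → ℤ → ℝ} {K : ℝ} {hm : ∀ j k, |m j k| ≤ K}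

lemma bandOp_apply (f : L2Z) (j : ℤ) :
    bandOp m K hm f j = ∑ d ∈ 𝔹, (m j (j + d) : ℂ) * f (j + d) := by
  rw [bandOp, sum_apply, lp.coeFn_sum, Finset.sum_apply]; rfl

lemma MstarOp_apply (θ : ℝ) (f : L2Z) (j : ℤ) :
    MstarOp θ f j = ca θ * f j + (cc θ / 2 : ℝ) * (f (j - 2) + f (j + 2)) := rfl

lemma inner_eq (f g : L2Z) : inner ℂ f g = ∑' j, g j * conj (f j) := by
  rw [lp.inner_eq_tsum]; rfl

lemma inner_shift (d : ℤ) (f g : L2Z) : inner ℂ (shift d f) g = inner ℂ f (shift (-d) g) := by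
  rw [inner_eq, inner_eq, ← (Equiv.addRight (-d)).tsum_eq]
  refine tsum_congr fun j => ?_
  change g (j + -d) * conj (f (j + -d + d)) = g (j + -d) * _
  rw [neg_add_cancel_right]

lemma inner_mulOp_shift (hsymm : ∀ j k, m j k = m k j) (d : ℤ) (f g : L2Z) :
    inner ℂ ((mulOp (fun j => m j (j + d)) K (fun j => hm j (j + d)) ∘L shift d) f) g
      = inner ℂ f ((mulOp (fun j => m j (j + -d)) K (fun j => hm j (j + -d)) ∘L shift (-d)) g) := by
  rw [inner_eq, inner_eq, ← (Equiv.addRight (-d)).tsum_eq]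
  refine tsum_congr fun j => ?_
  change g (j + -d) * conj ((m (j + -d) (j + -d + d) : ℂ) * f (j + -d + d))
    = (m j (j + -d) : ℂ) * g (j + -d) * conj (f j)
  rw [neg_add_cancel_right, map_mul, conj_ofReal, hsymm (j + -d) j]; ring

lemma bandOp_isSymmetric (hsymm : ∀ j k, m j k = m k j) (f g : L2Z) :
    inner ℂ (bandOp m K hm f) g = inner ℂ f (bandOp m K hm g) := by
  simp only [bandOp, sum_apply, sum_inner, inner_sum]
  refine Finset.sum_bij' (fun d _ => -d) (fun d _ => -d) ?_ ?_ ?_ ?_ ?_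
  · intro d hd; rw [Finset.mem_Icc] at hd ⊢; omega
  · intro d hd; rw [Finset.mem_Icc] at hd ⊢; omega
  · intro d _; exact neg_neg d
  · intro d _; exact neg_neg d
  · intro d _; exact inner_mulOp_shift (hm := hm) hsymm d f g

lemma MstarOp_isSymmetric (θ : ℝ) (f g : L2Z) :
    inner ℂ (MstarOp θ f) g = inner ℂ f (MstarOp θ g) := by
  simp only [MstarOp, add_apply, smul_apply,
    one_apply_eq_self, inner_add_left, inner_add_right, inner_smul_left, inner_smul_right,
    conj_ofReal, inner_shift, neg_neg]
  ring

/-- Off the real axis a symmetric operator is bounded below. -/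
lemma im_mul_norm_le {A : L2Z →L[ℂ] L2Z} (hA : ∀ f g, inner ℂ (A f) g = inner ℂ f (A g)) (z : ℂ)
    (f : L2Z) : ‖f‖ ^ 2 * |z.im| ≤ ‖inner ℂ ((A - z • (1 : L2Z →L[ℂ] L2Z)) f) f‖ := by
  have h1 : inner ℂ ((A - z • (1 : L2Z →L[ℂ] L2Z)) f) f
      = inner ℂ (A f) f - conj z * inner ℂ f f := by
    rw [sub_apply, inner_sub_left, smul_apply, inner_smul_left]; rfl
  have h2 : (inner ℂ (A f) f).im = 0 := by
    rw [← conj_eq_iff_im, inner_conj_symm, hA]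
  have h4 : (inner ℂ ((A - z • (1 : L2Z →L[ℂ] L2Z)) f) f).im = z.im * ‖f‖ ^ 2 := by
    rw [h1, sub_im, h2, inner_self_eq_norm_sq_to_K]
    simp [← Complex.ofReal_pow]
  have h5 := Complex.abs_im_le_norm (inner ℂ ((A - z • (1 : L2Z →L[ℂ] L2Z)) f) f)
  rw [h4, abs_mul, abs_of_nonneg (sq_nonneg ‖f‖)] at h5
  rwa [mul_comm]

lemma isUnit_sub_smul {A : L2Z →L[ℂ] L2Z} (hA : ∀ f g, inner ℂ (A f) g = inner ℂ f (A g)) {z : ℂ}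
    (hz : z.im ≠ 0) : IsUnit (A - z • (1 : L2Z →L[ℂ] L2Z)) := by
  refine ContinuousLinearMap.isUnit_of_forall_le_norm_inner_map _ (c := ⟨|z.im|, abs_nonneg _⟩)
    (abs_pos.2 hz) fun f => ?_
  exact im_mul_norm_le hA z f

lemma im_mul_norm_le_norm {A : L2Z →L[ℂ] L2Z} (hA : ∀ f g, inner ℂ (A f) g = inner ℂ f (A g)) (z : ℂ)
    (f : L2Z) : |z.im| * ‖f‖ ≤ ‖(A - z • (1 : L2Z →L[ℂ] L2Z)) f‖ := by
  have h1 := (im_mul_norm_le hA z f).trans (norm_inner_le_norm _ _)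
  rcases (norm_nonneg f).eq_or_lt with h0 | h0
  · rw [← h0, mul_zero]; exact norm_nonneg _
  · nlinarith

end Resolvent

/-! ### The resolvent of `M⋆` -/

section ExplicitResolvent

/-- `q` is the root inside the unit disk of the characteristic equation of `M⋆ - z`. -/
structure IsRoot (θ : ℝ) (z q : ℂ) : Prop where
  lt_one : ‖q‖ < 1
  eq : (cc θ : ℂ) / 2 * (q ^ 2 + 1) = (z - ca θ) * q

variable {θ : ℝ} {z q : ℂ}

lemma IsRoot.ne_zero (h : IsRoot θ z q) (hc : 0 < cc θ) : q ≠ 0 := by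
  rintro rfl
  have := h.eq
  have h1 : (cc θ : ℂ) ≠ 0 := by exact_mod_cast hc.ne'
  simp [h1] at this

lemma IsRoot.sq_ne_one (h : IsRoot θ z q) : q ^ 2 - 1 ≠ 0 := fun h1 => by
  have h2 : ‖q ^ 2‖ = 1 := by rw [sub_eq_zero.1 h1, norm_one]
  rw [norm_pow] at h2
  have := h.lt_one
  nlinarith [norm_nonneg q]

lemma IsRoot.conj (h : IsRoot θ z q) : IsRoot θ (conj z) (conj q) := by
  refine ⟨by rw [norm_conj]; exact h.lt_one, ?_⟩
  have := congrArg conj h.eq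
  have h2 : conj (2 : ℂ) = 2 := conj_ofNat 2
  simpa [h2] using this

lemma exists_isRoot (hc : 0 < cc θ) (hz : z.im ≠ 0) : ∃ q, IsRoot θ z q := by
  have hcc : (cc θ : ℂ) ≠ 0 := by exact_mod_cast hc.ne'
  set w : ℂ := (z - ca θ) / cc θ with hw
  obtain ⟨r, hr⟩ := IsAlgClosed.exists_pow_nat_eq (w ^ 2 - 1) two_pos
  have hwc : w * cc θ = z - ca θ := by rw [hw, div_mul_cancel₀ _ hcc]
  have e : ∀ q : ℂ, q ^ 2 + 1 = 2 * w * q → (cc θ : ℂ) / 2 * (q ^ 2 + 1) = (z - ca θ) * q := fun q hq => by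
    rw [hq, ← hwc]; ring
  have h1 : (w + r) ^ 2 + 1 = 2 * w * (w + r) := by linear_combination hr
  have h2 : (w - r) ^ 2 + 1 = 2 * w * (w - r) := by linear_combination hr
  have h4 : (w + r) * (w - r) = 1 := by linear_combination -hr
  have h5 : ‖w + r‖ * ‖w - r‖ = 1 := by rw [← norm_mul, h4, norm_one]
  rcases lt_trichotomy ‖w + r‖ 1 with h | h | h
  · exact ⟨w + r, h, e _ h1⟩
  · -- on the unit circle the equation forces `z` to be real
    exfalso
    have h6 : w - r = conj (w + r) := by
      have h7 : (w + r) * conj (w + r) = 1 := by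
        rw [mul_conj, normSq_eq_norm_sq, h]; norm_num
      have h8 : w + r ≠ 0 := by
        intro h0; rw [h0, norm_zero] at h; norm_num at h
      exact mul_left_cancel₀ h8 (h4.trans h7.symm)
    have h9 : conj w = w := by
      have : 2 * w = (w + r) + conj (w + r) := by rw [← h6]; ring
      have h10 := congrArg conj this
      rw [map_add, conj_conj, map_mul, add_comm, ← this] at h10
      have h11 : conj (2 : ℂ) = 2 := conj_ofNat 2
      simpa [h11] using h10
    apply hz
    rw [conj_eq_iff_im] at h9
    have : z = w * cc θ + ca θ := by rw [hwc]; ring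
    rw [this]
    simp [h9]
  · refine ⟨w - r, ?_, e _ h2⟩
    by_contra hle
    push Not at hle
    nlinarith [norm_nonneg (w - r)]

/-- The central entry of the resolvent. -/
def f0 (θ : ℝ) (q : ℂ) : ℂ := 2 / cc θ * q / (q ^ 2 - 1)

lemma summable_pow_natAbs {r : ℝ} (h0 : 0 ≤ r) (h1 : r < 1) : Summable fun m : ℤ => r ^ m.natAbs := by
  refine Summable.of_nat_of_neg ?_ ?_ <;>
  simpa using summable_geometric_of_lt_one h0 h1

lemma half_natAbs {j : ℤ} (h : Even j) : j.natAbs / 2 = (j / 2).natAbs := by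
  rw [even_iff] at h; omega

/-- The column of the resolvent with index `l`. -/
def gFun (θ : ℝ) (q : ℂ) (l j : ℤ) : ℂ :=
  if Even (j - l) then f0 θ q * q ^ ((j - l) / 2).natAbs else 0

lemma summable_gFun (hq : ‖q‖ < 1) (l : ℤ) : Summable fun j => ‖gFun θ q l j‖ ^ 2 := by
  have h1 := (hasSum_half (summable_pow_natAbs (sq_nonneg ‖q‖)
    (by nlinarith [norm_nonneg q] : ‖q‖ ^ 2 < 1)).hasSum).summable.mul_left (‖f0 θ q‖ ^ 2)
  refine ((Equiv.subRight l).summable_iff.2 h1).of_nonneg_of_le (fun _ => by positivity) fun j => ?_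
  simp only [Function.comp, Equiv.subRight_apply]
  rw [gFun]
  split_ifs
  · rw [norm_mul, norm_pow, mul_pow, ← pow_mul, ← pow_mul, mul_comm 2]
  · rw [norm_zero, zero_pow two_ne_zero]; positivity

/-- `gFun` as an element of `ℓ²(ℤ)`. -/
def gVec (θ : ℝ) (q : ℂ) (hq : ‖q‖ < 1) (l : ℤ) : L2Z := ⟨gFun θ q l, memlp_of_summable (summable_gFun hq l)⟩

/-- The explicit column solves the resolvent equation. -/
lemma MstarOp_sub_gVec (h : IsRoot θ z q) (hc : 0 < cc θ) (l : ℤ) :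
    (MstarOp θ - z • (1 : L2Z →L[ℂ] L2Z)) (gVec θ q h.lt_one l) = lp.single 2 l 1 := by
  have hcc : (cc θ : ℂ) ≠ 0 := by exact_mod_cast hc.ne'
  have hq := h.eq
  have hq1 := h.sq_ne_one
  ext j
  have e1 : ((MstarOp θ - z • (1 : L2Z →L[ℂ] L2Z)) (gVec θ q h.lt_one l) : ℤ → ℂ) j
      = ca θ * gFun θ q l j + (cc θ / 2 : ℝ) * (gFun θ q l (j - 2) + gFun θ q l (j + 2))
        - z * gFun θ q l j := rfl
  rw [e1, lp.single_apply, Pi.single_apply]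
  by_cases hev : Even (j - l)
  · obtain ⟨t, ht⟩ := hev
    obtain rfl : j = l + 2 * t := by omega
    have e : ∀ u : ℤ, gFun θ q l (l + 2 * u) = f0 θ q * q ^ u.natAbs := fun u => by
      rw [gFun, if_pos ⟨u, by ring⟩]
      congr 3; omega
    rw [show l + 2 * t - 2 = l + 2 * (t - 1) by ring, show l + 2 * t + 2 = l + 2 * (t + 1) by ring,
      e, e, e]
    push_cast
    rcases lt_trichotomy t 0 with h0 | rfl | h0
    · obtain ⟨k, hk⟩ : ∃ k, t.natAbs = k + 1 := ⟨t.natAbs - 1, by omega⟩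
      rw [if_neg (by omega), hk, show (t - 1).natAbs = k + 2 by omega, show (t + 1).natAbs = k by omega]
      linear_combination (f0 θ q * q ^ k) * hq
    · rw [if_pos (by omega)]
      simp only [Int.natAbs_zero, pow_zero, zero_sub, natAbs_neg, Int.natAbs_one, zero_add, pow_one]
      have hf : f0 θ q * (cc θ * (q ^ 2 - 1)) = 2 * q := by
        rw [f0]; field_simp
      have hq0 := h.ne_zero hc
      refine mul_right_cancel₀ (mul_ne_zero two_ne_zero hq0) ?_
      linear_combination (2 * f0 θ q) * hq + hf
    · obtain ⟨k, hk⟩ : ∃ k, t.natAbs = k + 1 := ⟨t.natAbs - 1, by omega⟩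
      rw [if_neg (by omega), hk, show (t - 1).natAbs = k by omega, show (t + 1).natAbs = k + 2 by omega]
      linear_combination (f0 θ q * q ^ k) * hq
  · rw [if_neg (fun h => hev (by rw [h]; simp)), gFun, if_neg hev, gFun,
      if_neg (by rw [Int.not_even_iff] at *; omega), gFun,
      if_neg (by rw [Int.not_even_iff] at *; omega)]
    ring

lemma inverse_single (h : IsRoot θ z q) (hc : 0 < cc θ) (hz : z.im ≠ 0) (l : ℤ) :
    Ring.inverse (MstarOp θ - z • (1 : L2Z →L[ℂ] L2Z)) (lp.single 2 l 1) = gVec θ q h.lt_one l := by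
  rw [← MstarOp_sub_gVec h hc l, ← mul_apply_eq_comp,
    Ring.inverse_mul_cancel _ (isUnit_sub_smul (MstarOp_isSymmetric θ) hz)]
  rfl

lemma Rstar_eq (h : IsRoot θ z q) (hc : 0 < cc θ) (hz : z.im ≠ 0) (j l : ℤ) :
    Rstar θ z j l = gFun θ q l j := by
  rw [Rstar, inverse_single h hc hz]; rfl

lemma gFun_add_two_mul (l t : ℤ) : gFun θ q l (l + 2 * t) = f0 θ q * q ^ t.natAbs := by
  rw [gFun, if_pos ⟨t, by ring⟩]
  congr 3; omega

lemma Rstar_two_mul (h : IsRoot θ z q) (hc : 0 < cc θ) (hz : z.im ≠ 0) (t : ℤ) :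
    Rstar θ z (2 * t) 0 = f0 θ q * q ^ t.natAbs := by
  rw [Rstar_eq h hc hz, ← gFun_add_two_mul 0 t, zero_add]

/-- The row of the resolvent, as a functional. -/
lemma inner_gVec_conj (h : IsRoot θ z q) (hc : 0 < cc θ) (hz : z.im ≠ 0) (j : ℤ) (f : L2Z) :
    inner ℂ (gVec θ (conj q) h.conj.lt_one j) f
      = Ring.inverse (MstarOp θ - z • (1 : L2Z →L[ℂ] L2Z)) f j := by
  have hu := isUnit_sub_smul (MstarOp_isSymmetric θ) hz
  set T := MstarOp θ - z • (1 : L2Z →L[ℂ] L2Z) with hT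
  have h1 : f = T (Ring.inverse T f) := by
    rw [← mul_apply_eq_comp, Ring.mul_inverse_cancel _ hu]; rfl
  conv_lhs => rw [h1]
  set g := Ring.inverse T f
  have h2 := MstarOp_sub_gVec h.conj hc j
  have h4 : inner ℂ (gVec θ (conj q) h.conj.lt_one j) (T g)
      = inner ℂ ((MstarOp θ - conj z • (1 : L2Z →L[ℂ] L2Z))
        (gVec θ (conj q) h.conj.lt_one j)) g := by
    rw [hT, sub_apply, sub_apply, inner_sub_left, inner_sub_right, MstarOp_isSymmetric, smul_apply,
      smul_apply, inner_smul_left, inner_smul_right, conj_conj]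
    rfl
  rw [h4, h2, lp.inner_single_left, RCLike.inner_apply, map_one, mul_one]

lemma gFun_conj (l j : ℤ) : conj (gFun θ q l j) = gFun θ (conj q) l j := by
  rw [gFun, gFun]
  split_ifs
  · have h2 : conj (2 : ℂ) = 2 := conj_ofNat 2
    simp [f0, h2]
  · simp

lemma norm_f0_conj (t : ℤ) : ‖f0 θ (conj q) * conj q ^ t.natAbs‖ = ‖f0 θ q * q ^ t.natAbs‖ := by
  rw [← gFun_add_two_mul 0, ← gFun_conj, norm_conj, gFun_add_two_mul]

/-- A weighted sum along a column. -/
lemma tsum_gFun_mul (F : ℤ → ℝ) (l : ℤ) : ∑' j, ‖gFun θ q l j‖ ^ 2 * F j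
    = ∑' t : ℤ, ‖f0 θ q * q ^ t.natAbs‖ ^ 2 * F (l + 2 * t) := by
  have hi : Injective fun t : ℤ => l + 2 * t := fun a b h => by simp only at h; omega
  rw [← hi.tsum_eq]
  · exact tsum_congr fun t => by rw [gFun_add_two_mul]
  · intro j hj
    by_contra hn
    apply hj
    have : ¬ Even (j - l) := by
      rintro ⟨t, ht⟩
      exact hn ⟨t, by simp only; omega⟩
    simp only [gFun, if_neg this, norm_zero]; norm_num

lemma norm_sq_gVec (hq : ‖q‖ < 1) (l : ℤ) :
    ‖gVec θ q hq l‖ ^ 2 = ∑' t : ℤ, ‖f0 θ q * q ^ t.natAbs‖ ^ 2 := by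
  have := tsum_gFun_mul (θ := θ) (q := q) (fun _ => 1) l
  simp only [mul_one] at this
  rw [norm_sq_eq, ← this]; rfl

/-- The Ward identity. -/
lemma im_Rstar_eq (h : IsRoot θ z q) (hc : 0 < cc θ) (hz : z.im ≠ 0) :
    (Rstar θ z 0 0).im = z.im * ‖gVec θ q h.lt_one 0‖ ^ 2 := by
  set g := gVec θ q h.lt_one 0 with hg
  have h1 : inner ℂ (lp.single 2 0 1 : L2Z) g = Rstar θ z 0 0 := by
    rw [lp.inner_single_left, RCLike.inner_apply, map_one, mul_one, Rstar, inverse_single h hc hz]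
  rw [← h1, ← MstarOp_sub_gVec h hc 0, ← hg, sub_apply, inner_sub_left, smul_apply, inner_smul_left]
  have h2 : (inner ℂ (MstarOp θ g) g).im = 0 := by
    rw [← conj_eq_iff_im, inner_conj_symm, MstarOp_isSymmetric]
  have h4 : inner ℂ ((1 : L2Z →L[ℂ] L2Z) g) g = ((‖g‖ ^ 2 : ℝ) : ℂ) := by
    have := inner_self_eq_norm_sq_to_K (𝕜 := ℂ) g
    push_cast
    exact this
  rw [sub_im, h2, h4, Complex.mul_im, ofReal_re, ofReal_im]; simp

/-- The Fourier coefficients of `1/(t - z)` along the spectrum of `M⋆`. -/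
lemma fcf_cauchy (h : IsRoot θ z q) (hc : 0 < cc θ) (m : ℕ) :
    fcf θ m (fun t => ((t : ℂ) - z)⁻¹) = f0 θ q * q ^ m := by
  have hcc : (cc θ : ℂ) ≠ 0 := by exact_mod_cast hc.ne'
  have hq0 := h.ne_zero hc
  have hq1 := h.sq_ne_one
  have hs := summable_pow_natAbs (norm_nonneg q) h.lt_one
  have hez : ∀ (l : ℤ) (k : ℕ) (x : ℝ), ez l x ^ k = ez (k * l) x := fun l k x => by
    rw [ez, ez, ← Complex.exp_nat_mul]
    congr 1; push_cast; ring
  -- the two-sided geometric series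
  have hgeo : ∀ x : ℝ, HasSum (fun k : ℤ => f0 θ q * q ^ k.natAbs * ez k x)
      ((((ca θ + cc θ * cos x : ℝ) : ℂ) - z)⁻¹) := fun x => by
    set e := ez 1 x with he
    have hee : e * ez (-1) x = 1 := by rw [he, ← ez_add, add_neg_cancel, ez_zero]
    have n1 : ‖q * e‖ < 1 := by rw [norm_mul, norm_ez, mul_one]; exact h.lt_one
    have n2 : ‖q * ez (-1) x‖ < 1 := by rw [norm_mul, norm_ez, mul_one]; exact h.lt_one
    have g1 := hasSum_geometric_of_norm_lt_one n1
    have g2 := (hasSum_geometric_of_norm_lt_one n2).mul_left (q * ez (-1) x)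
    have hs' : HasSum (fun k : ℤ => q ^ k.natAbs * ez k x)
        ((1 - q * e)⁻¹ + q * ez (-1) x * (1 - q * ez (-1) x)⁻¹) := by
      refine HasSum.of_nat_of_neg_add_one ?_ ?_
      · convert! g1 using 2 with k
        rw [natAbs_natCast, mul_pow, he, hez, mul_one]
      · convert! g2 using 2 with k
        rw [← pow_succ', mul_pow, hez, show (-((k : ℤ) + 1)).natAbs = k + 1 by omega]
        congr 2; push_cast; ring
    have d1 : 1 - q * e ≠ 0 := by
      intro h0; rw [sub_eq_zero] at h0; rw [← h0, norm_one] at n1; exact lt_irrefl _ n1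
    have d2 : 1 - q * ez (-1) x ≠ 0 := by
      intro h0; rw [sub_eq_zero] at h0; rw [← h0, norm_one] at n2; exact lt_irrefl _ n2
    convert! hs'.mul_left (f0 θ q) using 1
    · ext k; ring
    · have h5 := two_cos_eq 1 x
      simp only [Int.cast_one, one_mul] at h5
      have h6 : (cos x : ℂ) = (e + ez (-1) x) / 2 := by
        rw [he, ← h5]; push_cast; ring
      have hfac : (((ca θ + cc θ * cos x : ℝ) : ℂ) - z) * (2 * q)
          = -(cc θ * ((1 - q * e) * (1 - q * ez (-1) x))) := by
        push_cast [h6]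
        linear_combination (2 : ℂ) * h.eq + cc θ * q ^ 2 * hee
      have hfac2 : ((ca θ + cc θ * cos x : ℝ) : ℂ) - z
          = -(cc θ * ((1 - q * e) * (1 - q * ez (-1) x))) / (2 * q) := by
        rw [← hfac, mul_div_cancel_right₀ _ (mul_ne_zero two_ne_zero hq0)]
      rw [hfac2, f0]
      generalize ez (-1) x = e' at *
      field_simp
      linear_combination q ^ 2 * hee
  have hint : HasSum (fun k : ℤ => ∫ x in (-π)..π,
      f0 θ q * q ^ k.natAbs * ez k x * (cos (m * x) : ℝ))
      (∫ x in (-π)..π, (((ca θ + cc θ * cos x : ℝ) : ℂ) - z)⁻¹ * (cos (m * x) : ℝ)) := by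
    refine hasSum_integral_of_dominated_convergence
      (fun k _ => ‖f0 θ q‖ * ‖q‖ ^ k.natAbs) (fun k => ?_) (fun k => ?_) ?_ (by simp) ?_
    · have := continuous_ez k
      exact Continuous.aestronglyMeasurable (by fun_prop)
    · refine of_forall fun x _ => ?_
      rw [norm_mul, norm_mul, norm_mul, norm_ez, norm_pow, mul_one, norm_real, norm_eq_abs]
      exact mul_le_of_le_one_right (by positivity) (abs_cos_le_one _)
    · exact of_forall fun x _ => hs.mul_left _
    · exact of_forall fun x _ => (hgeo x).mul_right _
  have hcoef : ∀ k : ℤ, ∫ x in (-π)..π, f0 θ q * q ^ k.natAbs * ez k x * (cos (m * x) : ℝ)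
      = f0 θ q * q ^ m * π * ((if k = m then 1 else 0) + if k = -m then 1 else 0) := fun k => by
    have e : ∀ x : ℝ, f0 θ q * q ^ k.natAbs * ez k x * (cos (m * x) : ℝ)
        = f0 θ q * q ^ k.natAbs / 2 * (ez (k + m) x + ez (k + -m) x) := fun x => by
      have := two_cos_eq m x
      rw [ez_add, ez_add]
      have h6 : ((cos (m * x) : ℝ) : ℂ) = (ez m x + ez (-m) x) / 2 := by
        rw [← this]; push_cast; ring
      rw [h6]; ring
    simp only [e]
    rw [intervalIntegral.integral_const_mul, intervalIntegral.integral_add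
      ((continuous_ez _).intervalIntegrable _ _) ((continuous_ez _).intervalIntegrable _ _),
      integral_ez, integral_ez]
    by_cases h1 : k = m
    · subst h1
      by_cases h2 : m = 0
      · subst h2; norm_num; ring
      · rw [if_neg (by omega), if_pos (by omega), if_pos rfl, if_neg (by omega), natAbs_natCast]
        ring
    · by_cases h2 : k = -m
      · subst h2
        rw [if_pos (by omega), if_neg (by omega), if_neg h1, if_pos rfl, natAbs_neg,
          natAbs_natCast]
        ring
      · rw [if_neg (by omega), if_neg (by omega), if_neg h1, if_neg h2]
        ring
  simp only [hcoef] at hint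
  have htot := (((hasSum_ite_eq (m : ℤ) (1 : ℂ)).add (hasSum_ite_eq (-m : ℤ) (1 : ℂ))).mul_left
    (f0 θ q * q ^ m * π))
  have := hint.unique htot
  rw [fcf, this]
  field_simp; ring

/-- On Cauchy kernels the tails factor, which makes the linear part a product of two columns. -/
lemma Etail_cauchy (h : IsRoot θ z q) (hc : 0 < cc θ) (p : ℕ) :
    2 / (cc θ : ℂ) * Etail θ p (fun t => ((t : ℂ) - z)⁻¹) = -(f0 θ q * f0 θ q * q ^ p) := by
  have hq2 : ‖q ^ 2‖ < 1 := by rw [norm_pow]; exact pow_lt_one₀ (norm_nonneg _) h.lt_one two_ne_zero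
  rw [Etail]
  simp only [fcf_cauchy h hc]
  have e : ∀ j : ℕ, f0 θ q * q ^ (p + 1 + 2 * j) = f0 θ q * q ^ (p + 1) * (q ^ 2) ^ j := by
    intro j; rw [pow_add, ← pow_mul]; ring
  simp only [e]
  rw [tsum_mul_left, tsum_geometric_of_norm_lt_one hq2, f0, pow_succ q p]
  have h4 : (1 - q ^ 2 : ℂ)⁻¹ = -(q ^ 2 - 1)⁻¹ := by rw [← neg_sub, inv_neg]
  rw [h4]; field_simp

end ExplicitResolvent

/-! ### The resolvent of `M̃` -/

section SecondOrder

variable {V : ℝ → ℝ} {θ : ℝ} {n : ℕ} {z q : ℂ}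

/-- Bessel's inequality for the shifted CMV basis. -/
lemma bessel_psi (hV : ContinuousOn V 𝕁) {f : ℝ → ℂ} (hf : Continuous f) (s : Finset ℤ) :
    ∑ i ∈ s, ‖ip V n f (psi V n i)‖ ^ 2 ≤ ∫ x in (-π)..π, ‖f x‖ ^ 2 * wt V n x := by
  classical
  set c : ℤ → ℂ := fun i => ip V n f (psi V n i) with hc
  set t := s.filter fun i : ℤ => 0 ≤ (n : ℤ) + i with ht
  have h0 : ∑ i ∈ s, ‖c i‖ ^ 2 = ∑ i ∈ t, ‖c i‖ ^ 2 := by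
    rw [ht, Finset.sum_filter_of_ne]
    intro i _ hi
    by_contra h
    apply hi
    simp only [hc, psi_of_neg (by omega : (n : ℤ) + i < 0)]
    simp [ip]
  set p : ℝ → ℂ := fun x => ∑ i ∈ t, c i * psi V n i x with hp
  have hpc : ∀ i, Continuous fun x => c i * psi V n i x := fun i => continuous_const.mul (continuous_psi i)
  have hpcont : Continuous p := continuous_finsetSum _ fun i _ => hpc i
  have e1 : ∀ g : ℝ → ℂ, Continuous g → ip V n p g = ∑ i ∈ t, c i * ip V n (psi V n i) g := fun g hg => by
    rw [hp, ip_sum_left hV t (fun i _ => hpc i) hg]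
    simp only [ip_smul_left]
  have e2 : ∑ i ∈ t, c i * conj (c i) = ((∑ i ∈ t, ‖c i‖ ^ 2 : ℝ) : ℂ) := by
    push_cast
    refine sum_congr rfl fun i _ => ?_
    rw [mul_conj, normSq_eq_norm_sq]; push_cast; rfl
  have pf : ip V n p f = ((∑ i ∈ t, ‖c i‖ ^ 2 : ℝ) : ℂ) := by
    rw [e1 f hf, ← e2]
    exact sum_congr rfl fun i _ => by rw [ip_conj]
  have pp : ip V n p p = ((∑ i ∈ t, ‖c i‖ ^ 2 : ℝ) : ℂ) := by
    rw [e1 p hpcont, ← e2]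
    refine sum_congr rfl fun i hi => ?_
    rw [ip_conj, e1 _ (continuous_psi i)]
    congr 2
    rw [sum_eq_single i]
    · rw [psi_orthonormal hV (Finset.mem_filter.1 hi).2, if_pos rfl, mul_one]
    · intro j hj hji
      rw [psi_orthonormal hV (Finset.mem_filter.1 hj).2, if_neg hji, mul_zero]
    · exact fun h => absurd hi h
  have hh : ip V n (fun x => f x - p x) (fun x => f x - p x)
      = ((∫ x in (-π)..π, ‖f x‖ ^ 2 * wt V n x : ℝ) : ℂ) - ((∑ i ∈ t, ‖c i‖ ^ 2 : ℝ) : ℂ) := by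
    have hc : Continuous fun x => f x - p x := hf.sub hpcont
    rw [ip_sub_left hV hf hpcont hc, ip_conj, ip_conj (g := p),
      ip_sub_left hV hf hpcont hf, ip_sub_left hV hf hpcont hpcont, ip_self_eq, pf, pp,
      ip_conj, pf, map_sub, map_sub]
    simp only [conj_ofReal]; ring
  rw [ip_self_eq, ← ofReal_sub] at hh
  have h1 := Complex.ofReal_injective hh
  have h2 : 0 ≤ ∫ x in (-π)..π, ‖f x - p x‖ ^ 2 * wt V n x :=
    intervalIntegral.integral_nonneg (by linarith [pi_pos]) fun x _ =>
      mul_nonneg (by positivity) (wt_pos V n x).le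
  rw [h0]; linarith

/-- `x ↦ (cos x - z)⁻¹ ψ_j(x)`. -/
def cauchyPsi (V : ℝ → ℝ) (n : ℕ) (z : ℂ) (j : ℤ) (x : ℝ) : ℂ := ((cos x : ℂ) - z)⁻¹ * psi V n j x

lemma cos_sub_ne_zero (hz : z.im ≠ 0) (t : ℝ) : (t : ℂ) - z ≠ 0 := fun h => by
  apply hz
  rw [← sub_eq_zero.1 h, ofReal_im]

lemma continuous_cauchyPsi (hz : z.im ≠ 0) (j : ℤ) : Continuous (cauchyPsi V n z j) := by
  refine Continuous.mul (Continuous.inv₀ (by fun_prop) fun x => cos_sub_ne_zero hz _) (continuous_psi j)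

/-- The column of `(M̃ - z)⁻¹` with index `j`. -/
def gTilde (V : ℝ → ℝ) (hV : ContinuousOn V 𝕁) (n : ℕ) {z : ℂ} (hz : z.im ≠ 0) (j : ℤ) : L2Z :=
  ⟨fun i => ip V n (cauchyPsi V n z j) (psi V n i), memlp_of_summable
    (summable_of_sum_le (fun _ => by positivity) fun s => bessel_psi hV (continuous_cauchyPsi hz j) s)⟩

lemma abs_gTilde_le (hV : ContinuousOn V 𝕁) (hz : z.im ≠ 0) {j : ℤ} (hj : 0 ≤ n + j) {r : ℝ}
    (hr : ∀ t ∈ 𝕁, ‖((t : ℂ) - z)⁻¹‖ ≤ r) (i : ℤ) : ‖gTilde V hV n hz j i‖ ≤ r := by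
  have hr0 : 0 ≤ r := (norm_nonneg _).trans (hr 0 (by norm_num))
  have h1 := bessel_psi (n := n) hV (continuous_cauchyPsi (V := V) (n := n) hz j) {i}
  rw [Finset.sum_singleton] at h1
  refine abs_le_of_sq_le_sq' (h1.trans ?_) hr0 |>.2
  have h2 := psi_orthonormal hV hj (k := j)
  rw [if_pos rfl, ip_self_eq] at h2
  have h4 : ∫ x in (-π)..π, ‖psi V n j x‖ ^ 2 * wt V n x = 1 := by exact_mod_cast h2
  have hw := continuous_wt hV n
  have hpsi := continuous_psi (V := V) (n := n) j
  have hcp := continuous_cauchyPsi (V := V) (n := n) hz j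
  rw [← mul_one (r ^ 2), ← h4, ← intervalIntegral.integral_const_mul]
  refine intervalIntegral.integral_mono_on (by linarith [pi_pos])
    (intervalIntegrable (by fun_prop) _ _) (intervalIntegrable (by fun_prop) _ _)
    fun x _ => ?_
  rw [cauchyPsi, norm_mul, mul_pow, ← mul_assoc]
  have := hr (cos x) ⟨neg_one_le_cos x, cos_le_one x⟩
  have := (wt_pos V n x).le
  gcongr

lemma Mstar_band (f : L2Z) (i : ℤ) :
    MstarOp θ f i = ∑ d ∈ 𝔹, (Mstar θ i (i + d) : ℂ) * f (i + d) := by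
  rw [MstarOp_apply, sum_Icc_two]
  have e : ∀ d : ℤ, Mstar θ i (i + d) = if d = 0 then ca θ else if d = 2 ∨ d = -2 then cc θ / 2 else 0 := fun d => by
    rw [Mstar]
    by_cases h0 : d = 0
    · rw [if_pos (by omega), if_neg (by omega), if_neg (by omega), if_pos h0]; ring
    · rw [if_neg (by omega), if_neg h0]
      by_cases h2 : d = 2
      · rw [if_neg (by omega), if_pos (by omega), if_pos (by omega)]; ring
      · by_cases h3 : d = -2
        · rw [if_pos (by omega), if_neg (by omega), if_pos (by omega)]; ring
        · rw [if_neg (by omega), if_neg (by omega), if_neg (by omega)]; ring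
  simp only [e]
  rw [sub_eq_add_neg]; norm_num; ring

/-- `δM` as an operator. -/
def deltaOp (θ : ℝ) (n : ℕ) (hV : ContinuousOn V 𝕁) : L2Z →L[ℂ] L2Z :=
  bandOp (deltaM V θ n) 3 (abs_deltaM_le hV)

lemma deltaOp_isSymmetric (hV : ContinuousOn V 𝕁) (f g : L2Z) :
    inner ℂ (deltaOp θ n hV f) g = inner ℂ f (deltaOp θ n hV g) :=
  bandOp_isSymmetric (deltaM_symm V θ n) f g

lemma add_deltaOp_isSymmetric (hV : ContinuousOn V 𝕁) (f g : L2Z) :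
    inner ℂ ((MstarOp θ + deltaOp θ n hV) f) g = inner ℂ f ((MstarOp θ + deltaOp θ n hV) g) := by
  rw [add_apply, add_apply, inner_add_left, inner_add_right, MstarOp_isSymmetric, deltaOp_isSymmetric]

lemma add_deltaOp_apply (hV : ContinuousOn V 𝕁) (f : L2Z) (i : ℤ) :
    (MstarOp θ + deltaOp θ n hV) f i
      = ∑ d ∈ 𝔹, (Mtilde V θ n i (i + d) : ℂ) * f (i + d) := by
  have e : (MstarOp θ + deltaOp θ n hV) f i = MstarOp θ f i + deltaOp θ n hV f i := rfl
  rw [e, Mstar_band, deltaOp, bandOp_apply, ← sum_add_distrib]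
  refine sum_congr rfl fun d _ => ?_
  rw [← add_mul, deltaM]; push_cast; ring

lemma add_deltaOp_sub_gTilde (hV : ContinuousOn V 𝕁) (hz : z.im ≠ 0) {j : ℤ} (hj : 0 ≤ n + j) :
    (MstarOp θ + deltaOp θ n hV - z • (1 : L2Z →L[ℂ] L2Z)) (gTilde V hV n hz j) = lp.single 2 j 1 := by
  ext i
  have e : (MstarOp θ + deltaOp θ n hV - z • (1 : L2Z →L[ℂ] L2Z)) (gTilde V hV n hz j) i
      = (MstarOp θ + deltaOp θ n hV) (gTilde V hV n hz j) i
        - z * ip V n (cauchyPsi V n z j) (psi V n i) := rfl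
  have e2 : ∀ i, gTilde V hV n hz j i = ip V n (cauchyPsi V n z j) (psi V n i) := fun _ => rfl
  rw [e, add_deltaOp_apply, lp.single_apply, Pi.single_apply]
  simp only [e2]
  have hcp := continuous_cauchyPsi (V := V) (n := n) hz j
  by_cases hi : 0 ≤ n + i
  · have h1 : ∑ d ∈ 𝔹, (Mtilde V θ n i (i + d) : ℂ)
        * ip V n (cauchyPsi V n z j) (psi V n (i + d))
        = ip V n (fun x => (cos x : ℂ) * cauchyPsi V n z j x) (psi V n i) := by
      have h2 : ip V n (fun x => (cos x : ℂ) * psi V n i x) (cauchyPsi V n z j)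
          = ip V n (fun x => ∑ d ∈ 𝔹, (Mtilde V θ n i (i + d) : ℂ) * psi V n (i + d) x)
            (cauchyPsi V n z j) := by
        rw [ip, ip]
        refine integral_congr fun x hx => ?_
        rw [uIcc_of_le (by linarith [pi_pos])] at hx
        simp only [cos_mul_psi θ hV hi hx]
      rw [ip_sum_left hV (F := fun d x => (Mtilde V θ n i (i + d) : ℂ) * psi V n (i + d) x) _
        (fun d _ => continuous_const.mul (continuous_psi _)) hcp] at h2
      have h4 := congrArg conj h2
      simp only [ip_smul_left, map_sum, map_mul, conj_ofReal, ← ip_conj] at h4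
      rw [← h4, ip, ip]
      congr 1; ext x
      rw [map_mul, conj_ofReal]; ring
    have hcc : Continuous fun x => (cos x : ℂ) * cauchyPsi V n z j x := by fun_prop
    rw [h1, ← ip_smul_left, ← ip_sub_left hV hcc (by fun_prop) (continuous_psi i)]
    have h5 : (fun x => (cos x : ℂ) * cauchyPsi V n z j x - z * cauchyPsi V n z j x) = psi V n j := by
      ext x
      rw [← sub_mul, cauchyPsi, ← mul_assoc, mul_inv_cancel₀ (cos_sub_ne_zero hz _), one_mul]
    rw [h5, psi_orthonormal hV hj]
    simp only [eq_comm]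
  · have h0 : ∀ g : ℝ → ℂ, ∀ i : ℤ, n + i < 0 → ip V n g (psi V n i) = 0 := fun g i h => by
      rw [psi_of_neg h]; simp [ip]
    rw [h0 _ i (by omega), if_neg (by omega), mul_zero, sub_zero]
    refine sum_eq_zero fun d _ => ?_
    by_cases hd : 0 ≤ n + (i + d)
    · rw [Mtilde_low V θ n ⟨by omega, hd⟩, ofReal_zero, zero_mul]
    · rw [h0 _ _ (by omega), mul_zero]

/-- The identity `R̃ - R⋆ + R⋆ δM R⋆ = -R⋆ δM (R̃ - R⋆)`, for the entries. -/
lemma second_resolvent_identity (hV : ContinuousOn V 𝕁) (h : IsRoot θ z q) (hc : 0 < cc θ)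
    (hz : z.im ≠ 0) {j : ℤ} (hj : 0 ≤ n + j) (k : ℤ) :
    (gTilde V hV n hz j - gVec θ q h.lt_one j : L2Z) k
        + inner ℂ (deltaOp θ n hV (gVec θ (conj q) h.conj.lt_one k)) (gVec θ q h.lt_one j)
      = -inner ℂ (deltaOp θ n hV (gVec θ (conj q) h.conj.lt_one k))
          (gTilde V hV n hz j - gVec θ q h.lt_one j) := by
  set D := deltaOp θ n hV
  set u := gVec θ q h.lt_one j
  set g := gTilde V hV n hz j
  set T := MstarOp θ - z • (1 : L2Z →L[ℂ] L2Z) with hT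
  have h1 := add_deltaOp_sub_gTilde (θ := θ) hV hz hj
  have h2 : T u = lp.single 2 j 1 := MstarOp_sub_gVec h hc j
  have h4 : T (g - u) = -D g := by
    rw [map_sub, h2, ← h1, hT]
    simp only [sub_apply, add_apply]
    abel
  have h5 : g - u = Ring.inverse T (-D g) := by
    rw [← h4, ← mul_apply_eq_comp, Ring.inverse_mul_cancel _ (isUnit_sub_smul (MstarOp_isSymmetric θ) hz)]
    rfl
  have h6 := inner_gVec_conj h hc hz k (-D g)
  rw [← hT, ← h5, inner_neg_right] at h6
  rw [← h6, inner_sub_right, deltaOp_isSymmetric, deltaOp_isSymmetric]; ring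

/-- `R̃ - R⋆ = -R̃ δM R⋆` and `‖R̃‖ ≤ 1 / |Im z|`. -/
lemma im_mul_norm_gTilde_sub_le (hV : ContinuousOn V 𝕁) (h : IsRoot θ z q) (hc : 0 < cc θ)
    (hz : z.im ≠ 0) {j : ℤ} (hj : 0 ≤ n + j) :
    |z.im| * ‖gTilde V hV n hz j - gVec θ q h.lt_one j‖ ≤ ‖deltaOp θ n hV (gVec θ q h.lt_one j)‖ := by
  refine (im_mul_norm_le_norm (add_deltaOp_isSymmetric (θ := θ) (n := n) hV) z _).trans (le_of_eq ?_)
  rw [map_sub, add_deltaOp_sub_gTilde hV hz hj, ← MstarOp_sub_gVec h hc j, ← norm_neg]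
  congr 1
  simp only [sub_apply, add_apply]
  abel

/-- Schur-type bound with weights; the factor `25` counts the pairs of diagonals. -/
lemma norm_sq_bandOp_le {m : ℤ → ℤ → ℝ} {K : ℝ} {hm : ∀ j k, |m j k| ≤ K} {W : ℤ → ℝ} {B : ℝ}
    (hsymm : ∀ j k, m j k = m k j) (f : L2Z)
    (hW : ∀ j d, -2 ≤ d → d ≤ 2 → m j (j + d) ^ 2 ≤ W j) (hB : ∀ j, W j ≤ B) :
    ‖bandOp m K hm f‖ ^ 2 ≤ 25 * ∑' j, ‖f j‖ ^ 2 * W j := by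
  have hs : Summable fun j => ‖f j‖ ^ 2 * W j := by
    refine ((summable_sq f).mul_right B).of_nonneg_of_le (fun j => ?_) fun j => ?_
    · exact mul_nonneg (by positivity) ((sq_nonneg _).trans (hW j 0 (by norm_num) (by norm_num)))
    · exact mul_le_mul_of_nonneg_left (hB j) (by positivity)
  have hsd : ∀ d : ℤ, HasSum (fun j => ‖f (j + d)‖ ^ 2 * W (j + d)) (∑' j, ‖f j‖ ^ 2 * W j) := fun d =>
    (Equiv.addRight d).hasSum_iff.2 hs.hasSum
  have htot := (hasSum_sum fun (d : ℤ) (_ : d ∈ 𝔹) => hsd d).mul_left 5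
  rw [sum_const, show (𝔹).card = 5 by decide] at htot
  rw [norm_sq_eq]
  refine (Summable.tsum_le_tsum (fun j => ?_) (summable_sq _) htot.summable).trans (le_of_eq ?_)
  · rw [bandOp_apply]
    have h1 := norm_sum_le 𝔹 fun d => (m j (j + d) : ℂ) * f (j + d)
    have h2 := sq_sum_le_card_mul_sum_sq (s := 𝔹)
      (f := fun d => ‖(m j (j + d) : ℂ) * f (j + d)‖)
    rw [show (𝔹).card = 5 by decide] at h2
    refine (pow_le_pow_left₀ (norm_nonneg _) h1 2).trans (h2.trans ?_)
    push_cast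
    refine mul_le_mul_of_nonneg_left (sum_le_sum fun d hd => ?_) (by norm_num)
    rw [Finset.mem_Icc] at hd
    rw [norm_mul, mul_pow, norm_real, norm_eq_abs, sq_abs, mul_comm, hsymm]
    have := hW (j + d) (-d) (by omega) (by omega)
    rw [add_neg_cancel_right] at this
    exact mul_le_mul_of_nonneg_left this (by positivity)
  · rw [htot.tsum_eq]; ring

end SecondOrder

/-! ### The second-order functional -/

section SecondOrderFunctional

variable {V : ℝ → ℝ} {θ s : ℝ} {n : ℕ} {z q : ℂ}

/-- A term of the linear part of `F ↦ F(M̃)`: the coefficient of `δM_{k+l,k+l+d'}` is the matrix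
element of the divided difference of `F`. -/
def linTerm (V : ℝ → ℝ) (θ : ℝ) (n : ℕ) (k d d' l : ℤ) (F : ℝ → ℂ) : ℂ :=
  ((if Even (l - d) ∧ Even (l + d' + 1) then 2 / cc θ * deltaM V θ n (k + l) (k + l + d') else 0 : ℝ) : ℂ)
    * Etail θ (((l - d).natAbs + (l + d' + 1).natAbs) / 2) F

/-- The entry `(k+d, k-1)` of `F(M̃)`, minus its zeroth-order part and its part linear in `δM`. -/
def secondOrder (V : ℝ → ℝ) (θ : ℝ) (n : ℕ) (k d : ℤ) (F : ℝ → ℂ) : ℂ := (∫ x in (-π)..π, F (cos x)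
      * (psi V n (k + d) x * conj (psi V n (k - 1) x) * (wt V n x : ℂ)))
    - (if Even (d + 1) then 1 else 0) * fcf θ ((d + 1) / 2).natAbs F
    - ∑ d' ∈ 𝔹, ∑' l : ℤ, linTerm V θ n k d d' l F

lemma summable_tail_weight {d d' : ℤ} (h1 : -2 ≤ d ∧ d ≤ 2) (h2 : -2 ≤ d' ∧ d' ≤ 2) :
    Summable fun l : ℤ => (120 : ℝ) / (((((l - d).natAbs + (l + d' + 1).natAbs) / 2 : ℕ) + 1)
      * √((((l - d).natAbs + (l + d' + 1).natAbs) / 2 : ℕ) + 1)) := by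
  have hs := (hasSum_ite_eq (0 : ℤ) (120 : ℝ)).summable.add
    ((summable_abs_int_rpow (b := 3 / 2) (by norm_num)).mul_left (120 * 8))
  refine hs.of_nonneg_of_le (fun l => by positivity) fun l => ?_
  set p := ((l - d).natAbs + (l + d' + 1).natAbs) / 2 with hp
  have hlp : l.natAbs ≤ 4 * (p + 1) := by omega
  have e1 : (((p : ℝ) + 1) * √((p : ℝ) + 1))⁻¹ = ((p : ℝ) + 1) ^ (-(3 / 2) : ℝ) := by
    rw [rpow_neg (by positivity), sqrt_eq_rpow, ← rpow_one_add' (by positivity) (by norm_num)]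
    norm_num
  rw [div_eq_mul_inv, e1]
  split_ifs with h0
  · have := rpow_le_one_of_one_le_of_nonpos (x := (p : ℝ) + 1)
      (by linarith [Nat.cast_nonneg (α := ℝ) p]) (by norm_num : (-(3 / 2) : ℝ) ≤ 0)
    have : 0 ≤ |(l : ℝ)| ^ (-(3 / 2) : ℝ) := by positivity
    linarith
  · have hm0 : 0 < |(l : ℝ)| := abs_pos.2 (by exact_mod_cast h0)
    have hle : |(l : ℝ)| / 4 ≤ (p : ℝ) + 1 := by
      have : |(l : ℝ)| = ((l.natAbs : ℕ) : ℝ) := by rw [Nat.cast_natAbs, Int.cast_abs]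
      rw [this]
      have : ((l.natAbs : ℕ) : ℝ) ≤ ((4 * (p + 1) : ℕ) : ℝ) := by exact_mod_cast hlp
      push_cast at this; linarith
    rw [zero_add, mul_assoc]
    refine mul_le_mul_of_nonneg_left ?_ (by norm_num)
    refine (rpow_le_rpow_of_nonpos (by positivity) hle (by norm_num)).trans (le_of_eq ?_)
    rw [div_rpow hm0.le (by norm_num), div_eq_mul_inv, mul_comm, ← rpow_neg (by norm_num),
      neg_neg, show (4 : ℝ) = 2 ^ (2 : ℝ) by norm_num, ← rpow_mul (by norm_num)]
    norm_num

/-- The series of functionals converges, by the decay of `Etail` on exponentials. -/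
lemma exists_fourierFunctional_secondOrder (hV : ContinuousOn V 𝕁) (k : ℤ) {d : ℤ}
    (hd : -2 ≤ d ∧ d ≤ 2) : ∃ K, FourierFunctional (secondOrder V θ n k d) K := by
  obtain ⟨K1, hK1⟩ := fourierFunctional_fcf θ ((d + 1) / 2).natAbs
  have hw := continuous_wt hV n
  have hcont : Continuous fun x => psi V n (k + d) x * conj (psi V n (k - 1) x) * (wt V n x : ℂ) := by
    have h1 := continuous_psi (V := V) (n := n) (k + d)
    have h2 := continuous_conj.comp (continuous_psi (V := V) (n := n) (k - 1))
    simp only [Function.comp_def] at h2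
    fun_prop
  have h0 := FourierFunctional.of_integral continuous_cos
    (fun x => ⟨neg_one_le_cos x, cos_le_one x⟩) hcont
  have h2 : ∀ d' ∈ 𝔹, FourierFunctional (fun F => ∑' l : ℤ, linTerm V θ n k d d' l F) _ :=
      fun d' hd' => by
    rw [Finset.mem_Icc] at hd'
    refine FourierFunctional.tsum (fun l => (fourierFunctional_Etail θ _).const_mul _) ?_
    refine ((summable_tail_weight hd hd').mul_left (2 / cc θ * 3)).of_nonneg_of_le
      (fun l => by positivity) fun l => ?_
    refine mul_le_mul_of_nonneg_right ?_ (by positivity)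
    have := cc_nonneg θ
    rw [norm_real, norm_eq_abs]
    split_ifs
    · rw [abs_mul, abs_of_nonneg (by positivity : 0 ≤ 2 / cc θ)]
      exact mul_le_mul_of_nonneg_left (abs_deltaM_le hV _ _) (by positivity)
    · rw [abs_zero]; positivity
  exact ⟨_, (h0.sub (hK1.const_mul _)).sub (FourierFunctional.sum _ h2)⟩

/-- On Cauchy kernels the linear part is the first-order term of the resolvent expansion. -/
lemma inner_deltaOp_gVec (hV : ContinuousOn V 𝕁) (h : IsRoot θ z q) (hc : 0 < cc θ) (k d : ℤ) :
    inner ℂ (deltaOp θ n hV (gVec θ (conj q) h.conj.lt_one (k - 1))) (gVec θ q h.lt_one (k + d))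
      = -∑ d' ∈ 𝔹, ∑' l : ℤ, linTerm V θ n k d d' l (fun t => ((t : ℂ) - z)⁻¹) := by
  have e1 : ∀ i : ℤ, gVec θ q h.lt_one (k + d) i * conj
      (deltaOp θ n hV (gVec θ (conj q) h.conj.lt_one (k - 1)) i)
      = ∑ d' ∈ 𝔹, (deltaM V θ n i (i + d') : ℂ)
        * (gFun θ q (k + d) i * gFun θ q (k - 1) (i + d')) := fun i => by
    rw [deltaOp, bandOp_apply, map_sum, mul_sum]
    refine sum_congr rfl fun d' _ => ?_
    rw [map_mul, conj_ofReal]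
    have e : conj ((gVec θ (conj q) h.conj.lt_one (k - 1)) (i + d'))
        = gFun θ q (k - 1) (i + d') := by
      rw [← conj_conj (gFun θ q (k - 1) (i + d')), gFun_conj]; rfl
    rw [e]
    change gFun θ q (k + d) i * _ = _
    ring
  have hsum : ∀ d' ∈ 𝔹, Summable fun i => (deltaM V θ n i (i + d') : ℂ)
        * (gFun θ q (k + d) i * gFun θ q (k - 1) (i + d')) := fun d' _ => by
    have s1 := summable_gFun (θ := θ) h.lt_one (k + d)
    have s2 := (Equiv.addRight d').summable_iff.2 (summable_gFun (θ := θ) h.lt_one (k - 1))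
    refine Summable.of_norm_bounded ((s1.add s2).mul_left 3) fun i => ?_
    rw [norm_mul, norm_mul, norm_real, norm_eq_abs]
    refine mul_le_mul (abs_deltaM_le hV _ _) ?_ (by positivity) (by norm_num)
    change _ ≤ ‖gFun θ q (k + d) i‖ ^ 2 + ‖gFun θ q (k - 1) (i + d')‖ ^ 2
    nlinarith [sq_nonneg (‖gFun θ q (k + d) i‖ - ‖gFun θ q (k - 1) (i + d')‖),
      sq_nonneg (‖gFun θ q (k + d) i‖ + ‖gFun θ q (k - 1) (i + d')‖)]
  rw [inner_eq, tsum_congr e1, Summable.tsum_finsetSum hsum, ← Finset.sum_neg_distrib]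
  refine sum_congr rfl fun d' _ => ?_
  rw [← (Equiv.addLeft k).tsum_eq, ← tsum_neg]
  refine tsum_congr fun l => ?_
  simp only [Equiv.coe_addLeft]
  rw [linTerm, gFun, gFun, show k + l - (k + d) = l - d by ring, show k + l + d' - (k - 1) = l + d' + 1 by ring]
  by_cases h1 : Even (l - d)
  · by_cases h2 : Even (l + d' + 1)
    · rw [if_pos h1, if_pos h2, if_pos ⟨h1, h2⟩]
      have := Etail_cauchy h hc (((l - d).natAbs + (l + d' + 1).natAbs) / 2)
      rw [← half_natAbs h1, ← half_natAbs h2]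
      rw [even_iff] at h1 h2
      have e : ((l - d).natAbs + (l + d' + 1).natAbs) / 2
          = (l - d).natAbs / 2 + (l + d' + 1).natAbs / 2 := by omega
      rw [e, pow_add] at this
      push_cast
      rw [e]
      linear_combination (deltaM V θ n (k + l) (k + l + d') : ℂ) * this
    · simp only [h2, and_false, if_false]; simp
  · simp only [h1, false_and, if_false]; simp

/-- At a Cauchy kernel `secondOrder` is an entry of `R̃ - R⋆ + R⋆ δM R⋆`. -/
lemma secondOrder_cauchy (hV : ContinuousOn V 𝕁) (h : IsRoot θ z q) (hc : 0 < cc θ)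
    (hz : z.im ≠ 0) (k d : ℤ) : secondOrder V θ n k d (fun t => ((t : ℂ) - z)⁻¹)
      = (gTilde V hV n hz (k + d) - gVec θ q h.lt_one (k + d) : L2Z) (k - 1)
        + inner ℂ (deltaOp θ n hV (gVec θ (conj q) h.conj.lt_one (k - 1)))
          (gVec θ q h.lt_one (k + d)) := by
  rw [inner_deltaOp_gVec hV h hc, secondOrder, ← sub_eq_add_neg]
  congr 1
  change _ = gTilde V hV n hz (k + d) (k - 1) - gFun θ q (k + d) (k - 1)
  congr 1
  · change _ = ip V n _ _
    rw [ip]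
    congr 1; ext x
    rw [cauchyPsi]; ring
  · rw [gFun, show k - 1 - (k + d) = -(d + 1) by ring, fcf_cauchy h hc]
    simp only [even_neg]
    split_ifs with h1
    · rw [one_mul]
      rw [even_iff] at h1
      congr 2; omega
    · rw [zero_mul]

lemma norm_fcf_le {r : ℝ} {F : ℝ → ℂ} (hr : ∀ t ∈ 𝕁, ‖F t‖ ≤ r) (m : ℕ) : ‖fcf θ m F‖ ≤ r := by
  have h1 := intervalIntegral.norm_integral_le_of_norm_le_const (a := -π) (b := π)
    (f := fun x => F (ca θ + cc θ * cos x) * (cos (m * x) : ℝ)) (C := r) fun x _ => by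
      rw [norm_mul, norm_real, norm_eq_abs]
      exact (mul_le_of_le_one_right (norm_nonneg _) (abs_cos_le_one _)).trans (hr _ (arg_mem θ x))
  rw [fcf, norm_mul, show ‖(1 / (2 * π) : ℂ)‖ = 1 / (2 * π) by
    rw [← Complex.ofReal_ofNat, ← ofReal_mul, ← Complex.ofReal_one, ← ofReal_div,
      norm_real, norm_of_nonneg (by positivity)]]
  rw [show π - -π = 2 * π by ring, abs_of_pos (by positivity)] at h1
  calc _ ≤ 1 / (2 * π) * (r * (2 * π)) := mul_le_mul_of_nonneg_left h1 (by positivity)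
    _ = r := by field_simp

lemma norm_sq_deltaOp_le (hV : ContinuousOn V 𝕁) (f : L2Z) :
    ‖deltaOp θ n hV f‖ ^ 2 ≤ 225 * ‖f‖ ^ 2 := by
  have := norm_sq_bandOp_le (hm := abs_deltaM_le hV) (W := fun _ => 9) (deltaM_symm V θ n) f
    (fun j d _ _ => by
      have := abs_le.1 (abs_deltaM_le (θ := θ) (n := n) hV j (j + d))
      nlinarith) (fun _ => le_rfl)
  rw [tsum_mul_right, ← norm_sq_eq] at this
  rw [deltaOp]; linarith

/-- The two bounds for the second-order remainder of the resolvent. -/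
lemma exists_secondOrder_bound (hV : ContinuousOn V 𝕁) (h0 : 0 < θ) (hpi : θ < π)
    (hc : 0 < cc θ) : ∃ K : ℝ, 0 ≤ K ∧ ∀ (s : ℝ) (n : ℕ) (k d : ℤ) (z q : ℂ) (r : ℝ), (s = 1 ∨ s = -1) →
      -2 ≤ d ∧ d ≤ 2 → 0 ≤ n + (k + d) → z.im ≠ 0 → IsRoot θ z q →
      (∀ t ∈ 𝕁, ‖((t : ℂ) - z)⁻¹‖ ≤ r) →
      ‖secondOrder V θ n k d (fun t => ((t : ℂ) - z)⁻¹)‖ ≤ K * min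
        (|z.im|⁻¹ * ∑' t : ℤ, ‖f0 θ q * q ^ t.natAbs‖ ^ 2 * S V θ s n (k + 2 * t))
        (r + ∑' t : ℤ, ‖f0 θ q * q ^ t.natAbs‖ ^ 2) := by
  obtain ⟨KM, hKM0, hKM⟩ := exists_deltaM_bound hV h0 hpi
  refine ⟨125 * KM + 15, by positivity, fun s n k d z q r hs hd hj hz h hr => ?_⟩
  have hr0 : 0 ≤ r := (norm_nonneg _).trans (hr 0 (by norm_num))
  have hW : ∀ i, KM * locSq (xt V θ s n) i ≤ KM * (5 * 336) := fun i => by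
    refine mul_le_mul_of_nonneg_left ?_ hKM0
    have h1 := locSq_le_S (V := V) (θ := θ) (s := s) (n := n) (i := 0) (by norm_num) i
    rw [add_zero] at h1
    linarith [S_le (n := n) hV hs h0 hpi i]
  have hsf : Summable fun t : ℤ => ‖f0 θ q * q ^ t.natAbs‖ ^ 2 := by
    have := (summable_pow_natAbs (sq_nonneg ‖q‖) (by nlinarith [h.lt_one, norm_nonneg q] :
      ‖q‖ ^ 2 < 1)).mul_left (‖f0 θ q‖ ^ 2)
    refine this.congr fun t => ?_
    rw [norm_mul, norm_pow, mul_pow, ← pow_mul, ← pow_mul, mul_comm 2]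
  set Q := ∑' t : ℤ, ‖f0 θ q * q ^ t.natAbs‖ ^ 2 * S V θ s n (k + 2 * t) with hQ
  have hsQ : Summable fun t : ℤ => ‖f0 θ q * q ^ t.natAbs‖ ^ 2 * S V θ s n (k + 2 * t) :=
    (hsf.mul_right 336).of_nonneg_of_le (fun t => mul_nonneg (by positivity) (S_nonneg _)) fun t =>
      mul_le_mul_of_nonneg_left (S_le hV hs h0 hpi _) (by positivity)
  have hQ0 : 0 ≤ Q := tsum_nonneg fun t => mul_nonneg (by positivity) (S_nonneg _)
  set N := ∑' t : ℤ, ‖f0 θ q * q ^ t.natAbs‖ ^ 2 with hN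
  -- the bound for `δM R⋆` in terms of `Q`, at `q` and at its conjugate
  have hDG : ∀ {q' : ℂ} (hq' : ‖q'‖ < 1) (i : ℤ), -8 ≤ i ∧ i ≤ 8 →
      (∀ t : ℤ, ‖f0 θ q' * q' ^ t.natAbs‖ = ‖f0 θ q * q ^ t.natAbs‖) →
      ‖deltaOp θ n hV (gVec θ q' hq' (k + i))‖ ^ 2 ≤ 125 * KM * Q := fun {q'} hq' i hi he => by
    refine (norm_sq_bandOp_le (deltaM_symm V θ n) _ (fun j d h1 h2 => (hKM s n j d hs h1 h2).2.2) hW).trans ?_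
    have := tsum_gFun_mul (θ := θ) (q := q') (fun j => KM * locSq (xt V θ s n) j) (k + i)
    change 25 * ∑' j, ‖gFun θ q' (k + i) j‖ ^ 2 * (KM * locSq (xt V θ s n) j) ≤ _
    have hQ' : 5 * KM * Q = ∑' t : ℤ, 5 * KM * (‖f0 θ q * q ^ t.natAbs‖ ^ 2 * S V θ s n (k + 2 * t)) := by
      rw [hQ, ← tsum_mul_left]
    rw [this, show 125 * KM * Q = 25 * (5 * KM * Q) by ring, hQ']
    refine mul_le_mul_of_nonneg_left (Summable.tsum_le_tsum (fun t => ?_) ?_ (hsQ.mul_left (5 * KM))) (by norm_num)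
    · rw [he]
      have h1 := locSq_le_S (V := V) (θ := θ) (s := s) (n := n) hi (k + 2 * t)
      rw [show k + i + 2 * t = k + 2 * t + i by ring]
      calc _ ≤ ‖f0 θ q * q ^ t.natAbs‖ ^ 2 * (KM * (5 * S V θ s n (k + 2 * t))) := by gcongr
        _ = _ := by ring
    · simp only [he]
      refine (hsf.mul_right (KM * (5 * 336))).of_nonneg_of_le
        (fun t => mul_nonneg (by positivity) (mul_nonneg hKM0 (locSq_nonneg _ _))) fun t => ?_
      exact mul_le_mul_of_nonneg_left (hW _) (by positivity)
  have hA := hDG h.lt_one d (by omega) fun _ => rfl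
  have hB := hDG h.conj.lt_one (-1) (by omega) norm_f0_conj
  rw [← sub_eq_add_neg] at hB
  set u := gVec θ q h.lt_one (k + d) with hu
  set u' := gVec θ (conj q) h.conj.lt_one (k - 1) with hu'
  have hy : 0 < |z.im| := abs_pos.2 hz
  rw [secondOrder_cauchy hV h hc hz, mul_min_of_nonneg _ _ (by positivity)]
  refine le_min ?_ ?_
  · have h1 := im_mul_norm_gTilde_sub_le (θ := θ) hV h hc hz hj
    rw [← hu] at h1
    rw [second_resolvent_identity hV h hc hz hj, norm_neg]
    refine (norm_inner_le_norm _ _).trans ?_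
    rw [← hu, ← hu']
    have h2 : ‖gTilde V hV n hz (k + d) - u‖ ≤ |z.im|⁻¹ * ‖deltaOp θ n hV u‖ := by
      rw [inv_mul_eq_div, le_div_iff₀ hy]; linarith
    calc _ ≤ ‖deltaOp θ n hV u'‖ * (|z.im|⁻¹ * ‖deltaOp θ n hV u‖) := by gcongr
      _ = |z.im|⁻¹ * (‖deltaOp θ n hV u'‖ * ‖deltaOp θ n hV u‖) := by ring
      _ ≤ |z.im|⁻¹ * (125 * KM * Q) := by
        refine mul_le_mul_of_nonneg_left ?_ (by positivity)
        nlinarith only [sq_nonneg (‖deltaOp θ n hV u'‖ - ‖deltaOp θ n hV u‖), hA, hB]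
      _ ≤ (125 * KM + 15) * (|z.im|⁻¹ * Q) := by
        have : 0 ≤ |z.im|⁻¹ * Q := by positivity
        linarith
  · have h1 : ‖(gTilde V hV n hz (k + d) - u : L2Z) (k - 1)‖ ≤ r + r := by
      change ‖gTilde V hV n hz (k + d) (k - 1) - gFun θ q (k + d) (k - 1)‖ ≤ _
      refine (norm_sub_le _ _).trans (add_le_add (abs_gTilde_le hV hz hj hr _) ?_)
      rw [gFun]
      split_ifs
      · rw [← fcf_cauchy h hc]; exact norm_fcf_le hr _
      · rw [norm_zero]; exact hr0
    have h2 : ‖inner ℂ (deltaOp θ n hV u') u‖ ≤ 15 * N := by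
      refine (norm_inner_le_norm _ _).trans ?_
      have h5 : ‖u‖ ^ 2 = N := norm_sq_gVec _ _
      have h6 : ‖u'‖ ^ 2 = N := by
        rw [hu', norm_sq_gVec]; simp only [norm_f0_conj]; rfl
      have h7 := norm_sq_deltaOp_le (θ := θ) (n := n) hV u'
      rw [h6] at h7
      have h8 : ‖deltaOp θ n hV u'‖ ≤ 15 * ‖u‖ := by
        refine abs_le_of_sq_le_sq' ?_ (by positivity) |>.2
        rw [mul_pow, h5]; linarith
      calc _ ≤ 15 * ‖u‖ * ‖u‖ := by gcongr
        _ = 15 * N := by rw [← h5]; ring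
    refine (norm_add_le _ _).trans ((add_le_add h1 h2).trans ?_)
    have : 0 ≤ KM * (r + N) := by positivity
    linarith

end SecondOrderFunctional

/-! ### The remainder of the string equation -/

section Remainder

variable {V : ℝ → ℝ} {θ : ℝ} {n : ℕ} {z q : ℂ}

/-- The remainder of the string equation consists of the second-order remainders of the entries
of `V'(M̃)`. -/
lemma stringRemainder_eq (h3 : ConditionC3 V) (hc : cc θ ≠ 0) (hv : vc V θ 1 = vc V θ 0 + 1 / cc θ)
    (hn : 1 ≤ n) {k : ℤ} (hk : 1 ≤ n + k) : (stringRemainder V θ n k : ℂ)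
      = ∑ d ∈ 𝔹, (Ltilde V n k (k + d) : ℂ) * secondOrder V θ n k d fun t => (dV V t : ℂ) := by
  have hd := h3.contDiffOn.differentiableOn (by norm_num)
  have hdc : ContinuousOn (dV V) 𝕁 :=
    h3.contDiffOn.continuousOn_derivWithin (uniqueDiffOn_Icc (by norm_num)) (by norm_num)
  have h1 := string_equation_matrix hd hdc hn hk
  have e : ∀ d : ℤ, secondOrder V θ n k d (fun t => (dV V t : ℂ))
      = ip V n (fun x => (dV V (cos x) : ℂ) * psi V n (k + d) x) (psi V n (k - 1))
        - ((if Even (d + 1) then 1 else 0) * vc V θ ((d + 1) / 2).natAbs : ℝ)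
        - (∑ d' ∈ 𝔹, ∑' l : ℤ, Bcoef V θ (l - d) (l + d' + 1)
            * deltaM V θ n (k + l) (k + l + d') : ℝ) := fun d => by
    rw [secondOrder]
    congr 1
    · congr 1
      · rw [ip]; congr 1; ext x; ring
      · rw [fcf_dV]; split_ifs <;> simp
    · rw [Complex.ofReal_sum]
      refine sum_congr rfl fun d' _ => ?_
      rw [ofReal_tsum]
      refine tsum_congr fun l => ?_
      rw [linTerm, Etail_dV, ← ofReal_mul, Bcoef_eq h3 hc]
      congr 1
      split_ifs
      · ring
      · simp
  simp only [e, mul_sub, sum_sub_distrib]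
  rw [h1, stringRemainder, v0_eq_vc h3]
  have e2 : ∀ d d' l : ℤ, Ltilde V n k (k + d) * Bcoef V θ (l - d) (l + d' + 1)
            * deltaM V θ n (k + l) (k + l + d') = Ltilde V n k (k + d) * (Bcoef V θ (l - d) (l + d' + 1)
            * deltaM V θ n (k + l) (k + l + d')) := fun _ _ _ => mul_assoc _ _ _
  simp only [e2, tsum_mul_left, ← mul_sum]
  have e4 : ∑ d ∈ 𝔹, (Ltilde V n k (k + d) : ℂ)
      * ((if Even (d + 1) then 1 else 0) * vc V θ ((d + 1) / 2).natAbs : ℝ)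
      = (Ltilde V n k (k + 1) / cc θ + (Ltilde V n k (k + 1) + Ltilde V n k (k - 1)) * vc V θ 0 : ℝ) := by
    rw [sum_Icc_two, if_neg (by decide), if_pos (by decide), if_neg (by decide), if_pos (by decide),
      if_neg (by decide), show ((-1 + 1 : ℤ) / 2).natAbs = 0 by decide,
      show ((1 + 1 : ℤ) / 2).natAbs = 1 by decide, hv, ← sub_eq_add_neg k 1]
    push_cast; ring
  rw [e4]; push_cast; ring

lemma infDist_pos (hz : z.im ≠ 0) : 0 < Metric.infDist z ((fun t : ℝ => (t : ℂ)) '' 𝕁) := by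
  have hcl : IsClosed ((fun t : ℝ => (t : ℂ)) '' 𝕁) :=
    (isCompact_Icc.image continuous_ofReal).isClosed
  rw [← hcl.notMem_iff_infDist_pos ⟨_, 0, by norm_num, rfl⟩]
  rintro ⟨t, -, rfl⟩
  exact hz (ofReal_im t)

lemma norm_inv_le_infDist (hz : z.im ≠ 0) {t : ℝ} (ht : t ∈ 𝕁) :
    ‖((t : ℂ) - z)⁻¹‖ ≤ (Metric.infDist z ((fun t : ℝ => (t : ℂ)) '' 𝕁))⁻¹ := by
  rw [norm_inv]
  refine inv_anti₀ (infDist_pos hz) ?_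
  rw [← dist_eq_norm, dist_comm]
  exact Metric.infDist_le_dist_of_mem ⟨t, ht, rfl⟩

lemma rky_eq (s : ℝ) (k : ℤ) {y x : ℝ} (hy : 0 < y) (hc : 0 < cc θ)
    (h : IsRoot θ (-x + y * I) q) : rky V θ s n k y x = min
        (y⁻¹ * ∑' t : ℤ, ‖f0 θ q * q ^ t.natAbs‖ ^ 2 * S V θ s n (k + 2 * t))
        ((Metric.infDist (-x + y * I : ℂ) ((fun t : ℝ => (t : ℂ)) '' 𝕁))⁻¹
          + ∑' t : ℤ, ‖f0 θ q * q ^ t.natAbs‖ ^ 2) := by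
  have him : (-x + y * I : ℂ).im = y := by simp
  have hz : (-x + y * I : ℂ).im ≠ 0 := by rw [him]; exact hy.ne'
  rw [rky, im_Rstar_eq h hc hz, norm_sq_gVec, him, inv_mul_cancel_left₀ hy.ne']
  simp only [Rstar_two_mul h hc hz]

/-- At Poisson kernels `secondOrder` is bounded by `r_{k,y}`; conjugation gives the bound at `z̄`. -/
lemma exists_secondOrder_le_rky (hV : ContinuousOn V 𝕁) (h0 : 0 < θ) (hpi : θ < π)
    (hc : 0 < cc θ) : ∃ K : ℝ, 0 ≤ K ∧ ∀ (s : ℝ) (n : ℕ) (k d : ℤ) (y x : ℝ), (s = 1 ∨ s = -1) →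
      -2 ≤ d ∧ d ≤ 2 → 0 ≤ n + (k + d) → 0 < y →
      ‖secondOrder V θ n k d (fun t => ((t : ℂ) - (-x + y * I))⁻¹)
        - secondOrder V θ n k d (fun t => ((t : ℂ) - (-x - y * I))⁻¹)‖ ≤ K * rky V θ s n k y x := by
  obtain ⟨K, hK0, hK⟩ := exists_secondOrder_bound hV h0 hpi hc
  refine ⟨K + K, by positivity, fun s n k d y x hs hd hj hy => ?_⟩
  have him : (-x + y * I : ℂ).im = y := by simp
  have hz : (-x + y * I : ℂ).im ≠ 0 := by rw [him]; exact hy.ne'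
  obtain ⟨q, h⟩ := exists_isRoot hc hz
  have hcj : conj (-x + y * I : ℂ) = -x - y * I := by
    simp [sub_eq_add_neg]
  have h1 := hK s n k d _ q _ hs hd hj hz h fun t => norm_inv_le_infDist hz
  have h' := h.conj
  rw [hcj] at h'
  have h2 := hK s n k d _ _ _ hs hd hj (by simpa using hy.ne') h' fun t ht => by
    rw [← hcj, ← conj_ofReal, ← map_sub, ← map_inv₀, norm_conj]
    exact norm_inv_le_infDist hz ht
  have him2 : |(-x - y * I : ℂ).im| = y := by simp [abs_of_pos hy]
  simp only [norm_f0_conj, him2] at h2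
  rw [him, abs_of_pos hy] at h1
  rw [add_mul, rky_eq s k hy hc h]
  exact (norm_sub_le _ _).trans (add_le_add h1 h2)

lemma rky_nonneg (s : ℝ) (k : ℤ) {y : ℝ} (hy : 0 < y) (hc : 0 < cc θ) (x : ℝ) : 0 ≤ rky V θ s n k y x := by
  obtain ⟨q, h⟩ := exists_isRoot (θ := θ) hc (z := -x + y * I) (by simpa using hy.ne')
  rw [rky_eq s k hy hc h]
  exact le_min (mul_nonneg (by positivity) (tsum_nonneg fun t => mul_nonneg (by positivity) (S_nonneg _)))
    (add_nonneg (inv_nonneg.2 Metric.infDist_nonneg) (tsum_nonneg fun t => by positivity))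

/-- An integrable majorant, so that the norms of `r_{k,y}` are not junk values. -/
lemma rky_sq_le (s : ℝ) (k : ℤ) {y : ℝ} (hy : 0 < y) (hc : 0 < cc θ) (x : ℝ) :
    rky V θ s n k y x ^ 2 ≤ (1 + y⁻¹) ^ 2 * (5 * (1 + (y⁻¹) ^ 2)) * (1 + x ^ 2)⁻¹ := by
  have him : (-x + y * I : ℂ).im = y := by simp
  have hz : (-x + y * I : ℂ).im ≠ 0 := by rw [him]; exact hy.ne'
  obtain ⟨q, h⟩ := exists_isRoot (θ := θ) hc hz
  set z : ℂ := -x + y * I with hzdef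
  set r := (Metric.infDist z ((fun t : ℝ => (t : ℂ)) '' 𝕁))⁻¹ with hr
  have h1 : (Rstar θ z 0 0).im ≤ r := by
    refine (Complex.im_le_norm _).trans ?_
    have := Rstar_two_mul h hc hz 0
    rw [mul_zero] at this
    rw [this, Int.natAbs_zero, ← fcf_cauchy h hc]
    exact norm_fcf_le (fun t => norm_inv_le_infDist hz) _
  have h2 : rky V θ s n k y x ≤ (1 + y⁻¹) * r := by
    refine (min_le_right _ _).trans ?_
    rw [add_mul, one_mul]
    exact add_le_add le_rfl (mul_le_mul_of_nonneg_left h1 (by positivity))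
  have h4 : r ^ 2 ≤ 5 * (1 + (y⁻¹) ^ 2) * (1 + x ^ 2)⁻¹ := by
    obtain ⟨-, ⟨t, ht, rfl⟩, hd⟩ := ((isCompact_Icc (a := (-1 : ℝ)) (b := 1)).image
      continuous_ofReal).exists_infDist_eq_dist ((nonempty_Icc.2 (by norm_num)).image _) z
    have e : dist z (t : ℂ) ^ 2 = (x + t) ^ 2 + y ^ 2 := by
      rw [dist_eq_norm, ← normSq_eq_norm_sq, Complex.normSq_apply, hzdef]; simp; ring
    rw [hr, inv_pow, hd, e, ← div_eq_mul_inv, le_div_iff₀ (by positivity), inv_mul_le_iff₀ (by positivity)]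
    have h5 : y ^ 2 * (y⁻¹) ^ 2 = 1 := by rw [← mul_pow, mul_inv_cancel₀ hy.ne', one_pow]
    nlinarith [sq_nonneg (x + 2 * t), sq_nonneg y, mul_nonneg (sq_nonneg (x + t)) (sq_nonneg y⁻¹), ht.1, ht.2]
  calc _ ≤ ((1 + y⁻¹) * r) ^ 2 := pow_le_pow_left₀ (rky_nonneg s k hy hc x) h2 2
    _ = (1 + y⁻¹) ^ 2 * r ^ 2 := mul_pow _ _ _
    _ ≤ _ := by rw [mul_assoc]; gcongr

lemma continuousOn_Rstar (j l : ℤ) : ContinuousOn (fun p : ℝ × ℝ => Rstar θ (-p.2 + p.1 * I) j l)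
    (Ioi 0 ×ˢ univ) := fun p hp => by
  have hz : (-p.2 + p.1 * I : ℂ).im ≠ 0 := by simpa using (ne_of_gt hp.1 : p.1 ≠ 0)
  refine ContinuousAt.continuousWithinAt ?_
  obtain ⟨u, hu⟩ := isUnit_sub_smul (MstarOp_isSymmetric θ) hz
  have h1 : ContinuousAt (fun p : ℝ × ℝ =>
      MstarOp θ - (-p.2 + p.1 * I : ℂ) • (1 : L2Z →L[ℂ] L2Z)) p := by fun_prop
  have h2 : ContinuousAt Ring.inverse (MstarOp θ - (-p.2 + p.1 * I : ℂ) • (1 : L2Z →L[ℂ] L2Z)) := by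
    rw [← hu]; exact NormedRing.inverse_continuousAt u
  have h4 := ContinuousAt.comp (f := fun p : ℝ × ℝ =>
      MstarOp θ - (-p.2 + p.1 * I : ℂ) • (1 : L2Z →L[ℂ] L2Z)) h2 h1
  have h5 := h4.clm_apply (continuousAt_const (y := (lp.single 2 l (1 : ℂ) : L2Z)))
  have h6 : Continuous fun f : L2Z => f j := by
    have : (fun f : L2Z => f j) = fun f => inner ℂ (lp.single 2 j 1 : L2Z) f := by
      ext f; rw [lp.inner_single_left, RCLike.inner_apply, map_one, mul_one]
    rw [this]; fun_prop
  exact h6.continuousAt.comp h5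

lemma aemeasurable_rky (s : ℝ) (k : ℤ) : AEMeasurable (fun p : ℝ × ℝ => rky V θ s n k p.1 p.2)
    ((volume.restrict (Ioi 0)).prod volume) := by
  have hmeas : (volume.restrict (Ioi (0 : ℝ))).prod (volume : Measure ℝ)
      = (volume.prod volume).restrict (Ioi 0 ×ˢ univ) := by
    rw [← Measure.prod_restrict, Measure.restrict_univ]
  have hR : ∀ j l, AEMeasurable (fun p : ℝ × ℝ => Rstar θ (-p.2 + p.1 * I) j l)
      ((volume.restrict (Ioi 0)).prod volume) := fun j l => by
    rw [hmeas]
    exact (continuousOn_Rstar j l).aemeasurable (measurableSet_Ioi.prod MeasurableSet.univ)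
  have e : ∀ z : ℂ, ∑' t : ℤ, ‖Rstar θ z (2 * t) 0‖ ^ 2 * S V θ s n (k + 2 * t)
      = (∑' t : ℤ, ofReal (‖Rstar θ z (2 * t) 0‖ ^ 2 * S V θ s n (k + 2 * t))).toReal := fun z => by
    rw [ENNReal.tsum_toReal_eq fun _ => ofReal_ne_top]
    exact tsum_congr fun t => (ENNReal.toReal_ofReal (mul_nonneg (by positivity) (S_nonneg _))).symm
  have hy : AEMeasurable (fun p : ℝ × ℝ => p.1⁻¹) ((volume.restrict (Ioi 0)).prod volume) :=
    measurable_fst.inv.aemeasurable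
  have hd : Continuous fun p : ℝ × ℝ =>
      Metric.infDist (-p.2 + p.1 * I : ℂ) ((fun t : ℝ => (t : ℂ)) '' 𝕁) :=
    (Metric.continuous_infDist_pt _).comp (by fun_prop)
  unfold rky
  simp only [e]
  refine AEMeasurable.min (hy.mul (AEMeasurable.ennreal_toReal (AEMeasurable.tsum fun t =>
    (((hR _ _).norm.pow_const 2).mul_const _).ennreal_ofReal))) ?_
  exact hd.measurable.inv.aemeasurable.add (hy.mul (Complex.measurable_im.comp_aemeasurable (hR 0 0)))

end Remainder

section Remainder

variable {V ρ : ℝ → ℝ} {θ : ℝ} {n : ℕ}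

lemma integrable_rky_sq (s : ℝ) (k : ℤ) (hc : 0 < cc θ) :
    (∀ᵐ y ∂volume.restrict (Ioi (0 : ℝ)), Integrable fun x => rky V θ s n k y x ^ 2) ∧
    IntegrableOn (fun y => exp (-y) * y ^ 5 * ∫ x, rky V θ s n k y x ^ 2) (Ioi 0) := by
  have hm : AEMeasurable (fun p : ℝ × ℝ => rky V θ s n k p.1 p.2 ^ 2)
    ((volume.restrict (Ioi 0)).prod volume) := (aemeasurable_rky s k).pow_const 2
  have hpos : ∀ᵐ y ∂volume.restrict (Ioi (0 : ℝ)), 0 < y := ae_restrict_mem measurableSet_Ioi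
  have h1 : ∀ᵐ y ∂volume.restrict (Ioi (0 : ℝ)), Integrable fun x => rky V θ s n k y x ^ 2 := by
    filter_upwards [hm.aestronglyMeasurable.prodMk_left, hpos] with y h hy
    refine (integrable_inv_one_add_sq.const_mul ((1 + y⁻¹) ^ 2 * (5 * (1 + (y⁻¹) ^ 2)))).mono' h
      (of_forall fun x => ?_)
    rw [norm_of_nonneg (sq_nonneg _)]
    exact rky_sq_le s k hy hc x
  refine ⟨h1, ?_⟩
  have hg : ∀ m : ℕ, IntegrableOn (fun y : ℝ => exp (-y) * y ^ m) (Ioi 0) := fun m => by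
    refine (GammaIntegral_convergent (s := (m : ℝ) + 1) (by positivity)).congr_fun (fun y _ => ?_)
      measurableSet_Ioi
    simp
  refine (((hg 1).add (hg 5)).const_mul (20 * π)).mono'
    ((by fun_prop : Continuous fun y : ℝ => exp (-y) * y ^ 5).aestronglyMeasurable.mul
      hm.aestronglyMeasurable.integral_prod_right') ?_
  filter_upwards [h1, hpos] with y h hy
  have h2 : ∫ x, rky V θ s n k y x ^ 2 ≤ (1 + y⁻¹) ^ 2 * (5 * (1 + (y⁻¹) ^ 2)) * π := by
    rw [← integral_univ_inv_one_add_sq, ← integral_const_mul]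
    exact integral_mono h (integrable_inv_one_add_sq.const_mul _) fun x => rky_sq_le s k hy hc x
  have h0 : 0 ≤ ∫ x, rky V θ s n k y x ^ 2 := integral_nonneg fun x => sq_nonneg _
  rw [norm_of_nonneg (by positivity)]
  calc _ ≤ exp (-y) * y ^ 5 * ((1 + y⁻¹) ^ 2 * (5 * (1 + (y⁻¹) ^ 2)) * π) := by gcongr
    _ = 5 * π * exp (-y) * (y * ((1 + y) ^ 2 * (1 + y ^ 2))) := by
      field_simp; ring
    _ ≤ 5 * π * exp (-y) * (y * (4 * (1 + y ^ 4))) := by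
      have : (1 + y) ^ 2 * (1 + y ^ 2) ≤ 4 * (1 + y ^ 4) := by
        nlinarith [sq_nonneg (y - 1), sq_nonneg (y ^ 2 - 1), mul_nonneg (sq_nonneg (y - 1)) (sq_nonneg y)]
      have := pi_pos
      gcongr
    _ = _ := by simp only [Pi.add_apply]; ring

/-- The mean-square bound for the remainder. -/
lemma exists_stringRemainder_bound (h3 : ConditionC3 V) (h0 : 0 < θ) (hpi : θ < π) (hc : 0 < cc θ)
    (hv : vc V θ 1 = vc V θ 0 + 1 / cc θ) : ∃ C : ℝ, 0 < C ∧ ∀ (s : ℝ) (n : ℕ) (k : ℤ),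
      (s = 1 ∨ s = -1) → 1 ≤ n → 1 ≤ n + k → |stringRemainder V θ n k| ^ 2
        ≤ C * ∫ y in Ioi (0 : ℝ), exp (-y) * y ^ 5 * ∫ x, rky V θ s n k y x ^ 2 := by
  have hV := h3.contDiffOn.continuousOn
  obtain ⟨C, hC0, hC⟩ := exists_sobolev_duality h3
  obtain ⟨K, hK0, hK⟩ := exists_secondOrder_le_rky hV h0 hpi hc
  refine ⟨25 * (C * (K ^ 2 + 1)), by positivity, fun s n k hs hn hk => ?_⟩
  obtain ⟨hi1, hi2⟩ := integrable_rky_sq (V := V) (n := n) s k hc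
  set J := ∫ y in Ioi (0 : ℝ), exp (-y) * y ^ 5 * ∫ x, rky V θ s n k y x ^ 2 with hJ
  have hpos : ∀ᵐ y ∂volume.restrict (Ioi (0 : ℝ)), 0 < y := ae_restrict_mem measurableSet_Ioi
  have hJ0 : 0 ≤ J := integral_nonneg_of_ae (hpos.mono fun y hy => by
    have : 0 ≤ ∫ x, rky V θ s n k y x ^ 2 := integral_nonneg fun x => sq_nonneg _
    positivity)
  have hT : ∀ d ∈ 𝔹, ‖(Ltilde V n k (k + d) : ℂ)
      * secondOrder V θ n k d fun t => (dV V t : ℂ)‖ ^ 2 ≤ C * (K ^ 2 + 1) * J := fun d hd => by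
    rw [Finset.mem_Icc] at hd
    by_cases hj : 0 ≤ n + (k + d)
    swap
    · have : Ltilde V n k (k + d) = 0 := by
        rw [Ltilde, if_neg fun hh => hj hh.2]
      rw [this]; simp; positivity
    obtain ⟨K', hF⟩ := exists_fourierFunctional_secondOrder (θ := θ) (n := n) hV k hd
    have h1 := hC _ K' hF
    have h2 : ∫⁻ y in Ioi (0 : ℝ), ofReal (exp (-y) * y ^ 5) *
          ∫⁻ x : ℝ, ‖secondOrder V θ n k d (fun t => ((t : ℂ) - (x + y * I))⁻¹)
            - secondOrder V θ n k d (fun t => ((t : ℂ) - (x - y * I))⁻¹)‖ₑ ^ 2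
        ≤ ofReal (K ^ 2 * J) := by
      rw [hJ, ← integral_const_mul, ofReal_integral_eq_lintegral_ofReal (hi2.const_mul _)
        (hpos.mono fun y hy => by
          have : 0 ≤ ∫ x, rky V θ s n k y x ^ 2 := integral_nonneg fun x => sq_nonneg _
          simp only [Pi.zero_apply]; positivity)]
      refine lintegral_mono_ae ?_
      filter_upwards [hi1, hpos] with y hy1 hy
      rw [mul_left_comm, ← integral_const_mul, ENNReal.ofReal_mul (p := exp (-y) * y ^ 5) (by positivity),
        ofReal_integral_eq_lintegral_ofReal (hy1.const_mul _) (of_forall fun x => by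
          simp only [Pi.zero_apply]; positivity)]
      refine mul_le_mul' le_rfl ?_
      rw [← lintegral_neg_eq_self]
      refine lintegral_mono fun x => ?_
      have h5 := hK s n k d y x hs hd hj hy
      rw [← mul_pow, ofReal_pow (mul_nonneg hK0 (rky_nonneg s k hy hc x)), Complex.ofReal_neg,
        ← ofReal_norm]
      gcongr
    have h4 := h1.trans (mul_le_mul' le_rfl h2)
    rw [← ENNReal.ofReal_mul hC0.le, ← ofReal_norm, ← ofReal_pow (norm_nonneg _),
      ENNReal.ofReal_le_ofReal_iff (by positivity)] at h4
    rw [norm_mul, mul_pow, norm_real, norm_eq_abs]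
    have hL : |Ltilde V n k (k + d)| ^ 2 ≤ 1 := pow_le_one₀ (abs_nonneg _) (abs_Ltilde_le hV _ _)
    calc _ ≤ 1 * (C * (K ^ 2 * J)) := mul_le_mul hL h4 (by positivity) zero_le_one
      _ ≤ _ := by nlinarith [mul_nonneg hC0.le hJ0]
  have h1 := congrArg norm (stringRemainder_eq h3 hc.ne' hv hn hk)
  rw [norm_real, norm_eq_abs] at h1
  rw [h1]
  refine (pow_le_pow_left₀ (norm_nonneg _) (norm_sum_le _ _) 2).trans (sq_sum_le_card_mul_sum_sq.trans ?_)
  refine (mul_le_mul_of_nonneg_left (sum_le_sum hT) (by positivity)).trans (le_of_eq ?_)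
  rw [sum_const, show (𝔹).card = 5 by decide]
  simp only [nsmul_eq_mul]; push_cast; ring

end Remainder

end OPUC

end

theorem mainTheorem5 (V ρ : ℝ → ℝ) (θ : ℝ)
    (hρ : OPUC.IsEquilibriumDensity V ρ)
    (h1 : OPUC.ConditionC1 ρ θ) (h2 : OPUC.ConditionC2 V ρ θ) (h3 : OPUC.ConditionC3 V) :
    ∃ A : ℤ → ℝ,
      (∀ φ : ℝ, HasSum (fun l : ℤ => (A l : ℂ) * Complex.exp (Complex.I * l * φ))
        (OPUC.symbol V θ φ : ℂ)) ∧
      ∃ ε₁ : ℝ, 0 < ε₁ ∧ ∃ C : ℝ, 0 < C ∧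
        ∀ s : ℝ, (s = 1 ∨ s = -1) → ∀ n : ℕ, 1 ≤ n →
          (∀ j : ℕ,
            OPUC.xt V θ s n (j - n) ∈ Set.Ico (-Real.pi) Real.pi ∧
            OPUC.alpha V n j = (-1) ^ j * s * Real.cos (θ / 2 + OPUC.xt V θ s n (j - n)) ∧
            OPUC.rho V n j = Real.sin (θ / 2 + OPUC.xt V θ s n (j - n))) ∧
          ∀ k : ℤ, |(k : ℝ)| ≤ ε₁ * n →
            ∃ R : ℝ,
              HasSum (fun l : ℤ => A (k - l) * OPUC.xt V θ s n l)
                (OPUC.cb θ / OPUC.cc θ * (k / n) + R) ∧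
              |R| ≤ C * ((k : ℝ) ^ 2 / (n : ℝ) ^ 2 + OPUC.S V θ s n k
                  + ∑' l : ℤ, if l = 0 then 0
                      else OPUC.S V θ s n (k + 2 * l) * |(l : ℝ)| ^ (-(5 / 2) : ℝ))
                + |OPUC.stringRemainder V θ n k| ∧
              |OPUC.stringRemainder V θ n k| ^ 2 ≤
                C * ∫ y in Set.Ioi (0 : ℝ), Real.exp (-y) * y ^ 5
                  * ∫ x : ℝ, OPUC.rky V θ s n k y x ^ 2 := by
  open OPUC in
  have h0 := h1.pos
  have hpi := h1.lt_pi
  have hc := cc_pos h0 hpi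
  have hV := h3.contDiffOn.continuousOn
  have hv := vc_one_eq hρ h1 h2 h3
  obtain ⟨K, hK0, hK⟩ := exists_linearized_string_equation h3 h0 hpi hv
  obtain ⟨C, hC0, hC⟩ := exists_stringRemainder_bound h3 h0 hpi hc hv
  refine ⟨Acoef V θ, hasSum_symbol h3 h0 hpi, 1 / 2, by norm_num, K + C, by positivity,
    fun s hs n hn => ⟨fun j => ?_, fun k hk => ?_⟩⟩
  · obtain ⟨x0, x1, xa, xr⟩ := xt_facts (θ := θ) (n := n) (l := (j : ℤ) - n) hV hs (by omega)
    rw [show (n + ((j : ℤ) - n)).toNat = j by omega] at xa xr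
    exact ⟨⟨by linarith, by linarith⟩, xa, xr⟩
  · obtain ⟨R, hR1, hR2⟩ := hK s n k hs hn hk
    refine ⟨R, hR1, hR2.trans ?_, (hC s n k hs hn ?_).trans ?_⟩
    · have hX : 0 ≤ (k : ℝ) ^ 2 / (n : ℝ) ^ 2 + S V θ s n k + farSum V θ s n k :=
        add_nonneg (add_nonneg (by positivity) (S_nonneg _)) (tsum_nonneg fun l => by
          split_ifs
          · exact le_rfl
          · exact mul_nonneg (S_nonneg _) (by positivity))
      exact add_le_add (mul_le_mul_of_nonneg_right (by linarith) hX) le_rfl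
    · have hn' : (1 : ℝ) ≤ n := by exact_mod_cast hn
      have h5 : (0 : ℝ) < ((n + k : ℤ) : ℝ) := by
        push_cast; linarith [(abs_le.1 hk).1]
      have : 0 < (n + k : ℤ) := by exact_mod_cast h5
      omega
    · have hI : 0 ≤ ∫ y in Ioi (0 : ℝ), Real.exp (-y) * y ^ 5 * ∫ x, rky V θ s n k y x ^ 2 :=
        setIntegral_nonneg measurableSet_Ioi fun y hy => by
          have : 0 ≤ ∫ x, rky V θ s n k y x ^ 2 := integral_nonneg fun x => sq_nonneg _
          have : 0 < y := hy
          positivity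
      exact mul_le_mul_of_nonneg_right (by linarith) hI
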